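/- **Setting.** $AB$ is the category of abelian groups and $\mathrm{CHAIN}(\mathbb Z)$ the category of unbounded chain complexes of abelian groups. For a category $\mathcal C$, an object of $\mathrm{Inv}(\mathcal C)$ is a functor $X:I\to\mathcal C$ on a small cofiltered category $I$. A morphism $(X:I\to \mathcal C)\to(Y:J\to \mathcal C)$ in $\mathrm{Inv}(\mathcal C)$ is a pair of a functor $\varphi:J\to I$ and a natural transformation $\psi:X\circ\varphi\to Y$. The category $\mathrm{Pro}(\mathcal C)$ has the same objects, and $\mathrm{Hom}(X,Y)=\lim_j\mathrm{colim}_i\,\mathrm{Hom}_{\mathcal C}(X_i,Y_j)$; there is an evident functor $\mathrm{Inv}(\mathcal C)\to\mathrm{Pro}(\mathcal C)$. For $\mathbf A\in \mathrm{Inv}(AB)$ with index category $I$, $\lim^s\mathbf A$ is the value at $\mathbf A$ of the $s$-th right derived functor of $\lim:AB^I\to AB$. For $\mathbf C\in\mathrm{Inv}(\mathrm{CHAIN}(\mathbb Z))$, $\mathbf H_n(\mathbf C)$ is the system of the groups $H_n(C_i)$, and $\mathrm{holim}\,\mathbf C$ is the product total complex of the cosimplicial replacement, so $$(\mathrm{holim}\,\mathbf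 C)_n=\prod_{s\ge0}\ \prod_{i_0\to\cdots\to i_s}C_{n+s}(i_s).$$ Let $\mathrm{Tot}^{(s)}$, $s\in\mathbb Z$, be its quotient complex given by the columns $0,\dots,s$ (zero for $s<0$), and $\Gamma^{(s)}=\ker(\mathrm{Tot}^{(s)}\to \mathrm{Tot}^{(s-1)})$. For a tower $\cdots\to T_2\to T_1\to T_0$, $\lim^1T$ is the cokernel of $\prod T_s\to\prod T_s$, $(x_s)\mapsto(x_s-f_s(x_{s+1}))$, where $f_s:T_{s+1}\to T_s$. Let $(D_r,E_r)_{r\ge1}$ be the sequence of exact couples $$i:D_r^{s,t}\to D_r^{s-1,t+1},\qquad j:D_r^{s,t}\to E_r^{s+r,t+1-r},\qquad k:E_r^{s,t}\to D_r^{s,t}$$ that starts from the exact couple $D_1^{s,t}=H_{-s-t}(\mathrm{Tot}^{(s)})$, $E_1^{s,t}=H_{-s-t}(\Gamma^{(s)})$ of the tower $(\mathrm{Tot}^{(s)})$, in which $i$ and $k$ are induced by the projections and the inclusions of the kernels and $j$ is the connecting homomorphism, and in which each couple is the derived couple of the preceding one. Thus $D_{r+1}\subseteq D_r$ is the image of $i$,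 and $E_{r+1}$ is the homology of $(E_r,d_r=jk)$. The couples, and hence the spectral sequence $E_r^{s,t}(\mathbf C)$, with $d_r:E_r^{s,t}\to E_r^{s+r,t+1-r}$ and $E_r^{s,t}=0=D_r^{s,t}$ for $s<0$, are functorial on $\mathrm{Inv}(\mathrm{CHAIN}(\mathbb Z))$. **Theorem.** From $r=2$ on, the spectral sequence together with its exact couples $(D_r,E_r)_{r\ge 2}$ extends from $\mathrm{Inv}(\mathrm{CHAIN}(\mathbb Z))$ to a functor on $\mathrm{Pro}(\mathrm{CHAIN}(\mathbb Z))$. So do the functors $H_n(\mathrm{holim}\,-)$, $n\in\mathbb Z$, and, for all $r\ge2$, $n\in\mathbb Z$ and $s+t=-n$, the maps $\rho_r^{s,t}:H_n(\mathrm{holim}\,\mathbf C)\to D_r^{s,t}(\mathbf C)$ which are induced by the projection $\mathrm{holim}\,\mathbf C\to\mathrm{Tot}^{(s)}$ and are compatible with $i$ and with the inclusions $D_{r+1}\subseteq D_r$. For every $\mathbf C\in\mathrm{Pro}(\mathrm{CHAIN}(\mathbb Z))$ the following holds. 1. $E_2^{s,t}(\mathbf C)\cong\lim^s\mathbf H_{-t}(\mathbf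 C)$ for all $s\ge0$ and $t\in\mathbb Z$, naturally in $\mathbf C$ (and $E_2^{s,t}=0$ for $s<0$). 2. For all $n\in\mathbb Z$, $k:E_2^{0,n}\to D_2^{0,n}$ is an isomorphism, and $E_2^{0,n}\cong\lim\mathbf H_{-n}(\mathbf C)$, naturally in $\mathbf C$. 3. For all $n\in\mathbb Z$ there is a long exact sequence with maps $k,i,j$ $$0\to E_2^{1,n-1}\to D_2^{1,n-1}\to D_2^{0,n}\to E_2^{2,n-1}\to D_2^{2,n-1}\to D_2^{1,n}\to E_2^{3,n-1}\to\cdots\to E_2^{s,n-1}\to D_2^{s,n-1}\to D_2^{s-1,n}\to E_2^{s+1,n-1}\to\cdots.$$ 4. For all $r\ge2$ and $n\in\mathbb Z$ there is a short exact sequence, natural in $\mathbf C$, $$0\to{\lim_s}^1D_r^{s,-n-s-1}\to H_n(\mathrm{holim}\,\mathbf C)\to\lim_sD_r^{s,-n-s}\to0,$$ where the limits are taken along the maps $i$ and the second map is induced by the maps $\rho_r^{s,-n-s}$. 5. If $f:\mathbf C\to\mathbf C'$ is a morphism in $\mathrm{Pro}(\mathrm{CHAIN}(\mathbb Z))$ such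 that $E_2^{s,t}(\mathbf C)\to E_2^{s,t}(\mathbf C')$ is an isomorphism for all $s,t$, then $f$ induces isomorphisms $H_n(\mathrm{holim}\,\mathbf C)\cong H_n(\mathrm{holim}\,\mathbf C')$ for all $n\in\mathbb Z$. 6. For $r>s$ one has $E_{r+1}^{s,t}=\ker(d_r)\subseteq E_r^{s,t}$; put $E_\infty^{s,t}=\lim_rE_r^{s,t}$ (with $r\ge s+2$). If $\lim^1_rE_r^{s,t}=0$ for all $s\geq 0$ and all $t$, then the spectral sequence converges strongly (completely) to $H_{-s-t}(\mathrm{holim}\,\mathbf C)$: for every $n\in\mathbb Z$ there is a tower of epimorphisms $$\cdots\to Q^{s,-n-s}\to Q^{s-1,-n-s+1}\to\cdots\to Q^{0,-n}\to Q^{-1,-n+1}=0$$ with $H_n(\mathrm{holim}\,\mathbf C)\cong\lim_sQ^{s,-n-s}$ and $\ker(Q^{s,-n-s}\to Q^{s-1,-n-s+1})\cong E_\infty^{s,-n-s}$. Moreover, $Q^{s,-n-s}$ embeds in $D_r^{s,-n-s}$ for every $r\ge2$, such that the composite $H_n(\mathrm{holim}\,\mathbf C)\to Q^{s,-n-s}\to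 D_r^{s,-n-s}$ is $\rho_r^{s,-n-s}$ and, for $r\ge s+2$, the isomorphism of the kernel with $E_\infty^{s,-n-s}$ is compatible with $k:E_r^{s,-n-s}\to D_r^{s,-n-s}$. -/

import Mathlib

open CategoryTheory Limits

universe u v w

noncomputable section

/-! ### Inverse systems and pro-objects -/

/-- An inverse system in `C`: a functor `X : I ⥤ C` from a small cofiltered category `I`. -/
structure InvSystem (C : Type w) [Category.{v} C] where
  I : Type u
  [cat : SmallCategory I]
  [cofiltered : IsCofiltered I]
  X : I ⥤ C

namespace InvSystem

attribute [instance] InvSystem.cat InvSystem.cofiltered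

variable {C : Type w} [Category.{v} C]

/-- A morphism of inverse systems `(Xᵢ) ⟶ (Yⱼ)`: a functor `φ : J ⥤ I` together with a natural
transformation `ψ : X ∘ φ ⟶ Y`. -/
structure Hom (X Y : InvSystem.{u} C) where
  φ : Y.I ⥤ X.I
  ψ : φ ⋙ X.X ⟶ Y.X

/-- The category `Inv(C)` of inverse systems in `C`. -/
instance : Category (InvSystem.{u} C) where
  Hom := Hom
  id X := ⟨𝟭 X.I, (Functor.leftUnitor X.X).hom⟩
  comp f g :=
    ⟨g.φ ⋙ f.φ, (Functor.associator _ _ _).hom ≫ Functor.whiskerLeft g.φ f.ψ ≫ g.ψ⟩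
  id_comp f := by
    change Hom.mk _ _ = Hom.mk _ _
    congr 1
    ext j
    simp
  comp_id f := by
    change Hom.mk _ _ = Hom.mk _ _
    congr 1
    ext j
    simp
  assoc f g h := by
    change Hom.mk _ _ = Hom.mk _ _
    congr 1
    ext j
    simp

@[simp] lemma id_φ (X : InvSystem.{u} C) : Hom.φ (𝟙 X) = 𝟭 X.I := rfl

@[simp] lemma id_ψ_app (X : InvSystem.{u} C) (i : X.I) :
    (Hom.ψ (𝟙 X)).app i = 𝟙 (X.X.obj i) := rfl

@[simp] lemma comp_φ {X Y Z : InvSystem.{u} C} (f : X ⟶ Y) (g : Y ⟶ Z) :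
    Hom.φ (f ≫ g) = Hom.φ g ⋙ Hom.φ f := rfl

@[simp] lemma comp_ψ_app {X Y Z : InvSystem.{u} C} (f : X ⟶ Y) (g : Y ⟶ Z) (k : Z.I) :
    (Hom.ψ (f ≫ g)).app k = (Hom.ψ f).app ((Hom.φ g).obj k) ≫ (Hom.ψ g).app k := by
  change 𝟙 _ ≫ _ ≫ _ = _
  rw [Category.id_comp]
  rfl

/-- A functor `C ⥤ D`, applied objectwise to inverse systems. -/
def map {D : Type*} [Category.{v} D] (F : C ⥤ D) : InvSystem.{u} C ⥤ InvSystem.{u} D where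
  obj X := ⟨X.I, X.X ⋙ F⟩
  map {X Y} f := ⟨Hom.φ (X := X) (Y := Y) f, Functor.whiskerRight (Hom.ψ (X := X) (Y := Y) f) F⟩
  map_id X := by
    refine congrArg (Hom.mk (X := ⟨X.I, X.X ⋙ F⟩) (Y := ⟨X.I, X.X ⋙ F⟩) (𝟭 X.I)) ?_
    refine NatTrans.ext (funext fun j => ?_)
    exact F.map_id _
  map_comp {X Y Z} f g := by
    refine congrArg
      (Hom.mk (X := ⟨X.I, X.X ⋙ F⟩) (Y := ⟨Z.I, Z.X ⋙ F⟩) (Hom.φ (X := X) (Y := Z) (f ≫ g))) ?_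
    refine NatTrans.ext (funext fun j => ?_)
    change F.map _ = _
    rw [comp_ψ_app, F.map_comp]
    exact (Category.id_comp _).symm

/-- `colim_{i} Hom(Xᵢ, c)`: morphisms `Xᵢ ⟶ c`, where a morphism is identified with its
composition with any transition morphism `Xᵢ' ⟶ Xᵢ`. -/
def ColimHom (X : InvSystem.{u} C) (c : C) : Type (max u v) :=
  Quot fun p q : Σ i : X.I, (X.X.obj i ⟶ c) => ∃ a : q.1 ⟶ p.1, q.2 = X.X.map a ≫ p.2

/-- Postcomposition `colim_i Hom(Xᵢ, c) → colim_i Hom(Xᵢ, d)` with a morphism `c ⟶ d`. -/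
def ColimHom.post {X : InvSystem.{u} C} {c d : C} (x : X.ColimHom c) (g : c ⟶ d) :
    X.ColimHom d :=
  Quot.map (fun p => ⟨p.1, p.2 ≫ g⟩)
    (fun p q ⟨a, ha⟩ => ⟨a, by simp [ha]⟩) x

lemma ColimHom.post_id {X : InvSystem.{u} C} {c : C} (x : X.ColimHom c) : x.post (𝟙 c) = x := by
  obtain ⟨p⟩ := x
  exact congrArg (Quot.mk _) (by simp)

lemma ColimHom.post_comp {X : InvSystem.{u} C} {c d e : C} (x : X.ColimHom c)
    (g : c ⟶ d) (h : d ⟶ e) : x.post (g ≫ h) = (x.post g).post h := by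
  obtain ⟨p⟩ := x
  exact congrArg (Quot.mk _) (by simp)

end InvSystem

/-- Pro-objects of `C`; they are the same as inverse systems in `C`. -/
structure Pro (C : Type w) [Category.{v} C] where
  sys : InvSystem.{u} C

namespace Pro

variable {C : Type w} [Category.{v} C]

/-- `Hom(X, Y) = lim_j colim_i Hom(Xᵢ, Yⱼ)`. -/
@[ext]
structure Hom (X Y : Pro.{u} C) where
  toFun (j : Y.sys.I) : X.sys.ColimHom (Y.sys.X.obj j)
  compat {j j' : Y.sys.I} (a : j ⟶ j') : (toFun j).post (Y.sys.X.map a) = toFun j'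

/-- The composition of `f : X ⟶ Y` in `Pro(C)` with (the class of) a morphism `Yⱼ ⟶ c`. -/
def Hom.pre {X Y : Pro.{u} C} (f : Hom X Y) {c : C} (y : Y.sys.ColimHom c) :
    X.sys.ColimHom c :=
  Quot.lift (fun p => (f.toFun p.1).post p.2) (by
    rintro ⟨j, g⟩ ⟨j', g'⟩ ⟨a, ha⟩
    dsimp only at a ha ⊢
    rw [ha, InvSystem.ColimHom.post_comp, f.compat]) y

lemma Hom.pre_post {X Y : Pro.{u} C} (f : Hom X Y) {c d : C} (y : Y.sys.ColimHom c)
    (g : c ⟶ d) : f.pre (y.post g) = (f.pre y).post g := by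
  obtain ⟨p⟩ := y
  exact InvSystem.ColimHom.post_comp _ _ _

/-- The category `Pro(C)` of pro-objects in `C`. -/
instance : Category (Pro.{u} C) where
  Hom := Hom
  id X :=
    { toFun j := Quot.mk _ ⟨j, 𝟙 _⟩
      compat {j j'} a := (Quot.sound ⟨a, by simp⟩).symm }
  comp f g :=
    { toFun k := f.pre (g.toFun k)
      compat a := by rw [← Hom.pre_post, g.compat] }
  id_comp f := by
    ext j
    change Hom.pre _ (f.toFun j) = f.toFun j
    obtain ⟨⟨i, g⟩, hp⟩ := Quot.exists_rep (f.toFun j)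
    rw [← hp]
    exact congrArg (Quot.mk _) (by simp)
  comp_id f := by
    ext j
    exact InvSystem.ColimHom.post_id _
  assoc {X Y Z W} f g h := by
    ext k
    change Hom.pre _ (h.toFun k) = Hom.pre f (Hom.pre g (h.toFun k))
    obtain ⟨⟨i, a⟩, hp⟩ := Quot.exists_rep (h.toFun k)
    rw [← hp]
    exact (Hom.pre_post f _ _).symm

/-- The functor `Inv(C) ⥤ Pro(C)`, which is the identity on objects. -/
def ofInv : InvSystem.{u} C ⥤ Pro.{u} C where
  obj X := ⟨X⟩
  map {X Y} f :=
    { toFun j := Quot.mk _ ⟨(InvSystem.Hom.φ f).obj j, (InvSystem.Hom.ψ f).app j⟩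
      compat {j j'} a := (Quot.sound ⟨(InvSystem.Hom.φ f).map a, by
        simpa using ((InvSystem.Hom.ψ f).naturality a).symm⟩).symm }
  map_id X := rfl
  map_comp f g := by
    apply Hom.ext
    funext k
    exact congrArg (Quot.mk _) (by simp)

end Pro

/-! ### Homotopy inverse limits of diagrams of chain complexes -/

/-- The category of abelian groups. -/
abbrev AB : Type (u + 1) := ModuleCat.{u} ℤ

/-- The category of (unbounded) chain complexes of abelian groups. -/
abbrev CHAIN : Type (u + 1) := ChainComplex AB.{u} ℤ

namespace InvSystem

section Replacement

variable (X Y Z : InvSystem.{u} CHAIN.{u})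

/-- The product of the complexes `X(iₛ)` over all chains `i₀ ⟶ i₁ ⟶ ⋯ ⟶ iₛ` of
morphisms in the index category. -/
def repl (s : ℕ) : CHAIN.{u} :=
  ∏ᶜ fun σ : Fin (s + 1) ⥤ X.I => X.X.obj (σ.obj (Fin.last s))

/-- The coordinate at a chain `σ = (i₀ ⟶ ⋯ ⟶ iₛ)`. -/
def replπ {s : ℕ} (σ : Fin (s + 1) ⥤ X.I) : X.repl s ⟶ X.X.obj (σ.obj (Fin.last s)) :=
  Pi.π (fun σ : Fin (s + 1) ⥤ X.I => X.X.obj (σ.obj (Fin.last s))) σ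

variable {X Y Z}

/-- The morphism to `X.repl s` with given coordinates. -/
def replLift {W : CHAIN.{u}} {s : ℕ}
    (f : ∀ σ : Fin (s + 1) ⥤ X.I, W ⟶ X.X.obj (σ.obj (Fin.last s))) : W ⟶ X.repl s :=
  Pi.lift f

@[simp] lemma replLift_π {W : CHAIN.{u}} {s : ℕ}
    (f : ∀ σ : Fin (s + 1) ⥤ X.I, W ⟶ X.X.obj (σ.obj (Fin.last s))) (σ : Fin (s + 1) ⥤ X.I) :
    replLift f ≫ X.replπ σ = f σ :=
  limit.lift_π _ _

@[simp] lemma replLift_π_assoc {W V : CHAIN.{u}} {s : ℕ}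
    (f : ∀ σ : Fin (s + 1) ⥤ X.I, W ⟶ X.X.obj (σ.obj (Fin.last s))) (σ : Fin (s + 1) ⥤ X.I)
    (g : X.X.obj (σ.obj (Fin.last s)) ⟶ V) :
    replLift f ≫ X.replπ σ ≫ g = f σ ≫ g := by
  rw [← Category.assoc, replLift_π]

lemma repl_hom_ext {W : CHAIN.{u}} {s : ℕ} {f g : W ⟶ X.repl s}
    (h : ∀ σ, f ≫ X.replπ σ = g ≫ X.replπ σ) : f = g :=
  Pi.hom_ext _ _ h

/-- The cosimplicial replacement of a diagram of chain complexes `X : I ⥤ CHAIN`: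
it is `X.repl s` in degree `s`, and a monotone map `θ : [s] → [s']` acts by
`(θ c)(i₀ ⟶ ⋯ ⟶ iₛ') = X(i_{θ(s)} ⟶ i_{s'}) (c(i_{θ(0)} ⟶ ⋯ ⟶ i_{θ(s)}))`. -/
def cosimplicialReplacement (X : InvSystem.{u} CHAIN.{u}) : CosimplicialObject CHAIN.{u} where
  obj a := X.repl a.len
  map {a b} θ := replLift fun σ =>
    X.replπ (θ.toOrderHom.monotone.functor ⋙ σ) ≫
      X.X.map (σ.map (homOfLE (Fin.le_last (θ.toOrderHom (Fin.last _)))))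
  map_id a := by
    refine repl_hom_ext fun σ => ?_
    rw [replLift_π, Category.id_comp]
    change X.replπ σ ≫ X.X.map (σ.map (𝟙 _)) = _
    simp
  map_comp {a b c} θ θ' := by
    refine repl_hom_ext fun σ => ?_
    rw [replLift_π, Category.assoc, replLift_π, replLift_π_assoc, Category.assoc,
      ← Functor.map_comp]
    congr 2
    exact σ.map_comp (homOfLE _) (homOfLE _)

/-- The action of a morphism `(φ, ψ)` of inverse systems:
`c ↦ ((j₀ ⟶ ⋯ ⟶ jₛ) ↦ ψ (c (φ j₀ ⟶ ⋯ ⟶ φ jₛ)))`. -/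
def replMap (f : X ⟶ Y) (s : ℕ) : X.repl s ⟶ Y.repl s :=
  replLift fun σ => X.replπ (σ ⋙ Hom.φ f) ≫ (Hom.ψ f).app _

@[simp] lemma replMap_π (f : X ⟶ Y) {s : ℕ} (σ : Fin (s + 1) ⥤ Y.I) :
    replMap f s ≫ Y.replπ σ = X.replπ (σ ⋙ Hom.φ f) ≫ (Hom.ψ f).app _ :=
  replLift_π _ _

lemma replMap_id (s : ℕ) : replMap (𝟙 X) s = 𝟙 _ := by
  refine repl_hom_ext fun σ => ?_
  rw [replMap_π]
  exact (Category.comp_id _).trans (Category.id_comp _).symm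

lemma replMap_comp (f : X ⟶ Y) (g : Y ⟶ Z) (s : ℕ) :
    replMap (f ≫ g) s = replMap f s ≫ replMap g s := by
  refine repl_hom_ext fun σ => ?_
  rw [replMap_π, comp_ψ_app, Category.assoc, replMap_π, ← Category.assoc (replMap f s),
    replMap_π, Category.assoc]
  rfl

/-- Functoriality of the cosimplicial replacement. -/
def cosimplicialReplacementFunctor :
    InvSystem.{u} CHAIN.{u} ⥤ CosimplicialObject CHAIN.{u} where
  obj X := X.cosimplicialReplacement
  map {X Y} f :=
    { app a := replMap f a.len
      naturality {a b} θ := by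
        refine repl_hom_ext fun σ => ?_
        dsimp only [cosimplicialReplacement]
        rw [Category.assoc, Category.assoc, replMap_π, replLift_π, replLift_π_assoc,
          ← Category.assoc (replMap f _), replMap_π, Category.assoc, Category.assoc]
        exact congrArg _ ((Hom.ψ f).naturality _) }
  map_id X := NatTrans.ext (funext fun a => replMap_id a.len)
  map_comp f g := NatTrans.ext (funext fun a => replMap_comp f g a.len)

end Replacement

end InvSystem

/-! ### Total complexes (with products) -/

section Total

variable (K : CochainComplex CHAIN.{u} ℕ) (p : WithTop ℤ)

/-- The indices `(s, m)` with `s ≤ p` and `m - s = n`. -/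
structure TotIndex (n : ℤ) : Type where
  s : ℕ
  m : ℤ
  hs : ((s : ℤ) : WithTop ℤ) ≤ p
  hm : m = n + s

instance (n : ℤ) : Countable (TotIndex p n) :=
  Function.Injective.countable (f := fun a : TotIndex p n => a.s) (by
    rintro ⟨s, m, hs, rfl⟩ ⟨s', m', hs', rfl⟩ (rfl : s = s')
    rfl)

/-- The degree `n` part `∏_{0 ≤ s ≤ p} K^s_{n+s}` of the total complex. -/
def totX (n : ℤ) : AB.{u} := ∏ᶜ fun a : TotIndex p n => (K.X a.s).X a.m

variable {p}

/-- The projection to `K^s_m`, where `m = n + s`. -/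
def totπ {n : ℤ} (a : TotIndex p n) : totX K p n ⟶ (K.X a.s).X a.m :=
  Pi.π (fun a : TotIndex p n => (K.X a.s).X a.m) a

/-- The morphism to `totX K p n` with given coordinates. -/
def totLift {W : AB.{u}} {n : ℤ} (f : ∀ a : TotIndex p n, W ⟶ (K.X a.s).X a.m) :
    W ⟶ totX K p n :=
  Pi.lift f

lemma totLift_π {W : AB.{u}} {n : ℤ} (f : ∀ a : TotIndex p n, W ⟶ (K.X a.s).X a.m)
    (a : TotIndex p n) : totLift K f ≫ totπ K a = f a :=
  limit.lift_π _ _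

variable {K} in
lemma tot_hom_ext {W : AB.{u}} {n : ℤ} {f g : W ⟶ totX K p n}
    (h : ∀ a, f ≫ totπ K a = g ≫ totπ K a) : f = g :=
  Pi.hom_ext _ _ h

/-- The coordinate at `(s, m)` of the horizontal part of the differential: the projection to
`K^{s-1}_m`, followed by the differential `K^{s-1} ⟶ K^s`. It is zero for `s = 0`. -/
def totH {n n' : ℤ} (hn : n' + 1 = n) : ∀ a : TotIndex p n', totX K p n ⟶ (K.X a.s).X a.m
  | ⟨0, _, _, _⟩ => 0
  | ⟨s + 1, m, hs, hm⟩ =>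
    totπ K ⟨s, m, le_trans (by exact_mod_cast Nat.le_succ s) hs, by push_cast at hm; omega⟩ ≫
      (K.d s (s + 1)).f m

/-- The coordinate at `(s, m)` of the vertical part of the differential: the projection to
`K^s_{m+1}`, followed by the differential `K^s_{m+1} ⟶ K^s_m`. -/
def totV {n n' : ℤ} (hn : n' + 1 = n) (a : TotIndex p n') : totX K p n ⟶ (K.X a.s).X a.m :=
  totπ K ⟨a.s, a.m + 1, a.hs, by have := a.hm; omega⟩ ≫ (K.X a.s).d (a.m + 1) a.m

variable (p)

/-- The differential `(∂c)^s = d(c^{s-1}) + (-1)^s δ(c^s)`, where `d` is the horizontal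
differential, and `δ` the differential of the chain complex `K^s`. -/
def totD (n n' : ℤ) : totX K p n ⟶ totX K p n' :=
  if hn : n' + 1 = n then
    totLift K fun a => totH K hn a + ((-1 : ℤ) ^ a.s) • totV K hn a
  else 0

variable {p}

lemma totD_π {n n' : ℤ} (hn : n' + 1 = n) (a : TotIndex p n') :
    totD K p n n' ≫ totπ K a = totH K hn a + ((-1 : ℤ) ^ a.s) • totV K hn a := by
  rw [totD, dif_pos hn, totLift_π]

lemma totD_comp {n n' n'' : ℤ} (hn : n' + 1 = n) (hn' : n'' + 1 = n') :
    totD K p n n' ≫ totD K p n' n'' = 0 := by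
  have hV : ∀ a : TotIndex p n'', totV K hn' a = totπ K _ ≫ _ := fun _ => rfl
  refine tot_hom_ext fun ⟨s, m, hs, hm⟩ => ?_
  rw [Category.assoc, totD_π K hn', zero_comp, Preadditive.comp_add, Preadditive.comp_zsmul, hV,
    ← Category.assoc, totD_π K hn]
  obtain _ | _ | s := s
  · simp [totH, totV]
  · simp only [totH, totV, Preadditive.add_comp, Preadditive.zsmul_comp, Category.assoc,
      ← Category.assoc (totD _ _ _ _), totD_π K hn]
    simp
  · simp only [totH, totV, Preadditive.add_comp, Preadditive.zsmul_comp, Category.assoc,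
      ← Category.assoc (totD _ _ _ _), totD_π K hn]
    have h0 := congrArg (fun f => HomologicalComplex.Hom.f f m) (K.d_comp_d s (s + 1) (s + 2))
    have h0' : (K.d s (s + 1)).f m ≫ (K.d (s + 1) (s + 2)).f m = 0 := h0
    simp [h0', pow_succ]

variable (p)

/-- The total complex `Tot^{(p)}(K)_n = ∏_{0 ≤ s ≤ p} K^s_{n+s}` of the columns `0 ≤ s ≤ p` of a
cochain complex `K` of chain complexes. For `p = ⊤` all columns are used. -/
def tot : CHAIN.{u} where
  X := totX K p
  d := totD K p
  shape _ _ h := dif_neg h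
  d_comp_d' _ _ _ h h' := totD_comp K h h'

variable {K} {L M : CochainComplex CHAIN.{u} ℕ}

/-- The morphism of total complexes induced by a morphism of bicomplexes, in degree `n`. -/
def totMapX (f : K ⟶ L) (n : ℤ) : totX K p n ⟶ totX L p n :=
  totLift L fun a => totπ K a ≫ (f.f a.s).f a.m

variable {p}

lemma totMapX_π (f : K ⟶ L) {n : ℤ} (a : TotIndex p n) :
    totMapX p f n ≫ totπ L a = totπ K a ≫ (f.f a.s).f a.m :=
  totLift_π _ _ _

lemma totMapX_d (f : K ⟶ L) {n n' : ℤ} (h : n' + 1 = n) :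
    totMapX p f n ≫ totD L p n n' = totD K p n n' ≫ totMapX p f n' := by
  refine tot_hom_ext fun ⟨s, m, hs, hm⟩ => ?_
  rw [Category.assoc, Category.assoc, totD_π L h, totMapX_π, ← Category.assoc (totD _ _ _ _),
    totD_π K h]
  obtain _ | s := s
  · simp only [totH, totV, Preadditive.add_comp, Preadditive.zsmul_comp, Category.assoc,
      Preadditive.comp_add, Preadditive.comp_zsmul, ← Category.assoc (totMapX _ _ _), totMapX_π]
    simp
  · have h0 := congrArg (fun f => HomologicalComplex.Hom.f f m) (f.comm s (s + 1))
    have h0' : (f.f s).f m ≫ (L.d s (s + 1)).f m = (K.d s (s + 1)).f m ≫ (f.f (s + 1)).f m := h0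
    simp only [totH, totV, Preadditive.add_comp, Preadditive.zsmul_comp, Category.assoc,
      Preadditive.comp_add, Preadditive.comp_zsmul, ← Category.assoc (totMapX _ _ _), totMapX_π]
    simp [h0']

lemma totMapX_id (n : ℤ) : totMapX p (𝟙 K) n = 𝟙 _ := by
  refine tot_hom_ext fun a => (totMapX_π _ _).trans ?_
  exact (Category.comp_id _).trans (Category.id_comp _).symm

lemma totMapX_comp (f : K ⟶ L) (g : L ⟶ M) (n : ℤ) :
    totMapX p (f ≫ g) n = totMapX p f n ≫ totMapX p g n := by
  refine tot_hom_ext fun a => ?_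
  rw [totMapX_π, Category.assoc, totMapX_π, ← Category.assoc, totMapX_π, Category.assoc]
  rfl

variable (p)

/-- The functor `Tot^{(p)}` from bicomplexes to chain complexes. -/
def totFunctor : CochainComplex CHAIN.{u} ℕ ⥤ CHAIN.{u} where
  obj K := tot K p
  map f := { f := totMapX p f, comm' := fun _ _ h => totMapX_d f h }
  map_id K := HomologicalComplex.hom_ext _ _ fun n => totMapX_id n
  map_comp f g := HomologicalComplex.hom_ext _ _ fun n => totMapX_comp f g n

variable {p} {q : WithTop ℤ} (h : q ≤ p)

variable (K) in
/-- The projection `Tot^{(p)} ⟶ Tot^{(q)}`, for `q ≤ p`, in degree `n`. -/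
def totProjX (n : ℤ) : totX K p n ⟶ totX K q n :=
  totLift K fun a => totπ K ⟨a.s, a.m, a.hs.trans h, a.hm⟩

lemma totProjX_π {n : ℤ} (a : TotIndex q n) :
    totProjX K h n ≫ totπ K a = totπ K ⟨a.s, a.m, a.hs.trans h, a.hm⟩ :=
  totLift_π _ _ _

lemma totProjX_d {n n' : ℤ} (hn : n' + 1 = n) :
    totProjX K h n ≫ totD K q n n' = totD K p n n' ≫ totProjX K h n' := by
  refine tot_hom_ext fun ⟨s, m, hs, hm⟩ => ?_
  rw [Category.assoc, Category.assoc, totD_π K hn, totProjX_π, totD_π K hn]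
  obtain _ | s := s
  · simp only [totH, totV, Preadditive.comp_add, Preadditive.comp_zsmul,
      ← Category.assoc (totProjX _ _ _), totProjX_π]
    simp
  · simp only [totH, totV, Preadditive.comp_add, Preadditive.comp_zsmul,
      ← Category.assoc (totProjX _ _ _), totProjX_π]

/-- The natural projection `Tot^{(p)} ⟶ Tot^{(q)}` for `q ≤ p`. -/
def totProj : totFunctor.{u} p ⟶ totFunctor.{u} q where
  app K := { f := totProjX K h, comm' := fun _ _ hn => totProjX_d h hn }
  naturality K L f := HomologicalComplex.hom_ext _ _ fun n => by
    change totMapX p f n ≫ totProjX L h n = totProjX K h n ≫ totMapX q f n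
    refine tot_hom_ext fun a => ?_
    rw [Category.assoc, Category.assoc, totProjX_π, totMapX_π, totMapX_π, ← Category.assoc,
      totProjX_π]

variable (K) in
lemma epi_totProj : Epi ((totProj h).app K) := by
  refine @HomologicalComplex.epi_of_epi_f _ _ _ _ _ _ _ _ fun n => ?_
  classical
  let r : totX K q n ⟶ totX K p n := totLift K fun a =>
    if ha : ((a.s : ℤ) : WithTop ℤ) ≤ q then totπ K ⟨a.s, a.m, ha, a.hm⟩ else 0
  have hr : r ≫ totProjX K h n = 𝟙 _ := by
    refine tot_hom_ext fun a => ?_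
    rw [Category.assoc, totProjX_π, totLift_π, dif_pos a.hs, Category.id_comp]
  exact (SplitEpi.mk r hr).epi

end Total

namespace InvSystem

/-- The bicomplex `RC` of an inverse system `C` of chain complexes: the cochain complex (of chain
complexes) with alternating sums of coface maps associated with the cosimplicial replacement. -/
def bicomplex : InvSystem.{u} CHAIN.{u} ⥤ CochainComplex CHAIN.{u} ℕ :=
  cosimplicialReplacementFunctor ⋙ AlgebraicTopology.alternatingCofaceMapComplex CHAIN.{u}

/-- The homotopy inverse limit of an inverse system of chain complexes:
`(holim C)_n = ∏_s ∏_{i₀ ⟶ ⋯ ⟶ iₛ} C_{n+s}(iₛ)`. -/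
def holim : InvSystem.{u} CHAIN.{u} ⥤ CHAIN.{u} := bicomplex ⋙ totFunctor ⊤

/-- The tower of quotient complexes `Tot^{(s)}(RC)` of the homotopy inverse limit, `s ∈ ℤ`
(it is zero for `s < 0`). -/
def holimTot (s : ℤ) : InvSystem.{u} CHAIN.{u} ⥤ CHAIN.{u} := bicomplex ⋙ totFunctor s

/-- The projection `holim C ⟶ Tot^{(s)}(RC)`. -/
def holimToTot (s : ℤ) : holim.{u} ⟶ holimTot.{u} s :=
  Functor.whiskerLeft bicomplex (totProj le_top)

/-- The projection `Tot^{(s+1)}(RC) ⟶ Tot^{(s)}(RC)`. -/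
def holimTotProj (s : ℤ) : holimTot.{u} (s + 1) ⟶ holimTot.{u} s :=
  Functor.whiskerLeft bicomplex (totProj (by exact_mod_cast (Int.le_add_one le_rfl)))

/-- The short exact sequence
`0 ⟶ Γ^{(s+1)}(RC) ⟶ Tot^{(s+1)}(RC) ⟶ Tot^{(s)}(RC) ⟶ 0`, where `Γ^{(s+1)}` is the kernel. -/
def holimTotShortComplex (C : InvSystem.{u} CHAIN.{u}) (s : ℤ) : ShortComplex CHAIN.{u} :=
  ShortComplex.mk (kernel.ι ((holimTotProj s).app C)) ((holimTotProj s).app C)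
    (kernel.condition _)

lemma holimTotShortComplex_shortExact (C : InvSystem.{u} CHAIN.{u}) (s : ℤ) :
    (holimTotShortComplex C s).ShortExact where
  exact := ShortComplex.exact_of_f_is_kernel _ (kernelIsKernel _)
  mono_f := by dsimp [holimTotShortComplex]; infer_instance
  epi_g := epi_totProj _ _

end InvSystem

/-! ### Derived inverse limits -/

section Resolutions

variable {A B : Type*} [Category* A] [Abelian A] [Category* B] [Abelian B]

/-- The augmentation `X ⟶ P⁰` of an injective resolution. -/
def injAug {X : A} (P : InjectiveResolution X) : X ⟶ P.cocomplex.X 0 := P.ι.f 0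

/-- `0 ⟶ Z ⟶ K⁰ ⟶ K¹ ⟶ ⋯` is exact. -/
structure IsResolution {Z : A} {K : CochainComplex A ℕ} (e : Z ⟶ K.X 0) : Prop where
  mono : Mono e
  w : e ≫ K.d 0 1 = 0
  exact₀ : (ShortComplex.mk e (K.d 0 1) w).Exact
  exact_succ (n : ℕ) : (ShortComplex.mk _ _ (K.d_comp_d n (n + 1) (n + 2))).Exact

lemma isResolution_injAug {X : A} (P : InjectiveResolution X) : IsResolution (injAug P) where
  mono := inferInstanceAs (Mono (P.ι.f 0))
  w := P.ι_f_zero_comp_complex_d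
  exact₀ := P.exact₀
  exact_succ := P.exact_succ

lemma IsResolution.map {Z : A} {K : CochainComplex A ℕ} {e : Z ⟶ K.X 0} (h : IsResolution e)
    (F : A ⥤ B) [F.Additive] [PreservesFiniteLimits F] [PreservesFiniteColimits F] :
    IsResolution (K := (F.mapHomologicalComplex _).obj K) (F.map e) where
  mono := by have := h.mono; exact F.map_mono e
  w := by
    have := congrArg F.map h.w
    rwa [F.map_comp, F.map_zero] at this
  exact₀ := h.exact₀.map F
  exact_succ n := (h.exact_succ n).map F

lemma IsResolution.exists_lift {Z Y : A} {K : CochainComplex A ℕ} {e : Z ⟶ K.X 0}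
    (h : IsResolution e) (Q : InjectiveResolution Y) (f : Z ⟶ Y) :
    ∃ g : K ⟶ Q.cocomplex, e ≫ g.f 0 = f ≫ injAug Q := by
  have := h.mono
  have hQ := (isResolution_injAug Q).w
  let g₀ : K.X 0 ⟶ Q.cocomplex.X 0 := Injective.factorThru (f ≫ injAug Q) e
  have hg₀ : e ≫ g₀ = f ≫ injAug Q := Injective.comp_factorThru _ _
  have w₀ : e ≫ g₀ ≫ Q.cocomplex.d 0 1 = 0 := by
    rw [← Category.assoc, hg₀, Category.assoc, hQ, comp_zero]
  let g₁ : K.X 1 ⟶ Q.cocomplex.X 1 := h.exact₀.descToInjective (g₀ ≫ Q.cocomplex.d 0 1) w₀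
  have hg₁ : K.d 0 1 ≫ g₁ = g₀ ≫ Q.cocomplex.d 0 1 := h.exact₀.comp_descToInjective _ w₀
  refine ⟨CochainComplex.mkHom _ _ g₀ g₁ hg₁.symm fun n ⟨g, g', w⟩ =>
    have w' : K.d n (n + 1) ≫ g' ≫ Q.cocomplex.d (n + 1) (n + 2) = 0 := by
      rw [← Category.assoc, ← w, Category.assoc, HomologicalComplex.d_comp_d, comp_zero]
    ⟨(h.exact_succ n).descToInjective (g' ≫ Q.cocomplex.d (n + 1) (n + 2)) w',
      ((h.exact_succ n).comp_descToInjective _ w').symm⟩, ?_⟩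
  exact hg₀

lemma IsResolution.homotopy_zero {Z Y : A} {K : CochainComplex A ℕ} {e : Z ⟶ K.X 0}
    (h : IsResolution e) (Q : InjectiveResolution Y) (g : K ⟶ Q.cocomplex)
    (hg : e ≫ g.f 0 = 0) : Nonempty (Homotopy g 0) := by
  let s₀ : K.X 1 ⟶ Q.cocomplex.X 0 := h.exact₀.descToInjective (g.f 0) hg
  have hs₀ : K.d 0 1 ≫ s₀ = g.f 0 := h.exact₀.comp_descToInjective _ hg
  have w₁ : K.d 0 1 ≫ (g.f 1 - s₀ ≫ Q.cocomplex.d 0 1) = 0 := by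
    rw [Preadditive.comp_sub, ← Category.assoc, hs₀, HomologicalComplex.Hom.comm, sub_self]
  let s₁ : K.X 2 ⟶ Q.cocomplex.X 1 := (h.exact_succ 0).descToInjective _ w₁
  have hs₁ : K.d 1 2 ≫ s₁ = g.f 1 - s₀ ≫ Q.cocomplex.d 0 1 :=
    (h.exact_succ 0).comp_descToInjective _ w₁
  exact ⟨Homotopy.mkCoinductive _ s₀ hs₀.symm s₁ (by rw [hs₁, add_comm]; simp) fun n ⟨t, t', w⟩ =>
    have w' : K.d (n + 1) (n + 2) ≫ (g.f (n + 2) - t' ≫ Q.cocomplex.d (n + 1) (n + 2)) = 0 := by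
      have w : g.f (n + 1) = t ≫ Q.cocomplex.d n (n + 1) + K.d (n + 1) (n + 2) ≫ t' := w
      rw [Preadditive.comp_sub, ← HomologicalComplex.Hom.comm, w, Preadditive.add_comp,
        Category.assoc, Category.assoc, HomologicalComplex.d_comp_d, comp_zero, zero_add, sub_self]
    ⟨(h.exact_succ (n + 1)).descToInjective _ w', by
      have := (h.exact_succ (n + 1)).comp_descToInjective _ w'
      dsimp at this ⊢
      rw [this]
      simp⟩⟩

lemma IsResolution.homotopy {Z Y : A} {K : CochainComplex A ℕ} {e : Z ⟶ K.X 0}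
    (h : IsResolution e) (Q : InjectiveResolution Y) (g g' : K ⟶ Q.cocomplex)
    (hg : e ≫ g.f 0 = e ≫ g'.f 0) : Nonempty (Homotopy g g') := by
  obtain ⟨s⟩ := h.homotopy_zero Q (g - g') (by
    rw [HomologicalComplex.sub_f_apply, Preadditive.comp_sub, hg, sub_self])
  exact ⟨Homotopy.equivSubZero.symm s⟩

end Resolutions

instance enoughInjectives_functor (I : Type u) [SmallCategory I] :
    EnoughInjectives (I ⥤ AB.{u}) where
  presentation X := by
    let adj := fun i : I => evaluationAdjunctionLeft AB.{u} i
    let f : ∀ i, X ⟶ (evaluationRightAdjoint AB.{u} i).obj (Injective.under (X.obj i)) :=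
      fun i => (adj i).homEquiv _ _ (Injective.ι (X.obj i))
    have hJ : ∀ i, Injective ((evaluationRightAdjoint AB.{u} i).obj (Injective.under (X.obj i))) :=
      fun i => Injective.injective_of_adjoint (adj i) _
    have hf : Mono (Pi.lift f) := by
      have : ∀ i, Mono ((Pi.lift f).app i) := fun i => by
        have h : (Pi.lift f ≫ Pi.π _ i).app i ≫ (adj i).counit.app _ = Injective.ι (X.obj i) := by
          rw [limit.lift_π]
          exact ((adj i).homEquiv_counit _ _ _).symm.trans
            (((adj i).homEquiv _ _).symm_apply_apply _)
        rw [NatTrans.comp_app, Category.assoc] at h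
        exact mono_of_mono_fac h
      exact NatTrans.mono_of_mono_app _
    exact ⟨⟨∏ᶜ fun i => (evaluationRightAdjoint AB.{u} i).obj (Injective.under (X.obj i)),
      inferInstance, Pi.lift f, hf⟩⟩

instance additive_lim (I : Type u) [SmallCategory I] :
    (lim : (I ⥤ AB.{u}) ⥤ AB.{u}).Additive where
  map_add {X Y f g} := by
    refine limit.hom_ext fun i => ?_
    simp

namespace InvSystem

section LimDerived

variable {I J K : Type u} [SmallCategory I] [SmallCategory J] [SmallCategory K]

/-- Restriction of `I`-diagrams along `φ : J ⥤ I`. -/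
abbrev restr (φ : J ⥤ I) : (I ⥤ AB.{u}) ⥤ (J ⥤ AB.{u}) := (Functor.whiskeringLeft J I AB.{u}).obj φ

instance (φ : J ⥤ I) : (restr φ).Additive where

/-- The complex of limits of a cochain complex of `I`-diagrams. -/
abbrev limComplex (P : CochainComplex (I ⥤ AB.{u}) ℕ) : CochainComplex AB.{u} ℕ :=
  (lim.mapHomologicalComplex _).obj P

/-- The restriction of a cochain complex of `I`-diagrams along `φ : J ⥤ I`. -/
abbrev restrComplex (φ : J ⥤ I) (P : CochainComplex (I ⥤ AB.{u}) ℕ) :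
    CochainComplex (J ⥤ AB.{u}) ℕ :=
  ((restr φ).mapHomologicalComplex _).obj P

/-- The morphism `lim_I A ⟶ lim_J B` induced by `φ : J ⥤ I` and `g : φ^* A ⟶ B`. -/
def limAlong (φ : J ⥤ I) {A : I ⥤ AB.{u}} {B : J ⥤ AB.{u}} (g : φ ⋙ A ⟶ B) : limit A ⟶ limit B :=
  limit.pre A φ ≫ limMap g

lemma limAlong_π (φ : J ⥤ I) {A : I ⥤ AB.{u}} {B : J ⥤ AB.{u}} (g : φ ⋙ A ⟶ B) (j : J) :
    limAlong φ g ≫ limit.π B j = limit.π A (φ.obj j) ≫ g.app j := by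
  rw [limAlong, Category.assoc, limMap_π, ← Category.assoc, limit.pre_π]

lemma limAlong_id (A : I ⥤ AB.{u}) : limAlong (𝟭 I) (𝟙 A) = 𝟙 (limit A) := by
  refine limit.hom_ext fun a => ?_
  rw [limAlong_π, Category.id_comp]
  exact Category.comp_id _

lemma limAlong_comp (φ : J ⥤ I) (χ : K ⥤ J) {A : I ⥤ AB.{u}} {B : J ⥤ AB.{u}} {D : K ⥤ AB.{u}}
    (g : φ ⋙ A ⟶ B) (h : χ ⋙ B ⟶ D) (k : (χ ⋙ φ) ⋙ A ⟶ D)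
    (hk : ∀ a, k.app a = g.app (χ.obj a) ≫ h.app a) :
    limAlong (χ ⋙ φ) k = limAlong φ g ≫ limAlong χ h := by
  refine limit.hom_ext fun a => ?_
  rw [limAlong_π, Category.assoc, limAlong_π, ← Category.assoc, limAlong_π, Category.assoc, hk]
  rfl

/-- The canonical morphism `lim_I P ⟶ lim_J (φ^* P)`. -/
def limPre (φ : J ⥤ I) (P : CochainComplex (I ⥤ AB.{u}) ℕ) :
    limComplex P ⟶ limComplex (restrComplex φ P) where
  f n := limit.pre (P.X n) φ
  comm' i j _ := by
    refine limit.hom_ext (F := φ ⋙ P.X j) fun a => ?_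
    have h1 : (limit.pre (P.X i) φ ≫ limMap ((restr φ).map (P.d i j))) ≫ limit.π (φ ⋙ P.X j) a =
        limit.π (P.X i) (φ.obj a) ≫ (P.d i j).app (φ.obj a) := limAlong_π φ _ a
    have h2 : (limMap (P.d i j) ≫ limit.pre (P.X j) φ) ≫ limit.π (φ ⋙ P.X j) a =
        limit.π (P.X i) (φ.obj a) ≫ (P.d i j).app (φ.obj a) := by
      rw [Category.assoc, limit.pre_π, limMap_π]
    exact h1.trans h2.symm

/-- The morphism `lim_I P ⟶ lim_J (φ^* P) ⟶ lim_J Q` induced by `g : φ^* P ⟶ Q`. -/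
def limComplexMap (φ : J ⥤ I) {P : CochainComplex (I ⥤ AB.{u}) ℕ}
    {Q : CochainComplex (J ⥤ AB.{u}) ℕ} (g : restrComplex φ P ⟶ Q) :
    limComplex P ⟶ limComplex Q :=
  limPre φ P ≫ (lim.mapHomologicalComplex _).map g

lemma homologyMap_limComplexMap_congr (φ : J ⥤ I) {P : CochainComplex (I ⥤ AB.{u}) ℕ}
    {Q : CochainComplex (J ⥤ AB.{u}) ℕ} (g g' : restrComplex φ P ⟶ Q) (h : Homotopy g g') (s : ℕ) :
    HomologicalComplex.homologyMap (limComplexMap φ g) s =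
      HomologicalComplex.homologyMap (limComplexMap φ g') s :=
  ((lim.mapHomotopy h).compLeft (limPre φ P)).homologyMap_eq s

/-- A morphism of injective resolutions over `ψ : φ^* X ⟶ Y`. -/
def resLift (φ : J ⥤ I) {X : I ⥤ AB.{u}} {Y : J ⥤ AB.{u}} (ψ : φ ⋙ X ⟶ Y)
    (P : InjectiveResolution X) (Q : InjectiveResolution Y) :
    restrComplex φ P.cocomplex ⟶ Q.cocomplex :=
  (((isResolution_injAug P).map (restr φ)).exists_lift Q ψ).choose

lemma resLift_spec (φ : J ⥤ I) {X : I ⥤ AB.{u}} {Y : J ⥤ AB.{u}} (ψ : φ ⋙ X ⟶ Y)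
    (P : InjectiveResolution X) (Q : InjectiveResolution Y) :
    (restr φ).map (injAug P) ≫ (resLift φ ψ P Q).f 0 = ψ ≫ injAug Q :=
  (((isResolution_injAug P).map (restr φ)).exists_lift Q ψ).choose_spec

/-- The morphism `lim^s_I X ⟶ lim^s_J Y` induced by `φ : J ⥤ I` and `ψ : φ^* X ⟶ Y`. -/
def limDerivedMap (φ : J ⥤ I) {X : I ⥤ AB.{u}} {Y : J ⥤ AB.{u}} (ψ : φ ⋙ X ⟶ Y) (s : ℕ) :
    ((lim : (I ⥤ AB.{u}) ⥤ AB.{u}).rightDerived s).obj X ⟶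
      ((lim : (J ⥤ AB.{u}) ⥤ AB.{u}).rightDerived s).obj Y :=
  ((injectiveResolution X).isoRightDerivedObj lim s).hom ≫
    HomologicalComplex.homologyMap
      (limComplexMap φ (resLift φ ψ (injectiveResolution X) (injectiveResolution Y))) s ≫
    ((injectiveResolution Y).isoRightDerivedObj lim s).inv

lemma limDerivedMap_eq (φ : J ⥤ I) {X : I ⥤ AB.{u}} {Y : J ⥤ AB.{u}} (ψ : φ ⋙ X ⟶ Y) (s : ℕ)
    (g : restrComplex φ (injectiveResolution X).cocomplex ⟶ (injectiveResolution Y).cocomplex)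
    (hg : (restr φ).map (injAug (injectiveResolution X)) ≫ g.f 0 =
      ψ ≫ injAug (injectiveResolution Y)) :
    limDerivedMap φ ψ s = ((injectiveResolution X).isoRightDerivedObj lim s).hom ≫
      HomologicalComplex.homologyMap (limComplexMap φ g) s ≫
      ((injectiveResolution Y).isoRightDerivedObj lim s).inv := by
  obtain ⟨h⟩ := ((isResolution_injAug (injectiveResolution X)).map (restr φ)).homotopy
    (injectiveResolution Y) (resLift φ ψ _ _) g ((resLift_spec φ ψ _ _).trans hg.symm)
  rw [limDerivedMap, homologyMap_limComplexMap_congr φ _ _ h]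

lemma limDerivedMap_id (X : I ⥤ AB.{u}) (s : ℕ) :
    limDerivedMap (𝟭 I) (X.leftUnitor).hom s = 𝟙 _ := by
  rw [limDerivedMap_eq (𝟭 I) (X.leftUnitor).hom s (𝟙 _ : (injectiveResolution X).cocomplex ⟶ _)]
  · have : limComplexMap (𝟭 I) (𝟙 _ : (injectiveResolution X).cocomplex ⟶ _) = 𝟙 _ :=
      HomologicalComplex.hom_ext _ _ fun n => limAlong_id _
    rw [this]
    refine (congrArg (_ ≫ ·) ((congrArg (· ≫ _) (HomologicalComplex.homologyMap_id _ s)).trans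
      (Category.id_comp _))).trans (Iso.hom_inv_id _)
  · exact (Category.comp_id _).trans (Category.id_comp _).symm

lemma conj_comp {A A' B B' D D' : AB.{u}} (a : A ≅ A') (b : B ≅ B') (d : D ≅ D')
    (f : A' ⟶ B') (g : B' ⟶ D') :
    a.hom ≫ (f ≫ g) ≫ d.inv = (a.hom ≫ f ≫ b.inv) ≫ b.hom ≫ g ≫ d.inv := by
  simp

lemma limDerivedMap_comp (φ : J ⥤ I) (χ : K ⥤ J) {X : I ⥤ AB.{u}} {Y : J ⥤ AB.{u}} {Z : K ⥤ AB.{u}}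
    (ψ : φ ⋙ X ⟶ Y) (ω : χ ⋙ Y ⟶ Z) (ξ : (χ ⋙ φ) ⋙ X ⟶ Z)
    (hξ : ξ = (Functor.associator _ _ _).hom ≫ Functor.whiskerLeft χ ψ ≫ ω) (s : ℕ) :
    limDerivedMap (χ ⋙ φ) ξ s = limDerivedMap φ ψ s ≫ limDerivedMap χ ω s := by
  let P := injectiveResolution X
  let Q := injectiveResolution Y
  let R := injectiveResolution Z
  let g := resLift φ ψ P Q
  let g' := resLift χ ω Q R
  let g'' : restrComplex (χ ⋙ φ) P.cocomplex ⟶ R.cocomplex :=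
    ((restr χ).mapHomologicalComplex _).map g ≫ g'
  have h : (restr (χ ⋙ φ)).map (injAug P) ≫ g''.f 0 = ξ ≫ injAug R := by
    refine NatTrans.ext (funext fun a => ?_)
    have h1 := congrArg (fun t => NatTrans.app t (χ.obj a)) (resLift_spec φ ψ P Q)
    have h2 := congrArg (fun t => NatTrans.app t a) (resLift_spec χ ω Q R)
    have h1 : (injAug P).app (φ.obj (χ.obj a)) ≫ (g.f 0).app (χ.obj a) =
      ψ.app (χ.obj a) ≫ (injAug Q).app (χ.obj a) := h1
    have h2 : (injAug Q).app (χ.obj a) ≫ (g'.f 0).app a = ω.app a ≫ (injAug R).app a := h2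
    have h3 : ξ.app a = ψ.app (χ.obj a) ≫ ω.app a := by
      rw [hξ]
      exact Category.id_comp _
    change (injAug P).app (φ.obj (χ.obj a)) ≫ (g.f 0).app (χ.obj a) ≫ (g'.f 0).app a =
      ξ.app a ≫ (injAug R).app a
    exact (Category.assoc _ _ _).symm.trans ((congrArg (· ≫ _) h1).trans
      ((Category.assoc _ _ _).trans ((congrArg (_ ≫ ·) h2).trans
        ((Category.assoc _ _ _).symm.trans (congrArg (· ≫ _) h3.symm)))))
  have h3 : limComplexMap (χ ⋙ φ) g'' = limComplexMap φ g ≫ limComplexMap χ g' :=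
    HomologicalComplex.hom_ext _ _ fun n =>
      limAlong_comp φ χ (g.f n) (g'.f n) _ fun _ => rfl
  rw [limDerivedMap_eq (χ ⋙ φ) ξ s g'' h, h3, HomologicalComplex.homologyMap_comp]
  exact conj_comp (P.isoRightDerivedObj lim s) (Q.isoRightDerivedObj lim s)
    (R.isoRightDerivedObj lim s) (HomologicalComplex.homologyMap (limComplexMap φ g) s)
    (HomologicalComplex.homologyMap (limComplexMap χ g') s)

end LimDerived

/-- The derived inverse limits `lim^s`, as functors on inverse systems of abelian groups: on an
inverse system `X : I ⥤ AB` the value is that of the `s`-th right derived functor of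
`lim : (I ⥤ AB) ⥤ AB` at `X`. -/
def limDerived (s : ℕ) : InvSystem.{u} AB.{u} ⥤ AB.{u} where
  obj X := ((lim : (X.I ⥤ AB.{u}) ⥤ AB.{u}).rightDerived s).obj X.X
  map f := limDerivedMap (Hom.φ f) (Hom.ψ f) s
  map_id X := limDerivedMap_id X.X s
  map_comp f g := limDerivedMap_comp (Hom.φ f) (Hom.φ g) (Hom.ψ f) (Hom.ψ g) _ rfl s

/-- The inverse limit, as a functor on inverse systems of abelian groups. -/
def limFunctor : InvSystem.{u} AB.{u} ⥤ AB.{u} where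
  obj X := limit X.X
  map f := limAlong (Hom.φ f) (Hom.ψ f)
  map_id X := limAlong_id X.X
  map_comp f g := limAlong_comp (Hom.φ f) (Hom.φ g) (Hom.ψ f) (Hom.ψ g) _ (comp_ψ_app f g)

/-- The pro-homology `H_n(C)`, as a functor on inverse systems of chain complexes. -/
abbrev proHomology (n : ℤ) : InvSystem.{u} CHAIN.{u} ⥤ InvSystem.{u} AB.{u} :=
  InvSystem.map (HomologicalComplex.homologyFunctor AB.{u} _ n)

end InvSystem

/-! ### Spectral sequences with their exact couples -/

/-- A cohomological spectral sequence starting from the page `r₀`, together with the sequence of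
exact couples `(D_r, E_r, i, j, k)`, `r ≥ r₀`, defining it:
`i : D_r^{s,t} ⟶ D_r^{s-1,t+1}`, `j : D_r^{s,t} ⟶ E_r^{s+r,t+1-r}`, `k : E_r^{s,t} ⟶ D_r^{s,t}`.
The differential of the page `E_r` is `j ∘ k`, and the couple with index `r + 1` is the derived
couple of the one with index `r`. Everything vanishes for `s < 0`. -/
structure CoupledSS (A : Type w) [Category.{v} A] [Abelian A] (r₀ : ℤ) where
  /-- the underlying spectral sequence -/
  ss : CohomologicalSpectralSequence A r₀
  D (r : ℤ) (hr : r₀ ≤ r) (p : ℤ × ℤ) : A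
  i (r : ℤ) (hr : r₀ ≤ r) (p q : ℤ × ℤ) (h : p + (-1, 1) = q) : D r hr p ⟶ D r hr q
  j (r : ℤ) (hr : r₀ ≤ r) (p q : ℤ × ℤ) (h : p + (r, 1 - r) = q) : D r hr p ⟶ (ss.page r hr).X q
  k (r : ℤ) (hr : r₀ ≤ r) (p : ℤ × ℤ) : (ss.page r hr).X p ⟶ D r hr p
  /-- exactness of `E_r^p ⟶ D_r^p ⟶ D_r^q ⟶ E_r^p' ⟶ D_r^p'` at the three inner terms -/
  exact (r : ℤ) (hr : r₀ ≤ r) (p q p' : ℤ × ℤ) (h : p + (-1, 1) = q) (h' : q + (r, 1 - r) = p') :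
    (ComposableArrows.mk₄ (k r hr p) (i r hr p q h) (j r hr q p' h') (k r hr p')).Exact
  d_eq (r : ℤ) (hr : r₀ ≤ r) (p q : ℤ × ℤ) (h : p + (r, 1 - r) = q) :
    (ss.page r hr).d p q = k r hr p ≫ j r hr p q h
  /-- the inclusion of `D_{r+1}` into `D_r` -/
  ι (r r' : ℤ) (hr : r₀ ≤ r) (hr' : r + 1 = r') (p : ℤ × ℤ) : D r' (by lia) p ⟶ D r hr p
  /-- the map `i`, with codomain restricted to its image `D_{r+1}` -/
  π (r r' : ℤ) (hr : r₀ ≤ r) (hr' : r + 1 = r') (p q : ℤ × ℤ) (h : p + (-1, 1) = q) :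
    D r hr p ⟶ D r' (by lia) q
  mono_ι (r r' : ℤ) (hr : r₀ ≤ r) (hr' : r + 1 = r') (p : ℤ × ℤ) : Mono (ι r r' hr hr' p)
  epi_π (r r' : ℤ) (hr : r₀ ≤ r) (hr' : r + 1 = r') (p q : ℤ × ℤ) (h : p + (-1, 1) = q) :
    Epi (π r r' hr hr' p q h)
  π_ι (r r' : ℤ) (hr : r₀ ≤ r) (hr' : r + 1 = r') (p q : ℤ × ℤ) (h : p + (-1, 1) = q) :
    π r r' hr hr' p q h ≫ ι r r' hr hr' q = i r hr p q h
  /-- the map `i` of the derived couple is the restriction of `i` -/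
  i_ι (r r' : ℤ) (hr : r₀ ≤ r) (hr' : r + 1 = r') (p q : ℤ × ℤ) (h : p + (-1, 1) = q) :
    i r' (by lia) p q h ≫ ι r r' hr hr' q = ι r r' hr hr' p ≫ i r hr p q h
  /-- the map `k` of the derived couple sends the class of a cycle `z` to `k z` -/
  k_ι (r r' : ℤ) (hr : r₀ ≤ r) (hr' : r + 1 = r') (p : ℤ × ℤ) :
    (ss.page r hr).homologyπ p ≫ (ss.iso r r' p).hom ≫ k r' (by lia) p ≫ ι r r' hr hr' p =
      (ss.page r hr).iCycles p ≫ k r hr p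
  /-- the map `j` of the derived couple sends `i x` to the class of `j x` -/
  π_j (r r' : ℤ) (hr : r₀ ≤ r) (hr' : r + 1 = r') (p q p' : ℤ × ℤ) (h : p + (-1, 1) = q)
      (h' : p + (r, 1 - r) = p') (h'' : q + (r', 1 - r') = p') :
    π r r' hr hr' p q h ≫ j r' (by lia) q p' h'' ≫ (ss.iso r r' p').inv ≫
      (ss.page r hr).homologyι p' = j r hr p p' h' ≫ (ss.page r hr).pOpcycles p'
  isZero_D (r : ℤ) (hr : r₀ ≤ r) (p : ℤ × ℤ) (hp : p.1 < 0) : IsZero (D r hr p)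
  isZero_E (r : ℤ) (hr : r₀ ≤ r) (p : ℤ × ℤ) (hp : p.1 < 0) : IsZero ((ss.page r hr).X p)

namespace CoupledSS

variable {A : Type w} [Category.{v} A] [Abelian A] {r₀ r₁ : ℤ}

/-- Morphisms are morphisms of spectral sequences with compatible morphisms between the terms
`D_r`. -/
@[ext]
structure Hom (S T : CoupledSS A r₀) where
  ss : S.ss ⟶ T.ss
  D (r : ℤ) (hr : r₀ ≤ r) (p : ℤ × ℤ) : S.D r hr p ⟶ T.D r hr p
  i_comm (r : ℤ) (hr : r₀ ≤ r) (p q : ℤ × ℤ) (h : p + (-1, 1) = q) :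
    S.i r hr p q h ≫ D r hr q = D r hr p ≫ T.i r hr p q h
  j_comm (r : ℤ) (hr : r₀ ≤ r) (p q : ℤ × ℤ) (h : p + (r, 1 - r) = q) :
    S.j r hr p q h ≫ (ss.hom r hr).f q = D r hr p ≫ T.j r hr p q h
  k_comm (r : ℤ) (hr : r₀ ≤ r) (p : ℤ × ℤ) :
    S.k r hr p ≫ D r hr p = (ss.hom r hr).f p ≫ T.k r hr p
  ι_comm (r r' : ℤ) (hr : r₀ ≤ r) (hr' : r + 1 = r') (p : ℤ × ℤ) :
    S.ι r r' hr hr' p ≫ D r hr p = D r' (by lia) p ≫ T.ι r r' hr hr' p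

instance : Category (CoupledSS A r₀) where
  Hom := Hom
  id S :=
    { ss := 𝟙 _
      D r hr p := 𝟙 _
      i_comm := by simp
      j_comm := by simp
      k_comm := by simp
      ι_comm := by simp }
  comp f g :=
    { ss := f.ss ≫ g.ss
      D r hr p := f.D r hr p ≫ g.D r hr p
      i_comm r hr p q h := by
        rw [← Category.assoc, f.i_comm, Category.assoc, g.i_comm, Category.assoc]
      j_comm r hr p q h := by
        rw [SpectralSequence.comp_hom, HomologicalComplex.comp_f, ← Category.assoc, f.j_comm,
          Category.assoc, g.j_comm, Category.assoc]
      k_comm r hr p := by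
        rw [SpectralSequence.comp_hom, HomologicalComplex.comp_f, ← Category.assoc, f.k_comm,
          Category.assoc, g.k_comm, Category.assoc]
      ι_comm r r' hr hr' p := by
        rw [← Category.assoc, f.ι_comm, Category.assoc, g.ι_comm, Category.assoc] }
  id_comp f := by
    apply Hom.ext
    · exact Category.id_comp _
    · funext r hr p
      exact Category.id_comp _
  comp_id f := by
    apply Hom.ext
    · exact Category.comp_id _
    · funext r hr p
      exact Category.comp_id _
  assoc f g h := by
    apply Hom.ext
    · exact Category.assoc _ _ _
    · funext r hr p
      exact Category.assoc _ _ _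

/-- Forgetting the pages `E_r` and the terms `D_r` for `r < r₁`. -/
def truncate (A : Type w) [Category.{v} A] [Abelian A] (h : r₀ ≤ r₁) :
    CoupledSS A r₀ ⥤ CoupledSS A r₁ where
  obj S :=
    { ss :=
        { page r hr := S.ss.page r (h.trans hr)
          iso r r' p hrr' hr := S.ss.iso r r' p hrr' (h.trans hr) }
      D r hr := S.D r (h.trans hr)
      i r hr := S.i r (h.trans hr)
      j r hr := S.j r (h.trans hr)
      k r hr := S.k r (h.trans hr)
      exact r hr := S.exact r (h.trans hr)
      d_eq r hr := S.d_eq r (h.trans hr)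
      ι r r' hr := S.ι r r' (h.trans hr)
      π r r' hr := S.π r r' (h.trans hr)
      mono_ι r r' hr := S.mono_ι r r' (h.trans hr)
      epi_π r r' hr := S.epi_π r r' (h.trans hr)
      π_ι r r' hr := S.π_ι r r' (h.trans hr)
      i_ι r r' hr := S.i_ι r r' (h.trans hr)
      k_ι r r' hr := S.k_ι r r' (h.trans hr)
      π_j r r' hr := S.π_j r r' (h.trans hr)
      isZero_D r hr := S.isZero_D r (h.trans hr)
      isZero_E r hr := S.isZero_E r (h.trans hr) }
  map f :=
    { ss :=
        { hom r hr := (Hom.ss f).hom r (h.trans hr)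
          comm r r' p hrr' hr := (Hom.ss f).comm r r' p hrr' (h.trans hr) }
      D r hr := Hom.D f r (h.trans hr)
      i_comm r hr := Hom.i_comm f r (h.trans hr)
      j_comm r hr := Hom.j_comm f r (h.trans hr)
      k_comm r hr := Hom.k_comm f r (h.trans hr)
      ι_comm r r' hr := Hom.ι_comm f r r' (h.trans hr) }
  map_id _ := rfl
  map_comp _ _ := rfl

/-- The functor `S ↦ E_r^p`. -/
def eFunctor (A : Type w) [Category.{v} A] [Abelian A] {r₀ : ℤ} (r : ℤ) (hr : r₀ ≤ r)
    (p : ℤ × ℤ) : CoupledSS A r₀ ⥤ A where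
  obj S := (S.ss.page r hr).X p
  map f := ((Hom.ss f).hom r hr).f p
  map_id _ := rfl
  map_comp _ _ := rfl

/-- The functor `S ↦ D_r^p`. -/
def dFunctor (A : Type w) [Category.{v} A] [Abelian A] {r₀ : ℤ} (r : ℤ) (hr : r₀ ≤ r)
    (p : ℤ × ℤ) : CoupledSS A r₀ ⥤ A where
  obj S := S.D r hr p
  map f := Hom.D f r hr p
  map_id _ := rfl
  map_comp _ _ := rfl

/-- The maps `i : D_r^p ⟶ D_r^q`, as a natural transformation. -/
def iNat (r : ℤ) (hr : r₀ ≤ r) (p q : ℤ × ℤ) (h : p + (-1, 1) = q) :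
    dFunctor A r hr p ⟶ dFunctor A r hr q where
  app S := S.i r hr p q h
  naturality _ _ f := (Hom.i_comm f r hr p q h).symm

/-- The inclusions `D_{r+1}^p ⟶ D_r^p`, as a natural transformation. -/
def ιNat (r r' : ℤ) (hr : r₀ ≤ r) (hr' : r + 1 = r') (p : ℤ × ℤ) :
    dFunctor A r' (by lia : r₀ ≤ r') p ⟶ dFunctor A r hr p where
  app S := S.ι r r' hr hr' p
  naturality _ _ f := (Hom.ι_comm f r r' hr hr' p).symm

variable (S : CoupledSS A r₀)

lemma d_eq_zero (r : ℤ) (hr : r₀ ≤ r) (p q : ℤ × ℤ) (hq : q.1 < r) :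
    (S.ss.page r hr).d p q = 0 := by
  by_cases h : (ComplexShape.up' ((r, 1 - r) : ℤ × ℤ)).Rel p q
  · have h' : p + (r, 1 - r) = q := h
    refine (S.isZero_E r hr p ?_).eq_of_src _ _
    have := congrArg Prod.fst h'
    simp only [Prod.fst_add] at this
    lia
  · exact (S.ss.page r hr).shape _ _ h

/-- For `p = (s, t)` with `s < r` no differential of the page `E_r` arrives at `E_r^p`, and
`E_{r+1}^p ≅ ker d_r` is a subobject of `E_r^p`: this is the inclusion. -/
def pageIncl (r r' : ℤ) (hr : r₀ ≤ r) (hr' : r + 1 = r') (p : ℤ × ℤ) (hp : p.1 < r) :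
    (S.ss.page r' (by lia)).X p ⟶ (S.ss.page r hr).X p :=
  (S.ss.iso r r' p).inv ≫
    ((S.ss.page r hr).isoHomologyπ _ p rfl (S.d_eq_zero r hr _ p hp)).inv ≫
    (S.ss.page r hr).iCycles p

/-- The tower of the inclusions `E_{s+2+m+1}^{s,t} ⟶ E_{s+2+m}^{s,t}`, for `m = 0, 1, 2, …`. -/
def pageTower (S : CoupledSS A 2) (s : ℕ) (t : ℤ) : ℕᵒᵖ ⥤ A :=
  Functor.ofOpSequence (X := fun m : ℕ => (S.ss.page (s + 2 + m)).X (s, t)) fun m =>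
    S.pageIncl (s + 2 + m) (s + 2 + (m + 1 : ℕ)) (by lia) (by push_cast; ring) (s, t) (by
      dsimp only; lia)

/-- The tower `⋯ ⟶ D_r^{s,n-s} ⟶ D_r^{s-1,n-s+1} ⟶ ⋯ ⟶ D_r^{0,n}` of the maps `i`, as a tower of
functors. -/
def dTower (A : Type w) [Category.{v} A] [Abelian A] {r₀ : ℤ} (r : ℤ) (hr : r₀ ≤ r) (n : ℤ) :
    ℕᵒᵖ ⥤ (CoupledSS A r₀ ⥤ A) :=
  Functor.ofOpSequence (X := fun s : ℕ => dFunctor A r hr (s, n - s)) fun s =>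
    iNat r hr _ _ (by ext <;> simp; ring)

end CoupledSS

/-! ### Towers -/

/-- The map `T_{n+1} ⟶ T_n` of a tower `T`. -/
abbrev towerMap {A : Type w} [Category.{v} A] (T : ℕᵒᵖ ⥤ A) (n : ℕ) :
    T.obj (Opposite.op (n + 1)) ⟶ T.obj (Opposite.op n) :=
  T.map (homOfLE (Nat.le_succ n)).op

/-- The derived limit `lim¹` of a tower `⋯ ⟶ T_2 ⟶ T_1 ⟶ T_0`: the cokernel of
`∏ T_n ⟶ ∏ T_n`, `(x_n) ↦ (x_n - f_n (x_{n+1}))`, where `f_n : T_{n+1} ⟶ T_n`. -/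
def towerLim1 {A : Type w} [Category.{v} A] [Preadditive A] [HasProductsOfShape ℕ A]
    [HasCokernels A] (T : ℕᵒᵖ ⥤ A) : A :=
  cokernel (𝟙 (∏ᶜ fun n : ℕ => T.obj (Opposite.op n)) -
    Pi.lift fun n => Pi.π (fun n : ℕ => T.obj (Opposite.op n)) (n + 1) ≫ towerMap T n)

instance : HasProductsOfShape ℕ (Pro.{u} CHAIN.{u} ⥤ AB.{u}) :=
  functorCategoryHasLimitsOfShape

instance : HasCokernels (Pro.{u} CHAIN.{u} ⥤ AB.{u}) := Abelian.has_cokernels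

/-! ### The first exact couple of the homotopy inverse limit -/

namespace InvSystem

/-- The kernel `Γ^{(s+1)}` of `Tot^{(s+1)} ⟶ Tot^{(s)}`. -/
def holimGamma (s : ℤ) : InvSystem.{u} CHAIN.{u} ⥤ CHAIN.{u} where
  obj C := (holimTotShortComplex C s).X₁
  map f := kernel.map _ _ ((holimTot (s + 1)).map f) ((holimTot s).map f)
    ((holimTotProj s).naturality f).symm
  map_id C := (cancel_mono (kernel.ι ((holimTotProj s).app C))).1 <|
    (kernel.lift_ι _ _ _).trans ((congrArg (_ ≫ ·) ((holimTot (s + 1)).map_id C)).trans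
      ((Category.comp_id _).trans (Category.id_comp _).symm))
  map_comp {C C' C''} f g := (cancel_mono (kernel.ι ((holimTotProj s).app C''))).1 <| by
    have hf := kernel.lift_ι ((holimTotProj s).app C')
      (kernel.ι ((holimTotProj s).app C) ≫ (holimTot (s + 1)).map f) (by
        rw [Category.assoc, (holimTotProj s).naturality, kernel.condition_assoc, zero_comp])
    have hg := kernel.lift_ι ((holimTotProj s).app C'')
      (kernel.ι ((holimTotProj s).app C') ≫ (holimTot (s + 1)).map g) (by
        rw [Category.assoc, (holimTotProj s).naturality, kernel.condition_assoc, zero_comp])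
    refine (kernel.lift_ι _ _ _).trans ?_
    rw [Functor.map_comp, ← Category.assoc, ← hf, Category.assoc, ← hg]
    exact (Category.assoc _ _ _).symm

/-- The inclusion `Γ^{(s+1)} ⟶ Tot^{(s+1)}`. -/
def holimGammaι (s : ℤ) : holimGamma.{u} s ⟶ holimTot.{u} (s + 1) where
  app C := kernel.ι ((holimTotProj s).app C)
  naturality _ _ _ := kernel.lift_ι _ _ _

/-- The connecting homomorphism `H_n(Tot^{(s)}) ⟶ H_{n-1}(Γ^{(s+1)})`. -/
def holimδ (C : InvSystem.{u} CHAIN.{u}) (s n : ℤ) :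
    ((holimTot s).obj C).homology n ⟶ ((holimGamma s).obj C).homology (n - 1) :=
  (holimTotShortComplex_shortExact C s).δ n (n - 1) (by simp)

/-- The homology functor `H_n` on chain complexes. -/
abbrev homologyF (n : ℤ) : CHAIN.{u} ⥤ AB.{u} := HomologicalComplex.homologyFunctor AB.{u} _ n

/-- Identifications of the first exact couple of a functorial spectral sequence `S` with the exact
couple of the tower of complexes `Tot^{(s)}`:
`D_1^{s,t} = H_{-s-t}(Tot^{(s)})` and `E_1^{s,t} = H_{-s-t}(Γ^{(s)})`, where `i` is induced by the
projections, `k` by the inclusions of the kernels, and `j` is the connecting homomorphism. -/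
structure HolimCouple (S : InvSystem.{u} CHAIN.{u} ⥤ CoupledSS AB.{u} 1) where
  isoD (s t n : ℤ) (h : s + t = -n) :
    S ⋙ CoupledSS.dFunctor AB.{u} 1 le_rfl (s, t) ≅ holimTot s ⋙ homologyF n
  isoE (s t n : ℤ) (h : s + 1 + t = -n) :
    S ⋙ CoupledSS.eFunctor AB.{u} 1 le_rfl (s + 1, t) ≅ holimGamma s ⋙ homologyF n
  i_eq (C : InvSystem.{u} CHAIN.{u}) (s t n : ℤ) (h : s + 1 + t = -n) (h' : s + (t + 1) = -n) :
    (S.obj C).i 1 le_rfl (s + 1, t) (s, t + 1) (by ext <;> simp) ≫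
        (isoD s (t + 1) n h').hom.app C =
      (isoD (s + 1) t n h).hom.app C ≫ (homologyF n).map ((holimTotProj s).app C)
  k_eq (C : InvSystem.{u} CHAIN.{u}) (s t n : ℤ) (h : s + 1 + t = -n) :
    (S.obj C).k 1 le_rfl (s + 1, t) ≫ (isoD (s + 1) t n h).hom.app C =
      (isoE s t n h).hom.app C ≫ (homologyF n).map ((holimGammaι s).app C)
  j_eq (C : InvSystem.{u} CHAIN.{u}) (s t n : ℤ) (h : s + t = -n) (h' : s + 1 + t = -(n - 1)) :
    (S.obj C).j 1 le_rfl (s, t) (s + 1, t) (by ext <;> simp) ≫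
        (isoE s t (n - 1) h').hom.app C =
      (isoD s t n h).hom.app C ≫ holimδ C s n

end InvSystem

end

/-! ### Extension of functors from inverse systems to pro-objects -/

noncomputable section

namespace InvSystem

variable {C : Type w} [Category.{v} C]

/-! A pro-morphism is a fraction of morphisms of inverse systems. The representatives `X_i ⟶ Y_j` of
the components of `f : X ⟶ Y` form a cofiltered category `Rep f`, whose projection to the index
category of `Y` is initial. Restricting `Y` along this projection gives a system which receives a
numerator from `X` and a denominator from `Y`, and `f` followed by the denominator is the numerator
(`comp_denominator`). Hence every functor on inverse systems that inverts restrictions along initial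
functors extends to pro-objects (`Pro.extend`). It remains to prove this invertibility for the
spectral sequence from `E_2` on, and for the homology of `holim`.

The first page is, row by row, the complex of cochains on chains `i₀ ⟶ ⋯ ⟶ i_s` with values in the
homology groups (`pageCochains`), so `E_2` is the cohomology of this complex (`e₂Iso`). This
cohomology is invariant under initial functors (`bijective_cohomology_reindex`). In degree `0` it is
the limit. For the induction step, a diagram is embedded in a diagram coinduced from injective
groups, which is acyclic and stays acyclic after restriction along any functor from a cofiltered
category (`exists_primitive`). The acyclicity has two sources: over a cofiltered index category a
common cone vertex contracts the cochains on any finite set of chains (`exists_local_primitive`),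
and injectivity of the values turns these local primitives into a global one. The same acyclicity
identifies the cohomology with the derived functors `lim^s` by dimension shifting along an injective
resolution (`cohomologyIsoLimDerived`).

An isomorphism on `E_2` is an isomorphism of all later couples: the five lemma applies by induction
on the column because everything vanishes in negative columns (`bijective_D_of_bijective_E`), and
later couples are derived from earlier ones. The homology of `holim` is then controlled by Milnor
sequences. The complex `Tot` is the limit of the tower of surjections `Tot^{(s)}`, which gives the
sequence with `lim¹` and `lim` of `D_1` (`isMilnor_tot`). Replacing a tower by the tower of images
changes neither `lim` nor `lim¹`, which gives the sequence for every `D_r` (`isMilnor_succ`).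
Comparing the sequences with `r = 2` shows that an isomorphism on `E_2` induces one on `H_n(holim)`.
This proves both the extension of `H_n(holim)` to pro-complexes and the comparison statement.

For strong convergence, filter `D_2^s` by the subgroups `D_r^s`. On the kernel of `i` the induced
filtration is given by the images of the `E_r^s` under `k`. If all `lim¹_r E_r` vanish, an argument
about filtered towers (`IsFilteredTower`) shows that the tower `D_2` has no `lim¹` and that its maps
are surjective on the intersections of the filtrations. So `H_n(holim)` is the limit of the tower
`D_2`. The quotients `Q` are the images of `H_n(holim)` in the `D_2^s`, and an element of `lim_r
E_r^s` yields an element of the intersection of the `D_r^s` which lifts to `H_n(holim)` with zero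
image in lower columns. -/

lemma ColimHom.exists_of_eq {X : InvSystem.{u} C} {c : C} {i i' : X.I} {x : X.X.obj i ⟶ c}
    {x' : X.X.obj i' ⟶ c} (h : (Quot.mk _ ⟨i, x⟩ : X.ColimHom c) = Quot.mk _ ⟨i', x'⟩) :
    ∃ (i₀ : X.I) (a : i₀ ⟶ i) (a' : i₀ ⟶ i'), X.X.map a ≫ x = X.X.map a' ≫ x' := by
  suffices H : ∀ p q : Σ i : X.I, (X.X.obj i ⟶ c),
      Relation.EqvGen (fun p q => ∃ a : q.1 ⟶ p.1, q.2 = X.X.map a ≫ p.2) p q →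
      ∃ (i₀ : X.I) (a : i₀ ⟶ p.1) (a' : i₀ ⟶ q.1), X.X.map a ≫ p.2 = X.X.map a' ≫ q.2 from
    H ⟨i, x⟩ ⟨i', x'⟩ (Quot.eqvGen_exact h)
  intro p q hpq
  induction hpq with
  | rel p q h =>
    obtain ⟨a, ha⟩ := h
    exact ⟨q.1, a, 𝟙 _, by simp [ha]⟩
  | refl p => exact ⟨p.1, 𝟙 _, 𝟙 _, rfl⟩
  | symm p q _ ih =>
    obtain ⟨i₀, a, a', h⟩ := ih
    exact ⟨i₀, a', a, h.symm⟩
  -- The only case that uses cofilteredness: the two transition morphisms into the middle index are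
  -- completed to a square.
  | trans p q r _ _ ih ih' =>
    obtain ⟨i₀, a, a', h⟩ := ih
    obtain ⟨i₁, b, b', h'⟩ := ih'
    obtain ⟨i₂, e, e', he⟩ := IsCofiltered.cospan a' b
    refine ⟨i₂, e ≫ a, e' ≫ b', ?_⟩
    rw [Functor.map_comp, Category.assoc, h, Functor.map_comp, Category.assoc, ← h',
      ← Category.assoc, ← Category.assoc, ← Functor.map_comp, ← Functor.map_comp, he]

/-- The restriction of an inverse system along a functor of index categories. -/
def reindex (Y : InvSystem.{u} C) {J : Type u} [SmallCategory J] [IsCofiltered J] (φ : J ⥤ Y.I) :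
    InvSystem.{u} C := ⟨J, φ ⋙ Y.X⟩

/-- The canonical morphism from an inverse system to its restriction. -/
def toReindex (Y : InvSystem.{u} C) {J : Type u} [SmallCategory J] [IsCofiltered J]
    (φ : J ⥤ Y.I) : Y ⟶ Y.reindex φ := Hom.mk φ (𝟙 _)

/-- Functors on inverse systems that invert the restrictions along initial functors. -/
def InvertsInitial {D : Type*} [Category* D] (F : InvSystem.{u} C ⥤ D) : Prop :=
  ∀ (Y : InvSystem.{u} C) (J : Type u) [SmallCategory J] [IsCofiltered J] (φ : J ⥤ Y.I)
    [φ.Initial], IsIso (F.map (Y.toReindex φ))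

lemma hom_ext' {X Y : InvSystem.{u} C} {φ : Y.I ⥤ X.I} {ψ ψ' : φ ⋙ X.X ⟶ Y.X}
    (h : ∀ j, ψ.app j = ψ'.app j) : (Hom.mk φ ψ : X ⟶ Y) = Hom.mk φ ψ' :=
  congrArg (Hom.mk φ) (NatTrans.ext (funext h))

end InvSystem

namespace Pro

open InvSystem

variable {C : Type w} [Category.{u} C]

/-- The morphism of pro-objects defined by a morphism of inverse systems. -/
def inc {X Y : Pro.{u} C} (a : X.sys ⟶ Y.sys) : X ⟶ Y := ofInv.map a

/-- The morphisms of pro-objects `X ⟶ Y_j`. -/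
abbrev component {X Y : Pro.{u} C} (f : X ⟶ Y) (j : Y.sys.I) :
    X.sys.ColimHom (Y.sys.X.obj j) := Hom.toFun f j

/-- The class of a morphism `X_i ⟶ c`. -/
abbrev germ (X : Pro.{u} C) {c : C} (i : X.sys.I) (x : X.sys.X.obj i ⟶ c) : X.sys.ColimHom c :=
  Quot.mk _ ⟨i, x⟩

lemma germ_precomp (X : Pro.{u} C) {c : C} {i i' : X.sys.I} (a : i' ⟶ i)
    (x : X.sys.X.obj i ⟶ c) : X.germ i' (X.sys.X.map a ≫ x) = X.germ i x :=
  (Quot.sound ⟨a, rfl⟩).symm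

lemma germ_post (X : Pro.{u} C) {c d : C} (i : X.sys.I) (x : X.sys.X.obj i ⟶ c) (g : c ⟶ d) :
    (X.germ i x).post g = X.germ i (x ≫ g) := rfl

lemma component_post {X Y : Pro.{u} C} (f : X ⟶ Y) {j j' : Y.sys.I} (b : j ⟶ j') :
    (component f j).post (Y.sys.X.map b) = component f j' := Pro.Hom.compat f b

/-- The representatives `X_i ⟶ Y_j` of the components of a morphism of pro-objects. -/
structure Rep {X Y : Pro.{u} C} (f : X ⟶ Y) : Type u where
  i : X.sys.I
  j : Y.sys.I
  x : X.sys.X.obj i ⟶ Y.sys.X.obj j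
  eq : X.germ i x = component f j

/-- Morphisms of representatives are commutative squares. -/
@[ext]
structure RepHom {X Y : Pro.{u} C} {f : X ⟶ Y} (p q : Rep f) : Type u where
  a : p.i ⟶ q.i
  b : p.j ⟶ q.j
  w : p.x ≫ Y.sys.X.map b = X.sys.X.map a ≫ q.x

namespace Rep

variable {X Y : Pro.{u} C} {f : X ⟶ Y}

instance : Category (Rep f) where
  Hom := RepHom
  id p := ⟨𝟙 _, 𝟙 _, by simp⟩
  comp g h := ⟨g.a ≫ h.a, g.b ≫ h.b, by
    rw [Functor.map_comp, ← Category.assoc, g.w, Category.assoc, h.w, Functor.map_comp,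
      Category.assoc]⟩
  id_comp _ := RepHom.ext (Category.id_comp _) (Category.id_comp _)
  comp_id _ := RepHom.ext (Category.comp_id _) (Category.comp_id _)
  assoc _ _ _ := RepHom.ext (Category.assoc _ _ _) (Category.assoc _ _ _)

variable (f)

/-- The projection to the index category of the source. -/
def fst : Rep f ⥤ X.sys.I where
  obj p := p.i
  map g := RepHom.a g

/-- The projection to the index category of the target. -/
def snd : Rep f ⥤ Y.sys.I where
  obj p := p.j
  map g := RepHom.b g

variable {f}

/-- The morphism given by a commutative square. -/
def homMk {p q : Rep f} (a : p.i ⟶ q.i) (b : p.j ⟶ q.j)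
    (w : p.x ≫ Y.sys.X.map b = X.sys.X.map a ≫ q.x) : p ⟶ q := ⟨a, b, w⟩

lemma hom_ext {p q : Rep f} {g h : p ⟶ q} (h₁ : (fst f).map g = (fst f).map h)
    (h₂ : (snd f).map g = (snd f).map h) : g = h := RepHom.ext h₁ h₂

lemma w {p q : Rep f} (g : p ⟶ q) :
    p.x ≫ Y.sys.X.map ((snd f).map g) = X.sys.X.map ((fst f).map g) ≫ q.x := RepHom.w g

lemma exists_over (f : X ⟶ Y) (j : Y.sys.I) : ∃ p : Rep f, p.j = j := by
  obtain ⟨⟨i, x⟩, h⟩ := Quot.exists_rep (component f j)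
  exact ⟨⟨i, j, x, h⟩, rfl⟩

/-- The compatibility of the components of `f` says that any representative over `j`, followed by `Y
b`, has the same germ as `p.x`. Equal germs agree after a transition morphism of the source, and
precomposing with it gives the required square. All properties of `Rep f` follow from this. -/
lemma exists_lift (p : Rep f) {j : Y.sys.I} (b : j ⟶ p.j) :
    ∃ (i : X.sys.I) (x : X.sys.X.obj i ⟶ Y.sys.X.obj j) (_ : X.germ i x = component f j)
      (a : i ⟶ p.i), x ≫ Y.sys.X.map b = X.sys.X.map a ≫ p.x := by
  obtain ⟨⟨i, x⟩, h⟩ := Quot.exists_rep (component f j)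
  have h' : X.germ i x = component f j := h
  have h1 : X.germ i (x ≫ Y.sys.X.map b) = X.germ p.i p.x := by
    rw [p.eq, ← component_post f b, ← h', germ_post]
  obtain ⟨i₀, a, a', h2⟩ := ColimHom.exists_of_eq h1
  exact ⟨i₀, X.sys.X.map a ≫ x, by rw [germ_precomp, h'], a', by rw [Category.assoc, h2]⟩

/-- Precomposition of a representative with a transition morphism of the source. -/
abbrev precomp (p : Rep f) {i : X.sys.I} (a : i ⟶ p.i) : Rep f :=
  ⟨i, p.j, X.sys.X.map a ≫ p.x, by rw [germ_precomp, p.eq]⟩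

/-- Constructions are first carried out in the index category of `Y` and lifted by `exists_lift`;
the remaining discrepancies live in the index category of `X` and disappear after a further
precomposition. -/
instance : IsCofiltered (Rep f) where
  nonempty := by
    obtain ⟨p, -⟩ := exists_over f (Classical.choice IsCofiltered.nonempty)
    exact ⟨p⟩
  cone_objs p q := by
    obtain ⟨i₁, x₁, h₁, a₁, w₁⟩ := p.exists_lift (IsCofiltered.minToLeft p.j q.j)
    obtain ⟨i₂, x₂, h₂, a₂, w₂⟩ := q.exists_lift (IsCofiltered.minToRight p.j q.j)
    -- The two lifts represent the same component of `f`, so they agree on a common refinement of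
    -- the source indices.
    obtain ⟨i, a, a', h⟩ := ColimHom.exists_of_eq (h₁.trans h₂.symm)
    exact ⟨precomp ⟨i₁, _, x₁, h₁⟩ a, homMk (a ≫ a₁) (IsCofiltered.minToLeft p.j q.j) (by
      simp [w₁]), homMk (a' ≫ a₂) (IsCofiltered.minToRight p.j q.j) (by
      simp [h, w₂]), trivial⟩
  cone_maps p q g g' := by
    obtain ⟨i, x, h, a, w⟩ :=
      p.exists_lift (IsCofiltered.eqHom ((snd f).map g) ((snd f).map g'))
    -- The lift equalizes only the target parts of `g` and `g'`; this second equalizer takes care of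
    -- the source parts.
    let a₀ := IsCofiltered.eqHom (a ≫ (fst f).map g) (a ≫ (fst f).map g')
    have h₀ : a₀ ≫ a ≫ (fst f).map g = a₀ ≫ a ≫ (fst f).map g' := IsCofiltered.eq_condition _ _
    refine ⟨precomp ⟨i, _, x, h⟩ a₀,
      homMk (a₀ ≫ a) (IsCofiltered.eqHom ((snd f).map g) ((snd f).map g')) (by simp [w]), ?_⟩
    refine hom_ext ?_ ?_
    · exact (Category.assoc _ _ _).trans (h₀.trans (Category.assoc _ _ _).symm)
    · exact IsCofiltered.eq_condition ((snd f).map g) ((snd f).map g')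

/-- As `Rep f` is cofiltered, it suffices to find an object over each index and to equalize two
arrows into an index of the form `p.j`. The first is the existence of representatives, the second is
a lift of the equalizer. -/
instance initial_snd : (snd f).Initial := by
  refine Functor.initial_of_exists_of_isCofiltered _ (fun j => ?_) fun {j p} s s' => ?_
  · obtain ⟨p, rfl⟩ := exists_over f j
    exact ⟨p, ⟨𝟙 _⟩⟩
  · obtain ⟨i, x, h, a, w⟩ := p.exists_lift (IsCofiltered.eqHom s s')
    exact ⟨⟨i, _, x, h⟩, homMk a _ w, IsCofiltered.eq_condition s s'⟩

end Rep

/-- The target, restricted to the representatives of `f`. -/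
def repTarget {X Y : Pro.{u} C} (f : X ⟶ Y) : Pro.{u} C := ⟨Y.sys.reindex (Rep.snd f)⟩

/-- The morphism `X ⟶ p^* Y` of inverse systems given by the representatives of `f`. -/
def numerator {X Y : Pro.{u} C} (f : X ⟶ Y) : X.sys ⟶ (repTarget f).sys :=
  InvSystem.Hom.mk (Rep.fst f) { app p := p.x, naturality _ _ g := (Rep.w g).symm }

/-- The morphism `Y ⟶ p^* Y`. -/
def denominator {X Y : Pro.{u} C} (f : X ⟶ Y) : Y.sys ⟶ (repTarget f).sys :=
  Y.sys.toReindex (Rep.snd f)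

/-- Both sides have the germ of `p.x` as their component at `p`. Once the denominator is inverted,
`f` is thus expressed by morphisms of inverse systems. -/
lemma comp_denominator {X Y : Pro.{u} C} (f : X ⟶ Y) :
    f ≫ inc (denominator f) = inc (numerator f) := by
  refine Pro.Hom.ext (funext fun p => ?_)
  exact (ColimHom.post_id _).trans p.eq.symm

section

variable {X Y : Pro.{u} C} (a : X.sys ⟶ Y.sys)

/-- The representatives of the components of a morphism of inverse systems. -/
def repSection : Y.sys.I ⥤ Rep (inc a) where
  obj j := ⟨(InvSystem.Hom.φ a).obj j, j, (InvSystem.Hom.ψ a).app j, rfl⟩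
  map b := Rep.homMk ((InvSystem.Hom.φ a).map b) b ((InvSystem.Hom.ψ a).naturality b).symm
  map_id _ := Rep.hom_ext ((InvSystem.Hom.φ a).map_id _) rfl
  map_comp _ _ := Rep.hom_ext ((InvSystem.Hom.φ a).map_comp _ _) rfl

/-- The retraction of `Y ⟶ p^* Y` defined by a morphism of inverse systems. -/
def repRetraction : (repTarget (inc a)).sys ⟶ Y.sys :=
  InvSystem.Hom.mk (repSection a) (𝟙 Y.sys.X)

lemma numerator_repRetraction : numerator (inc a) ≫ repRetraction a = a :=
  hom_ext' fun j => (comp_ψ_app (numerator (inc a)) (repRetraction a) j).trans (Category.comp_id _)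

/-- A morphism of inverse systems comes with a functorial choice of representatives, so its
denominator has a strict retraction. This makes the extended functor agree with the given one on
such morphisms. -/
lemma denominator_repRetraction : denominator (inc a) ≫ repRetraction a = 𝟙 Y.sys :=
  hom_ext' fun j =>
    (comp_ψ_app (denominator (inc a)) (repRetraction a) j).trans (Category.comp_id _)

end

section

variable {X Y Z : Pro.{u} C} (f : X ⟶ Y) (b : Y.sys ⟶ Z.sys)

/-- The pro-morphism `X ⟶ φ^* Y`, for `b = (φ, ψ) : Y ⟶ Z`. -/
def restrHom : X ⟶ (⟨Y.sys.reindex (InvSystem.Hom.φ b)⟩ : Pro.{u} C) :=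
  f ≫ inc (Y := ⟨Y.sys.reindex (InvSystem.Hom.φ b)⟩) (Y.sys.toReindex (InvSystem.Hom.φ b))

/-- Representatives of `X ⟶ φ^* Y` are representatives of `X ⟶ Y`. -/
def repLeft : Rep (restrHom f b) ⥤ Rep f where
  obj p := ⟨p.i, (InvSystem.Hom.φ b).obj p.j, p.x, p.eq.trans (ColimHom.post_id _)⟩
  map g := Rep.homMk ((Rep.fst _).map g) ((InvSystem.Hom.φ b).map ((Rep.snd _).map g)) (Rep.w g)
  map_id _ := Rep.hom_ext rfl ((InvSystem.Hom.φ b).map_id _)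
  map_comp _ _ := Rep.hom_ext rfl ((InvSystem.Hom.φ b).map_comp _ _)

/-- The index category of the target, for the representatives of `X ⟶ φ^* Y`. -/
def repIndex : Rep (restrHom f b) ⥤ Z.sys.I := Rep.snd (restrHom f b)

instance : (repIndex f b).Initial :=
  Rep.initial_snd (f := restrHom f b)

/-- The components of `ψ` at the representatives of `X ⟶ φ^* Y`. -/
def repψ : repLeft f b ⋙ Rep.snd f ⋙ Y.sys.X ⟶ repIndex f b ⋙ Z.sys.X :=
  Functor.whiskerLeft (repIndex f b) (InvSystem.Hom.ψ b)

/-- Representatives of `X ⟶ φ^* Y` induce representatives of `X ⟶ Z`. -/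
def repRight : Rep (restrHom f b) ⥤ Rep (f ≫ inc b) where
  obj p := ⟨p.i, (repIndex f b).obj p, p.x ≫ (repψ f b).app p,
    congrArg (ColimHom.post · ((repψ f b).app p)) (p.eq.trans (ColimHom.post_id _))⟩
  map {p q} g := Rep.homMk ((Rep.fst _).map g) ((repIndex f b).map g) (by
    have h := Rep.w g
    have h2 := (repψ f b).naturality g
    refine (Category.assoc _ _ _).trans ?_
    refine (congrArg (p.x ≫ ·) h2.symm).trans ?_
    refine (Category.assoc _ _ _).symm.trans ?_
    refine (congrArg (· ≫ (repψ f b).app q) h).trans ?_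
    exact Category.assoc _ _ _)
  map_id _ := rfl
  map_comp _ _ := rfl

/-- The restriction to the representatives of `X ⟶ φ^* Y`, followed by `ψ`. -/
def leftMap : (repTarget f).sys ⟶ Z.sys.reindex (repIndex f b) :=
  InvSystem.Hom.mk (repLeft f b) (repψ f b)

/-- The restriction to the representatives of `X ⟶ φ^* Y`. -/
def rightMap : (repTarget (f ≫ inc b)).sys ⟶ Z.sys.reindex (repIndex f b) :=
  InvSystem.Hom.mk (repRight f b) (𝟙 (repIndex f b ⋙ Z.sys.X))

/-- A representative of `X ⟶ φ^* Y` is a representative of `f` over an index `φ k`, and by `ψ` it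
also yields one of `f ≫ inc b` over `k`. This lemma and the next two state that the fractions of `f`
(followed by `b`) and of `f ≫ inc b` agree over this common refinement. -/
lemma numerator_leftMap :
    numerator f ≫ leftMap f b = numerator (f ≫ inc b) ≫ rightMap f b :=
  hom_ext' fun p => (comp_ψ_app (numerator f) (leftMap f b) p).trans <|
    ((comp_ψ_app (numerator (f ≫ inc b)) (rightMap f b) p).trans (Category.comp_id _)).symm

lemma denominator_leftMap :
    denominator f ≫ leftMap f b = b ≫ Z.sys.toReindex (repIndex f b) :=
  hom_ext' fun p =>
    ((comp_ψ_app (denominator f) (leftMap f b) p).trans (Category.id_comp _)).trans <|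
    ((comp_ψ_app b (Z.sys.toReindex (repIndex f b)) p).trans (Category.comp_id _)).symm

lemma denominator_rightMap :
    denominator (f ≫ inc b) ≫ rightMap f b = Z.sys.toReindex (repIndex f b) :=
  hom_ext' fun p =>
    (comp_ψ_app (denominator (f ≫ inc b)) (rightMap f b) p).trans (Category.comp_id _)

end

section Extend

variable {D : Type*} [Category* D] (F : InvSystem.{u} C ⥤ D) (hF : InvertsInitial F)

include hF in
lemma isIso_map_denominator {X Y : Pro.{u} C} (f : X ⟶ Y) : IsIso (F.map (denominator f)) :=
  hF _ _ _

/-- The action on pro-morphisms of a functor that inverts restrictions along initial functors. -/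
def extendMap {X Y : Pro.{u} C} (f : X ⟶ Y) : F.obj X.sys ⟶ F.obj Y.sys :=
  have := isIso_map_denominator F hF f
  F.map (numerator f) ≫ inv (F.map (denominator f))

lemma extendMap_comp_denominator {X Y : Pro.{u} C} (f : X ⟶ Y) :
    extendMap F hF f ≫ F.map (denominator f) = F.map (numerator f) := by
  simp [extendMap]

lemma extendMap_inc {X Y : Pro.{u} C} (a : X.sys ⟶ Y.sys) :
    extendMap F hF (inc a) = F.map a := by
  have h := extendMap_comp_denominator F hF (inc a)
  have h1 := numerator_repRetraction a
  have h2 := denominator_repRetraction a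
  have h3 : F.map (numerator (inc a)) ≫ F.map (repRetraction a) = F.map a := by
    rw [← F.map_comp, h1]
  rw [← h3, ← h, Category.assoc, ← F.map_comp, h2, F.map_id, Category.comp_id]

/-- Both sides are compared after the restriction of `Z` along `repIndex f b`. This functor is
initial, so `F` inverts that restriction. -/
lemma extendMap_comp_inc {X Y Z : Pro.{u} C} (f : X ⟶ Y) (b : Y.sys ⟶ Z.sys) :
    extendMap F hF (f ≫ inc b) = extendMap F hF f ≫ F.map b := by
  have : IsIso (F.map (Z.sys.toReindex (repIndex f b))) := hF _ _ _
  have h1 := extendMap_comp_denominator F hF f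
  have h2 := extendMap_comp_denominator F hF (f ≫ inc b)
  rw [← cancel_mono (F.map (Z.sys.toReindex (repIndex f b))), Category.assoc,
    ← F.map_comp, ← denominator_leftMap, F.map_comp, ← Category.assoc, h1, ← F.map_comp,
    numerator_leftMap, F.map_comp, ← h2, ← denominator_rightMap, F.map_comp, Category.assoc]

/-- The extension to pro-objects of a functor on inverse systems that inverts restrictions along
initial functors. -/
def extend : Pro.{u} C ⥤ D where
  obj X := F.obj X.sys
  map f := extendMap F hF f
  map_id X := (extendMap_inc F hF (𝟙 X.sys)).trans (F.map_id _)
  map_comp {X Y Z} f g := by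
    have := isIso_map_denominator F hF g
    -- Composition with the invertible `F.map (denominator g)` replaces `g` by its numerator, so
    -- that only composites with morphisms of inverse systems remain.
    rw [← cancel_mono (F.map (denominator g)), Category.assoc, extendMap_comp_denominator]
    have h1 := extendMap_comp_inc F hF (f ≫ g) (denominator g)
    have h2 := extendMap_comp_inc F hF f (numerator g)
    rw [← h1, ← h2, Category.assoc, comp_denominator]

/-- The extension of `F` agrees with `F` on inverse systems. -/
def ofInvExtend : ofInv ⋙ extend F hF ≅ F :=
  NatIso.ofComponents (fun _ => Iso.refl _) fun {X Y} a =>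
    (Category.comp_id _).trans
      ((extendMap_inc (X := ⟨X⟩) (Y := ⟨Y⟩) F hF a).trans (Category.id_comp _).symm)

lemma InvertsInitial.of_iso {F G : InvSystem.{u} C ⥤ D} (hF : InvertsInitial F) (e : F ≅ G) :
    InvertsInitial G := fun Y J _ _ φ _ => by
  have := hF Y J φ
  exact (NatIso.isIso_map_iff e _).1 this

lemma InvertsInitial.comp {F : InvSystem.{u} C ⥤ D} (hF : InvertsInitial F) {D' : Type*}
    [Category* D'] (G : D ⥤ D') : InvertsInitial (F ⋙ G) := fun Y J _ _ φ _ => by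
  have := hF Y J φ
  change IsIso (G.map (F.map _))
  infer_instance

lemma invertsInitial_ofInv_extend : InvertsInitial (ofInv ⋙ extend F hF) :=
  InvertsInitial.of_iso hF (ofInvExtend F hF).symm

variable {G G' : Pro.{u} C ⥤ D}

/-- Natural transformations on inverse systems are natural on pro-objects. -/
def natTransOfInv (hG' : InvertsInitial (ofInv ⋙ G')) (τ : ∀ X : Pro.{u} C, G.obj X ⟶ G'.obj X)
    (hτ : ∀ (X Y : Pro.{u} C) (a : X.sys ⟶ Y.sys),
      G.map (inc a) ≫ τ Y = τ X ≫ G'.map (inc a)) : G ⟶ G' where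
  app := τ
  naturality X Y f := by
    -- Writing `f` as a fraction reduces naturality to that for its numerator and its denominator.
    have : IsIso (G'.map (inc (denominator f))) := hG' _ _ _
    have h1 := hτ Y (repTarget f) (denominator f)
    have h2 := hτ X (repTarget f) (numerator f)
    rw [← cancel_mono (G'.map (inc (denominator f))), Category.assoc,
      Category.assoc, ← h1, ← G'.map_comp, comp_denominator, ← h2, ← Category.assoc,
      ← G.map_comp, comp_denominator]

end Extend

end Pro

end

noncomputable section

/-! ### Elements of homology groups -/

namespace HomologicalComplex

variable {ι : Type*} {c : ComplexShape ι} (K L : HomologicalComplex AB.{u} c)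

lemma iCycles_injective (p : ι) : Function.Injective (K.iCycles p) :=
  (ModuleCat.mono_iff_injective _).1 inferInstance

lemma homologyπ_surjective (p : ι) : Function.Surjective (K.homologyπ p) :=
  (ModuleCat.epi_iff_surjective _).1 inferInstance

variable {K L}

lemma d_iCycles (p q : ι) (z : K.cycles p) : K.d p q (K.iCycles p z) = 0 := by
  rw [← ConcreteCategory.comp_apply, iCycles_d]
  rfl

lemma exists_iCycles {p : ι} (x : K.X p) (hx : ∀ q, K.d p q x = 0) :
    ∃ z : K.cycles p, K.iCycles p z = x := by
  have h : (ShortComplex.mk _ _ (K.iCycles_d p (c.next p))).Exact :=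
    ShortComplex.exact_of_f_is_kernel _ (K.cyclesIsKernel p _ rfl)
  exact (ShortComplex.moduleCat_exact_iff _).1 h x (hx _)

/-- The homology class of a cycle. -/
def cls {p : ι} (x : K.X p) (hx : ∀ q, K.d p q x = 0) : K.homology p :=
  K.homologyπ p (exists_iCycles x hx).choose

lemma homologyπ_eq_cls {p : ι} (z : K.cycles p) :
    K.homologyπ p z = cls (K.iCycles p z) fun q => d_iCycles p q z :=
  congrArg _ (K.iCycles_injective p (exists_iCycles _ fun q => d_iCycles p q z).choose_spec.symm)

lemma exists_cls {p : ι} (h : K.homology p) :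
    ∃ (x : K.X p) (hx : ∀ q, K.d p q x = 0), h = cls x hx := by
  obtain ⟨z, rfl⟩ := K.homologyπ_surjective p h
  exact ⟨_, _, homologyπ_eq_cls z⟩

lemma cls_congr {p : ι} {x y : K.X p} (h : x = y) (hx : ∀ q, K.d p q x = 0) :
    cls x hx = cls y (h ▸ hx) := by
  subst h
  rfl

lemma homologyπ_eq {p : ι} (z : K.cycles p) (x : K.X p) (hx : ∀ q, K.d p q x = 0)
    (h : K.iCycles p z = x) : K.homologyπ p z = cls x hx := by
  subst h
  exact homologyπ_eq_cls z

lemma cls_sub {p : ι} {x y : K.X p} (hx : ∀ q, K.d p q x = 0) (hy : ∀ q, K.d p q y = 0) :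
    cls x hx - cls y hy = cls (x - y) fun q => by rw [map_sub, hx, hy, sub_zero] := by
  rw [cls, cls, ← map_sub]
  refine homologyπ_eq _ _ _ ?_
  rw [map_sub, (exists_iCycles x hx).choose_spec, (exists_iCycles y hy).choose_spec]

lemma cls_eq_zero_of_eq_d {p o : ι} {x : K.X p} (hx : ∀ q, K.d p q x = 0) (y : K.X o)
    (hy : K.d o p y = x) : cls x hx = 0 := by
  have h : K.toCycles o p y = (exists_iCycles x hx).choose := by
    apply K.iCycles_injective p
    rw [← ConcreteCategory.comp_apply, toCycles_i, hy, (exists_iCycles x hx).choose_spec]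
  rw [cls, ← h, ← ConcreteCategory.comp_apply, toCycles_comp_homologyπ]
  rfl

lemma exists_of_cls_eq_zero {p o : ι} (ho : c.prev p = o) {x : K.X p}
    {hx : ∀ q, K.d p q x = 0} (h : cls x hx = 0) : ∃ y : K.X o, K.d o p y = x := by
  have he : (ShortComplex.mk _ _ (K.toCycles_comp_homologyπ o p)).Exact :=
    ShortComplex.exact_of_g_is_cokernel _ (K.homologyIsCokernel o p ho)
  obtain ⟨y, hy⟩ := (ShortComplex.moduleCat_exact_iff _).1 he _ h
  refine ⟨y, ?_⟩
  have hy : K.toCycles o p y = _ := hy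
  rw [← K.toCycles_i o p, ConcreteCategory.comp_apply, hy, (exists_iCycles x hx).choose_spec]

lemma cls_eq_iff {p o : ι} (ho : c.prev p = o) {x y : K.X p}
    {hx : ∀ q, K.d p q x = 0} {hy : ∀ q, K.d p q y = 0} :
    cls x hx = cls y hy ↔ ∃ z : K.X o, K.d o p z = x - y := by
  rw [← sub_eq_zero, cls_sub]
  exact ⟨exists_of_cls_eq_zero ho, fun ⟨z, hz⟩ => cls_eq_zero_of_eq_d _ z hz⟩

lemma d_map_eq_zero (f : K ⟶ L) {p : ι} {x : K.X p} (hx : ∀ q, K.d p q x = 0) (q : ι) :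
    L.d p q (f.f p x) = 0 := by
  rw [← ConcreteCategory.comp_apply, f.comm, ConcreteCategory.comp_apply, hx, map_zero]

lemma homologyMap_cls (f : K ⟶ L) {p : ι} {x : K.X p} (hx : ∀ q, K.d p q x = 0) :
    homologyMap f p (cls x hx) = cls (f.f p x) (d_map_eq_zero f hx) := by
  rw [cls, ← ConcreteCategory.comp_apply, homologyπ_naturality, ConcreteCategory.comp_apply]
  refine homologyπ_eq _ _ _ ?_
  rw [← ConcreteCategory.comp_apply, cyclesMap_i, ConcreteCategory.comp_apply,
    (exists_iCycles x hx).choose_spec]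

end HomologicalComplex

/-- The morphism induced on the target of a surjective morphism. -/
def ModuleCat.descSurj {R : Type*} [Ring R] {A B D : ModuleCat.{u} R} (f : A ⟶ B) (hf : Function.Surjective f) (g : A ⟶ D)
    (h : ∀ a, f a = 0 → g a = 0) : B ⟶ D :=
  ModuleCat.ofHom <| ((LinearMap.ker f.hom).liftQ g.hom h).comp
    (f.hom.quotKerEquivOfSurjective hf).symm.toLinearMap

lemma ModuleCat.descSurj_apply {R : Type*} [Ring R] {A B D : ModuleCat.{u} R} (f : A ⟶ B) (hf : Function.Surjective f)
    (g : A ⟶ D) (h : ∀ a, f a = 0 → g a = 0) (a : A) :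
    ModuleCat.descSurj f hf g h (f a) = g a := by
  have : (f.hom.quotKerEquivOfSurjective hf).symm (f a) = Submodule.Quotient.mk a :=
    (LinearEquiv.symm_apply_eq _).2 rfl
  change (LinearMap.ker f.hom).liftQ g.hom h ((f.hom.quotKerEquivOfSurjective hf).symm (f a)) = _
  rw [this]
  rfl

lemma ModuleCat.comp_descSurj {R : Type*} [Ring R] {A B D : ModuleCat.{u} R} (f : A ⟶ B) (hf : Function.Surjective f)
    (g : A ⟶ D) (h : ∀ a, f a = 0 → g a = 0) : f ≫ ModuleCat.descSurj f hf g h = g := by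
  ext a
  exact ModuleCat.descSurj_apply f hf g h a

lemma ModuleCat.exists_kernel_ι {A B : AB.{u}} (f : A ⟶ B) (a : A) (h : f a = 0) :
    ∃ x : (kernel f : AB.{u}), kernel.ι f x = a :=
  (ShortComplex.moduleCat_exact_iff _).1
    (ShortComplex.exact_of_f_is_kernel (ShortComplex.mk _ _ (kernel.condition f))
      (kernelIsKernel f)) a h

lemma ModuleCat.kernel_ι_injective {A B : AB.{u}} (f : A ⟶ B) :
    Function.Injective (kernel.ι f) := (ModuleCat.mono_iff_injective _).1 inferInstance

/-! ### Exact couples of abelian groups -/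

/-- An exact couple of abelian groups, with the bidegrees of the couple `(D_n, E_n)`. -/
structure ExactCouple (n : ℕ) where
  D (p : ℤ × ℤ) : AB.{u}
  E (p : ℤ × ℤ) : AB.{u}
  i (p q : ℤ × ℤ) (h : p + (-1, 1) = q) : D p ⟶ D q
  j (p q : ℤ × ℤ) (h : p + ((n : ℤ), 1 - (n : ℤ)) = q) : D p ⟶ E q
  k (p : ℤ × ℤ) : E p ⟶ D p
  exact_i (p q : ℤ × ℤ) (h : p + (-1, 1) = q) (x : D p) : i p q h x = 0 ↔ ∃ e, k p e = x
  exact_j (p q q' : ℤ × ℤ) (h : p + (-1, 1) = q) (h' : q + ((n : ℤ), 1 - (n : ℤ)) = q')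
    (y : D q) : j q q' h' y = 0 ↔ ∃ x, i p q h x = y
  exact_k (p q : ℤ × ℤ) (h : p + ((n : ℤ), 1 - (n : ℤ)) = q) (e : E q) :
    k q e = 0 ↔ ∃ x, j p q h x = e
  isZero_D (p : ℤ × ℤ) (hp : p.1 < 0) : IsZero (D p)
  isZero_E (p : ℤ × ℤ) (hp : p.1 < 0) : IsZero (E p)

namespace ExactCouple

variable {n : ℕ}

/-- Morphisms of exact couples. -/
@[ext]
structure Hom (c c' : ExactCouple.{u} n) where
  D (p : ℤ × ℤ) : c.D p ⟶ c'.D p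
  E (p : ℤ × ℤ) : c.E p ⟶ c'.E p
  i_comm (p q : ℤ × ℤ) (h : p + (-1, 1) = q) : c.i p q h ≫ D q = D p ≫ c'.i p q h
  j_comm (p q : ℤ × ℤ) (h : p + ((n : ℤ), 1 - (n : ℤ)) = q) :
    c.j p q h ≫ E q = D p ≫ c'.j p q h
  k_comm (p : ℤ × ℤ) : c.k p ≫ D p = E p ≫ c'.k p

instance : Category (ExactCouple.{u} n) where
  Hom := Hom
  id c := ⟨fun _ => 𝟙 _, fun _ => 𝟙 _, by simp, by simp, by simp⟩
  comp f g := ⟨fun p => f.D p ≫ g.D p, fun p => f.E p ≫ g.E p,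
    fun p q h => by rw [← Category.assoc, f.i_comm, Category.assoc, g.i_comm, Category.assoc],
    fun p q h => by rw [← Category.assoc, f.j_comm, Category.assoc, g.j_comm, Category.assoc],
    fun p => by rw [← Category.assoc, f.k_comm, Category.assoc, g.k_comm, Category.assoc]⟩
  id_comp f := Hom.ext (funext fun _ => Category.id_comp _) (funext fun _ => Category.id_comp _)
  comp_id f := Hom.ext (funext fun _ => Category.comp_id _) (funext fun _ => Category.comp_id _)
  assoc f g h := Hom.ext (funext fun _ => Category.assoc _ _ _)
    (funext fun _ => Category.assoc _ _ _)

section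

variable (c : ExactCouple.{u} n)

lemma k_i (p q : ℤ × ℤ) (h : p + (-1, 1) = q) : c.k p ≫ c.i p q h = 0 := by
  ext e
  exact (c.exact_i p q h _).2 ⟨e, rfl⟩

lemma i_j (p q q' : ℤ × ℤ) (h : p + (-1, 1) = q) (h' : q + ((n : ℤ), 1 - (n : ℤ)) = q') :
    c.i p q h ≫ c.j q q' h' = 0 := by
  ext e
  exact (c.exact_j p q q' h h' _).2 ⟨e, rfl⟩

lemma j_k (p q : ℤ × ℤ) (h : p + ((n : ℤ), 1 - (n : ℤ)) = q) : c.j p q h ≫ c.k q = 0 := by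
  ext e
  exact (c.exact_k p q h _).2 ⟨e, rfl⟩

lemma j_k_apply (p q : ℤ × ℤ) (h : p + ((n : ℤ), 1 - (n : ℤ)) = q) (x : c.D p) :
    c.k q (c.j p q h x) = 0 := (c.exact_k p q h _).2 ⟨x, rfl⟩

lemma mk₄_exact (p q p' : ℤ × ℤ) (h : p + (-1, 1) = q)
    (h' : q + ((n : ℤ), 1 - (n : ℤ)) = p') :
    (ComposableArrows.mk₄ (c.k p) (c.i p q h) (c.j q p' h') (c.k p')).Exact :=
  ComposableArrows.exact_of_δ₀
    (ShortComplex.Exact.exact_toComposableArrows (S := ShortComplex.mk _ _ (c.k_i p q h))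
      ((ShortComplex.moduleCat_exact_iff _).2 fun x => (c.exact_i p q h x).1))
    (ComposableArrows.exact_of_δ₀
      (ShortComplex.Exact.exact_toComposableArrows (S := ShortComplex.mk _ _ (c.i_j p q p' h h'))
        ((ShortComplex.moduleCat_exact_iff _).2 fun x => (c.exact_j p q p' h h' x).1))
      (ShortComplex.Exact.exact_toComposableArrows (S := ShortComplex.mk _ _ (c.j_k q p' h'))
        ((ShortComplex.moduleCat_exact_iff _).2 fun x => (c.exact_k q p' h' x).1)))

variable (r : ℤ) (hr : r = n)

/-- The terms `E` of an exact couple form a complex, with the differentials `j ∘ k`. -/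
abbrev page : HomologicalComplex AB.{u} (ComplexShape.up' ((r, 1 - r) : ℤ × ℤ)) where
  X := c.E
  d p q := if h : p + (r, 1 - r) = q then c.k p ≫ c.j p q (by rw [← hr]; exact h) else 0
  shape p q h := dif_neg h
  d_comp_d' p q q' h h' := by
    rw [dif_pos (show p + (r, 1 - r) = q from h), dif_pos (show q + (r, 1 - r) = q' from h'),
      Category.assoc, ← Category.assoc (c.j _ _ _), j_k, zero_comp, comp_zero]

lemma page_d_apply (p q : ℤ × ℤ) (h : p + (r, 1 - r) = q) (e : c.E p) :
    (c.page r hr).d p q e = c.j p q (by rw [← hr]; exact h) (c.k p e) := by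
  dsimp only
  rw [dif_pos h]
  rfl

lemma page_d (p q : ℤ × ℤ) (h : p + (r, 1 - r) = q) :
    (c.page r hr).d p q = c.k p ≫ c.j p q (by rw [← hr]; exact h) := dif_pos h

/-- The functoriality of `ExactCouple.page`. -/
def pageMap {c c' : ExactCouple.{u} n} (f : c ⟶ c') : c.page r hr ⟶ c'.page r hr where
  f p := Hom.E f p
  comm' p q h := by
    have h' : p + (r, 1 - r) = q := h
    dsimp only
    rw [dif_pos h', dif_pos h', ← Category.assoc, ← Hom.k_comm f, Category.assoc,
      Category.assoc, Hom.j_comm f]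

end

/-! #### The derived couple -/

section Derived

variable (c : ExactCouple.{u} n)

/-- The page of an exact couple, with its own index. -/
abbrev pg := c.page (n : ℤ) rfl

/-- The image of `i`, written as the kernel of `j`. -/
def D' (q : ℤ × ℤ) : AB.{u} := kernel (c.j q (q + ((n : ℤ), 1 - (n : ℤ))) rfl)

/-- The inclusion of the image of `i`. -/
def ι (q : ℤ × ℤ) : c.D' q ⟶ c.D q := kernel.ι _

lemma ι_injective (q : ℤ × ℤ) : Function.Injective (c.ι q) := ModuleCat.kernel_ι_injective _

lemma exists_ι (q q' : ℤ × ℤ) (h : q + ((n : ℤ), 1 - (n : ℤ)) = q') (x : c.D q)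
    (hx : c.j q q' h x = 0) : ∃ y, c.ι q y = x := by
  subst h
  exact ModuleCat.exists_kernel_ι _ x hx

lemma ι_j (q q' : ℤ × ℤ) (h : q + ((n : ℤ), 1 - (n : ℤ)) = q') : c.ι q ≫ c.j q q' h = 0 := by
  subst h
  exact kernel.condition _

lemma ι_j_apply (q q' : ℤ × ℤ) (h : q + ((n : ℤ), 1 - (n : ℤ)) = q') (y : c.D' q) :
    c.j q q' h (c.ι q y) = 0 := congr($(c.ι_j q q' h) y)

/-- The map `i`, with codomain restricted to its image. -/
def π (p q : ℤ × ℤ) (h : p + (-1, 1) = q) : c.D p ⟶ c.D' q :=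
  kernel.lift _ (c.i p q h) (c.i_j p q _ h rfl)

lemma π_ι (p q : ℤ × ℤ) (h : p + (-1, 1) = q) : c.π p q h ≫ c.ι q = c.i p q h := kernel.lift_ι _ _ _

lemma π_ι_apply (p q : ℤ × ℤ) (h : p + (-1, 1) = q) (x : c.D p) :
    c.ι q (c.π p q h x) = c.i p q h x := congr($(c.π_ι p q h) x)

lemma π_surjective (p q : ℤ × ℤ) (h : p + (-1, 1) = q) : Function.Surjective (c.π p q h) := by
  intro y
  obtain ⟨x, hx⟩ := (c.exact_j p q _ h rfl (c.ι q y)).1 (c.ι_j_apply q _ rfl y)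
  exact ⟨x, c.ι_injective q ((c.π_ι_apply p q h x).trans hx)⟩

lemma d_j (p q q' : ℤ × ℤ) (h : p + ((n : ℤ), 1 - (n : ℤ)) = q) (x : c.D p) :
    c.pg.d q q' (c.j p q h x) = 0 := by
  by_cases h' : q + ((n : ℤ), 1 - (n : ℤ)) = q'
  · exact (c.page_d_apply _ _ q q' h' _).trans (by rw [j_k_apply, map_zero])
  · rw [HomologicalComplex.shape _ _ _ h']
    rfl

/-- The map `j`, to the cycles. -/
def jCycles (p q : ℤ × ℤ) (h : p + ((n : ℤ), 1 - (n : ℤ)) = q) : c.D p ⟶ c.pg.cycles q :=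
  c.pg.liftCycles (c.j p q h) _ rfl (by
    ext x
    exact c.d_j p q _ h x)

lemma jCycles_i (p q : ℤ × ℤ) (h : p + ((n : ℤ), 1 - (n : ℤ)) = q) :
    c.jCycles p q h ≫ c.pg.iCycles q = c.j p q h := HomologicalComplex.liftCycles_i ..

/-- The boundaries are the elements `j (k e)`, because `d = j ∘ k`. Well-definedness of the derived
`j` and its exactness both rest on this. -/
lemma jCycles_homologyπ_eq_zero (p q : ℤ × ℤ) (h : p + ((n : ℤ), 1 - (n : ℤ)) = q)
    (x : c.D p) :
    (c.jCycles p q h ≫ c.pg.homologyπ q) x = 0 ↔ ∃ e, c.j p q h (c.k p e) = c.j p q h x := by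
  have hx : c.pg.iCycles q (c.jCycles p q h x) = c.j p q h x := by
    exact congr($(c.jCycles_i p q h) x)
  rw [ConcreteCategory.comp_apply, HomologicalComplex.homologyπ_eq _ _
    (fun q' => by rw [← hx]; exact HomologicalComplex.d_iCycles _ _ _) hx]
  have hd : ∀ e, c.pg.d p q e = c.j p q h (c.k p e) := c.page_d_apply _ _ p q h
  constructor
  · intro h0
    obtain ⟨e, he⟩ := HomologicalComplex.exists_of_cls_eq_zero (o := p)
      (ComplexShape.prev_eq' _ h) h0
    exact ⟨e, (hd e).symm.trans he⟩
  · rintro ⟨e, he⟩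
    exact HomologicalComplex.cls_eq_zero_of_eq_d _ e ((hd e).trans he)

/-- The map `j` of the derived couple. -/
def j' (q q' : ℤ × ℤ) (h : q + (((n + 1 : ℕ) : ℤ), 1 - ((n + 1 : ℕ) : ℤ)) = q') :
    c.D' q ⟶ c.pg.homology q' :=
  ModuleCat.descSurj (c.π (q + (1, -1)) q (by ext <;> simp)) (c.π_surjective _ _ _)
    (c.jCycles (q + (1, -1)) q' (by rw [← h]; ext <;> simp <;> ring) ≫ c.pg.homologyπ q') (by
      intro x hx
      rw [jCycles_homologyπ_eq_zero]
      -- Two preimages under `i` differ by some `k e`, and `j (k e)` is a boundary.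
      obtain ⟨e, he⟩ := (c.exact_i _ q (by ext <;> simp) x).1
        ((c.π_ι_apply _ _ _ x).symm.trans ((congrArg (c.ι q) hx).trans (map_zero _)))
      exact ⟨e, by rw [he]⟩)

lemma π_j' (p q q' : ℤ × ℤ) (h : p + (-1, 1) = q) (h' : p + ((n : ℤ), 1 - (n : ℤ)) = q')
    (h'' : q + (((n + 1 : ℕ) : ℤ), 1 - ((n + 1 : ℕ) : ℤ)) = q') :
    c.π p q h ≫ c.j' q q' h'' = c.jCycles p q' h' ≫ c.pg.homologyπ q' := by
  obtain rfl : p = q + (1, -1) := by rw [← h]; ext <;> simp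
  exact ModuleCat.comp_descSurj _ _ _ _

/-- The map `k`, restricted to the cycles. -/
def kCycles (p : ℤ × ℤ) : c.pg.cycles p ⟶ c.D' p :=
  kernel.lift _ (c.pg.iCycles p ≫ c.k p) (by
    ext z
    exact (c.page_d_apply _ rfl p _ rfl _).symm.trans (HomologicalComplex.d_iCycles p _ z))

lemma kCycles_ι (p : ℤ × ℤ) : c.kCycles p ≫ c.ι p = c.pg.iCycles p ≫ c.k p :=
  kernel.lift_ι _ _ _

/-- The map `k` of the derived couple. -/
def k' (p : ℤ × ℤ) : c.pg.homology p ⟶ c.D' p :=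
  ModuleCat.descSurj (c.pg.homologyπ p) (HomologicalComplex.homologyπ_surjective _ _)
    (c.kCycles p) (by
      intro z hz
      rw [HomologicalComplex.homologyπ_eq_cls] at hz
      obtain ⟨e, he⟩ := HomologicalComplex.exists_of_cls_eq_zero
        (o := p - ((n : ℤ), 1 - (n : ℤ))) (ComplexShape.prev_eq' _ (sub_add_cancel _ _)) hz
      -- A boundary is a value of `j`, and `k ∘ j = 0`.
      have he' := (c.page_d_apply _ rfl _ p (sub_add_cancel _ _) e).symm.trans he
      apply c.ι_injective p
      refine (congr($(c.kCycles_ι p) z) : _ = c.k p (c.pg.iCycles p z)).trans ?_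
      rw [← he', j_k_apply, map_zero])

lemma homologyπ_k'_ι (p : ℤ × ℤ) :
    c.pg.homologyπ p ≫ c.k' p ≫ c.ι p = c.pg.iCycles p ≫ c.k p := by
  rw [k', ← Category.assoc, ModuleCat.comp_descSurj, kCycles_ι]

lemma ι_k'_cls (p : ℤ × ℤ) (x : c.E p) (hx : ∀ q, c.pg.d p q x = 0) :
    c.ι p (c.k' p (HomologicalComplex.cls (K := c.pg) x hx)) = c.k p x := by
  obtain ⟨z, rfl⟩ := HomologicalComplex.exists_iCycles (K := c.pg) x hx
  rw [← HomologicalComplex.homologyπ_eq_cls]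
  exact congr($(c.homologyπ_k'_ι p) z)

lemma j'_π (p q q' : ℤ × ℤ) (h : p + (-1, 1) = q) (h' : p + ((n : ℤ), 1 - (n : ℤ)) = q')
    (h'' : q + (((n + 1 : ℕ) : ℤ), 1 - ((n + 1 : ℕ) : ℤ)) = q') (x : c.D p) (hx) :
    c.j' q q' h'' (c.π p q h x) = HomologicalComplex.cls (K := c.pg) (c.j p q' h' x) hx := by
  rw [← ConcreteCategory.comp_apply, c.π_j' p q q' h h' h'', ConcreteCategory.comp_apply]
  exact HomologicalComplex.homologyπ_eq _ _ _ congr($(c.jCycles_i p q' h') x)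

/-- The restriction of `i` to its image. -/
def i' (p q : ℤ × ℤ) (h : p + (-1, 1) = q) : c.D' p ⟶ c.D' q := c.ι p ≫ c.π p q h

lemma i'_ι (p q : ℤ × ℤ) (h : p + (-1, 1) = q) : c.i' p q h ≫ c.ι q = c.ι p ≫ c.i p q h := by
  rw [i', Category.assoc, π_ι]

lemma i'_ι_apply (p q : ℤ × ℤ) (h : p + (-1, 1) = q) (x : c.D' p) :
    c.ι q (c.i' p q h x) = c.i p q h (c.ι p x) := congr($(c.i'_ι p q h) x)

/-- The derived couple. -/
def derived : ExactCouple.{u} (n + 1) where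
  D := c.D'
  E p := c.pg.homology p
  i := c.i'
  j := c.j'
  k := c.k'
  exact_i p q h x := by
    have h0 : c.i' p q h x = 0 ↔ c.i p q h (c.ι p x) = 0 := by
      rw [← i'_ι_apply, map_eq_zero_iff _ (c.ι_injective q)]
    rw [h0, c.exact_i]
    constructor
    · rintro ⟨e, he⟩
      -- Since `k e` lies in the kernel of `j`, the element `e` is a cycle and defines a class.
      have hd : ∀ q', c.pg.d p q' e = 0 := fun q' => by
        by_cases h' : p + ((n : ℤ), 1 - (n : ℤ)) = q'
        · exact (c.page_d_apply _ _ p q' h' _).trans (by rw [he, ι_j_apply])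
        · rw [HomologicalComplex.shape _ _ _ h']
          rfl
      exact ⟨_, c.ι_injective p ((c.ι_k'_cls p e hd).trans he)⟩
    · rintro ⟨e, rfl⟩
      obtain ⟨x, hx, rfl⟩ := HomologicalComplex.exists_cls e
      exact ⟨x, (c.ι_k'_cls p x hx).symm⟩
  exact_j p q q' h h' y := by
    have hq' : p + ((n : ℤ), 1 - (n : ℤ)) = q' := by rw [← h', ← h]; ext <;> simp <;> ring
    obtain ⟨x, rfl⟩ := c.π_surjective p q h y
    rw [← ConcreteCategory.comp_apply, c.π_j' p q q' h hq' h', jCycles_homologyπ_eq_zero]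
    constructor
    · rintro ⟨e, he⟩
      -- Subtracting `k e` does not change the image under `i`, and puts `x` into the kernel of `j`,
      -- that is, into the derived `D`.
      obtain ⟨y, hy⟩ := c.exists_ι p q' hq' (x - c.k p e) (by rw [map_sub, he, sub_self])
      refine ⟨y, c.ι_injective q ?_⟩
      rw [i'_ι_apply, hy, π_ι_apply, map_sub, (c.exact_i p q h _).2 ⟨e, rfl⟩, sub_zero]
    · rintro ⟨y, hy⟩
      have hy : c.i p q h (c.ι p y) = c.i p q h x := by
        rw [← i'_ι_apply, hy, π_ι_apply]
      -- The difference is `k e` for some `e`, and `j` vanishes on elements of the derived `D`; so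
      -- `j x = j (k e)`.
      obtain ⟨e, he⟩ := (c.exact_i p q h (x - c.ι p y)).1 (by rw [map_sub, hy, sub_self])
      exact ⟨e, by rw [he, map_sub, ι_j_apply, sub_zero]⟩
  exact_k q q' h e := by
    have h1 : q + (1, -1) + (-1, 1) = q := by ext <;> simp
    have hq' : q + (1, -1) + ((n : ℤ), 1 - (n : ℤ)) = q' := by rw [← h]; ext <;> simp <;> ring
    obtain ⟨x, hx, rfl⟩ := HomologicalComplex.exists_cls e
    have h0 := c.ι_k'_cls q' x hx
    constructor
    · intro h2
      rw [h2, map_zero] at h0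
      obtain ⟨y, hy⟩ := (c.exact_k (q + (1, -1)) q' hq' x).1 h0.symm
      refine ⟨c.π _ q h1 y, ?_⟩
      rw [c.j'_π _ q q' h1 hq' h y (fun q'' => c.d_j _ _ _ _ _)]
      exact HomologicalComplex.cls_congr hy _
    · rintro ⟨y, hy⟩
      obtain ⟨z, rfl⟩ := c.π_surjective _ q h1 y
      rw [← hy, c.j'_π _ q q' h1 hq' h z (fun q'' => c.d_j _ _ _ _ _)]
      apply c.ι_injective
      rw [ι_k'_cls, j_k_apply, map_zero]
  isZero_D p hp := by
    have := ModuleCat.subsingleton_of_isZero (c.isZero_D p hp)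
    exact ModuleCat.isZero_of_iff_subsingleton.2 (c.ι_injective p).subsingleton
  isZero_E p hp := by
    refine ModuleCat.isZero_of_iff_subsingleton.2 ⟨fun e e' => ?_⟩
    have := ModuleCat.subsingleton_of_isZero (c.isZero_E p hp)
    obtain ⟨x, hx, rfl⟩ := HomologicalComplex.exists_cls e
    obtain ⟨x', hx', rfl⟩ := HomologicalComplex.exists_cls e'
    exact HomologicalComplex.cls_congr (Subsingleton.elim (α := c.E p) x x') _

end Derived

end ExactCouple

end

/-! ### Functoriality and iteration of derived couples -/

noncomputable section

namespace ExactCouple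

variable {n : ℕ}

section

variable {c c' : ExactCouple.{u} n} (f : c ⟶ c')

/-- The map induced on the images of `i`. -/
def mapD' (p : ℤ × ℤ) : c.D' p ⟶ c'.D' p :=
  kernel.map _ _ (Hom.D f p) (Hom.E f _) (Hom.j_comm f _ _ _)

lemma mapD'_ι (p : ℤ × ℤ) : mapD' f p ≫ c'.ι p = c.ι p ≫ Hom.D f p := kernel.lift_ι _ _ _

lemma π_mapD' (p q : ℤ × ℤ) (h : p + (-1, 1) = q) :
    c.π p q h ≫ mapD' f q = Hom.D f p ≫ c'.π p q h := by
  have : Mono (c'.ι q) := inferInstanceAs (Mono (kernel.ι _))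
  rw [← cancel_mono (c'.ι q), Category.assoc, mapD'_ι, Category.assoc, π_ι, ← Category.assoc,
    π_ι, Hom.i_comm]

/-- The map induced on homology groups. -/
abbrev mapE' (p : ℤ × ℤ) : c.pg.homology p ⟶ c'.pg.homology p :=
  HomologicalComplex.homologyMap (pageMap n rfl f) p

/-- The map induced on derived couples. -/
def derivedMap : c.derived ⟶ c'.derived where
  D := mapD' f
  E := mapE' f
  i_comm p q h := by
    change (c.ι p ≫ c.π p q h) ≫ _ = _ ≫ c'.ι p ≫ c'.π p q h
    rw [Category.assoc, π_mapD', ← Category.assoc, ← Category.assoc, mapD'_ι]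
  j_comm q q' h := by
    have h1 : q + (1, -1) + (-1, 1) = q := by ext <;> simp
    have hq' : q + (1, -1) + ((n : ℤ), 1 - (n : ℤ)) = q' := by rw [← h]; ext <;> simp <;> ring
    change c.j' q q' h ≫ mapE' f q' = mapD' f q ≫ c'.j' q q' h
    -- The derived `j` is only known after composition with the surjection `π`.
    have : Epi (c.π _ q h1) := (ModuleCat.epi_iff_surjective _).2 (c.π_surjective _ q h1)
    rw [← cancel_epi (c.π _ q h1), ← Category.assoc, c.π_j' _ q q' h1 hq' h, ← Category.assoc,
      π_mapD', Category.assoc, Category.assoc, c'.π_j' _ q q' h1 hq' h,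
      HomologicalComplex.homologyπ_naturality, ← Category.assoc, ← Category.assoc]
    refine congrArg (· ≫ c'.pg.homologyπ q') ?_
    rw [← cancel_mono (c'.pg.iCycles q'), Category.assoc, HomologicalComplex.cyclesMap_i,
      ← Category.assoc]
    refine (congrArg (· ≫ Hom.E f q') (c.jCycles_i _ q' hq')).trans ?_
    refine (Hom.j_comm f _ q' hq').trans ?_
    exact (congrArg (Hom.D f _ ≫ ·) (c'.jCycles_i _ q' hq').symm).trans
      (Category.assoc _ _ _).symm
  k_comm p := by
    change c.k' p ≫ mapD' f p = mapE' f p ≫ c'.k' p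
    have : Mono (c'.ι p) := inferInstanceAs (Mono (kernel.ι _))
    rw [← cancel_mono (c'.ι p), ← cancel_epi (c.pg.homologyπ p), Category.assoc, mapD'_ι,
      Category.assoc, HomologicalComplex.homologyπ_naturality_assoc, homologyπ_k'_ι,
      ← Category.assoc, ← Category.assoc, Category.assoc _ (c.k' p), homologyπ_k'_ι,
      ← Category.assoc, HomologicalComplex.cyclesMap_i, Category.assoc, Category.assoc]
    exact congrArg (c.pg.iCycles p ≫ ·) (Hom.k_comm f p)

end

/-- The derived couple, as a functor. -/
def derivedFunctor : ExactCouple.{u} n ⥤ ExactCouple.{u} (n + 1) where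
  obj c := c.derived
  map f := derivedMap f
  map_id c := by
    refine Hom.ext (funext fun p => ?_) (funext fun p => ?_)
    · exact (cancel_mono (kernel.ι (c.j p _ rfl))).1
        ((kernel.lift_ι _ _ _).trans ((Category.comp_id _).trans (Category.id_comp _).symm))
    · exact HomologicalComplex.homologyMap_id _ _
  map_comp {c c' c''} f g := by
    refine Hom.ext (funext fun p => ?_) (funext fun p => ?_)
    · have : Mono (c''.ι p) := inferInstanceAs (Mono (kernel.ι _))
      refine (cancel_mono (c''.ι p)).1 ?_
      change mapD' (f ≫ g) p ≫ c''.ι p = (mapD' f p ≫ mapD' g p) ≫ c''.ι p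
      rw [mapD'_ι, Category.assoc, mapD'_ι, ← Category.assoc, mapD'_ι, Category.assoc]
      rfl
    · exact HomologicalComplex.homologyMap_comp (pageMap n rfl f) (pageMap n rfl g) p

/-- The iterated derived couples. -/
def iterated : ∀ m : ℕ, ExactCouple.{u} 1 ⥤ ExactCouple.{u} (1 + m)
  | 0 => 𝟭 _
  | m + 1 => iterated m ⋙ derivedFunctor

/-! #### The spectral sequence of an exact couple -/

variable (c : ExactCouple.{u} 1)

/-- The `m`-th derived couple. -/
abbrev it (m : ℕ) : ExactCouple.{u} (1 + m) := (iterated m).obj c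

section

lemma deg_eq (m : ℕ) (r : ℤ) (hr : r = (1 + m : ℕ)) {p q : ℤ × ℤ} (h : p + (r, 1 - r) = q) :
    p + (((1 + m : ℕ) : ℤ), 1 - ((1 + m : ℕ) : ℤ)) = q := by rw [← hr]; exact h

/-- The homology of a page is the next page. -/
def itIso (m m' : ℕ) (hm : m' = m + 1) (r : ℤ) (hr : r = (1 + m : ℕ))
    (p : ℤ × ℤ) : ((c.it m).page r hr).homology p ≅ (c.it m').E p :=
  eqToIso (by subst hm hr; rfl)

/-- The inclusion of the image of `i`. -/
def itι (m m' : ℕ) (hm : m' = m + 1) (p : ℤ × ℤ) : (c.it m').D p ⟶ (c.it m).D p :=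
  eqToHom (by subst hm; rfl) ≫ (c.it m).ι p

/-- The map `i`, with codomain restricted to its image. -/
def itπ (m m' : ℕ) (hm : m' = m + 1) (p q : ℤ × ℤ) (h : p + (-1, 1) = q) : (c.it m).D p ⟶ (c.it m').D q :=
  (c.it m).π p q h ≫ eqToHom (by subst hm; rfl)

/-- The index `m'` and the equation `m' = m + 1` are kept as separate data because `(r' - 1).toNat`
equals `(r - 1).toNat + 1` only propositionally. After substitution the transports become
identities. -/
lemma itι_rfl (m : ℕ) (p : ℤ × ℤ) : c.itι m _ rfl p = (c.it m).ι p := Category.id_comp _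

lemma itπ_rfl (m : ℕ) (p q : ℤ × ℤ) (h : p + (-1, 1) = q) : c.itπ m _ rfl p q h = (c.it m).π p q h :=
  Category.comp_id _

lemma mono_itι (m m' : ℕ) (hm : m' = m + 1) (p : ℤ × ℤ) : Mono (c.itι m m' hm p) := by
  subst hm
  rw [itι_rfl]
  exact inferInstanceAs (Mono (kernel.ι _))

lemma epi_itπ (m m' : ℕ) (hm : m' = m + 1) (p q : ℤ × ℤ) (h : p + (-1, 1) = q) : Epi (c.itπ m m' hm p q h) := by
  subst hm
  rw [itπ_rfl]
  exact (ModuleCat.epi_iff_surjective _).2 ((c.it m).π_surjective p q h)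

lemma itπ_itι (m m' : ℕ) (hm : m' = m + 1) (p q : ℤ × ℤ) (h : p + (-1, 1) = q) :
    c.itπ m m' hm p q h ≫ c.itι m m' hm q = (c.it m).i p q h := by
  subst hm
  rw [itπ_rfl, itι_rfl]
  exact π_ι _ _ _ _

lemma it_i_ι (m m' : ℕ) (hm : m' = m + 1) (p q : ℤ × ℤ) (h : p + (-1, 1) = q) :
    (c.it m').i p q h ≫ c.itι m m' hm q = c.itι m m' hm p ≫ (c.it m).i p q h := by
  subst hm
  rw [itι_rfl, itι_rfl]
  exact i'_ι _ _ _ _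

lemma it_k_ι (m m' : ℕ) (hm : m' = m + 1) (r : ℤ) (hr : r = (1 + m : ℕ))
    (p : ℤ × ℤ) :
    ((c.it m).page r hr).homologyπ p ≫ (c.itIso m m' hm r hr p).hom ≫ (c.it m').k p ≫
      c.itι m m' hm p = ((c.it m).page r hr).iCycles p ≫ (c.it m).k p := by
  subst hm hr
  rw [itι_rfl]
  refine (congrArg (((c.it m).page _ rfl).homologyπ p ≫ ·) (Category.id_comp _)).trans ?_
  exact homologyπ_k'_ι _ _

lemma it_π_j (m m' : ℕ) (hm : m' = m + 1) (r r' : ℤ)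
    (hr : r = (1 + m : ℕ)) (hr' : r' = (1 + m' : ℕ)) (p q p' : ℤ × ℤ) (h : p + (-1, 1) = q) (h' : p + (r, 1 - r) = p')
    (h'' : q + (r', 1 - r') = p') :
    c.itπ m m' hm p q h ≫ (c.it m').j q p' (deg_eq m' r' hr' h'') ≫
        (c.itIso m m' hm r hr p').inv ≫ ((c.it m).page r hr).homologyι p' =
      (c.it m).j p p' (deg_eq m r hr h') ≫ ((c.it m).page r hr).pOpcycles p' := by
  subst hm hr hr'
  rw [itπ_rfl]
  have h1 := (c.it m).π_j' p q p' h h' h''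
  have h2 : (c.it m).j' q p' h'' ≫ (c.itIso m _ rfl _ rfl p').inv = (c.it m).j' q p' h'' :=
    Category.comp_id _
  have h3 := (c.it m).jCycles_i p p' h'
  refine (congrArg ((c.it m).π p q h ≫ ·) ((Category.assoc _ _ _).symm.trans
    (congrArg (· ≫ (c.it m).pg.homologyι p') h2))).trans ?_
  refine ((Category.assoc _ _ _).symm.trans (congrArg (· ≫ _) h1)).trans ?_
  rw [Category.assoc, HomologicalComplex.homology_π_ι, ← Category.assoc]
  exact congrArg (· ≫ (c.it m).pg.pOpcycles p') h3

variable {c} {c' : ExactCouple.{u} 1} (f : c ⟶ c')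

lemma itι_naturality (m m' : ℕ) (hm : m' = m + 1) (p : ℤ × ℤ) :
    c.itι m m' hm p ≫ Hom.D ((iterated m).map f) p =
      Hom.D ((iterated m').map f) p ≫ c'.itι m m' hm p := by
  subst hm
  rw [itι_rfl, itι_rfl]
  exact (mapD'_ι _ p).symm

lemma itIso_naturality (m m' : ℕ) (hm : m' = m + 1) (r : ℤ) (hr : r = (1 + m : ℕ))
    (p : ℤ × ℤ) :
    HomologicalComplex.homologyMap (pageMap r hr ((iterated m).map f)) p ≫
        (c'.itIso m m' hm r hr p).hom =
      (c.itIso m m' hm r hr p).hom ≫ Hom.E ((iterated m').map f) p := by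
  subst hm hr
  exact (Category.comp_id _).trans (Category.id_comp _).symm

end

/-- The index of the couple `(D_r, E_r)`. -/
lemma toNat_spec {r : ℤ} (hr : 1 ≤ r) : r = (1 + (r - 1).toNat : ℕ) := by lia

lemma toNat_succ {r r' : ℤ} (hr : 1 ≤ r) (hr' : r + 1 = r') :
    (r' - 1).toNat = (r - 1).toNat + 1 := by lia

/-- The spectral sequence of an exact couple, together with the derived couples. -/
def toCoupledSS : CoupledSS AB.{u} 1 where
  ss :=
    { page r hr := (c.it (r - 1).toNat).page r (toNat_spec hr)
      iso r r' p hrr' hr := c.itIso _ _ (toNat_succ hr hrr') r (toNat_spec hr) p }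
  D r hr p := (c.it (r - 1).toNat).D p
  i r hr p q h := (c.it (r - 1).toNat).i p q h
  j r hr p q h := (c.it (r - 1).toNat).j p q (deg_eq _ r (toNat_spec hr) h)
  k r hr p := (c.it (r - 1).toNat).k p
  exact r hr p q p' h h' := (c.it (r - 1).toNat).mk₄_exact p q p' h (deg_eq _ r (toNat_spec hr) h')
  d_eq r hr p q h := page_d _ r (toNat_spec hr) p q h
  ι r r' hr hr' p := c.itι _ _ (toNat_succ hr hr') p
  π r r' hr hr' p q h := c.itπ _ _ (toNat_succ hr hr') p q h
  mono_ι r r' hr hr' p := c.mono_itι _ _ (toNat_succ hr hr') p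
  epi_π r r' hr hr' p q h := c.epi_itπ _ _ (toNat_succ hr hr') p q h
  π_ι r r' hr hr' p q h := c.itπ_itι _ _ (toNat_succ hr hr') p q h
  i_ι r r' hr hr' p q h := c.it_i_ι _ _ (toNat_succ hr hr') p q h
  k_ι r r' hr hr' p := c.it_k_ι _ _ (toNat_succ hr hr') r (toNat_spec hr) p
  π_j r r' hr hr' p q p' h h' h'' := c.it_π_j _ _ (toNat_succ hr hr') r r' (toNat_spec hr)
    (toNat_spec (by lia)) p q p' h h' h''
  isZero_D r hr p hp := (c.it (r - 1).toNat).isZero_D p hp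
  isZero_E r hr p hp := (c.it (r - 1).toNat).isZero_E p hp

/-- The spectral sequence of an exact couple, as a functor. -/
def toCoupledSSFunctor : ExactCouple.{u} 1 ⥤ CoupledSS AB.{u} 1 where
  obj c := c.toCoupledSS
  map f :=
    { ss :=
        { hom r hr := pageMap r (toNat_spec hr) ((iterated _).map f)
          comm r r' p hrr' hr := itIso_naturality f _ _ (toNat_succ hr hrr') r (toNat_spec hr) p }
      D r hr p := Hom.D ((iterated (r - 1).toNat).map f) p
      i_comm r hr p q h := Hom.i_comm ((iterated (r - 1).toNat).map f) p q h
      j_comm r hr p q h := Hom.j_comm ((iterated (r - 1).toNat).map f) p q _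
      k_comm r hr p := Hom.k_comm ((iterated (r - 1).toNat).map f) p
      ι_comm r r' hr hr' p := itι_naturality f _ _ (toNat_succ hr hr') p }
  map_id c := by
    apply CoupledSS.Hom.ext
    · refine SpectralSequence.hom_ext fun r hr => ?_
      refine HomologicalComplex.hom_ext _ _ fun p => ?_
      exact congrArg (Hom.E · p) ((iterated (r - 1).toNat).map_id c)
    · funext r hr p
      exact congrArg (Hom.D · p) ((iterated (r - 1).toNat).map_id c)
  map_comp f g := by
    apply CoupledSS.Hom.ext
    · refine SpectralSequence.hom_ext fun r hr => ?_
      refine HomologicalComplex.hom_ext _ _ fun p => ?_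
      exact congrArg (Hom.E · p) ((iterated (r - 1).toNat).map_comp f g)
    · funext r hr p
      exact congrArg (Hom.D · p) ((iterated (r - 1).toNat).map_comp f g)

end ExactCouple

end

noncomputable section

/-! ### The exact couple of the tower of total complexes -/

section HCast

variable {ι : Type*} {c : ComplexShape ι}

/-- The identification of homology groups with equal indices. -/
def hcast (L : HomologicalComplex AB.{u} c) {a b : ι} (h : a = b) : L.homology a ≅ L.homology b :=
  eqToIso (by rw [h])

lemma hcast_trans (L : HomologicalComplex AB.{u} c) {a b d : ι} (h : a = b) (h' : b = d) :
    (hcast L h).hom ≫ (hcast L h').hom = (hcast L (h.trans h')).hom :=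
  by subst h h'; exact Category.id_comp _

lemma hcast_naturality {L M : HomologicalComplex AB.{u} c} (f : L ⟶ M) {a b : ι} (h : a = b) :
    (hcast L h).hom ≫ HomologicalComplex.homologyMap f b =
      HomologicalComplex.homologyMap f a ≫ (hcast M h).hom := by
  subst h
  exact (Category.id_comp _).trans (Category.comp_id _).symm

lemma δ_hcast {S : ShortComplex (HomologicalComplex AB.{u} c)} (hS : S.ShortExact) {i j j' : ι}
    (hij : c.Rel i j) (h : j = j') :
    hS.δ i j hij ≫ (hcast _ h).hom = hS.δ i j' (h ▸ hij) := by
  subst h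
  exact Category.comp_id _

end HCast

namespace TotCouple

open HomologicalComplex

section

variable (K : CochainComplex CHAIN.{u} ℕ)

lemma down_rel {n n' : ℤ} (h : n' + 1 = n) : (ComplexShape.down ℤ).Rel n n' := h

/-- The projection `Tot^{(p)} ⟶ Tot^{(q)}`. -/
abbrev proj (p q : ℤ) (h : q ≤ p) : tot K p ⟶ tot K q :=
  (totProj (show (q : WithTop ℤ) ≤ p by exact_mod_cast h)).app K

lemma totProj_refl (p : WithTop ℤ) : (totProj (le_refl p)).app K = 𝟙 (tot K p) := by
  refine HomologicalComplex.hom_ext _ _ fun n => tot_hom_ext fun a => ?_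
  exact (totProjX_π (le_refl p) a).trans (Category.id_comp _).symm

lemma totProj_comp {p q r : WithTop ℤ} (h : q ≤ p) (h' : r ≤ q) :
    (totProj h).app K ≫ (totProj h').app K = (totProj (h'.trans h)).app K := by
  refine HomologicalComplex.hom_ext _ _ fun n => tot_hom_ext fun a => ?_
  change (totProjX K h n ≫ totProjX K h' n) ≫ totπ K a = totProjX K (h'.trans h) n ≫ totπ K a
  rw [Category.assoc, totProjX_π, totProjX_π, totProjX_π]

/-- The short exact sequence `0 ⟶ Γ^{(s)} ⟶ Tot^{(s)} ⟶ Tot^{(s-1)} ⟶ 0`. -/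
abbrev ses (s : ℤ) : ShortComplex CHAIN.{u} :=
  ShortComplex.mk (kernel.ι (proj K s (s - 1) (by lia))) (proj K s (s - 1) (by lia))
    (kernel.condition _)

lemma ses_shortExact (s : ℤ) : (ses K s).ShortExact where
  exact := ShortComplex.exact_of_f_is_kernel _ (kernelIsKernel _)
  mono_f := inferInstanceAs (Mono (kernel.ι _))
  epi_g := epi_totProj _ _

/-- The map `i`. -/
def iMap (s a n n' : ℤ) (h : a ≤ s) (hn : n = n') :
    (tot K s).homology n ⟶ (tot K a).homology n' :=
  homologyMap (proj K s a h) n ≫ (hcast _ hn).hom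

/-- The map `k`. -/
def kMap (s n : ℤ) : (ses K s).X₁.homology n ⟶ (tot K s).homology n :=
  homologyMap (ses K s).f n

/-- The map `j`. -/
def jMap (a s n n' : ℤ) (h : s - 1 ≤ a) (hn : n' + 1 = n) :
    (tot K a).homology n ⟶ (ses K s).X₁.homology n' :=
  homologyMap (proj K a (s - 1) h) n ≫ (ses_shortExact K s).δ n n' (down_rel hn)

/-- This is a piece of the long exact homology sequence of `ses`. The target indices are free
variables subject to equations, so that the bidegrees of the couple, which match only up to such
equations, can be inserted. -/
lemma iMap_eq_zero_iff (s a n n' : ℤ) (h : a + 1 = s) (hn : n = n') (x : (tot K s).homology n) :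
    iMap K s a n n' (by lia) hn x = 0 ↔ ∃ e, kMap K s n e = x := by
  obtain rfl : a = s - 1 := by lia
  subst hn
  have hx : iMap K s (s - 1) n n (by lia) rfl = homologyMap (ses K s).g n := Category.comp_id _
  rw [hx]
  exact ⟨(ShortComplex.moduleCat_exact_iff _).1 ((ses_shortExact K s).homology_exact₂ n) x,
    fun ⟨e, he⟩ => by
      rw [← he]
      exact congr($((homologyMap_comp _ _ _).symm.trans
        ((congrArg (homologyMap · n) (ses K s).zero).trans (homologyMap_zero _ _ _))) e)⟩

lemma jMap_eq (s n n' : ℤ) (hn : n' + 1 = n) :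
    jMap K (s - 1) s n n' le_rfl hn = (ses_shortExact K s).δ n n' (down_rel hn) := by
  rw [jMap, proj, totProj_refl, homologyMap_id, Category.id_comp]

lemma jMap_eq_zero_iff (s a n n' m : ℤ) (h : a + 1 = s) (hn : n = n') (hm : m + 1 = n')
    (y : (tot K a).homology n') :
    jMap K a s n' m (by lia) hm y = 0 ↔ ∃ x, iMap K s a n n' (by lia) hn x = y := by
  obtain rfl : a = s - 1 := by lia
  subst hn
  have hx : iMap K s (s - 1) n n (by lia) rfl = homologyMap (ses K s).g n := Category.comp_id _
  rw [hx, jMap_eq]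
  exact ⟨(ShortComplex.moduleCat_exact_iff _).1 ((ses_shortExact K s).homology_exact₃ n m hm) y,
    fun ⟨e, he⟩ => by
      rw [← he]
      exact (ShortComplex.mk _ _ ((ses_shortExact K s).comp_δ n m hm)).moduleCat_zero_apply e⟩

lemma kMap_eq_zero_iff (s a n n' : ℤ) (h : a + 1 = s) (hn : n' + 1 = n)
    (e : (ses K s).X₁.homology n') :
    kMap K s n' e = 0 ↔ ∃ x, jMap K a s n n' (by lia) hn x = e := by
  obtain rfl : a = s - 1 := by lia
  rw [jMap_eq]
  exact ⟨(ShortComplex.moduleCat_exact_iff _).1 ((ses_shortExact K s).homology_exact₁ n n' hn) e,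
    fun ⟨x, hx⟩ => by
      rw [← hx]
      exact (ShortComplex.mk _ _ ((ses_shortExact K s).δ_comp n n' hn)).moduleCat_zero_apply x⟩

lemma isZero_totX (s n : ℤ) (hs : s < 0) : IsZero ((tot K s).X n) := by
  have : IsEmpty (TotIndex (s : WithTop ℤ) n) := ⟨fun a => by
    have := a.hs
    have : (a.s : ℤ) ≤ s := by exact_mod_cast this
    lia⟩
  exact (IsZero.iff_id_eq_zero _).2 (tot_hom_ext fun a => this.elim a)

lemma isZero_homology_of_isZero_X {L : CHAIN.{u}} {n : ℤ} (h : IsZero (L.X n)) :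
    IsZero (L.homology n) :=
  ShortComplex.isZero_homology_of_isZero_X₂ _ h

lemma isZero_sesX (s n : ℤ) (hs : s < 0) : IsZero ((ses K s).X₁.X n) := by
  have : Mono ((ses K s).f.f n) := by
    have := (ses_shortExact K s).mono_f
    infer_instance
  exact IsZero.of_mono ((ses K s).f.f n) (isZero_totX K s n hs)

/-- The exact couple of the tower of total complexes. -/
def couple : ExactCouple.{u} 1 where
  D p := (tot K p.1).homology (-p.1 - p.2)
  E p := (ses K p.1).X₁.homology (-p.1 - p.2)
  i p q h := iMap K _ _ _ _ (by subst h; simp) (by subst h; simp; ring)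
  j p q h := jMap K _ _ _ _ (by subst h; simp) (by subst h; simp; ring)
  k p := kMap K _ _
  exact_i p q h x := iMap_eq_zero_iff K _ _ _ _ (by subst h; simp) _ x
  exact_j := by
    rintro ⟨s, t⟩ ⟨a, b⟩ ⟨s', b'⟩ h h' y
    obtain rfl : s' = s := by
      have h1 := congrArg Prod.fst h
      have h2 := congrArg Prod.fst h'
      simp only [Prod.fst_add, Nat.cast_one] at h1 h2
      lia
    have h1 : a + 1 = s' := by simpa using congrArg Prod.fst h'
    have h2 : t + 1 = b := by simpa using congrArg Prod.snd h
    have h3 : b = b' := by simpa using congrArg Prod.snd h'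
    exact jMap_eq_zero_iff K s' a _ _ _ h1 (by dsimp only; lia) (by dsimp only; lia) y
  exact_k p q h e := kMap_eq_zero_iff K _ _ _ _ (by subst h; simp) (by subst h; simp; ring) e
  isZero_D p hp := isZero_homology_of_isZero_X (isZero_totX K _ _ hp)
  isZero_E p hp := isZero_homology_of_isZero_X (isZero_sesX K _ _ hp)

end

variable {K L : CochainComplex CHAIN.{u} ℕ} (f : K ⟶ L)

/-- The functoriality of `Tot^{(p)}`. -/
abbrev totMap (p : WithTop ℤ) : tot K p ⟶ tot L p := (totFunctor p).map f

lemma totMap_proj (p q : ℤ) (h : q ≤ p) : totMap f p ≫ proj L p q h = proj K p q h ≫ totMap f q :=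
  (totProj _).naturality f

/-- The functoriality of the short exact sequences. -/
def sesMap (s : ℤ) : ses K s ⟶ ses L s where
  τ₁ := kernel.map _ _ (totMap f s) (totMap f (s - 1 : ℤ)) (totMap_proj f s (s - 1) (by lia)).symm
  τ₂ := totMap f s
  τ₃ := totMap f (s - 1 : ℤ)
  comm₁₂ := kernel.lift_ι _ _ _
  comm₂₃ := totMap_proj f s (s - 1) (by lia)

lemma iMap_naturality (s a n n' : ℤ) (h : a ≤ s) (hn : n = n') :
    iMap K s a n n' h hn ≫ homologyMap (totMap f a) n' =
      homologyMap (totMap f s) n ≫ iMap L s a n n' h hn := by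
  rw [iMap, iMap, Category.assoc, hcast_naturality, ← Category.assoc, ← Category.assoc,
    ← homologyMap_comp, ← homologyMap_comp, totMap_proj]

lemma kMap_naturality (s n : ℤ) :
    kMap K s n ≫ homologyMap (totMap f s) n = homologyMap (sesMap f s).τ₁ n ≫ kMap L s n :=
  (homologyMap_comp _ _ _).symm.trans
    ((congrArg (homologyMap · n) (sesMap f s).comm₁₂.symm).trans (homologyMap_comp _ _ _))

lemma jMap_naturality (a s n n' : ℤ) (h : s - 1 ≤ a) (hn : n' + 1 = n) :
    jMap K a s n n' h hn ≫ homologyMap (sesMap f s).τ₁ n' =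
      homologyMap (totMap f a) n ≫ jMap L a s n n' h hn := by
  rw [jMap, jMap, Category.assoc, HomologySequence.δ_naturality (sesMap f s) (ses_shortExact K s)
    (ses_shortExact L s) n n' (down_rel hn), ← Category.assoc, ← Category.assoc]
  refine congrArg (· ≫ _) ?_
  exact (homologyMap_comp _ _ _).symm.trans
    ((congrArg (homologyMap · n) (totMap_proj f _ _ _).symm).trans (homologyMap_comp _ _ _))

lemma sesMap_id (s : ℤ) : sesMap (𝟙 K) s = 𝟙 _ := by
  have h1 : (sesMap (𝟙 K) s).τ₂ = 𝟙 _ := (totFunctor s).map_id K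
  refine ShortComplex.hom_ext _ _ ((cancel_mono (kernel.ι _)).1 ?_) h1 ((totFunctor _).map_id K)
  refine (sesMap (𝟙 K) s).comm₁₂.trans ?_
  exact (congrArg (_ ≫ ·) h1).trans ((Category.comp_id _).trans (Category.id_comp _).symm)

lemma sesMap_comp {M : CochainComplex CHAIN.{u} ℕ} (g : L ⟶ M) (s : ℤ) :
    sesMap (f ≫ g) s = sesMap f s ≫ sesMap g s := by
  have h1 : (sesMap (f ≫ g) s).τ₂ = (sesMap f s ≫ sesMap g s).τ₂ := (totFunctor s).map_comp f g
  refine ShortComplex.hom_ext _ _ ((cancel_mono (kernel.ι _)).1 ?_) h1 ((totFunctor _).map_comp f g)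
  refine (sesMap (f ≫ g) s).comm₁₂.trans ?_
  exact (congrArg (_ ≫ ·) h1).trans (sesMap f s ≫ sesMap g s).comm₁₂.symm

/-- The exact couple of the tower of total complexes, as a functor. -/
def coupleFunctor : CochainComplex CHAIN.{u} ℕ ⥤ ExactCouple.{u} 1 where
  obj K := couple K
  map f :=
    { D p := homologyMap ((totFunctor p.1).map f) _
      E p := homologyMap (sesMap f p.1).τ₁ _
      i_comm _ _ _ := iMap_naturality f _ _ _ _ _ _
      j_comm p q h := jMap_naturality f _ _ _ _ _ (by subst h; simp; ring)
      k_comm _ := kMap_naturality f _ _ }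
  map_id K := ExactCouple.Hom.ext
    (funext fun _ => (congrArg (homologyMap · _) ((totFunctor _).map_id K)).trans
      (homologyMap_id _ _))
    (funext fun p => (congrArg (fun t => homologyMap (ShortComplex.Hom.τ₁ t) _)
      (sesMap_id p.1)).trans (homologyMap_id _ _))
  map_comp f g := ExactCouple.Hom.ext
    (funext fun _ => (congrArg (homologyMap · _) ((totFunctor _).map_comp f g)).trans
      (homologyMap_comp _ _ _))
    (funext fun p => (congrArg (fun t => homologyMap (ShortComplex.Hom.τ₁ t) _)
      (sesMap_comp f g p.1)).trans (homologyMap_comp _ _ _))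

end TotCouple

namespace InvSystem

open HomologicalComplex TotCouple

/-- The spectral sequence of the homotopy inverse limit, with its exact couples. -/
def holimSS : InvSystem.{u} CHAIN.{u} ⥤ CoupledSS AB.{u} 1 :=
  bicomplex ⋙ coupleFunctor ⋙ ExactCouple.toCoupledSSFunctor

variable (C : InvSystem.{u} CHAIN.{u})

/-- The projection `Tot^{(s+1)} ⟶ Tot^{(s)}`. -/
abbrev totProjSucc (s : ℤ) : tot (bicomplex.obj C) (s + 1 : ℤ) ⟶ tot (bicomplex.obj C) s :=
  proj (bicomplex.obj C) (s + 1) s (by lia)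

/-- The short exact sequence `0 ⟶ Γ^{(s+1)} ⟶ Tot^{(s+1)} ⟶ Tot^{(s)} ⟶ 0`. -/
abbrev totSES (s : ℤ) : ShortComplex CHAIN.{u} :=
  ShortComplex.mk (kernel.ι (totProjSucc C s)) (totProjSucc C s) (kernel.condition _)

lemma totSES_shortExact (s : ℤ) : (totSES C s).ShortExact := holimTotShortComplex_shortExact C s

lemma proj_comp {K : CochainComplex CHAIN.{u} ℕ} (p q r : ℤ) (h : q ≤ p) (h' : r ≤ q) :
    proj K p q h ≫ proj K q r h' = proj K p r (h'.trans h) :=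
  totProj_comp _ _ _

/-- The identification of `Tot^{(s+1-1)}` with `Tot^{(s)}`. -/
abbrev totPredIso (s : ℤ) :
    tot (bicomplex.obj C) ((s + 1 - 1 : ℤ) : WithTop ℤ) ≅ tot (bicomplex.obj C) s where
  hom := proj (bicomplex.obj C) (s + 1 - 1) s (by lia)
  inv := proj (bicomplex.obj C) s (s + 1 - 1) (by lia)
  hom_inv_id := (proj_comp _ _ _ (by lia) (by lia)).trans (totProj_refl _ _)
  inv_hom_id := (proj_comp _ _ _ (by lia) (by lia)).trans (totProj_refl _ _)

lemma proj_totPredIso (s : ℤ) : (ses (bicomplex.obj C) (s + 1)).g ≫ (totPredIso C s).hom =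
    𝟙 _ ≫ totProjSucc C s :=
  (proj_comp _ _ _ (by lia) (by lia)).trans (Category.id_comp _).symm

/-- The comparison of the two forms of the short exact sequence of `Tot^{(s+1)} ⟶ Tot^{(s)}`. -/
def sesComparison (s : ℤ) : ses (bicomplex.obj C) (s + 1) ≅ totSES C s :=
  ShortComplex.isoMk
    (kernel.mapIso _ _ (Iso.refl _) (totPredIso C s) (proj_totPredIso C s))
    (Iso.refl _) (totPredIso C s) (kernel.lift_ι _ _ _) (proj_totPredIso C s).symm

/-- The comparison of the two forms of `Γ^{(s+1)}`. -/
def gammaIso (s : ℤ) : (ses (bicomplex.obj C) (s + 1)).X₁ ≅ (totSES C s).X₁ :=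
  ShortComplex.π₁.mapIso (sesComparison C s)

lemma gammaIso_ι (s : ℤ) : (gammaIso C s).hom ≫ (totSES C s).f = (ses (bicomplex.obj C) (s + 1)).f :=
  (sesComparison C s).hom.comm₁₂.trans (Category.comp_id _)

lemma gammaIso_naturality {C C' : InvSystem.{u} CHAIN.{u}} (f : C ⟶ C') (s : ℤ) :
    (sesMap (bicomplex.map f) (s + 1)).τ₁ ≫ (gammaIso C' s).hom =
      (gammaIso C s).hom ≫ (holimGamma s).map f := by
  refine (cancel_mono (kernel.ι (totProjSucc C' s))).1 ?_
  refine (Category.assoc _ _ _).trans ?_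
  refine (congrArg (_ ≫ ·) (gammaIso_ι C' s)).trans ?_
  refine Eq.trans ?_ (Category.assoc _ _ _).symm
  refine Eq.trans ?_ (congrArg (_ ≫ ·) (kernel.lift_ι _ _ _).symm)
  refine Eq.trans ?_ (Category.assoc _ _ _)
  refine Eq.trans ?_ (congrArg (· ≫ _) (gammaIso_ι C s).symm)
  exact kernel.lift_ι _ _ _

/-- The connecting homomorphism is natural along `sesComparison`. The projection from `Tot^{(s)}` to
`Tot^{(s+1-1)}` contained in `jMap` is undone by the third component of this comparison. -/
lemma δ_totSES (s n n' : ℤ) (h : n' + 1 = n) :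
    jMap (bicomplex.obj C) s (s + 1) n n' (by lia) h ≫ homologyMap (gammaIso C s).hom n' =
      (totSES_shortExact C s).δ n n' (down_rel h) := by
  rw [jMap, Category.assoc]
  have := HomologySequence.δ_naturality (sesComparison C s).hom (ses_shortExact _ _)
    (totSES_shortExact C s) n n' (down_rel h)
  refine (congrArg (_ ≫ ·) this).trans ?_
  refine (Category.assoc _ _ _).symm.trans ?_
  refine (congrArg (· ≫ _) ((homologyMap_comp _ _ _).symm.trans
    (congrArg (homologyMap · n) ((proj_comp s (s + 1 - 1) s (by lia) (by lia)).trans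
      (totProj_refl _ _))))).trans ?_
  rw [homologyMap_id, Category.id_comp]

/-- The first exact couple of `holimSS`. -/
def holimCouple : HolimCouple holimSS.{u} where
  isoD s t n h := NatIso.ofComponents
    (fun C => hcast (tot (bicomplex.obj C) s) (show -s - t = n by lia))
    (fun f => (hcast_naturality (totMap (bicomplex.map f) s) _).symm)
  isoE s t n h := NatIso.ofComponents
    (fun C => hcast (ses (bicomplex.obj C) (s + 1)).X₁ (show -(s + 1) - t = n by lia) ≪≫
      (homologyF n).mapIso (gammaIso C s))
    (fun {C C'} f => by
      obtain rfl : n = -(s + 1) - t := by lia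
      change homologyMap (sesMap (bicomplex.map f) (s + 1)).τ₁ _ ≫ 𝟙 _ ≫
        homologyMap (gammaIso C' s).hom _ =
        (𝟙 _ ≫ homologyMap (gammaIso C s).hom _) ≫ homologyMap ((holimGamma s).map f) _
      rw [Category.id_comp, Category.id_comp]
      refine (homologyMap_comp _ _ _).symm.trans (Eq.trans ?_ (homologyMap_comp _ _ _))
      exact congrArg (homologyMap · _) (gammaIso_naturality f s))
  i_eq C s t n h h' := by
    have key : iMap (bicomplex.obj C) (s + 1) s (-(s + 1) - t) (-s - (t + 1)) (by lia) (by lia) ≫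
        (hcast (tot (bicomplex.obj C) s) (show -s - (t + 1) = n by lia)).hom =
        (hcast (tot (bicomplex.obj C) (s + 1 : ℤ)) (show -(s + 1) - t = n by lia)).hom ≫
          homologyMap (totProjSucc C s) n := by
      rw [hcast_naturality, iMap, Category.assoc]
      refine congrArg (_ ≫ ·) ?_
      exact hcast_trans _ _ _
    exact key
  k_eq C s t n h := by
    have key : kMap (bicomplex.obj C) (s + 1) (-(s + 1) - t) ≫
        (hcast (tot (bicomplex.obj C) (s + 1 : ℤ)) (show -(s + 1) - t = n by lia)).hom =
        ((hcast (ses (bicomplex.obj C) (s + 1)).X₁ (show -(s + 1) - t = n by lia)).hom ≫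
          homologyMap (gammaIso C s).hom n) ≫ homologyMap (totSES C s).f n := by
      rw [Category.assoc, ← homologyMap_comp, gammaIso_ι, kMap, hcast_naturality]
    exact key
  j_eq C s t n h h' := by
    obtain rfl : n = -s - t := by lia
    have key : jMap (bicomplex.obj C) s (s + 1) (-s - t) (-(s + 1) - t) (by lia) (by lia) ≫
        (hcast (ses (bicomplex.obj C) (s + 1)).X₁ (show -(s + 1) - t = -s - t - 1 by lia)).hom ≫
          homologyMap (gammaIso C s).hom _ =
        (totSES_shortExact C s).δ (-s - t) (-s - t - 1) (down_rel (by lia)) := by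
      rw [hcast_naturality, ← Category.assoc, δ_totSES, δ_hcast]
    exact key.trans (Category.id_comp _).symm

end InvSystem

end

noncomputable section

/-! ### Isomorphisms between spectral sequences with exact couples -/

namespace CoupledSS

section Elements

variable {r₀ : ℤ} (S : CoupledSS AB.{u} r₀) (r : ℤ) (hr : r₀ ≤ r)

lemma i_eq_zero_iff (p q : ℤ × ℤ) (h : p + (-1, 1) = q) (x : S.D r hr p) :
    S.i r hr p q h x = 0 ↔ ∃ e, S.k r hr p e = x := by
  have hS := (S.exact r hr p q _ h rfl).exact 0
  refine ⟨(ShortComplex.moduleCat_exact_iff _).1 hS x, ?_⟩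
  rintro ⟨e, rfl⟩
  exact (ComposableArrows.sc _ (S.exact r hr p q _ h rfl).toIsComplex 0).moduleCat_zero_apply e

lemma j_eq_zero_iff (p q p' : ℤ × ℤ) (h : p + (-1, 1) = q) (h' : q + (r, 1 - r) = p')
    (y : S.D r hr q) :
    S.j r hr q p' h' y = 0 ↔ ∃ x, S.i r hr p q h x = y := by
  have hS := (S.exact r hr p q _ h h').exact 1
  refine ⟨(ShortComplex.moduleCat_exact_iff _).1 hS y, ?_⟩
  rintro ⟨e, rfl⟩
  exact (ComposableArrows.sc _ (S.exact r hr p q _ h h').toIsComplex 1).moduleCat_zero_apply e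

lemma k_eq_zero_iff (q p' : ℤ × ℤ) (h' : q + (r, 1 - r) = p') (e : (S.ss.page r hr).X p') :
    S.k r hr p' e = 0 ↔ ∃ y, S.j r hr q p' h' y = e := by
  have h : q + (1, -1) + (-1, 1) = q := by ext <;> simp
  have hS := (S.exact r hr _ q _ h h').exact 2
  refine ⟨(ShortComplex.moduleCat_exact_iff _).1 hS e, ?_⟩
  rintro ⟨e, rfl⟩
  exact (ComposableArrows.sc _ (S.exact r hr _ q _ h h').toIsComplex 2).moduleCat_zero_apply e

lemma ι_injective (r' : ℤ) (hr' : r + 1 = r') (p : ℤ × ℤ) :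
    Function.Injective (S.ι r r' hr hr' p) :=
  (ModuleCat.mono_iff_injective _).1 (S.mono_ι r r' hr hr' p)

lemma π_surjective (r' : ℤ) (hr' : r + 1 = r') (p q : ℤ × ℤ) (h : p + (-1, 1) = q) :
    Function.Surjective (S.π r r' hr hr' p q h) :=
  (ModuleCat.epi_iff_surjective _).1 (S.epi_π r r' hr hr' p q h)

lemma π_ι_apply (r' : ℤ) (hr' : r + 1 = r') (p q : ℤ × ℤ) (h : p + (-1, 1) = q) (x : S.D r hr p) :
    S.ι r r' hr hr' q (S.π r r' hr hr' p q h x) = S.i r hr p q h x :=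
  congr($(S.π_ι r r' hr hr' p q h) x)

lemma i_ι_apply (r' : ℤ) (hr' : r + 1 = r') (p q : ℤ × ℤ) (h : p + (-1, 1) = q)
    (x : S.D r' (by lia) p) :
    S.ι r r' hr hr' q (S.i r' (by lia) p q h x) = S.i r hr p q h (S.ι r r' hr hr' p x) :=
  congr($(S.i_ι r r' hr hr' p q h) x)

lemma subsingleton_D (p : ℤ × ℤ) (hp : p.1 < 0) : Subsingleton (S.D r hr p) :=
  ModuleCat.subsingleton_of_isZero (S.isZero_D r hr p hp)

lemma subsingleton_E (p : ℤ × ℤ) (hp : p.1 < 0) : Subsingleton ((S.ss.page r hr).X p) :=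
  ModuleCat.subsingleton_of_isZero (S.isZero_E r hr p hp)

end Elements

section Comparison

variable {r₀ : ℤ} {S T : CoupledSS AB.{u} r₀} (f : S ⟶ T)

/-- Not part of the data of a morphism: it follows from the compatibility with `i` and `ι`, as `ι`
is a monomorphism. -/
lemma π_comm (r r' : ℤ) (hr : r₀ ≤ r) (hr' : r + 1 = r') (p q : ℤ × ℤ) (h : p + (-1, 1) = q) :
    S.π r r' hr hr' p q h ≫ Hom.D f r' (by lia) q = Hom.D f r hr p ≫ T.π r r' hr hr' p q h := by
  have := T.mono_ι r r' hr hr' q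
  rw [← cancel_mono (T.ι r r' hr hr' q), Category.assoc, ← Hom.ι_comm f, Category.assoc, T.π_ι,
    ← Hom.i_comm f, ← S.π_ι r r' hr hr' p q h, Category.assoc]

variable (r : ℤ) (hr : r₀ ≤ r)

lemma k_comm_apply (p : ℤ × ℤ) (e : (S.ss.page r hr).X p) :
    Hom.D f r hr p (S.k r hr p e) = T.k r hr p (((Hom.ss f).hom r hr).f p e) :=
  congr($(Hom.k_comm f r hr p) e)

lemma j_comm_apply (p q : ℤ × ℤ) (h : p + (r, 1 - r) = q) (x : S.D r hr p) :
    ((Hom.ss f).hom r hr).f q (S.j r hr p q h x) = T.j r hr p q h (Hom.D f r hr p x) :=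
  congr($(Hom.j_comm f r hr p q h) x)

lemma i_comm_apply (p q : ℤ × ℤ) (h : p + (-1, 1) = q) (x : S.D r hr p) :
    Hom.D f r hr q (S.i r hr p q h x) = T.i r hr p q h (Hom.D f r hr p x) :=
  congr($(Hom.i_comm f r hr p q h) x)

/-- The five lemma for the terms `D_r`. -/
lemma bijective_D_of_bijective_E (h1 : 1 ≤ r)
    (hE : ∀ p, Function.Bijective (((Hom.ss f).hom r hr).f p)) :
    ∀ p, Function.Bijective (Hom.D f r hr p) := by
  have hneg : ∀ p : ℤ × ℤ, p.1 < 0 → Function.Bijective (Hom.D f r hr p) := fun p hp => by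
    have := S.subsingleton_D r hr p hp
    have := T.subsingleton_D r hr p hp
    exact ⟨Function.injective_of_subsingleton _, fun y => ⟨0, Subsingleton.elim _ _⟩⟩
  -- Induction on the column. The other `D`-terms in the five-term exact sequence around `D^p` lie
  -- in the columns `p.1 - 1` and `p.1 - r`, which are smaller since `r ≥ 1`, and negative columns
  -- vanish.
  suffices H : ∀ (m : ℕ) (p : ℤ × ℤ), p.1 < m → Function.Bijective (Hom.D f r hr p) from
    fun p => H (p.1.toNat + 1) p (by lia)
  intro m
  induction m with
  | zero => exact fun p hp => hneg p hp
  | succ m IH =>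
    intro p hp
    obtain ⟨q, hq⟩ : ∃ q, p + (-1, 1) = q := ⟨_, rfl⟩
    obtain ⟨o, ho⟩ : ∃ o, o + (r, 1 - r) = p := ⟨p - (r, 1 - r), by simp⟩
    have hqm : q.1 < m := by subst hq; simp; lia
    have hom : o.1 < m := by
      have := congrArg Prod.fst ho
      simp only [Prod.fst_add] at this
      lia
    constructor
    · refine (injective_iff_map_eq_zero _).2 fun x hx => ?_
      -- Injectivity: `x` is some `k e`; the image of `e` is a value of `j`, and this lifts to the
      -- source because the column of `o` is already known.
      have h1 : S.i r hr p q hq x = 0 := (IH q hqm).1 (by rw [i_comm_apply, hx, map_zero, map_zero])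
      obtain ⟨e, rfl⟩ := (S.i_eq_zero_iff r hr p q hq x).1 h1
      rw [k_comm_apply] at hx
      obtain ⟨y, hy⟩ := (T.k_eq_zero_iff r hr o p ho _).1 hx
      obtain ⟨y, rfl⟩ := (IH o hom).2 y
      rw [← j_comm_apply] at hy
      exact (S.k_eq_zero_iff r hr o p ho _).2 ⟨y, (hE p).1 hy⟩
    · intro y
      -- Surjectivity: `i y` lifts to an element of the image of `i`, which corrects `y` up to some
      -- `k e`.
      obtain ⟨x, hx⟩ := (IH q hqm).2 (T.i r hr p q hq y)
      have h1 : S.j r hr q _ rfl x = 0 := (hE _).1 (by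
        rw [j_comm_apply, hx, map_zero]
        exact (T.j_eq_zero_iff r hr p q _ hq rfl _).2 ⟨y, rfl⟩)
      obtain ⟨x, rfl⟩ := (S.j_eq_zero_iff r hr p q _ hq rfl _).1 h1
      rw [i_comm_apply] at hx
      obtain ⟨e, he⟩ := (T.i_eq_zero_iff r hr p q hq (y - Hom.D f r hr p x)).1 (by
        rw [map_sub, hx, sub_self])
      obtain ⟨e, rfl⟩ := (hE p).2 e
      refine ⟨x + S.k r hr p e, ?_⟩
      rw [map_add, k_comm_apply, he]
      abel

/-- The next `D` is both a subobject of `D_r` by `ι` and a quotient of `D_r` by `π`. It inherits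
injectivity from the first description and surjectivity from the second. -/
lemma bijective_D_succ (r' : ℤ) (hr' : r + 1 = r')
    (hD : ∀ p, Function.Bijective (Hom.D f r hr p)) (q : ℤ × ℤ) :
    Function.Bijective (Hom.D f r' (by lia) q) := by
  obtain ⟨p, hp⟩ : ∃ p, p + (-1, 1) = q := ⟨q + (1, -1), by ext <;> simp⟩
  constructor
  · refine Function.Injective.of_comp (f := T.ι r r' hr hr' q) ?_
    have h : (T.ι r r' hr hr' q) ∘ (Hom.D f r' (by lia) q) =
        (Hom.D f r hr q) ∘ (S.ι r r' hr hr' q) := funext fun x =>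
      (congr($(Hom.ι_comm f r r' hr hr' q) x)).symm
    rw [h]
    exact (hD q).1.comp (S.ι_injective r hr r' hr' q)
  · refine Function.Surjective.of_comp (g := S.π r r' hr hr' p q hp) ?_
    have h : (Hom.D f r' (by lia) q) ∘ (S.π r r' hr hr' p q hp) =
        (T.π r r' hr hr' p q hp) ∘ (Hom.D f r hr p) := funext fun x =>
      congr($(π_comm f r r' hr hr' p q hp) x)
    rw [h]
    exact (T.π_surjective r hr r' hr' p q hp).comp (hD p).2

lemma isIso_page_succ (r' : ℤ) (hr' : r + 1 = r') (hE : IsIso ((Hom.ss f).hom r hr)) :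
    IsIso ((Hom.ss f).hom r' (by lia)) := by
  have : ∀ p, IsIso (((Hom.ss f).hom r' (by lia)).f p) := fun p => by
    have h := (Hom.ss f).comm r r' p hr' hr
    have : ((Hom.ss f).hom r' (by lia)).f p = (S.ss.iso r r' p).inv ≫
        HomologicalComplex.homologyMap ((Hom.ss f).hom r hr) p ≫ (T.ss.iso r r' p).hom := by
      rw [h, Iso.inv_hom_id_assoc]
    rw [this]
    infer_instance
  exact HomologicalComplex.Hom.isIso_of_components _

/-- The five lemma is needed only for the first couple. Later pages are homology groups of earlier
ones, and later `D` are images of `i`. -/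
lemma bijective_of_isIso_E (h1 : 1 ≤ r₀)
    (hE : ∀ p, IsIso (((Hom.ss f).hom r₀ le_rfl).f p)) (r : ℤ) (hr : r₀ ≤ r) :
    IsIso ((Hom.ss f).hom r hr) ∧ ∀ p, Function.Bijective (Hom.D f r hr p) := by
  induction r, hr using Int.leInduction with
  | base =>
    exact ⟨HomologicalComplex.Hom.isIso_of_components _, bijective_D_of_bijective_E f _ _ h1
      fun p => ConcreteCategory.bijective_of_isIso _⟩
  | succ r hr ih => exact ⟨isIso_page_succ f r hr _ rfl ih.1, bijective_D_succ f r hr _ rfl ih.2⟩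

lemma isIso_of_isIso_components (hE : ∀ r hr, IsIso ((Hom.ss f).hom r hr))
    (hD : ∀ r hr p, IsIso (Hom.D f r hr p)) : IsIso f := by
  let gss : T.ss ⟶ S.ss :=
    { hom r hr := inv ((Hom.ss f).hom r hr)
      comm r r' p hrr' hr := by
        have h := (Hom.ss f).comm r r' p hrr' hr
        rw [← cancel_epi (HomologicalComplex.homologyMap ((Hom.ss f).hom r hr) p),
          ← HomologicalComplex.homologyMap_comp_assoc, IsIso.hom_inv_id,
          HomologicalComplex.homologyMap_id, Category.id_comp, reassoc_of% h,
          ← HomologicalComplex.comp_f, IsIso.hom_inv_id]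
        exact (Category.comp_id _).symm }
  have hEf : ∀ r hr p, IsIso (((Hom.ss f).hom r hr).f p) := fun r hr p => inferInstance
  have hg : ∀ r hr p, (gss.hom r hr).f p = inv (((Hom.ss f).hom r hr).f p) := fun r hr p => by
    rw [← cancel_epi (((Hom.ss f).hom r hr).f p), IsIso.hom_inv_id, ← HomologicalComplex.comp_f,
      IsIso.hom_inv_id]
    rfl
  let g : T ⟶ S := Hom.mk gss (fun r hr p => inv (Hom.D f r hr p))
    (fun r hr p q h => by rw [IsIso.eq_inv_comp, ← Category.assoc, ← Hom.i_comm f, Category.assoc,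
      IsIso.hom_inv_id, Category.comp_id])
    (fun r hr p q h => by rw [hg, IsIso.eq_inv_comp, ← Category.assoc, ← Hom.j_comm f,
      Category.assoc, IsIso.hom_inv_id, Category.comp_id])
    (fun r hr p => by rw [hg, IsIso.eq_inv_comp, ← Category.assoc, ← Hom.k_comm f,
      Category.assoc, IsIso.hom_inv_id, Category.comp_id])
    (fun r r' hr hr' p => by rw [IsIso.eq_inv_comp, ← Category.assoc, ← Hom.ι_comm f,
      Category.assoc, IsIso.hom_inv_id, Category.comp_id])
  refine ⟨g, Hom.ext (SpectralSequence.hom_ext fun r hr => ?_) ?_,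
    Hom.ext (SpectralSequence.hom_ext fun r hr => ?_) ?_⟩
  · exact IsIso.hom_inv_id ((Hom.ss f).hom r hr)
  · funext r hr p
    exact IsIso.hom_inv_id (Hom.D f r hr p)
  · exact IsIso.inv_hom_id ((Hom.ss f).hom r hr)
  · funext r hr p
    exact IsIso.inv_hom_id (Hom.D f r hr p)

/-- A morphism inducing isomorphisms between the first pages is an isomorphism. -/
lemma isIso_of_isIso_E (h1 : 1 ≤ r₀) (hE : ∀ p, IsIso ((eFunctor AB.{u} r₀ le_rfl p).map f)) :
    IsIso f :=
  isIso_of_isIso_components f (fun r hr => (bijective_of_isIso_E f h1 hE r hr).1)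
    fun r hr p => (ConcreteCategory.isIso_iff_bijective _).2 ((bijective_of_isIso_E f h1 hE r hr).2 p)

end Comparison

end CoupledSS

end

noncomputable section

/-! ### Products of abelian groups and of complexes, elementwise -/

namespace AB

/-- The free module of rank one. -/
abbrev unitModule (R : Type) [Ring R] : ModuleCat.{u} R := ModuleCat.of R (ULift.{u} R)

/-- The generator of the free module of rank one. -/
def unitGen (R : Type) [Ring R] : unitModule.{u} R := ⟨1⟩

lemma unitModule_hom_ext {R : Type} [Ring R] {A : ModuleCat.{u} R} {f g : unitModule R ⟶ A}
    (h : f (unitGen R) = g (unitGen R)) : f = g := by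
  ext z
  have hz : z = z.down • unitGen R := ULift.ext _ _ (mul_one z.down).symm
  rw [hz]
  exact (f.hom.map_smul _ _).trans ((congrArg (z.down • ·) h).trans (g.hom.map_smul _ _).symm)

/-- The morphism from the free module of rank one to `A` sending the generator to `a`. -/
def ofElement {R : Type} [Ring R] {A : ModuleCat.{u} R} (a : A) : unitModule R ⟶ A :=
  ModuleCat.ofHom ((LinearMap.toSpanSingleton R A a).comp ULift.moduleEquiv.toLinearMap)

lemma ofElement_gen {R : Type} [Ring R] {A : ModuleCat.{u} R} (a : A) :
    ofElement a (unitGen R) = a := one_smul R a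

/-- Elements are morphisms from the free module of rank one, so the universal property of the
product gives unique coordinates. No bound on the size of `J` is needed. -/
lemma fan_bijective {J : Type*} {F : J → AB.{u}} (c : Fan F) (hc : IsLimit c) :
    Function.Bijective (fun (x : c.pt) (j : J) => c.proj j x) := by
  constructor
  · intro x y hxy
    have h : ofElement x = ofElement y := Fan.IsLimit.hom_ext hc _ _ fun j =>
      unitModule_hom_ext (by
        change c.proj j (ofElement x (unitGen ℤ)) = c.proj j (ofElement y (unitGen ℤ))
        rw [ofElement_gen, ofElement_gen]
        exact congrFun hxy j)
    rw [← ofElement_gen x, h, ofElement_gen]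
  · intro y
    refine ⟨Fan.IsLimit.lift hc (fun j => ofElement (y j)) (unitGen ℤ), funext fun j => ?_⟩
    refine Eq.trans ?_ (ofElement_gen (y j))
    exact congr($(Fan.IsLimit.fac hc (fun j => ofElement (y j)) j) (unitGen ℤ))

section Pi

variable {J : Type*} (F : J → AB.{u}) [HasProduct F]

lemma pi_bijective : Function.Bijective (fun (x : (∏ᶜ F : AB.{u})) (j : J) => Pi.π F j x) :=
  fan_bijective (Fan.mk _ (Pi.π F)) (productIsProduct F)

variable {F}

lemma pi_ext {x y : (∏ᶜ F : AB.{u})} (h : ∀ j, Pi.π F j x = Pi.π F j y) : x = y :=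
  (pi_bijective F).1 (funext h)

/-- The element of the product with given coordinates. -/
def mkPi (y : ∀ j, F j) : (∏ᶜ F : AB.{u}) := ((pi_bijective F).2 y).choose

@[simp] lemma π_mkPi (y : ∀ j, F j) (j : J) : Pi.π F j (mkPi y) = y j :=
  congrFun ((pi_bijective F).2 y).choose_spec j

end Pi

end AB

namespace HomologicalComplex

variable {ι : Type*} {c : ComplexShape ι} {J : Type*} [HasProductsOfShape J AB.{u}]
  (F : J → HomologicalComplex AB.{u} c)

lemma pi_f_bijective (n : ι) :
    Function.Bijective (fun (x : (∏ᶜ F : HomologicalComplex AB.{u} c).X n) (j : J) =>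
      (Pi.π F j).f n x) :=
  AB.fan_bijective (Fan.mk _ fun j => (Pi.π F j).f n)
    (isLimitOfHasProductOfPreservesLimit (eval AB.{u} c n) F)

variable {F}

lemma pi_ext {n : ι} {x y : (∏ᶜ F : HomologicalComplex AB.{u} c).X n}
    (h : ∀ j, (Pi.π F j).f n x = (Pi.π F j).f n y) : x = y :=
  (pi_f_bijective F n).1 (funext h)

/-- The element of the product with given coordinates. -/
def mkPi {n : ι} (y : ∀ j, (F j).X n) : (∏ᶜ F : HomologicalComplex AB.{u} c).X n :=
  ((pi_f_bijective F n).2 y).choose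

@[simp] lemma π_mkPi {n : ι} (y : ∀ j, (F j).X n) (j : J) : (Pi.π F j).f n (mkPi y) = y j :=
  congrFun ((pi_f_bijective F n).2 y).choose_spec j

lemma comm_apply {K L : HomologicalComplex AB.{u} c} (f : K ⟶ L) (p q : ι) (x : K.X p) :
    f.f q (K.d p q x) = L.d p q (f.f p x) :=
  congr($((f.comm p q).symm) x)

variable (F)

/-- Products of abelian groups are exact: cycles and bounding elements are chosen in each
coordinate. -/
lemma homology_pi_bijective (n : ι) :
    Function.Bijective (fun (x : (∏ᶜ F : HomologicalComplex AB.{u} c).homology n) (j : J) =>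
      homologyMap (Pi.π F j) n x) := by
  constructor
  · intro a b hab
    obtain ⟨x, hx, rfl⟩ := exists_cls a
    obtain ⟨y, hy, rfl⟩ := exists_cls b
    have h : ∀ j, ∃ z, (F j).d (c.prev n) n z = (Pi.π F j).f n x - (Pi.π F j).f n y := fun j => by
      have := congrFun hab j
      dsimp only at this
      rw [homologyMap_cls, homologyMap_cls] at this
      obtain ⟨z, hz⟩ := (cls_eq_iff rfl).1 this
      exact ⟨z, hz⟩
    choose z hz using h
    refine (cls_eq_iff rfl).2 ⟨mkPi z, pi_ext fun j => ?_⟩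
    rw [comm_apply, π_mkPi, hz, map_sub]
  · intro y
    choose x hx hy using fun j => exists_cls (y j)
    refine ⟨cls (mkPi x) fun q => pi_ext fun j => ?_, funext fun j => ?_⟩
    · rw [comm_apply, π_mkPi, hx, map_zero]
    · rw [hy j]
      refine (homologyMap_cls _ _).trans ?_
      exact cls_congr (π_mkPi x j) _

/-- Homology commutes with products of complexes of abelian groups. -/
def homologyPiIso (n : ι) :
    (∏ᶜ F : HomologicalComplex AB.{u} c).homology n ≅ ∏ᶜ fun j => (F j).homology n :=
  have : IsIso (Pi.lift fun j => homologyMap (Pi.π F j) n) := by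
    rw [ConcreteCategory.isIso_iff_bijective]
    refine (Function.Bijective.of_comp_iff' (AB.pi_bijective fun j => (F j).homology n) _).1 ?_
    convert homology_pi_bijective F n using 1
    funext x j
    exact congr($(Pi.lift_π (fun j => homologyMap (Pi.π F j) n) j) x)
  asIso (Pi.lift fun j => homologyMap (Pi.π F j) n)

lemma homologyPiIso_hom_π (n : ι) (j : J) :
    (homologyPiIso F n).hom ≫ Pi.π _ j = homologyMap (Pi.π F j) n :=
  Pi.lift_π _ _

end HomologicalComplex

/-! ### The exact sequence of Milnor -/

/-- A group `H` with maps to a tower `Y`, sitting in an exact sequence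
`0 ⟶ lim¹ X ⟶ H ⟶ lim Y ⟶ 0`. -/
structure IsMilnor {X Y : ℕ → AB.{u}} (p : ∀ s, X (s + 1) ⟶ X s) (q : ∀ s, Y (s + 1) ⟶ Y s)
    {H : AB.{u}} (ρ : ∀ s, H ⟶ Y s) (α : ∏ᶜ X ⟶ H) : Prop where
  ρ_q (s : ℕ) : ρ (s + 1) ≫ q s = ρ s
  α_eq_zero_iff (x : (∏ᶜ X : AB.{u})) :
    α x = 0 ↔ ∃ z : ∀ s, X s, ∀ s, Pi.π X s x = z s - p s (z (s + 1))
  ρ_eq_zero_iff (h : H) : (∀ s, ρ s h = 0) ↔ ∃ x, α x = h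
  exists_lift (y : ∀ s, Y s) (hy : ∀ s, q s (y (s + 1)) = y s) : ∃ h, ∀ s, ρ s h = y s

namespace IsMilnor

variable {X Y : ℕ → AB.{u}} {p : ∀ s, X (s + 1) ⟶ X s} {q : ∀ s, Y (s + 1) ⟶ Y s}
  {H : AB.{u}} {ρ : ∀ s, H ⟶ Y s} {α : ∏ᶜ X ⟶ H}

lemma of_iso (h : IsMilnor p q ρ α) {X' Y' : ℕ → AB.{u}} {p' : ∀ s, X' (s + 1) ⟶ X' s}
    {q' : ∀ s, Y' (s + 1) ⟶ Y' s} (a : ∀ s, X' s ≅ X s) (b : ∀ s, Y s ≅ Y' s)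
    (ha : ∀ s, p' s ≫ (a s).hom = (a (s + 1)).hom ≫ p s)
    (hb : ∀ s, q s ≫ (b s).hom = (b (s + 1)).hom ≫ q' s) :
    IsMilnor p' q' (fun s => ρ s ≫ (b s).hom) (Limits.Pi.map (fun s => (a s).hom) ≫ α) where
  ρ_q s := by rw [Category.assoc, ← hb, ← Category.assoc, h.ρ_q]
  α_eq_zero_iff x := by
    have hπ : ∀ s, Pi.π X s (Limits.Pi.map (fun s => (a s).hom) x) = (a s).hom (Pi.π X' s x) :=
      fun s => congr($(Limits.Pi.map_π (fun s => (a s).hom) s) x)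
    have ha' : ∀ s y, (a s).hom (p' s y) = p s ((a (s + 1)).hom y) := fun s y => congr($(ha s) y)
    refine (h.α_eq_zero_iff (Limits.Pi.map (fun s => (a s).hom) x)).trans ⟨fun ⟨z, hz⟩ => ⟨fun s => (a s).inv (z s), fun s => ?_⟩,
      fun ⟨z, hz⟩ => ⟨fun s => (a s).hom (z s), fun s => ?_⟩⟩
    · have h1 := hz s
      rw [hπ] at h1
      have h2 : (a s).inv ((a s).hom (Pi.π X' s x)) = Pi.π X' s x := Iso.hom_inv_id_apply _ _
      have h3 : ∀ s y, (a s).hom ((a s).inv y) = y := fun s y => Iso.inv_hom_id_apply _ _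
      rw [← h2, h1, map_sub]
      congr 1
      rw [← h3 (s + 1) (z (s + 1)), ← ha']
      exact Iso.hom_inv_id_apply (a s) _
    · rw [hπ, hz, map_sub, ha']
  ρ_eq_zero_iff x := by
    have h1 : (∀ s, (ρ s ≫ (b s).hom) x = 0) ↔ ∀ s, ρ s x = 0 := forall_congr' fun s =>
      ⟨fun h0 => (ConcreteCategory.bijective_of_isIso (b s).hom).1 (h0.trans (map_zero _).symm),
        fun h0 => (congrArg (b s).hom h0).trans (map_zero _)⟩
    rw [h1, h.ρ_eq_zero_iff]
    refine ⟨fun ⟨y, hy⟩ => ?_, fun ⟨y, hy⟩ => ⟨_, hy⟩⟩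
    refine ⟨Limits.Pi.map (fun s => (a s).inv) y, ?_⟩
    rw [← hy]
    have : Limits.Pi.map (fun s => (a s).inv) ≫ Limits.Pi.map (fun s => (a s).hom) = 𝟙 _ := by
      ext s : 1
      simp
    exact congrArg α congr($this y)
  exists_lift y hy := by
    have h3 : ∀ s (y : Y' s), (b s).hom ((b s).inv y) = y := fun s y => Iso.inv_hom_id_apply _ _
    obtain ⟨x, hx⟩ := h.exists_lift (fun s => (b s).inv (y s)) fun s =>
      (ConcreteCategory.bijective_of_isIso (b s).hom).1 (by
        refine (congr($(hb s) ((b (s + 1)).inv (y (s + 1)))) : _).trans ?_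
        refine (congrArg (q' s) (h3 _ _)).trans ?_
        rw [hy, h3])
    exact ⟨x, fun s => (congrArg (b s).hom (hx s)).trans (h3 _ _)⟩

/-- A morphism of Milnor sequences that is bijective on the towers is bijective. -/
lemma bijective (h : IsMilnor p q ρ α) {X' Y' : ℕ → AB.{u}} {p' : ∀ s, X' (s + 1) ⟶ X' s}
    {q' : ∀ s, Y' (s + 1) ⟶ Y' s} {H' : AB.{u}} {ρ' : ∀ s, H' ⟶ Y' s} {α' : ∏ᶜ X' ⟶ H'}
    (h' : IsMilnor p' q' ρ' α') (a : ∀ s, X s ⟶ X' s) (b : ∀ s, Y s ⟶ Y' s) (f : H ⟶ H')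
    (ha : ∀ s, p s ≫ a s = a (s + 1) ≫ p' s) (hb : ∀ s, q s ≫ b s = b (s + 1) ≫ q' s)
    (hα : α ≫ f = Limits.Pi.map a ≫ α') (hρ : ∀ s, ρ s ≫ b s = f ≫ ρ' s)
    (ha' : ∀ s, Function.Bijective (a s)) (hb' : ∀ s, Function.Bijective (b s)) :
    Function.Bijective f := by
  have hα' : ∀ x, f (α x) = α' (Limits.Pi.map a x) := fun x => congr($hα x)
  have hρ' : ∀ s x, b s (ρ s x) = ρ' s (f x) := fun s x => congr($(hρ s) x)
  have ha1 : ∀ s x, a s (p s x) = p' s (a (s + 1) x) := fun s x => congr($(ha s) x)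
  have hb1 : ∀ s x, b s (q s x) = q' s (b (s + 1) x) := fun s x => congr($(hb s) x)
  have hπ : ∀ s x, Pi.π X' s (Limits.Pi.map a x) = a s (Pi.π X s x) :=
    fun s x => congr($(Limits.Pi.map_π a s) x)
  constructor
  · refine (injective_iff_map_eq_zero _).2 fun x hx => ?_
    -- An element of the kernel comes from the `lim¹` part, where a primitive of its image is
    -- carried back along the bijections `a s`.
    obtain ⟨y, rfl⟩ := (h.ρ_eq_zero_iff x).1 fun s => (hb' s).1 (by
      rw [hρ', hx, map_zero, map_zero])
    rw [hα'] at hx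
    obtain ⟨z, hz⟩ := (h'.α_eq_zero_iff _).1 hx
    choose w hw using fun s => (ha' s).2 (z s)
    refine (h.α_eq_zero_iff y).2 ⟨w, fun s => (ha' s).1 ?_⟩
    rw [← hπ, hz, map_sub, ha1, hw, hw]
  · intro y
    -- First the image of `y` in the limit is lifted; the remaining error lies in the `lim¹` part
    -- and is lifted afterwards.
    choose w hw using fun s => (hb' s).2 (ρ' s y)
    obtain ⟨x, hx⟩ := h.exists_lift w fun s => (hb' s).1 (by
      rw [hb1, hw, hw]
      exact congr($(h'.ρ_q s) y))
    obtain ⟨z, hz⟩ := (h'.ρ_eq_zero_iff (y - f x)).1 fun s => by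
      rw [map_sub, ← hρ', hx, hw, sub_self]
    choose v hv using fun s => (ha' s).2 (Pi.π X' s z)
    refine ⟨x + α (AB.mkPi v), ?_⟩
    have : Limits.Pi.map a (AB.mkPi v) = z := AB.pi_ext fun s => by rw [hπ, AB.π_mkPi, hv]
    rw [map_add, hα', this, hz]
    abel

end IsMilnor

end

noncomputable section

/-! ### The Milnor sequence of a total complex -/

namespace TotCouple

open HomologicalComplex

section Elements

variable {K : CochainComplex CHAIN.{u} ℕ} {p : WithTop ℤ} {n : ℤ}

lemma totX_bijective : Function.Bijective (fun (x : totX K p n) (a : TotIndex p n) => totπ K a x) :=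
  AB.pi_bijective fun a : TotIndex p n => (K.X a.s).X a.m

lemma totX_ext {x y : totX K p n} (h : ∀ a, totπ K a x = totπ K a y) : x = y :=
  totX_bijective.1 (funext h)

/-- The element of the total complex with given coordinates. -/
def mkTot (y : ∀ a : TotIndex p n, (K.X a.s).X a.m) : totX K p n := (totX_bijective.2 y).choose

lemma totπ_mkTot (y : ∀ a : TotIndex p n, (K.X a.s).X a.m) (a : TotIndex p n) :
    totπ K a (mkTot y) = y a :=
  congrFun (totX_bijective.2 y).choose_spec a

lemma totProjX_π_apply {q : WithTop ℤ} (h : q ≤ p) (x : totX K p n) (a : TotIndex q n) :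
    totπ K a (totProjX K h n x) = totπ K ⟨a.s, a.m, a.hs.trans h, a.hm⟩ x :=
  congr($(totProjX_π h a) x)

lemma totProjX_surjective {q : WithTop ℤ} (h : q ≤ p) : Function.Surjective (totProjX K h n) := by
  classical
  intro y
  refine ⟨mkTot fun a => if ha : ((a.s : ℤ) : WithTop ℤ) ≤ q then totπ K ⟨a.s, a.m, ha, a.hm⟩ y
    else 0, totX_ext fun a => ?_⟩
  rw [totProjX_π_apply, totπ_mkTot]
  exact dif_pos a.hs

end Elements

variable (K : CochainComplex CHAIN.{u} ℕ)

/-- The complexes `Tot^{(s)}`, `s ∈ ℕ`. -/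
abbrev totNat (s : ℕ) : CHAIN.{u} := tot K ((s : ℤ) : WithTop ℤ)

lemma natCast_le (s : ℕ) : ((s : ℤ) : WithTop ℤ) ≤ ((s + 1 : ℕ) : ℤ) := by
  exact_mod_cast Nat.le_succ s

/-- The projection `Tot^{(s+1)} ⟶ Tot^{(s)}`. -/
abbrev natProj (s : ℕ) : totNat K (s + 1) ⟶ totNat K s := (totProj (natCast_le s)).app K

/-- The projection `Tot ⟶ Tot^{(s)}`. -/
abbrev topProj (s : WithTop ℤ) : tot K ⊤ ⟶ tot K s := (totProj le_top).app K

lemma topProj_natProj (s : ℕ) : topProj K ((s + 1 : ℕ) : ℤ) ≫ natProj K s = topProj K (s : ℤ) :=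
  totProj_comp _ _ _

/-- The morphism `∏ Tot^{(s)} ⟶ ∏ Tot^{(s)}`, `(x_s) ↦ (x_s - f_s (x_{s+1}))`. -/
abbrev milnorMap : ∏ᶜ totNat K ⟶ ∏ᶜ totNat K :=
  Pi.lift fun s => Pi.π (totNat K) s - Pi.π (totNat K) (s + 1) ≫ natProj K s

/-- The coordinates of the elements of `∏ Tot^{(s)}`. -/
def piCoord (n : ℤ) (s : ℕ) : (∏ᶜ totNat K : CHAIN.{u}).X n ⟶ totX K ((s : ℤ) : WithTop ℤ) n :=
  (Pi.π (totNat K) s).f n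

variable {K} in
lemma piCoord_ext {n : ℤ} {x y : (∏ᶜ totNat K : CHAIN.{u}).X n}
    (h : ∀ s, piCoord K n s x = piCoord K n s y) : x = y :=
  pi_ext h

lemma exists_piCoord {n : ℤ} (y : ∀ s : ℕ, totX K ((s : ℤ) : WithTop ℤ) n) :
    ∃ x, ∀ s, piCoord K n s x = y s :=
  ⟨mkPi (F := totNat K) y, π_mkPi (F := totNat K) y⟩

lemma milnorMap_π_apply (n : ℤ) (x : (∏ᶜ totNat K : CHAIN.{u}).X n) (s : ℕ) :
    piCoord K n s ((milnorMap K).f n x) =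
      piCoord K n s x - totProjX K (natCast_le s) n (piCoord K n (s + 1) x) :=
  congr($(congrArg (fun f => Hom.f f n) (Pi.lift_π (fun s => Pi.π (totNat K) s -
    Pi.π (totNat K) (s + 1) ≫ natProj K s) s)) x)

lemma lift_topProj_π_apply (n : ℤ) (x : totX K ⊤ n) (s : ℕ) :
    piCoord K n s ((Pi.lift fun s : ℕ => topProj K (s : ℤ)).f n x) = totProjX K le_top n x :=
  congr($(congrArg (fun f => Hom.f f n) (Pi.lift_π (fun s : ℕ => topProj K (s : ℤ)) s)) x)

/-- A compatible family comes from an element of `Tot` whose coordinate in column `a` is read off in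
`Tot^{(a)}`; iterated compatibility (`key`) shows that any later stage gives the same value. -/
lemma exists_of_milnorMap_eq_zero (n : ℤ) (y : (∏ᶜ totNat K : CHAIN.{u}).X n)
    (hy : (milnorMap K).f n y = 0) :
    ∃ x : totX K ⊤ n, (Pi.lift fun s : ℕ => topProj K (s : ℤ)).f n x = y := by
  have hy' : ∀ s, piCoord K n s y = totProjX K (natCast_le s) n (piCoord K n (s + 1) y) :=
    fun s => by rw [← sub_eq_zero, ← milnorMap_π_apply, hy, map_zero]
  have key : ∀ (k s t : ℕ) (hs : s + k = t) (h : ((s : ℤ) : WithTop ℤ) ≤ (t : ℤ)),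
      piCoord K n s y = totProjX K h n (piCoord K n t y) := by
    intro k
    induction k with
    | zero =>
      rintro s _ rfl h
      exact totX_ext fun a => (totProjX_π_apply h _ a).symm
    | succ k ih =>
      rintro s _ rfl h
      rw [ih s _ rfl (by exact_mod_cast Nat.le_add_right s k), hy' (s + k)]
      refine totX_ext fun a => ?_
      rw [totProjX_π_apply, totProjX_π_apply]
      exact (totProjX_π_apply h (piCoord K n (s + (k + 1)) y) a).symm
  refine ⟨mkTot fun a => totπ K ⟨a.s, a.m, le_rfl, a.hm⟩ (piCoord K n a.s y),
    piCoord_ext fun s => ?_⟩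
  refine (lift_topProj_π_apply K n _ s).trans (totX_ext fun a => ?_)
  rw [totProjX_π_apply, totπ_mkTot]
  have ha : a.s ≤ s := by exact_mod_cast a.hs
  rw [key (s - a.s) a.s s (by lia) (by exact_mod_cast ha)]
  exact totProjX_π_apply _ _ _

lemma lift_topProj_injective (n : ℤ) :
    Function.Injective ((Pi.lift fun s : ℕ => topProj K (s : ℤ)).f n) := by
  refine (injective_iff_map_eq_zero _).2 fun (x : totX K ⊤ n) hx => totX_ext fun a => ?_
  have h1 := lift_topProj_π_apply K n x a.s
  rw [hx, map_zero] at h1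
  have h3 := totProjX_π_apply (q := ((a.s : ℤ) : WithTop ℤ)) le_top x ⟨a.s, a.m, le_rfl, a.hm⟩
  rw [← h1, map_zero] at h3
  exact h3.symm.trans (map_zero _).symm

/-- The tower consists of surjections in each degree, so it has no `lim¹` at the level of chains: a
preimage of `z` is built recursively, starting from `0`, by lifting `w s - z_s` to the next stage.
-/
lemma milnorMap_surjective (n : ℤ) : Function.Surjective ((milnorMap K).f n) := by
  intro z
  let w : ∀ s : ℕ, totX K ((s : ℤ) : WithTop ℤ) n := fun s =>
    Nat.rec (motive := fun s => totX K ((s : ℤ) : WithTop ℤ) n) 0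
    (fun s y => (totProjX_surjective (K := K) (n := n) (natCast_le s)
      (y - piCoord K n s z)).choose) s
  have hw : ∀ s, totProjX K (natCast_le s) n (w (s + 1)) = w s - piCoord K n s z :=
    fun s => (totProjX_surjective (K := K) (n := n) (natCast_le s) (w s - piCoord K n s z)).choose_spec
  obtain ⟨x, hx⟩ := exists_piCoord K w
  refine ⟨x, piCoord_ext fun s => ?_⟩
  rw [milnorMap_π_apply, hx, hx, hw, sub_sub_cancel]

/-- The short exact sequence `0 ⟶ Tot ⟶ ∏ Tot^{(s)} ⟶ ∏ Tot^{(s)} ⟶ 0`. -/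
abbrev milnorSES : ShortComplex CHAIN.{u} :=
  ShortComplex.mk (Pi.lift fun s : ℕ => topProj K (s : ℤ)) (milnorMap K) (by
    refine Pi.hom_ext _ _ fun s => ?_
    rw [Category.assoc, Pi.lift_π, Preadditive.comp_sub, Pi.lift_π, ← Category.assoc, Pi.lift_π,
      topProj_natProj, sub_self, zero_comp])

lemma milnorSES_shortExact : (milnorSES K).ShortExact := by
  refine shortExact_of_degreewise_shortExact _ fun n => ShortComplex.ShortExact.mk' ?_ ?_ ?_
  · exact (ShortComplex.moduleCat_exact_iff _).2 (exists_of_milnorMap_eq_zero K n)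
  · exact (ModuleCat.mono_iff_injective _).2 (lift_topProj_injective K n)
  · exact (ModuleCat.epi_iff_surjective _).2 (milnorMap_surjective K n)

variable (n n' : ℤ) (hn : n + 1 = n')

/-- The map `∏ H_{n+1}(Tot^{(s)}) ⟶ H_n(Tot)`. -/
def milnorα : (∏ᶜ fun s => (totNat K s).homology n') ⟶ (tot K ⊤).homology n :=
  (homologyPiIso (totNat K) n').inv ≫ (milnorSES_shortExact K).δ n' n (down_rel hn)

lemma homologyPiIso_milnorMap (x : (∏ᶜ totNat K : CHAIN.{u}).homology n) (s : ℕ) :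
    Pi.π (fun s => (totNat K s).homology n) s
      ((homologyPiIso (totNat K) n).hom (homologyMap (milnorMap K) n x)) =
    Pi.π (fun s => (totNat K s).homology n) s ((homologyPiIso (totNat K) n).hom x) -
      homologyMap (natProj K s) n (Pi.π (fun s => (totNat K s).homology n) (s + 1)
        ((homologyPiIso (totNat K) n).hom x)) := by
  have h : homologyMap (milnorMap K) n ≫ homologyMap (Pi.π (totNat K) s) n =
      homologyMap (Pi.π (totNat K) s) n -
        homologyMap (Pi.π (totNat K) (s + 1)) n ≫ homologyMap (natProj K s) n := by
    rw [← homologyMap_comp, Pi.lift_π, homologyMap_sub, homologyMap_comp]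
  have hπ : ∀ s x, Pi.π (fun s => (totNat K s).homology n) s ((homologyPiIso (totNat K) n).hom x) =
    homologyMap (Pi.π (totNat K) s) n x := fun s x => congr($(homologyPiIso_hom_π (totNat K) n s) x)
  rw [hπ, hπ, hπ]
  exact congr($h x)

/-- This is the long exact homology sequence of `milnorSES`, in which the homology of the products
is replaced by the product of the homology groups. The difference map then has `lim` as kernel and
`lim¹` as cokernel. -/
lemma isMilnor_tot : IsMilnor (fun s => homologyMap (natProj K s) n')
    (fun s => homologyMap (natProj K s) n) (fun s : ℕ => homologyMap (topProj K (s : ℤ)) n)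
    (milnorα K n n' hn) where
  ρ_q s := by rw [← homologyMap_comp, topProj_natProj]
  α_eq_zero_iff x := by
    let e := homologyPiIso (totNat K) n'
    have he : ∀ x, e.hom (e.inv x) = x := fun x => Iso.inv_hom_id_apply e x
    have hei : ∀ x, e.inv (e.hom x) = x := fun x => Iso.hom_inv_id_apply e x
    have h3 : (milnorSES_shortExact K).δ n' n (down_rel hn) (e.inv x) = 0 ↔
        ∃ z, homologyMap (milnorMap K) n' z = e.inv x := by
      refine ⟨(ShortComplex.moduleCat_exact_iff _).1
        ((milnorSES_shortExact K).homology_exact₃ n' n (down_rel hn)) _, ?_⟩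
      rintro ⟨z, hz⟩
      rw [← hz]
      exact congr($((milnorSES_shortExact K).comp_δ n' n (down_rel hn)) z)
    refine h3.trans ⟨fun ⟨z, hz⟩ => ⟨fun s => Pi.π (fun s => (totNat K s).homology n') s (e.hom z), fun s => ?_⟩, fun ⟨z, hz⟩ => ?_⟩
    · rw [← homologyPiIso_milnorMap, hz]
      exact congrArg _ (he x).symm
    · refine ⟨e.inv (AB.mkPi z), (ConcreteCategory.bijective_of_isIso e.hom).1 ?_⟩
      rw [he]
      refine AB.pi_ext fun s => ?_
      refine (homologyPiIso_milnorMap K n' _ s).trans ?_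
      have h4 : (homologyPiIso (totNat K) n').hom (e.inv (AB.mkPi z)) = AB.mkPi z := he _
      rw [h4, AB.π_mkPi, AB.π_mkPi, hz]
  ρ_eq_zero_iff h := by
    let e := homologyPiIso (totNat K) n'
    have hei : ∀ x, e.inv (e.hom x) = x := fun x => Iso.hom_inv_id_apply e x
    have h1 : (∀ s : ℕ, homologyMap (topProj K (s : ℤ)) n h = 0) ↔
        homologyMap (milnorSES K).f n h = 0 := by
      have h2 : ∀ s : ℕ, homologyMap (Pi.π (totNat K) s) n (homologyMap (milnorSES K).f n h) =
          homologyMap (topProj K (s : ℤ)) n h := fun s => by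
        have : homologyMap (milnorSES K).f n ≫ homologyMap (Pi.π (totNat K) s) n =
            homologyMap (topProj K (s : ℤ)) n := by rw [← homologyMap_comp, Pi.lift_π]
        exact congr($this h)
      refine ⟨fun h0 => (homology_pi_bijective (totNat K) n).1 (funext fun s => ?_), fun h0 s => ?_⟩
      · dsimp only
        rw [h2, h0, map_zero]
      · rw [← h2, h0, map_zero]
    rw [h1]
    constructor
    · intro h0
      obtain ⟨x, hx⟩ := (ShortComplex.moduleCat_exact_iff _).1
        ((milnorSES_shortExact K).homology_exact₁ n' n (down_rel hn)) _ h0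
      refine ⟨e.hom x, ?_⟩
      refine Eq.trans ?_ hx
      exact congrArg ((milnorSES_shortExact K).δ n' n (down_rel hn)) (hei x)
    · rintro ⟨x, rfl⟩
      exact congr($((milnorSES_shortExact K).δ_comp n' n (down_rel hn)) _)
  exists_lift y hy := by
    let e := homologyPiIso (totNat K) n
    have he : ∀ x, e.hom (e.inv x) = x := fun x => Iso.inv_hom_id_apply e x
    have hy0 : homologyMap (milnorMap K) n (e.inv (AB.mkPi y)) = 0 := by
      refine (ConcreteCategory.bijective_of_isIso e.hom).1 ?_
      rw [map_zero]
      refine AB.pi_ext fun s => ?_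
      refine (homologyPiIso_milnorMap K n _ s).trans ?_
      have h4 : (homologyPiIso (totNat K) n).hom (e.inv (AB.mkPi y)) = AB.mkPi y := he _
      rw [h4, AB.π_mkPi, AB.π_mkPi, hy, sub_self, map_zero]
    obtain ⟨x, hx⟩ := (ShortComplex.moduleCat_exact_iff _).1
        ((milnorSES_shortExact K).homology_exact₂ n) _ hy0
    refine ⟨x, fun s => ?_⟩
    have : homologyMap (milnorSES K).f n ≫ e.hom ≫ Pi.π _ s = homologyMap (topProj K (s : ℤ)) n := by
      rw [homologyPiIso_hom_π, ← homologyMap_comp, Pi.lift_π]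
    refine (congr($this x)).symm.trans ?_
    refine (congrArg (fun t => Pi.π (fun s => (totNat K s).homology n) s (e.hom t)) hx).trans ?_
    exact (congrArg _ (he _)).trans (AB.π_mkPi y s)

variable {K} {L : CochainComplex CHAIN.{u} ℕ} (f : K ⟶ L)

lemma milnorα_naturality :
    milnorα K n n' hn ≫ homologyMap (totMap f ⊤) n =
      Limits.Pi.map (fun s : ℕ => homologyMap (totMap f (s : ℤ)) n') ≫ milnorα L n n' hn := by
  let φ : milnorSES K ⟶ milnorSES L :=
    { τ₁ := totMap f ⊤
      τ₂ := Limits.Pi.map fun s : ℕ => totMap f (s : ℤ)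
      τ₃ := Limits.Pi.map fun s : ℕ => totMap f (s : ℤ)
      comm₁₂ := Pi.hom_ext _ _ fun s => by
        rw [Category.assoc, Category.assoc, Pi.lift_π, Limits.Pi.map_π, ← Category.assoc, Pi.lift_π]
        exact (totProj le_top).naturality f
      comm₂₃ := Pi.hom_ext _ _ fun s => by
        have h := (totProj (natCast_le s)).naturality f
        have h' : totMap f ((s + 1 : ℕ) : ℤ) ≫ natProj L s = natProj K s ≫ totMap f (s : ℤ) := h
        rw [Category.assoc, Category.assoc, Pi.lift_π, Limits.Pi.map_π, ← Category.assoc, Pi.lift_π,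
          Preadditive.comp_sub, Preadditive.sub_comp, Limits.Pi.map_π, ← Category.assoc,
          Limits.Pi.map_π, Category.assoc, Category.assoc, h'] }
  have h1 := HomologySequence.δ_naturality φ (milnorSES_shortExact K) (milnorSES_shortExact L)
    n' n (down_rel hn)
  have h2 : (homologyPiIso (totNat K) n').hom ≫
      Limits.Pi.map (fun s : ℕ => homologyMap (totMap f (s : ℤ)) n') =
      homologyMap φ.τ₃ n' ≫ (homologyPiIso (totNat L) n').hom := Pi.hom_ext _ _ fun s => by
    rw [Category.assoc, Category.assoc, Limits.Pi.map_π, homologyPiIso_hom_π, ← Category.assoc,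
      homologyPiIso_hom_π, ← homologyMap_comp, ← homologyMap_comp, Limits.Pi.map_π]
  rw [milnorα, milnorα, Category.assoc]
  refine (congrArg (_ ≫ ·) h1).trans ?_
  rw [Iso.inv_comp_eq, ← Category.assoc, ← Category.assoc, h2, Category.assoc, Category.assoc,
    Iso.hom_inv_id_assoc]

end TotCouple

end

noncomputable section

/-! ### The Milnor sequences of the derived couples -/

lemma ModuleCat.exists_lift {R : Type*} [Ring R] {A B X : ModuleCat.{v} R} (f : A ⟶ B)
    (hf : Function.Injective f) (g : X ⟶ B) (h : ∀ x, ∃ a, f a = g x) : ∃ l : X ⟶ A, l ≫ f = g := by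
  choose l hl using h
  refine ⟨ModuleCat.ofHom
    { toFun := l
      map_add' := fun x y => hf (by rw [hl, map_add, map_add, hl, hl])
      map_smul' := fun r x => hf (by
        rw [hl]
        refine (g.hom.map_smul _ _).trans (Eq.trans ?_ (f.hom.map_smul _ _).symm)
        exact congrArg (r • ·) (hl x).symm) }, ?_⟩
  ext x
  exact hl x

namespace CoupledSS

section ToOne

variable {r₀ : ℤ} (S : CoupledSS AB.{u} r₀)

/-- The inclusion of `D_r` into `D_{r₀}`, where `r = r₀ + m`. -/
def ιIter (p : ℤ × ℤ) : ∀ (m : ℕ) (r : ℤ) (hr : r₀ ≤ r) (_ : r = r₀ + m),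
    S.D r hr p ⟶ S.D r₀ le_rfl p
  | 0, r, hr, h => eqToHom (by congr 1; simpa using h)
  | m + 1, r, hr, h => S.ι (r - 1) r (by push_cast at h; lia) (by lia) p ≫
      ιIter p m (r - 1) (by push_cast at h; lia) (by push_cast at h; lia)

/-- The inclusion of `D_r` into the first term `D_{r₀}`. -/
def ιFirst (r : ℤ) (hr : r₀ ≤ r) (p : ℤ × ℤ) : S.D r hr p ⟶ S.D r₀ le_rfl p :=
  S.ιIter p (r - r₀).toNat r hr (by lia)

lemma ιFirst_self (p : ℤ × ℤ) : S.ιFirst r₀ le_rfl p = 𝟙 _ := by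
  have : ∀ (m : ℕ) (_ : m = 0) (h : r₀ = r₀ + m), S.ιIter p m r₀ le_rfl h = 𝟙 _ := by
    rintro _ rfl h
    rw [ιIter, eqToHom_refl]
  exact this (r₀ - r₀).toNat (by simp) _

lemma ιFirst_succ (r r' : ℤ) (hr : r₀ ≤ r) (hr' : r + 1 = r') (p : ℤ × ℤ) :
    S.ιFirst r' (by lia) p = S.ι r r' hr hr' p ≫ S.ιFirst r hr p := by
  obtain rfl : r = r' - 1 := by lia
  have : ∀ (m m' : ℕ) (hm : m' = m + 1) (h' : r' = r₀ + m') (h : r' - 1 = r₀ + m),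
      S.ιIter p m' r' (by lia) h' = S.ι (r' - 1) r' hr hr' p ≫ S.ιIter p m (r' - 1) hr h := by
    rintro m _ rfl h' h
    rfl
  exact this (r' - 1 - r₀).toNat (r' - r₀).toNat (by omega) (by omega) (by omega)

lemma ιFirst_injective (r : ℤ) (hr : r₀ ≤ r) (p : ℤ × ℤ) : Function.Injective (S.ιFirst r hr p) := by
  induction r, hr using Int.leInduction with
  | base =>
    rw [ιFirst_self]
    exact Function.injective_id
  | succ r hr ih =>
    rw [S.ιFirst_succ r _ hr rfl]
    exact ih.comp (S.ι_injective r hr _ rfl p)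

lemma i_ιFirst (r : ℤ) (hr : r₀ ≤ r) (p q : ℤ × ℤ) (h : p + (-1, 1) = q) :
    S.i r hr p q h ≫ S.ιFirst r hr q = S.ιFirst r hr p ≫ S.i r₀ le_rfl p q h := by
  induction r, hr using Int.leInduction with
  | base => rw [ιFirst_self, ιFirst_self, Category.comp_id, Category.id_comp]
  | succ r hr ih =>
    rw [S.ιFirst_succ r _ hr rfl, S.ιFirst_succ r _ hr rfl, ← Category.assoc,
      S.i_ι r _ hr rfl p q h, Category.assoc, ih, Category.assoc]

lemma ιFirst_naturality {S T : CoupledSS AB.{u} r₀} (f : S ⟶ T) (r : ℤ) (hr : r₀ ≤ r) (p : ℤ × ℤ) :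
    S.ιFirst r hr p ≫ Hom.D f r₀ le_rfl p = Hom.D f r hr p ≫ T.ιFirst r hr p := by
  induction r, hr using Int.leInduction with
  | base => rw [ιFirst_self, ιFirst_self, Category.comp_id, Category.id_comp]
  | succ r hr ih =>
    rw [S.ιFirst_succ r _ hr rfl, T.ιFirst_succ r _ hr rfl, Category.assoc, ih, ← Category.assoc,
      Hom.ι_comm f r _ hr rfl p, Category.assoc]

end ToOne

section Tower

variable {r₀ : ℤ} (S : CoupledSS AB.{u} r₀)

/-- The tower of the groups `D_r^{s,n-s}`. -/
abbrev tow (r : ℤ) (hr : r₀ ≤ r) (n : ℤ) (s : ℕ) : AB.{u} := S.D r hr ((s : ℤ), n - s)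

lemma tow_rel (n : ℤ) (s : ℕ) :
    (((s + 1 : ℕ) : ℤ), n - ((s + 1 : ℕ) : ℤ)) + (-1, 1) = ((s : ℤ), n - s) := by
  ext <;> simp; ring

/-- The maps of the tower of the groups `D_r^{s,n-s}`. -/
abbrev towMap (r : ℤ) (hr : r₀ ≤ r) (n : ℤ) (s : ℕ) : S.tow r hr n (s + 1) ⟶ S.tow r hr n s :=
  S.i r hr _ _ (tow_rel n s)

/-- The inclusion of the product of the groups `D_{r+1}^{s,n-s}`. -/
abbrev towι (r r' : ℤ) (hr : r₀ ≤ r) (hr' : r + 1 = r') (n : ℤ) :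
    ∏ᶜ S.tow r' (by lia) n ⟶ ∏ᶜ S.tow r hr n :=
  Limits.Pi.map fun s : ℕ => S.ι r r' hr hr' ((s : ℤ), n - s)

/-- The inclusion of the product of the groups `D_r^{s,n-s}` into that for `r = r₀`. -/
abbrev towιFirst (r : ℤ) (hr : r₀ ≤ r) (n : ℤ) : ∏ᶜ S.tow r hr n ⟶ ∏ᶜ S.tow r₀ le_rfl n :=
  Limits.Pi.map fun s : ℕ => S.ιFirst r hr ((s : ℤ), n - s)

/-- The passage of a Milnor sequence to the derived couple. -/
lemma isMilnor_succ {n n' : ℤ} {H : AB.{u}} (r r' : ℤ) (hr : r₀ ≤ r) (hr' : r + 1 = r')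
    {ρ : ∀ s, H ⟶ S.tow r hr n s} {α : ∏ᶜ S.tow r hr n' ⟶ H}
    (h : IsMilnor (S.towMap r hr n') (S.towMap r hr n) ρ α)
    (ρ' : ∀ s, H ⟶ S.tow r' (by lia) n s) (hρ : ∀ s, ρ' s ≫ S.ι r r' hr hr' _ = ρ s) :
    IsMilnor (S.towMap r' (by lia) n') (S.towMap r' (by lia) n) ρ'
      (S.towι r r' hr hr' n' ≫ α) := by
  have hρ1 : ∀ s x, S.ι r r' hr hr' _ (ρ' s x) = ρ s x := fun s x => congr($(hρ s) x)
  have hπ : ∀ s x, Pi.π (S.tow r hr n') s (S.towι r r' hr hr' n' x) =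
      S.ι r r' hr hr' _ (Pi.π (S.tow r' (by lia) n') s x) := fun s x =>
    congr($(Limits.Pi.map_π (fun s : ℕ => S.ι r r' hr hr' ((s : ℤ), n' - s)) s) x)
  refine ⟨fun s => ?_, fun x => ?_, fun x => ?_, fun y hy => ?_⟩
  · have := S.mono_ι r r' hr hr' ((s : ℤ), n - s)
    rw [← cancel_mono (S.ι r r' hr hr' ((s : ℤ), n - s)), hρ, Category.assoc, S.i_ι,
      ← Category.assoc, hρ]
    exact h.ρ_q s
  · refine (h.α_eq_zero_iff (S.towι r r' hr hr' n' x)).trans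
      ⟨fun ⟨z, hz⟩ => ?_, fun ⟨z, hz⟩ => ⟨fun s => S.ι r r' hr hr' _ (z s), fun s => ?_⟩⟩
    -- If `x_s = z_s - i z_{s+1}` with `x_s` in the next `D`, then `z_s` is the sum of `x_s` and a
    -- value of `i`, hence it lies in the next `D` as well. So `lim¹` of the derived tower injects.
    · refine ⟨fun s => Pi.π (S.tow r' _ n') s x +
        S.π r r' hr hr' _ _ (tow_rel n' s) (z (s + 1)), fun s => ?_⟩
      have hw : ∀ s, S.ι r r' hr hr' _ (Pi.π (S.tow r' _ n') s x +
          S.π r r' hr hr' _ _ (tow_rel n' s) (z (s + 1))) = z s := fun s => by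
        rw [map_add, ← hπ, hz, π_ι_apply, sub_add_cancel]
      refine S.ι_injective r hr r' hr' _ ?_
      rw [map_sub, hw, i_ι_apply, hw, ← hz, hπ]
    · rw [hπ, hz, map_sub, i_ι_apply]
  · have h1 : (∀ s, ρ' s x = 0) ↔ ∀ s, ρ s x = 0 := forall_congr' fun s => by
      rw [← hρ1]
      exact (map_eq_zero_iff _ (S.ι_injective r hr r' hr' _)).symm
    rw [h1, h.ρ_eq_zero_iff]
    refine ⟨fun ⟨y, hy⟩ => ?_, fun ⟨y, hy⟩ => ⟨_, hy⟩⟩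
    -- The family `i y_{s+1}` comes from the derived tower and represents the same class as `y`: the
    -- difference is the coboundary of `-y`.
    refine ⟨AB.mkPi fun s => S.π r r' hr hr' _ _ (tow_rel n' s) (Pi.π (S.tow r hr n') (s + 1) y), ?_⟩
    rw [← hy]
    change α (S.towι r r' hr hr' n' _) = α y
    rw [← sub_eq_zero, ← map_sub]
    refine (h.α_eq_zero_iff _).2 ⟨fun s => - Pi.π (S.tow r hr n') s y, fun s => ?_⟩
    rw [map_sub, hπ, AB.π_mkPi, π_ι_apply, map_neg, sub_neg_eq_add, neg_add_eq_sub]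
  -- Limits need no correction: a compatible family in the subobjects is lifted as a family in
  -- `D_r`.
  · obtain ⟨x, hx⟩ := h.exists_lift (fun s => S.ι r r' hr hr' _ (y s)) fun s => by
      rw [← i_ι_apply, hy]
    exact ⟨x, fun s => S.ι_injective r hr r' hr' _ ((hρ1 s x).trans (hx s))⟩

/-- The Milnor sequences of all derived couples. -/
lemma isMilnor_of_first {n n' : ℤ} {H : AB.{u}} {ρ₁ : ∀ s, H ⟶ S.tow r₀ le_rfl n s}
    {α : ∏ᶜ S.tow r₀ le_rfl n' ⟶ H}
    (h : IsMilnor (S.towMap r₀ le_rfl n') (S.towMap r₀ le_rfl n) ρ₁ α)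
    (ρ : ∀ (r : ℤ) (hr : r₀ ≤ r) (s : ℕ), H ⟶ S.tow r hr n s)
    (hρ : ∀ r hr s, ρ r hr s ≫ S.ιFirst r hr _ = ρ₁ s) (r : ℤ) (hr : r₀ ≤ r) :
    IsMilnor (S.towMap r hr n') (S.towMap r hr n) (ρ r hr)
      (S.towιFirst r hr n' ≫ α) := by
  induction r, hr using Int.leInduction with
  | base =>
    have h1 : ρ r₀ le_rfl = ρ₁ := funext fun s => by
      rw [← hρ r₀ le_rfl s, ιFirst_self, Category.comp_id]
    have h2 : S.towιFirst r₀ le_rfl n' = 𝟙 _ := Pi.hom_ext _ _ fun s => by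
      rw [Limits.Pi.map_π, ιFirst_self, Category.comp_id, Category.id_comp]
    rw [h1, h2, Category.id_comp]
    exact h
  | succ r hr ih =>
    have h1 := S.isMilnor_succ r _ hr rfl ih (ρ (r + 1) (by lia)) fun s => by
      have := (ModuleCat.mono_iff_injective _).2 (S.ιFirst_injective r hr ((s : ℤ), n - s))
      rw [← cancel_mono (S.ιFirst r hr ((s : ℤ), n - s)), Category.assoc, ← ιFirst_succ, hρ, hρ]
    have h2 : S.towιFirst (r + 1) (by lia) n' =
        S.towι r (r + 1) hr rfl n' ≫ S.towιFirst r hr n' := Pi.hom_ext _ _ fun s => by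
      rw [Category.assoc, Limits.Pi.map_π, Limits.Pi.map_π, ← Category.assoc, Limits.Pi.map_π,
        Category.assoc, S.ιFirst_succ r _ hr rfl]
    rw [h2, Category.assoc]
    exact h1

end Tower

end CoupledSS

end

noncomputable section

/-! ### The Milnor sequences of the homotopy inverse limit -/

namespace InvSystem

open HomologicalComplex TotCouple CoupledSS

/-- The identification of `D_1`. -/
abbrev isoD₁ (C : InvSystem.{u} CHAIN.{u}) (s t n : ℤ) (h : s + t = -n) :
    (holimSS.obj C).D 1 le_rfl (s, t) ≅ (tot (bicomplex.obj C) s).homology n :=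
  (holimCouple.isoD s t n h).app C

variable (C : InvSystem.{u} CHAIN.{u})

/-- The map `H_n(holim C) ⟶ D_1^{s,t}`, where `s + t = -n`. -/
def rhoFirst (n s t : ℤ) (h : s + t = -n) :
    (holim.obj C).homology n ⟶ (holimSS.obj C).D 1 le_rfl (s, t) :=
  homologyMap (topProj (bicomplex.obj C) s) n ≫ (isoD₁ C s t n h).inv

/-- The map `∏ D_1^{s,-n-1-s} ⟶ H_n(holim C)`. -/
def alphaFirst (n : ℤ) :
    ∏ᶜ (holimSS.obj C).tow 1 le_rfl (-n - 1) ⟶ (holim.obj C).homology n :=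
  Limits.Pi.map (fun s : ℕ => (isoD₁ C s (-n - 1 - s) (n + 1) (by lia)).hom) ≫
    milnorα (bicomplex.obj C) n (n + 1) rfl

lemma isoD₁_i (s t s' t' n : ℤ) (h : s + t = -n) (h' : s' + t' = -n) (hq : (s, t) + (-1, 1) = (s', t'))
    (hs : (s' : WithTop ℤ) ≤ (s : WithTop ℤ)) :
    (holimSS.obj C).i 1 le_rfl (s, t) (s', t') hq ≫ (isoD₁ C s' t' n h').hom =
      (isoD₁ C s t n h).hom ≫ homologyMap ((totProj hs).app (bicomplex.obj C)) n := by
  obtain rfl : s = s' + 1 := by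
    have := congrArg Prod.fst hq
    simp at this
    lia
  obtain rfl : t' = t + 1 := by
    have := congrArg Prod.snd hq
    simp at this
    lia
  exact holimCouple.i_eq C s' t n h h'

lemma isMilnor_first (n : ℤ) :
    IsMilnor ((holimSS.obj C).towMap 1 le_rfl (-n - 1)) ((holimSS.obj C).towMap 1 le_rfl (-n))
      (fun s : ℕ => rhoFirst C n s (-n - s) (by lia)) (alphaFirst C n) := by
  refine (isMilnor_tot (bicomplex.obj C) n (n + 1) rfl).of_iso
    (fun s : ℕ => isoD₁ C s (-n - 1 - s) (n + 1) (by lia))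
    (fun s : ℕ => (isoD₁ C s (-n - s) n (by lia)).symm) (fun s => ?_) (fun s => ?_)
  · exact isoD₁_i C _ _ _ _ _ _ _ _ _
  · refine (Iso.comp_inv_eq _).2 ?_
    rw [Category.assoc]
    refine Eq.trans ?_ (congrArg (_ ≫ ·) (isoD₁_i C ((s + 1 : ℕ) : ℤ) (-n - ((s + 1 : ℕ) : ℤ)) s
      (-n - s) n (by lia) (by lia) (tow_rel _ _) (natCast_le s)).symm)
    exact (Iso.inv_hom_id_assoc _ _).symm

variable {C} in
lemma rhoFirst_naturality {C' : InvSystem.{u} CHAIN.{u}} (f : C ⟶ C') (n s t : ℤ) (h : s + t = -n) :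
    homologyMap (holim.map f) n ≫ rhoFirst C' n s t h =
      rhoFirst C n s t h ≫ CoupledSS.Hom.D (holimSS.map f) 1 le_rfl (s, t) := by
  have h1 := (holimCouple.isoD s t n h).inv.naturality f
  have h2 : homologyMap (holim.map f) n ≫ homologyMap (topProj (bicomplex.obj C') s) n =
      homologyMap (topProj (bicomplex.obj C) s) n ≫ homologyMap (totMap (bicomplex.map f) s) n :=
    (homologyMap_comp _ _ _).symm.trans
      ((congrArg (homologyMap · n) ((totProj le_top).naturality (bicomplex.map f))).trans
        (homologyMap_comp _ _ _))
  refine (Category.assoc _ _ _).symm.trans ((congrArg (· ≫ _) h2).trans ?_)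
  exact (Category.assoc _ _ _).trans ((congrArg (_ ≫ ·) h1).trans (Category.assoc _ _ _).symm)

variable {C} in
lemma alphaFirst_naturality {C' : InvSystem.{u} CHAIN.{u}} (f : C ⟶ C') (n : ℤ) :
    alphaFirst C n ≫ homologyMap (holim.map f) n =
      Limits.Pi.map (fun s : ℕ => CoupledSS.Hom.D (holimSS.map f) 1 le_rfl ((s : ℤ), -n - 1 - s)) ≫
        alphaFirst C' n := by
  have h2 : Limits.Pi.map (fun s : ℕ => (isoD₁ C s (-n - 1 - s) (n + 1) (by lia)).hom) ≫
      Limits.Pi.map (fun s : ℕ => homologyMap (totMap (bicomplex.map f) (s : ℤ)) (n + 1)) =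
      Limits.Pi.map (fun s : ℕ => CoupledSS.Hom.D (holimSS.map f) 1 le_rfl ((s : ℤ), -n - 1 - s)) ≫
      Limits.Pi.map (fun s : ℕ => (isoD₁ C' s (-n - 1 - s) (n + 1) (by lia)).hom) :=
    Pi.hom_ext _ _ fun s => by
      rw [Category.assoc, Category.assoc, Limits.Pi.map_π, Limits.Pi.map_π, ← Category.assoc,
        Limits.Pi.map_π, ← Category.assoc, Limits.Pi.map_π]
      exact (Category.assoc _ _ _).trans ((congrArg (_ ≫ ·)
        ((holimCouple.isoD s (-n - 1 - s) (n + 1) (by lia)).hom.naturality f).symm).trans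
          (Category.assoc _ _ _).symm)
  have h1 := milnorα_naturality n (n + 1) rfl (bicomplex.map f)
  refine (Category.assoc _ _ _).trans ((congrArg (_ ≫ ·) h1).trans ?_)
  refine (Category.assoc _ _ _).symm.trans ((congrArg (· ≫ _) h2).trans (Category.assoc _ _ _))

lemma rhoFirst_i (n s t : ℤ) (h : s + t = -n) (q : ℤ × ℤ) (hq : (s, t) + (-1, 1) = q)
    (h' : q.1 + q.2 = -n) :
    rhoFirst C n s t h ≫ (holimSS.obj C).i 1 le_rfl (s, t) q hq = rhoFirst C n q.1 q.2 h' := by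
  have hs : (q.1 : WithTop ℤ) ≤ (s : WithTop ℤ) := by
    have := congrArg Prod.fst hq
    simp at this
    exact_mod_cast (by lia : q.1 ≤ s)
  have h1 := isoD₁_i C s t q.1 q.2 n h h' hq hs
  have h3 : homologyMap (topProj (bicomplex.obj C) s) n ≫
      homologyMap ((totProj hs).app (bicomplex.obj C)) n =
      homologyMap (topProj (bicomplex.obj C) q.1) n :=
    (homologyMap_comp _ _ _).symm.trans (congrArg (homologyMap · n) (totProj_comp _ _ _))
  refine (Iso.eq_comp_inv _).2 ?_
  refine (Category.assoc _ _ _).trans ((congrArg (_ ≫ ·) h1).trans ?_)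
  refine (Category.assoc _ _ _).trans (Eq.trans ?_ h3)
  exact congrArg (_ ≫ ·) (Iso.inv_hom_id_assoc _ _)

/-- The map to `D_1^{s,t}` factors through the image of `i` because it is the map to the next column
followed by `i`. Iterating, `ρ_{r+1}` in column `s` is `ρ_r` in column `s + 1` followed by `π`;
hence the induction over all `s` and `t` at once. -/
lemma exists_rho (n r : ℤ) (hr : 1 ≤ r) (s t : ℤ) (h : s + t = -n) :
    ∃ ρ : (holim.obj C).homology n ⟶ (holimSS.obj C).D r hr (s, t),
      ρ ≫ (holimSS.obj C).ιFirst r hr (s, t) = rhoFirst C n s t h := by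
  induction r, hr using Int.leInduction generalizing s t with
  | base => exact ⟨_, (congrArg (_ ≫ ·) (ιFirst_self _ _)).trans (Category.comp_id _)⟩
  | succ r hr ih =>
    obtain ⟨ρ, hρ⟩ := ih (s + 1) (t - 1) (by lia)
    have hq : (s + 1, t - 1) + (-1, 1) = (s, t) := by ext <;> simp
    refine ⟨ρ ≫ (holimSS.obj C).π r _ hr rfl _ _ hq, ?_⟩
    rw [(holimSS.obj C).ιFirst_succ r _ hr rfl, Category.assoc, ← Category.assoc (π ..), π_ι,
      i_ιFirst, ← Category.assoc, hρ]
    exact rhoFirst_i C n (s + 1) (t - 1) (by lia) (s, t) hq h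

/-- The map `ρ_r : H_n(holim C) ⟶ D_r^{s,t}`, where `s + t = -n`. -/
def rho (n r : ℤ) (hr : 1 ≤ r) (s t : ℤ) (h : s + t = -n) :
    (holim.obj C).homology n ⟶ (holimSS.obj C).D r hr (s, t) :=
  (exists_rho C n r hr s t h).choose

lemma rho_ιFirst (n r : ℤ) (hr : 1 ≤ r) (s t : ℤ) (h : s + t = -n) :
    rho C n r hr s t h ≫ (holimSS.obj C).ιFirst r hr (s, t) = rhoFirst C n s t h :=
  (exists_rho C n r hr s t h).choose_spec

variable {C} in
-- All identities for `ρ_r` are checked in `D_1`, where `ρ` is induced by the projections of the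
-- total complexes. In particular the choice of `rho` is unique.
lemma hom_D_ext {r : ℤ} {hr : 1 ≤ r} {p : ℤ × ℤ} {A : AB.{u}} {f g : A ⟶ (holimSS.obj C).D r hr p}
    (h : f ≫ (holimSS.obj C).ιFirst r hr p = g ≫ (holimSS.obj C).ιFirst r hr p) : f = g := by
  have := (ModuleCat.mono_iff_injective _).2 ((holimSS.obj C).ιFirst_injective r hr p)
  exact (cancel_mono _).1 h

lemma rho_ι (n r r' : ℤ) (hr : 1 ≤ r) (hr' : r + 1 = r') (s t : ℤ) (h : s + t = -n) :
    rho C n r' (by lia) s t h ≫ (holimSS.obj C).ι r r' hr hr' (s, t) = rho C n r hr s t h :=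
  hom_D_ext (by rw [Category.assoc, ← ιFirst_succ, rho_ιFirst, rho_ιFirst])

lemma rho_i (n r : ℤ) (hr : 1 ≤ r) (s t : ℤ) (h : s + t = -n) (q : ℤ × ℤ)
    (hq : (s, t) + (-1, 1) = q) (h' : q.1 + q.2 = -n) :
    rho C n r hr s t h ≫ (holimSS.obj C).i r hr (s, t) q hq = rho C n r hr q.1 q.2 h' :=
  hom_D_ext (by
    rw [Category.assoc, i_ιFirst, ← Category.assoc, rho_ιFirst]
    exact (rhoFirst_i C n s t h q hq h').trans (rho_ιFirst C n r hr q.1 q.2 h').symm)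

variable {C} in
lemma rho_naturality {C' : InvSystem.{u} CHAIN.{u}} (f : C ⟶ C') (n r : ℤ) (hr : 1 ≤ r) (s t : ℤ)
    (h : s + t = -n) :
    homologyMap (holim.map f) n ≫ rho C' n r hr s t h =
      rho C n r hr s t h ≫ CoupledSS.Hom.D (holimSS.map f) r hr (s, t) :=
  hom_D_ext (by
    rw [Category.assoc, rho_ιFirst, Category.assoc, ← ιFirst_naturality, ← Category.assoc,
      rho_ιFirst, rhoFirst_naturality])

/-- The map `∏ D_r^{s,-n-1-s} ⟶ H_n(holim C)`. -/
def alpha (n r : ℤ) (hr : 1 ≤ r) :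
    ∏ᶜ (holimSS.obj C).tow r hr (-n - 1) ⟶ (holim.obj C).homology n :=
  (holimSS.obj C).towιFirst r hr (-n - 1) ≫ alphaFirst C n

variable {C} in
lemma alpha_naturality {C' : InvSystem.{u} CHAIN.{u}} (f : C ⟶ C') (n r : ℤ) (hr : 1 ≤ r) :
    alpha C n r hr ≫ homologyMap (holim.map f) n =
      Limits.Pi.map (fun s : ℕ => CoupledSS.Hom.D (holimSS.map f) r hr ((s : ℤ), -n - 1 - s)) ≫
        alpha C' n r hr := by
  rw [alpha, Category.assoc, alphaFirst_naturality, ← Category.assoc, alpha, ← Category.assoc]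
  refine congrArg (· ≫ _) (Pi.hom_ext _ _ fun s => ?_)
  rw [Category.assoc, Category.assoc, Limits.Pi.map_π, Limits.Pi.map_π, ← Category.assoc,
    Limits.Pi.map_π, ← Category.assoc, Limits.Pi.map_π, Category.assoc, ιFirst_naturality,
    ← Category.assoc]

/-- The Milnor sequence of the homotopy inverse limit. -/
lemma isMilnor (n r : ℤ) (hr : 1 ≤ r) :
    IsMilnor ((holimSS.obj C).towMap r hr (-n - 1)) ((holimSS.obj C).towMap r hr (-n))
      (fun s : ℕ => rho C n r hr s (-n - s) (by lia)) (alpha C n r hr) :=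
  (holimSS.obj C).isMilnor_of_first (isMilnor_first C n)
    (fun r hr s => rho C n r hr s (-n - s) (by lia)) (fun r hr s => rho_ιFirst C n r hr _ _ _) r hr

/-- If `f` induces isomorphisms between the terms `D_r` then it induces isomorphisms between the
homology groups of the homotopy inverse limits. -/
lemma bijective_homologyMap_holim {C C' : InvSystem.{u} CHAIN.{u}} (f : C ⟶ C') (r : ℤ) (hr : 1 ≤ r)
    (hD : ∀ p, Function.Bijective (CoupledSS.Hom.D (holimSS.map f) r hr p)) (n : ℤ) :
    Function.Bijective (homologyMap (holim.map f) n) :=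
  (isMilnor C n r hr).bijective (isMilnor C' n r hr) (fun _ => CoupledSS.Hom.D (holimSS.map f) r hr _)
    (fun _ => CoupledSS.Hom.D (holimSS.map f) r hr _) _ (fun _ => Hom.i_comm (holimSS.map f) r hr _ _ _)
    (fun _ => Hom.i_comm (holimSS.map f) r hr _ _ _) (alpha_naturality f n r hr)
    (fun _ => (rho_naturality f n r hr _ _ _).symm) (fun _ => hD _) (fun _ => hD _)

end InvSystem

end

noncomputable section

/-! ### Maps of homology groups defined on cycles -/

namespace AB

lemma ofElement_comp {A B : AB.{u}} (a : A) (f : A ⟶ B) : ofElement a ≫ f = ofElement (f a) :=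
  unitModule_hom_ext ((congrArg f (ofElement_gen a)).trans (ofElement_gen (f a)).symm)

lemma ofElement_eq_zero {A : AB.{u}} {a : A} (h : a = 0) : ofElement a = 0 :=
  unitModule_hom_ext ((ofElement_gen a).trans h)

end AB

namespace HomologicalComplex

variable {ι ι' : Type*} {c : ComplexShape ι} {c' : ComplexShape ι'}

lemma homology_ext {L : HomologicalComplex AB.{u} c} {n : ι} {A : AB.{u}}
    {f g : L.homology n ⟶ A} (h : ∀ x hx, f (cls x hx) = g (cls x hx)) : f = g := by
  ext a
  obtain ⟨x, hx, rfl⟩ := exists_cls a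
  exact h x hx

lemma cls_of_iCycles {L : HomologicalComplex AB.{u} c} {n : ι} {x : L.X n}
    (hx : ∀ q, L.d n q x = 0) : ∃ z : L.cycles n, L.iCycles n z = x ∧ L.homologyπ n z = cls x hx := by
  obtain ⟨z, hz⟩ := exists_iCycles x hx
  exact ⟨z, hz, homologyπ_eq z x hx hz⟩

/-- The usual zigzag on elements; it is obtained from the description of `δ` on generalized elements
by viewing elements as morphisms from the free module of rank one. -/
lemma δ_cls {S : ShortComplex (HomologicalComplex AB.{u} c)} (hS : S.ShortExact) {i j : ι}
    (hij : c.Rel i j) {x₃ : S.X₃.X i} (hx₃ : ∀ q, S.X₃.d i q x₃ = 0) (x₂ : S.X₂.X i)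
    (h₂ : S.g.f i x₂ = x₃) (x₁ : S.X₁.X j) (h₁ : S.f.f j x₁ = S.X₂.d i j x₂)
    (hx₁ : ∀ q, S.X₁.d j q x₁ = 0) : hS.δ i j hij (cls x₃ hx₃) = cls x₁ hx₁ := by
  have h := hS.δ_eq i j hij (AB.ofElement x₃)
    ((AB.ofElement_comp _ _).trans (AB.ofElement_eq_zero (hx₃ j))) (AB.ofElement x₂)
    ((AB.ofElement_comp _ _).trans (congrArg _ h₂)) (AB.ofElement x₁)
    ((AB.ofElement_comp _ _).trans ((congrArg _ h₁).trans (AB.ofElement_comp _ _).symm)) _ rfl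
  have h' := congr($h (AB.unitGen ℤ))
  have e3 := homologyπ_eq (S.X₃.liftCycles (AB.ofElement x₃) j (c.next_eq' hij)
    ((AB.ofElement_comp _ _).trans (AB.ofElement_eq_zero (hx₃ j))) (AB.unitGen ℤ)) x₃ hx₃
    (congr($(S.X₃.liftCycles_i _ _ _ _) (AB.unitGen ℤ)).trans (AB.ofElement_gen x₃))
  have e1 := homologyπ_eq (S.X₁.liftCycles (AB.ofElement x₁) _ rfl
    ((AB.ofElement_comp _ _).trans (AB.ofElement_eq_zero (hx₁ _))) (AB.unitGen ℤ)) x₁ hx₁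
    (congr($(S.X₁.liftCycles_i _ _ _ _) (AB.unitGen ℤ)).trans (AB.ofElement_gen x₁))
  rw [← e3, ← e1]
  exact h'

section ClsMap

variable {L : HomologicalComplex AB.{u} c} {K : HomologicalComplex AB.{u} c'} {n : ι} {m : ι'}
  (κ : L.X n ⟶ K.X m) (hc : ∀ x, (∀ q, L.d n q x = 0) → ∀ q, K.d m q (κ x) = 0)
  (hb : ∀ o (y : L.X o), ∃ o' y', K.d o' m y' = κ (L.d o n y))

/-- The map of cycles induced by a map that respects cycles. -/
def cyclesMapOf : L.cycles n ⟶ K.cycles m :=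
  K.liftCycles (L.iCycles n ≫ κ) _ rfl (by
    ext z
    exact hc _ (fun q => d_iCycles n q z) _)

lemma iCycles_cyclesMapOf (z : L.cycles n) :
    K.iCycles m (cyclesMapOf κ hc z) = κ (L.iCycles n z) := by
  have h : cyclesMapOf κ hc ≫ K.iCycles m = L.iCycles n ≫ κ := K.liftCycles_i _ _ _ _
  exact congr($h z)

lemma homologyπ_cyclesMapOf (z : L.cycles n) :
    K.homologyπ m (cyclesMapOf κ hc z) =
      cls (κ (L.iCycles n z)) (hc _ fun q => d_iCycles n q z) :=
  homologyπ_eq _ _ _ (iCycles_cyclesMapOf κ hc z)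

/-- The map of homology groups induced by a map that respects cycles and boundaries. -/
def clsMap : L.homology n ⟶ K.homology m :=
  ModuleCat.descSurj (L.homologyπ n) (L.homologyπ_surjective n)
    (cyclesMapOf κ hc ≫ K.homologyπ m) (by
      intro z hz
      rw [homologyπ_eq_cls] at hz
      obtain ⟨y, hy⟩ := exists_of_cls_eq_zero rfl hz
      obtain ⟨o', y', hy'⟩ := hb _ y
      refine (homologyπ_cyclesMapOf κ hc z).trans ?_
      exact cls_eq_zero_of_eq_d _ y' (hy'.trans (congrArg κ hy)))

lemma clsMap_cls {x : L.X n} (hx : ∀ q, L.d n q x = 0) :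
    clsMap κ hc hb (cls x hx) = cls (κ x) (hc x hx) := by
  obtain ⟨z, rfl, hz⟩ := cls_of_iCycles hx
  rw [← hz, clsMap, ModuleCat.descSurj_apply]
  exact homologyπ_cyclesMapOf κ hc z

include hc hb in
-- The map `κ` in a single degree is not required to be part of a chain map. For the columns of the
-- total complex it commutes with the differentials only up to sign.
lemma clsMap_bijective (hκ : Function.Bijective κ)
    (hc' : ∀ x, (∀ q, K.d m q (κ x) = 0) → ∀ q, L.d n q x = 0)
    (hb' : ∀ x o' y', K.d o' m y' = κ x → ∃ o y, L.d o n y = x) :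
    Function.Bijective (clsMap κ hc hb) := by
  constructor
  · refine (injective_iff_map_eq_zero _).2 fun a ha => ?_
    obtain ⟨x, hx, rfl⟩ := exists_cls a
    rw [clsMap_cls] at ha
    obtain ⟨y, hy⟩ := exists_of_cls_eq_zero rfl ha
    obtain ⟨o, z, hz⟩ := hb' x _ y hy
    exact cls_eq_zero_of_eq_d _ z hz
  · intro b
    obtain ⟨y, hy, rfl⟩ := exists_cls b
    obtain ⟨x, rfl⟩ := hκ.2 y
    exact ⟨cls x (hc' x hy), clsMap_cls κ hc hb _⟩

end ClsMap

end HomologicalComplex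

/-! ### The cosimplicial replacement of a diagram of abelian groups -/

namespace ModuleCat

variable {R : Type v} [Ring R] {J : Type u} (F : J → ModuleCat.{max u w} R)

/-- The module of families of elements. -/
def piObj : ModuleCat.{max u w} R := ModuleCat.of R (∀ j, F j)

/-- The family with given values. -/
def piMk (a : ∀ j, F j) : piObj F := a

variable {F}

/-- The morphism to a module of families with given coordinates. -/
def piLift {A : ModuleCat.{max u w} R} (f : ∀ j, A ⟶ F j) : A ⟶ piObj F :=
  ModuleCat.ofHom (LinearMap.pi fun j => (f j).hom)

variable (F) in
/-- The evaluation of families. -/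
def piEval (j : J) : piObj F ⟶ F j := ModuleCat.ofHom (LinearMap.proj j)

lemma pi_ext {x y : piObj F} (h : ∀ j, piEval F j x = piEval F j y) : x = y := funext h

end ModuleCat

namespace InvSystem

variable (X Y Z : InvSystem.{u} AB.{u})

/-- The functions assigning to a chain `i₀ ⟶ ⋯ ⟶ iₙ` an element of `X(iₙ)`. -/
abbrev Cochains (n : ℕ) : AB.{u} :=
  ModuleCat.piObj fun σ : Fin (n + 1) ⥤ X.I => X.X.obj (σ.obj (Fin.last n))

/-- The evaluation of cochains at a chain. -/
abbrev cochainsEval {n : ℕ} (σ : Fin (n + 1) ⥤ X.I) :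
    X.Cochains n ⟶ X.X.obj (σ.obj (Fin.last n)) :=
  ModuleCat.piEval (fun σ : Fin (n + 1) ⥤ X.I => X.X.obj (σ.obj (Fin.last n))) σ

variable {X} in
lemma cochains_ext {n : ℕ} {c c' : X.Cochains n}
    (h : ∀ σ, X.cochainsEval σ c = X.cochainsEval σ c') : c = c' := ModuleCat.pi_ext h

/-- The functor given by a monotone map. -/
abbrev monoFunctor {a b : SimplexCategory} (θ : a ⟶ b) : Fin (a.len + 1) ⥤ Fin (b.len + 1) :=
  θ.toOrderHom.monotone.functor

/-- The cosimplicial replacement of a diagram of abelian groups. -/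
def cosimplicialCochains : CosimplicialObject AB.{u} where
  obj a := X.Cochains a.len
  map {a b} θ := ModuleCat.piLift fun σ => X.cochainsEval (monoFunctor θ ⋙ σ) ≫
    X.X.map (σ.map (homOfLE (Fin.le_last (θ.toOrderHom (Fin.last _)))))
  map_id a := by
    ext c
    refine cochains_ext fun σ => ?_
    change X.X.map (σ.map (𝟙 _)) _ = _
    rw [σ.map_id, X.X.map_id]
    rfl
  map_comp {a b d} θ θ' := by
    ext c
    refine cochains_ext fun σ => ?_
    change X.X.map (σ.map _) _ = X.X.map _ (X.X.map _ _)
    rw [← ConcreteCategory.comp_apply, ← X.X.map_comp]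
    congr 3
    exact σ.map_comp (homOfLE _) (homOfLE _)

variable {X Y Z}

/-- The functoriality of the groups of cochains. -/
def cochainsMap (f : X ⟶ Y) (n : ℕ) : X.Cochains n ⟶ Y.Cochains n :=
  ModuleCat.piLift fun σ => X.cochainsEval (σ ⋙ Hom.φ f) ≫ (Hom.ψ f).app _

/-- The cosimplicial replacement, as a functor. -/
def cosimplicialCochainsFunctor : InvSystem.{u} AB.{u} ⥤ CosimplicialObject AB.{u} where
  obj X := X.cosimplicialCochains
  map {X Y} f :=
    { app a := cochainsMap f a.len
      naturality {a b} θ := by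
        ext c
        refine cochains_ext fun σ => ?_
        exact (congr($((Hom.ψ f).naturality (σ.map _)) _) :) }
  map_id X := by
    ext a c
    exact cochains_ext fun σ => rfl
  map_comp {X Y Z} f g := by
    ext a c
    exact cochains_ext fun σ => congr($(comp_ψ_app f g _) _)

/-- The cochain complex of a diagram of abelian groups. -/
def cochains : InvSystem.{u} AB.{u} ⥤ CochainComplex AB.{u} ℕ :=
  cosimplicialCochainsFunctor ⋙ AlgebraicTopology.alternatingCofaceMapComplex AB.{u}

/-- The `k`-th face of a chain. -/
abbrev face {n : ℕ} {I : Type*} [Category* I] (k : Fin (n + 2)) (σ : Fin (n + 2) ⥤ I) :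
    Fin (n + 1) ⥤ I :=
  monoFunctor (SimplexCategory.δ k) ⋙ σ

/-- The morphism from the last object of a face to the last object of a chain. -/
abbrev faceLast {n : ℕ} {I : Type*} [Category* I] (k : Fin (n + 2)) (σ : Fin (n + 2) ⥤ I) :
    (face k σ).obj (Fin.last n) ⟶ σ.obj (Fin.last (n + 1)) :=
  σ.map (homOfLE (Fin.le_last _))

variable (X)

lemma cochains_d (n : ℕ) : (cochains.obj X).d n (n + 1) =
    ∑ k : Fin (n + 2), (-1 : ℤ) ^ (k : ℕ) • X.cosimplicialCochains.map (SimplexCategory.δ k) :=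
  CochainComplex.of_d (V := AB.{u}) (fun n => X.cosimplicialCochains.obj (SimplexCategory.mk n))
    (AlgebraicTopology.AlternatingCofaceMapComplex.objD X.cosimplicialCochains) n

/-- The differential of the complex of cochains. -/
abbrev cochainsD (n : ℕ) : X.Cochains n ⟶ X.Cochains (n + 1) := (cochains.obj X).d n (n + 1)

lemma cochainsD_apply {n : ℕ} (c : X.Cochains n) (σ : Fin (n + 2) ⥤ X.I) :
    X.cochainsEval σ (X.cochainsD n c) =
      ∑ k : Fin (n + 2), (-1 : ℤ) ^ (k : ℕ) • X.X.map (faceLast k σ) (X.cochainsEval (face k σ) c) := by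
  have h : X.cochainsD n ≫ X.cochainsEval σ = ∑ k : Fin (n + 2), (-1 : ℤ) ^ (k : ℕ) •
      (X.cochainsEval (face k σ) ≫ X.X.map (faceLast k σ)) := by
    refine (congrArg (· ≫ X.cochainsEval σ) (X.cochains_d n)).trans ?_
    refine (Preadditive.sum_comp _ _ _).trans (Finset.sum_congr rfl fun k _ => ?_)
    exact Preadditive.zsmul_comp _ _ _
  refine (congr($h c)).trans ?_
  refine (congr($(ModuleCat.hom_sum _ _) c) :).trans ?_
  rw [LinearMap.sum_apply]
  rfl

end InvSystem

end

noncomputable section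

/-! ### Local primitives of cocycles -/

section Cone

variable {I : Type*} [Category* I]

lemma CategoryTheory.Functor.map_eq_of_eq {N : Type*} [Preorder N] (F : N ⥤ I) {a a' b b' : N}
    (h : a ≤ b) (h' : a' ≤ b') (ha : a = a') (hb : b = b') :
    F.map (homOfLE h) = eqToHom (by rw [ha]) ≫ F.map (homOfLE h') ≫ eqToHom (by rw [hb]) := by
  subst ha hb
  simp

lemma precomp_map_zero_succ {n : ℕ} (σ : ComposableArrows I n) {T : I} (h : T ⟶ σ.left)
    (x : Fin (n + 1)) : (σ.precomp h).map (homOfLE (Fin.zero_le x.succ)) =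
      h ≫ σ.map (homOfLE (Fin.zero_le x)) := by
  obtain ⟨_ | x, hx⟩ := x
  · exact ((congrArg (h ≫ ·) (σ.map_id 0)).trans (Category.comp_id h)).symm
  · rfl

/-- Omitting vertex `k + 1` of a cone leaves the cone vertex in place, so the face is the cone on
the `k`-th face of the base. The first vertex of that face is a new one if `k = 0`, which explains
the extra factor in the leg of the cone. -/
lemma face_succ_precomp {n : ℕ} (k : Fin (n + 2)) (σ : ComposableArrows I (n + 1)) {T : I}
    (h : T ⟶ σ.left) : InvSystem.face k.succ (σ.precomp h) =
      ComposableArrows.precomp (InvSystem.face k σ)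
        (h ≫ σ.map (homOfLE (Fin.zero_le (k.succAbove 0)))) := by
  have e : Fin.succFunctor (n + 1) ⋙ InvSystem.monoFunctor (SimplexCategory.δ k.succ) =
      InvSystem.monoFunctor (SimplexCategory.δ k) ⋙ Fin.succFunctor (n + 2) :=
    CategoryTheory.Functor.ext (fun (i : Fin (n + 1)) => Fin.succ_succAbove_succ k i) (fun _ _ _ => Subsingleton.elim _ _)
  have h0 : k.succ.succAbove 0 = 0 := Fin.succ_succAbove_zero k
  refine ComposableArrows.ext_succ ?_ ?_ ?_
  · exact congrArg (σ.precomp h).obj h0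
  · exact congrArg (· ⋙ σ.precomp h) e
  · refine ((σ.precomp h).map_eq_of_eq
      ((Fin.strictMono_succAbove k.succ).monotone (Fin.zero_le (Fin.succ 0))) (Fin.zero_le (k.succAbove 0).succ) h0
      (Fin.succ_succAbove_succ k 0)).trans ?_
    rw [precomp_map_zero_succ]
    rfl

end Cone

namespace InvSystem

variable {X : InvSystem.{u} AB.{u}}

lemma cochains_congr {n : ℕ} (c : X.Cochains n) {σ σ' : Fin (n + 1) ⥤ X.I} (h : σ = σ') {i : X.I}
    (f : σ.obj (Fin.last n) ⟶ i) (f' : σ'.obj (Fin.last n) ⟶ i)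
    (hf : f = eqToHom (by rw [h]) ≫ f') :
    X.X.map f (X.cochainsEval σ c) = X.X.map f' (X.cochainsEval σ' c) := by
  subst h
  rw [hf, eqToHom_refl, Category.id_comp]

/-- The cone on a chain, as a chain. -/
abbrev coneChain {I : Type*} [Category* I] {n : ℕ} (σ : Fin (n + 1) ⥤ I) {T : I}
    (h : T ⟶ σ.obj 0) : Fin (n + 2) ⥤ I :=
  ComposableArrows.precomp (n := n) σ h

/-- The morphism from the first object of a chain to the first object of a face. -/
abbrev faceFirst {n : ℕ} {I : Type*} [Category* I] (k : Fin (n + 2)) (σ : Fin (n + 2) ⥤ I) :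
    σ.obj 0 ⟶ (face k σ).obj 0 :=
  σ.map (homOfLE (Fin.zero_le (k.succAbove 0)))

/-- The identity of the last object of a chain, as a morphism from the last object of a cone. -/
def coneLast {I : Type*} [Category* I] {n : ℕ} (σ : Fin (n + 1) ⥤ I) {T : I} (h : T ⟶ σ.obj 0) :
    (coneChain σ h).obj (Fin.last (n + 1)) ⟶ σ.obj (Fin.last n) := 𝟙 (σ.obj (Fin.last n))

lemma neg_sum_signs {A : Type*} [AddCommGroup A] {n : ℕ} (a : Fin (n + 1) → A) :
    -∑ k : Fin n, (-1 : ℤ) ^ (k.succ : ℕ) • a k.succ = ∑ k : Fin n, (-1 : ℤ) ^ (k : ℕ) • a k.succ := by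
  rw [← Finset.sum_neg_distrib]
  refine Finset.sum_congr rfl fun k _ => ?_
  rw [Fin.val_succ, pow_succ, mul_neg_one, neg_smul, neg_neg]

/-- Evaluate the cocycle condition at the cone on `σ`. The `0`-th face is `σ`, the others are cones
on the faces of `σ`, and the shift of the index by one compensates the sign. This says that
evaluation on cones is a contracting homotopy. -/
lemma eq_sum_cone {n : ℕ} (c : X.Cochains (n + 1)) (hc : X.cochainsD (n + 1) c = 0)
    (σ : Fin (n + 2) ⥤ X.I) {T : X.I} (h : T ⟶ σ.obj 0) :
    X.cochainsEval σ c = ∑ k : Fin (n + 2), (-1 : ℤ) ^ (k : ℕ) • X.X.map (faceLast k σ)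
      (X.X.map (coneLast (face k σ) (h ≫ faceFirst k σ))
        (X.cochainsEval (coneChain (face k σ) (h ≫ faceFirst k σ)) c)) := by
  have h0 := (X.cochainsD_apply c (coneChain σ h)).symm
  rw [hc, map_zero, Fin.sum_univ_succ, add_eq_zero_iff_eq_neg] at h0
  have h1 : X.cochainsEval σ c = (-1 : ℤ) ^ ((0 : Fin (n + 3)) : ℕ) •
      X.X.map (faceLast 0 (coneChain σ h)) (X.cochainsEval (face 0 (coneChain σ h)) c) := by
    rw [Fin.val_zero, pow_zero, one_zsmul]
    exact congr($((congrArg X.X.map (σ.map_id _)).trans (X.X.map_id _)) _).symm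
  refine h1.trans ((h0.trans (neg_sum_signs fun k => X.X.map (faceLast k (coneChain σ h))
    (X.cochainsEval (face k (coneChain σ h)) c))).trans ?_)
  refine Finset.sum_congr rfl fun k _ => congrArg _ ?_
  refine (cochains_congr c (face_succ_precomp k σ h) _
    (coneLast (face k σ) (h ≫ faceFirst k σ) ≫ faceLast k σ) ?_).trans ?_
  · refine ((coneChain σ h).map_eq_of_eq _ (Fin.le_last (k.succAbove (Fin.last n)).succ)
      (Fin.succ_succAbove_succ k (Fin.last n)) rfl).trans ?_
    rw [eqToHom_refl, Category.comp_id]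
    exact congrArg (_ ≫ ·) (Category.id_comp (faceLast k σ)).symm
  · exact congr($(X.X.map_comp (coneLast (face k σ) (h ≫ faceFirst k σ)) (faceLast k σ)) _)

/-- On finitely many chains, a cocycle of positive degree is a coboundary. -/
lemma exists_local_primitive {n : ℕ} (c : X.Cochains (n + 1)) (hc : X.cochainsD (n + 1) c = 0)
    (P : Set (Fin (n + 2) ⥤ X.I)) (hP : P.Finite) :
    ∃ g : X.Cochains n, ∀ σ ∈ P, X.cochainsEval σ (X.cochainsD n g) = X.cochainsEval σ c := by
  classical
  let O : Finset X.I := hP.toFinset.biUnion fun σ => Finset.univ.image σ.obj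
  have hO : ∀ σ ∈ P, ∀ k, σ.obj k ∈ O := fun σ hσ k =>
    Finset.mem_biUnion.2 ⟨σ, hP.mem_toFinset.2 hσ, Finset.mem_image_of_mem _ (Finset.mem_univ _)⟩
  -- Only morphisms from the first vertex are needed: a face of `σ` starts at some vertex of `σ`,
  -- and its cone leg has to be the one of `σ` followed by the morphism to that vertex.
  let H : Finset (Σ' (i j : X.I) (_ : i ∈ O) (_ : j ∈ O), i ⟶ j) :=
    hP.toFinset.attach.biUnion fun σ => Finset.univ.image fun k =>
      ⟨σ.1.obj 0, σ.1.obj k, hO _ (hP.mem_toFinset.1 σ.2) _, hO _ (hP.mem_toFinset.1 σ.2) _,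
        σ.1.map (homOfLE (Fin.zero_le k))⟩
  -- Cofilteredness provides one cone vertex for all chains in `P` simultaneously.
  obtain ⟨T, t, ht⟩ := IsCofiltered.inf_exists O H
  -- The value `0` is irrelevant: every face of a chain in `P` starts at an object of `O`.
  let g : X.Cochains n := ModuleCat.piMk _ fun τ =>
    if h : τ.obj 0 ∈ O then X.X.map (coneLast τ (t h)) (X.cochainsEval (coneChain τ (t h)) c)
    else 0
  refine ⟨g, fun σ hσ => ?_⟩
  refine (X.cochainsD_apply g σ).trans ((eq_sum_cone c hc σ (t (hO σ hσ 0))).trans ?_).symm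
  refine Finset.sum_congr rfl fun k _ => congrArg _ (congrArg _ ?_)
  have h : (face k σ).obj 0 ∈ O := hO σ hσ _
  have e : t (hO σ hσ 0) ≫ faceFirst k σ = t h := by
    refine ht _ _ (Finset.mem_biUnion.2 ⟨⟨σ, hP.mem_toFinset.2 hσ⟩, Finset.mem_attach _ _,
      Finset.mem_image.2 ⟨k.succAbove 0, Finset.mem_univ _, rfl⟩⟩)
  rw [e]
  exact (dif_pos (t := fun h : (face k σ).obj 0 ∈ O =>
    X.X.map (coneLast (face k σ) (t h)) (X.cochainsEval (coneChain (face k σ) (t h)) c))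
    (e := fun _ => 0) h).symm

end InvSystem

end

noncomputable section

/-! ### Coinduced diagrams are acyclic -/

namespace ModuleCat

variable {R : Type} [Ring R] {α : Type u}

/-- The free module on a type. -/
def freeObj (R : Type) [Ring R] (α : Type u) : ModuleCat.{u} R := ModuleCat.of R (α →₀ R)

variable (R) in
/-- The generators of a free module. -/
def gen (a : α) : freeObj R α := Finsupp.single a (1 : R)

/-- The morphism from a free module with given values at the generators. -/
def descFree {M : ModuleCat.{u} R} (f : α → M) : freeObj R α ⟶ M :=
  ModuleCat.ofHom (Finsupp.linearCombination R f)

@[simp] lemma descFree_gen {M : ModuleCat.{u} R} (f : α → M) (a : α) :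
    descFree f (gen R a) = f a :=
  (Finsupp.linearCombination_single R 1 a).trans (one_smul R (f a))

lemma freeObj_hom_ext {M : ModuleCat.{u} R} {f g : freeObj R α ⟶ M}
    (h : ∀ a, f (gen R a) = g (gen R a)) : f = g :=
  ModuleCat.hom_ext (Finsupp.lhom_ext' fun a => LinearMap.ext_ring (h a))

/-- An element of a free module involves only the finitely many generators in its support. Through
this, statements about finite sets of chains suffice. -/
lemma exists_finite_descFree (x : freeObj R α) : ∃ P : Set α, P.Finite ∧
    ∀ {M : ModuleCat.{u} R} (f f' : α → M), (∀ a ∈ P, f a = f' a) → descFree f x = descFree f' x :=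
  let x' : α →₀ R := x
  ⟨_, x'.support.finite_toSet, fun _ _ h =>
    Finset.sum_congr rfl fun a ha => congrArg (x' a • ·) (h a ha)⟩

lemma exists_extension {A B M : ModuleCat.{u} R} [Injective M] (e : A ⟶ B) (f : A ⟶ M)
    (h : ∀ x, e x = 0 → f x = 0) : ∃ g : B ⟶ M, e ≫ g = f := by
  have hS : (ShortComplex.mk (kernel.ι e) e (kernel.condition e)).Exact :=
    ShortComplex.exact_of_f_is_kernel _ (kernelIsKernel _)
  have hf : kernel.ι e ≫ f = 0 := by
    ext x
    exact h _ (congr($(kernel.condition e) x))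
  exact ⟨hS.descToInjective f hf, hS.comp_descToInjective f hf⟩

end ModuleCat

namespace InvSystem

variable {I J : Type u} [SmallCategory I] [SmallCategory J]

/-- The product of the diagrams coinduced from the values `M i`. -/
def coind (M : I → AB.{u}) : I ⥤ AB.{u} where
  obj k := ModuleCat.piObj fun p : Σ i, (k ⟶ i) => M p.1
  map {k l} f := ModuleCat.piLift fun p =>
    ModuleCat.piEval (fun p : Σ i, (k ⟶ i) => M p.1) ⟨p.1, f ≫ p.2⟩
  map_id k := by
    refine ModuleCat.hom_ext (LinearMap.ext fun x => ModuleCat.pi_ext fun p => ?_)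
    change ModuleCat.piEval _ (⟨p.1, 𝟙 k ≫ p.2⟩ : Σ i, (k ⟶ i)) x = _
    rw [Category.id_comp]
    rfl
  map_comp {k l m} f g := by
    refine ModuleCat.hom_ext (LinearMap.ext fun x => ModuleCat.pi_ext fun p => ?_)
    change ModuleCat.piEval _ (⟨p.1, (f ≫ g) ≫ p.2⟩ : Σ i, (k ⟶ i)) x =
      ModuleCat.piEval _ (⟨p.1, f ≫ g ≫ p.2⟩ : Σ i, (k ⟶ i)) x
    rw [Category.assoc]

/-- The coordinates of a coinduced diagram. -/
def coindEval (M : I → AB.{u}) {k i : I} (a : k ⟶ i) : (coind M).obj k ⟶ M i :=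
  ModuleCat.piEval (fun p : Σ i, (k ⟶ i) => M p.1) ⟨i, a⟩

lemma coind_ext {M : I → AB.{u}} {k : I} {x y : (coind M).obj k}
    (h : ∀ i (a : k ⟶ i), coindEval M a x = coindEval M a y) : x = y :=
  ModuleCat.pi_ext fun p => h p.1 p.2

/-- The morphism to a coinduced diagram with given coordinates. -/
def toCoind {M : I → AB.{u}} (A : I ⥤ AB.{u}) (e : ∀ i, A.obj i ⟶ M i) : A ⟶ coind M where
  app k := ModuleCat.piLift fun p => A.map p.2 ≫ e p.1
  naturality k l f := by
    ext x
    refine ModuleCat.pi_ext fun p => ?_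
    change e p.1 (A.map p.2 (A.map f x)) = e p.1 (A.map (f ≫ p.2) x)
    rw [A.map_comp]
    rfl

/-- The coordinate at the identity of `k` recovers `e k`. -/
lemma mono_toCoind {M : I → AB.{u}} (A : I ⥤ AB.{u}) (e : ∀ i, A.obj i ⟶ M i)
    [∀ i, Mono (e i)] : Mono (toCoind A e) := by
  have (k : I) : Mono ((toCoind A e).app k) := by
    have h : (toCoind A e).app k ≫ coindEval M (𝟙 k) = e k :=
      (congrArg (· ≫ e k) (A.map_id k)).trans (Category.id_comp _)
    have : Mono ((toCoind A e).app k ≫ coindEval M (𝟙 k)) := by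
      rw [h]
      infer_instance
    exact mono_of_mono _ (coindEval M (𝟙 k))
  exact NatTrans.mono_of_mono_app _

section

variable [IsCofiltered J] (φ : J ⥤ I) (M : I → AB.{u})

/-- The index set of the coordinates in `M i` of cochains with values in a coinduced diagram. -/
abbrev CoindIndex (n : ℕ) (i : I) : Type u :=
  Σ σ : Fin (n + 1) ⥤ J, (φ.obj (σ.obj (Fin.last n)) ⟶ i)

/-- The inverse system obtained by restriction of a coinduced diagram. -/
abbrev coindSystem : InvSystem.{u} AB.{u} := ⟨J, φ ⋙ coind M⟩

variable {φ M}

/-- The coordinates of cochains with values in a coinduced diagram. -/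
def coindCoord {n : ℕ} {i : I} (p : CoindIndex φ n i) : (coindSystem φ M).Cochains n ⟶ M i :=
  (coindSystem φ M).cochainsEval p.1 ≫ coindEval M p.2

lemma coindCoord_ext {n : ℕ} {c c' : (coindSystem φ M).Cochains n}
    (h : ∀ i (p : CoindIndex φ n i), coindCoord p c = coindCoord p c') : c = c' :=
  cochains_ext fun σ => coind_ext fun i a => h i ⟨σ, a⟩

lemma exists_coindCoord {n : ℕ} (a : ∀ i, CoindIndex φ n i → M i) :
    ∃ c : (coindSystem φ M).Cochains n, ∀ i p, coindCoord p c = a i p :=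
  ⟨ModuleCat.piMk _ fun σ => ModuleCat.piMk _ fun p => a p.1 ⟨σ, p.2⟩, fun _ _ => rfl⟩

variable (φ) in
/-- The boundary operator dual to the differential of cochains. -/
def coindBoundary (n : ℕ) (i : I) : ModuleCat.freeObj ℤ (CoindIndex φ (n + 1) i) ⟶
    ModuleCat.freeObj ℤ (CoindIndex φ n i) :=
  ModuleCat.descFree fun p => ∑ k : Fin (n + 2), (-1 : ℤ) ^ (k : ℕ) •
    ModuleCat.gen ℤ (⟨face k p.1, φ.map (faceLast k p.1) ≫ p.2⟩ : CoindIndex φ n i)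

/-- The `i`-coordinates of a cochain form a homomorphism from the free group on `CoindIndex` to `M
i`. In this description the differential is dual to `coindBoundary`. -/
lemma coindBoundary_descFree {n : ℕ} (i : I) (g : (coindSystem φ M).Cochains n) :
    coindBoundary φ n i ≫ ModuleCat.descFree (fun p => coindCoord p g) =
      ModuleCat.descFree (fun p => coindCoord p ((coindSystem φ M).cochainsD n g)) := by
  refine ModuleCat.freeObj_hom_ext fun p => ?_
  refine (congrArg (ConcreteCategory.hom (ModuleCat.descFree fun p => coindCoord p g))
    (ModuleCat.descFree_gen (R := ℤ) _ p)).trans ?_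
  refine Eq.trans ?_ (ModuleCat.descFree_gen _ p).symm
  refine Eq.trans ?_ (congrArg (coindEval M p.2)
    ((coindSystem φ M).cochainsD_apply g p.1)).symm
  rw [map_sum, map_sum]
  refine Finset.sum_congr rfl fun k _ => ?_
  rw [map_zsmul, map_zsmul, ModuleCat.descFree_gen]
  rfl

/-- The `i`-coordinates of `c` define a homomorphism to the injective group `M i`. It extends along
the boundary operator as soon as it kills the kernel of the latter. An element of that kernel
involves finitely many chains, and on these `c` is a coboundary. The extension, evaluated at the
generators, is the primitive. -/
lemma exists_primitive [∀ i, Injective (M i)] {n : ℕ}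
    (c : (coindSystem φ M).Cochains (n + 1)) (hc : (coindSystem φ M).cochainsD (n + 1) c = 0) :
    ∃ g, (coindSystem φ M).cochainsD n g = c := by
  have h (i : I) : ∃ g : ModuleCat.freeObj ℤ (CoindIndex φ n i) ⟶ M i,
      coindBoundary φ n i ≫ g = ModuleCat.descFree fun p => coindCoord p c := by
    refine ModuleCat.exists_extension _ _ fun x hx => ?_
    obtain ⟨P, hP, hx'⟩ := ModuleCat.exists_finite_descFree x
    obtain ⟨g, hg⟩ := exists_local_primitive c hc (Sigma.fst '' P) (hP.image _)
    -- At `x`, the cocycle `c` may be replaced by the coboundary of the local primitive `g`; its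
    -- value is then that of `g` at the boundary of `x`, which is zero.
    refine (hx' _ (fun p => coindCoord p ((coindSystem φ M).cochainsD n g)) fun p hp =>
      congrArg (coindEval M p.2) (hg p.1 ⟨p, hp, rfl⟩).symm).trans ?_
    refine (congr($(coindBoundary_descFree i g) x)).symm.trans ?_
    exact (congrArg (ModuleCat.descFree fun p => coindCoord p g) hx).trans (map_zero _)
  choose g hg using h
  obtain ⟨b, hb⟩ := exists_coindCoord (φ := φ) (n := n) fun i p => g i (ModuleCat.gen ℤ p)
  refine ⟨b, coindCoord_ext fun i p => ?_⟩
  have e : ModuleCat.descFree (fun p => coindCoord p b) = g i :=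
    ModuleCat.freeObj_hom_ext fun p => (ModuleCat.descFree_gen _ p).trans (hb i p)
  have e' := (coindBoundary_descFree i b).symm.trans ((congrArg _ e).trans (hg i))
  exact (ModuleCat.descFree_gen _ p).symm.trans
    (congr($e' (ModuleCat.gen ℤ p)).trans (ModuleCat.descFree_gen _ p))

end

/-- The cohomology of the complex of cochains. -/
abbrev cohomology (s : ℕ) : InvSystem.{u} AB.{u} ⥤ AB.{u} :=
  cochains ⋙ HomologicalComplex.homologyFunctor AB.{u} _ s

lemma subsingleton_cohomology_coindSystem [IsCofiltered J] (φ : J ⥤ I) (M : I → AB.{u})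
    [∀ i, Injective (M i)] (s : ℕ) : Subsingleton ((cohomology (s + 1)).obj (coindSystem φ M)) := by
  refine subsingleton_of_forall_eq 0 fun a => ?_
  obtain ⟨x, hx, rfl⟩ := HomologicalComplex.exists_cls
    (K := cochains.obj (coindSystem φ M)) (p := s + 1) a
  obtain ⟨y, hy⟩ := exists_primitive x (hx (s + 2))
  exact HomologicalComplex.cls_eq_zero_of_eq_d _ y hy

end InvSystem

end

noncomputable section

/-! ### The long exact cohomology sequence -/

namespace InvSystem

variable {I J : Type u} [SmallCategory I] [SmallCategory J] [IsCofiltered I] [IsCofiltered J]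

/-- An `I`-diagram as an inverse system. -/
abbrev of (A : I ⥤ AB.{u}) : InvSystem.{u} AB.{u} := ⟨I, A⟩

/-- A morphism of inverse systems given by a functor and a natural transformation. -/
abbrev ofHom (φ : J ⥤ I) {A : I ⥤ AB.{u}} {B : J ⥤ AB.{u}} (ψ : φ ⋙ A ⟶ B) : of A ⟶ of B :=
  Hom.mk φ ψ

/-- A morphism of diagrams with the same index category, as a morphism of inverse systems. -/
abbrev diagHom {A B : I ⥤ AB.{u}} (τ : A ⟶ B) : of A ⟶ of B := ofHom (𝟭 I) (A.leftUnitor.hom ≫ τ)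

lemma Hom.ext' {C : Type w} [Category.{v} C] {X Y : InvSystem.{u} C} {φ : Y.I ⥤ X.I}
    {ψ ψ' : φ ⋙ X.X ⟶ Y.X} (h : ∀ j, ψ.app j = ψ'.app j) :
    (Hom.mk φ ψ : X ⟶ Y) = Hom.mk φ ψ' :=
  congrArg (Hom.mk φ) (NatTrans.ext (funext h))

lemma diagHom_comp {A B D : I ⥤ AB.{u}} (τ : A ⟶ B) (τ' : B ⟶ D) :
    diagHom τ ≫ diagHom τ' = diagHom (τ ≫ τ') := by
  refine Hom.ext' (X := of A) (Y := of D) fun j => ?_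
  refine (comp_ψ_app (diagHom τ) (diagHom τ') j).trans ?_
  change (𝟙 _ ≫ τ.app j) ≫ 𝟙 _ ≫ τ'.app j = 𝟙 _ ≫ (τ ≫ τ').app j
  simp

lemma diagHom_id (A : I ⥤ AB.{u}) : diagHom (𝟙 A) = 𝟙 (of A) :=
  Hom.ext' (X := of A) (Y := of A) fun _ => Category.comp_id _

lemma diagHom_ofHom (φ : J ⥤ I) {A A' : I ⥤ AB.{u}} {B B' : J ⥤ AB.{u}} (τ : A ⟶ A')
    (τ' : B ⟶ B') (ψ : φ ⋙ A ⟶ B) (ψ' : φ ⋙ A' ⟶ B')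
    (h : ∀ j, ψ.app j ≫ τ'.app j = τ.app (φ.obj j) ≫ ψ'.app j) :
    diagHom τ ≫ ofHom φ ψ' = ofHom φ ψ ≫ diagHom τ' := by
  refine Hom.ext' (X := of A) (Y := of B') fun j => ?_
  refine (comp_ψ_app (diagHom τ) (ofHom φ ψ') j).trans
    (Eq.trans ?_ (comp_ψ_app (ofHom φ ψ) (diagHom τ') j).symm)
  change (𝟙 _ ≫ τ.app (φ.obj j)) ≫ ψ'.app j = ψ.app j ≫ 𝟙 _ ≫ τ'.app j
  rw [Category.id_comp, Category.id_comp, h]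

/-- The sequence of complexes of cochains associated with a sequence of diagrams. -/
def cochainsSES (S : ShortComplex (I ⥤ AB.{u})) : ShortComplex (CochainComplex AB.{u} ℕ) :=
  ShortComplex.mk (cochains.map (diagHom S.f)) (cochains.map (diagHom S.g)) (by
    refine HomologicalComplex.hom_ext _ _ fun n => ModuleCat.hom_ext (LinearMap.ext fun c => ?_)
    exact cochains_ext (X := of S.X₃) fun σ => congr($(congr_app S.zero (σ.obj (Fin.last n))) _))

/-- In each degree the cochains are a product of values of the diagram, and products of abelian
groups are exact. -/
lemma cochainsSES_shortExact {S : ShortComplex (I ⥤ AB.{u})} (hS : S.ShortExact) :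
    (cochainsSES S).ShortExact := by
  have h (i : I) := hS.map_of_exact ((evaluation I AB.{u}).obj i)
  refine HomologicalComplex.shortExact_of_degreewise_shortExact _ fun n =>
    ShortComplex.ShortExact.mk' ?_ ?_ ?_
  · refine (ShortComplex.moduleCat_exact_iff _).2 fun (c : (of S.X₂).Cochains n) hc => ?_
    have e (σ : Fin (n + 1) ⥤ I) := (ShortComplex.moduleCat_exact_iff _).1
      (h (σ.obj (Fin.last n))).exact ((of S.X₂).cochainsEval σ c)
      congr((of S.X₃).cochainsEval σ $hc)
    choose b hb using e
    exact ⟨ModuleCat.piMk _ b, cochains_ext (X := of S.X₂) hb⟩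
  · refine (ModuleCat.mono_iff_injective _).2 fun c c' hc =>
      cochains_ext (X := of S.X₁) fun σ => ?_
    exact (ModuleCat.mono_iff_injective _).1 (h (σ.obj (Fin.last n))).mono_f
      congr((of S.X₂).cochainsEval σ $hc)
  · refine (ModuleCat.epi_iff_surjective _).2 fun c => ?_
    have e (σ : Fin (n + 1) ⥤ I) := (ModuleCat.epi_iff_surjective _).1
      (h (σ.obj (Fin.last n))).epi_g ((of S.X₃).cochainsEval σ c)
    choose b hb using e
    exact ⟨ModuleCat.piMk _ b, cochains_ext (X := of S.X₃) hb⟩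

/-- A morphism of sequences of complexes of cochains. -/
def cochainsSESMap (φ : J ⥤ I) {S : ShortComplex (I ⥤ AB.{u})} {S' : ShortComplex (J ⥤ AB.{u})}
    (ψ : S.map (restr φ) ⟶ S') : cochainsSES S ⟶ cochainsSES S' where
  τ₁ := cochains.map (ofHom φ ψ.τ₁)
  τ₂ := cochains.map (ofHom φ ψ.τ₂)
  τ₃ := cochains.map (ofHom φ ψ.τ₃)
  comm₁₂ := ((cochains.map_comp _ _).symm.trans (congrArg cochains.map
    (diagHom_ofHom φ S.f S'.f ψ.τ₁ ψ.τ₂ fun j => congr_app ψ.comm₁₂ j).symm)).trans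
    (cochains.map_comp _ _)
  comm₂₃ := ((cochains.map_comp _ _).symm.trans (congrArg cochains.map
    (diagHom_ofHom φ S.g S'.g ψ.τ₂ ψ.τ₃ fun j => congr_app ψ.comm₂₃ j).symm)).trans
    (cochains.map_comp _ _)

section

variable {S : ShortComplex (I ⥤ AB.{u})} (hS : S.ShortExact) (s : ℕ)

/-- The connecting homomorphism of the long exact cohomology sequence. -/
def cohomologyδ : (cohomology s).obj (of S.X₃) ⟶ (cohomology (s + 1)).obj (of S.X₁) :=
  (cochainsSES_shortExact hS).δ s (s + 1) rfl

lemma cohomologyδ_eq_zero_iff (x : (cohomology s).obj (of S.X₃)) :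
    cohomologyδ hS s x = 0 ↔ ∃ y, (cohomology s).map (diagHom S.g) y = x :=
  ⟨(ShortComplex.moduleCat_exact_iff _).1
    ((cochainsSES_shortExact hS).homology_exact₃ s (s + 1) rfl) x, fun ⟨y, hy⟩ => by
      rw [← hy]
      exact (ShortComplex.mk _ _ ((cochainsSES_shortExact hS).comp_δ s (s + 1)
        rfl)).moduleCat_zero_apply y⟩

lemma exists_cohomologyδ (x : (cohomology (s + 1)).obj (of S.X₁))
    (hx : (cohomology (s + 1)).map (diagHom S.f) x = 0) : ∃ y, cohomologyδ hS s y = x :=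
  (ShortComplex.moduleCat_exact_iff _).1
    ((cochainsSES_shortExact hS).homology_exact₁ s (s + 1) rfl) x hx

lemma cohomologyδ_naturality (φ : J ⥤ I) {S' : ShortComplex (J ⥤ AB.{u})} (hS' : S'.ShortExact)
    (ψ : S.map (restr φ) ⟶ S') :
    cohomologyδ hS s ≫ (cohomology (s + 1)).map (ofHom φ ψ.τ₁) =
      (cohomology s).map (ofHom φ ψ.τ₃) ≫ cohomologyδ hS' s :=
  HomologicalComplex.HomologySequence.δ_naturality (cochainsSESMap φ ψ)
    (cochainsSES_shortExact hS) (cochainsSES_shortExact hS') s (s + 1) rfl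

end

/-! ### Cohomology in degree zero -/

section

variable (X : InvSystem.{u} AB.{u})

/-- The cochain of degree `0` given by an element of the limit. -/
def limToCochains : limit X.X ⟶ X.Cochains 0 :=
  ModuleCat.piLift fun σ => limit.π X.X (σ.obj (Fin.last 0))

lemma cochainsD_zero_apply (c : X.Cochains 0) (σ : Fin 2 ⥤ X.I) :
    X.cochainsEval σ (X.cochainsD 0 c) = X.X.map (faceLast 0 σ) (X.cochainsEval (face 0 σ) c) -
      X.X.map (faceLast 1 σ) (X.cochainsEval (face 1 σ) c) := by
  refine (X.cochainsD_apply c σ).trans ?_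
  rw [Fin.sum_univ_two, Fin.val_zero, Fin.val_one, pow_zero, pow_one, one_zsmul, neg_one_zsmul,
    sub_eq_add_neg]

lemma cochainsD_limToCochains (x : (limit X.X : AB.{u})) :
    X.cochainsD 0 (limToCochains X x) = 0 := by
  refine cochains_ext fun σ => (X.cochainsD_zero_apply _ σ).trans ?_
  rw [map_zero, sub_eq_zero]
  exact congr($((limit.w X.X (faceLast 0 σ)).trans (limit.w X.X (faceLast 1 σ)).symm) x)

lemma AB.exists_limit {K : Type*} [Category* K] (F : K ⥤ AB.{u}) [HasLimit F] (a : ∀ k, F.obj k)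
    (ha : ∀ {k l} (f : k ⟶ l), F.map f (a k) = a l) :
    ∃ x : (limit F : AB.{u}), ∀ k, limit.π F k x = a k := by
  let c : Cone F := Cone.mk (AB.unitModule ℤ)
    { app k := AB.ofElement (a k)
      naturality k l f := (Category.id_comp _).trans
        ((AB.ofElement_comp _ _).trans (congrArg AB.ofElement (ha f))).symm }
  exact ⟨limit.lift F c (AB.unitGen ℤ), fun k =>
    congr($(limit.lift_π c k) (AB.unitGen ℤ)).trans (AB.ofElement_gen _)⟩

lemma AB.limit_ext {K : Type*} [Category* K] {F : K ⥤ AB.{u}} [HasLimit F] {x y : (limit F : AB.{u})}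
    (h : ∀ k, limit.π F k x = limit.π F k y) : x = y := by
  have e : AB.ofElement x = AB.ofElement y := limit.hom_ext fun k =>
    (AB.ofElement_comp _ _).trans ((congrArg AB.ofElement (h k)).trans (AB.ofElement_comp _ _).symm)
  exact (AB.ofElement_gen x).symm.trans (congr($e (AB.unitGen ℤ)).trans (AB.ofElement_gen y))

lemma limToCochains_injective : Function.Injective (limToCochains X) := fun _ _ h =>
  AB.limit_ext fun k => congr(X.cochainsEval (ComposableArrows.mk₀ k) $h)

/-- The cocycle condition at the chain `f : k ⟶ l` says that `X f` maps the value at `k` to the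
value at `l`: the faces `1` and `0` of this chain are its source and its target. -/
lemma exists_limToCochains (c : X.Cochains 0) (hc : X.cochainsD 0 c = 0) :
    ∃ x, limToCochains X x = c := by
  obtain ⟨x, hx⟩ := AB.exists_limit X.X
    (fun k => X.cochainsEval (ComposableArrows.mk₀ k) c) (by
      intro k l f
      have h := X.cochainsD_zero_apply c (ComposableArrows.mk₁ f)
      rw [hc, map_zero] at h
      have h := (sub_eq_zero.1 h.symm).symm
      refine Eq.trans ?_ (h.trans ?_)
      · refine cochains_congr c (σ := ComposableArrows.mk₀ k)
          (σ' := face 1 (ComposableArrows.mk₁ f)) (ComposableArrows.ext₀ rfl) f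
          (faceLast 1 (ComposableArrows.mk₁ f)) ?_
        exact (Category.id_comp _).symm
      · refine (cochains_congr c (σ := face 0 (ComposableArrows.mk₁ f))
          (σ' := ComposableArrows.mk₀ l) (ComposableArrows.ext₀ rfl)
          (faceLast 0 (ComposableArrows.mk₁ f)) (𝟙 l) ?_).trans congr($(X.X.map_id l) _)
        exact (Category.comp_id (𝟙 l)).symm)
  refine ⟨x, cochains_ext fun σ => ?_⟩
  obtain ⟨k, rfl⟩ := ComposableArrows.mk₀_surjective σ
  exact hx k

lemma limToCochains_cycle (x : (limit X.X : AB.{u})) (q : ℕ) :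
    (cochains.obj X).d 0 q (limToCochains X x) = 0 := by
  by_cases h : 0 + 1 = q
  · subst h
    exact cochainsD_limToCochains X x
  · rw [(cochains.obj X).shape _ _ h]
    rfl

/-- The map from the limit to the cohomology in degree `0`. -/
def limToCohomology : limit X.X ⟶ (cohomology 0).obj X :=
  (cochains.obj X).liftCycles (limToCochains X) _ rfl
    (ModuleCat.hom_ext (LinearMap.ext fun x => limToCochains_cycle X x _)) ≫
      (cochains.obj X).homologyπ 0

lemma limToCohomology_apply (x : (limit X.X : AB.{u})) :
    limToCohomology X x = HomologicalComplex.cls (K := cochains.obj X)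
      (limToCochains X x) (limToCochains_cycle X x) := by
  have h : (cochains.obj X).liftCycles (limToCochains X) _ rfl
      (ModuleCat.hom_ext (LinearMap.ext fun x => limToCochains_cycle X x _)) ≫
        (cochains.obj X).iCycles 0 = limToCochains X := HomologicalComplex.liftCycles_i _ _ _ _ _
  exact HomologicalComplex.homologyπ_eq _ _ _ (congr($h x))

lemma limToCohomology_bijective : Function.Bijective (limToCohomology X) := by
  constructor
  · refine (injective_iff_map_eq_zero _).2 fun x hx => ?_
    rw [limToCohomology_apply] at hx
    obtain ⟨y, hy⟩ := HomologicalComplex.exists_of_cls_eq_zero rfl hx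
    refine limToCochains_injective X (Eq.trans ?_ (map_zero _).symm)
    rw [← hy, (cochains.obj X).shape _ _ (by simp)]
    rfl
  · intro a
    obtain ⟨c, hc, rfl⟩ := HomologicalComplex.exists_cls (K := cochains.obj X) (p := 0) a
    obtain ⟨x, rfl⟩ := exists_limToCochains X c (hc 1)
    exact ⟨x, limToCohomology_apply X x⟩

end

/-- The cohomology in degree `0` is the limit. -/
def limIsoCohomology : limFunctor.{u} ≅ cohomology 0 :=
  NatIso.ofComponents (fun X =>
    @asIso _ _ _ _ (limToCohomology X)
      ((ConcreteCategory.isIso_iff_bijective _).2 (limToCohomology_bijective X))) fun {X Y} f => by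
    refine ModuleCat.hom_ext (LinearMap.ext fun x => ?_)
    refine (limToCohomology_apply Y _).trans
      (Eq.trans ?_ (congrArg ((cohomology 0).map f) (limToCohomology_apply X x)).symm)
    refine Eq.trans ?_ (HomologicalComplex.homologyMap_cls _ _).symm
    refine HomologicalComplex.cls_congr ?_ _
    exact cochains_ext (X := Y) fun σ => congr($(limAlong_π (Hom.φ f) (Hom.ψ f) _) x)

lemma invertsInitial_limFunctor : InvertsInitial limFunctor.{u} := fun Y J _ _ φ _ => by
  have h : limFunctor.map (Y.toReindex φ) = limit.pre Y.X φ := limit.hom_ext fun j =>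
    (limAlong_π φ (𝟙 (φ ⋙ Y.X)) j).trans ((Category.comp_id _).trans (limit.pre_π _ _ _).symm)
  exact h ▸ Functor.Initial.limit_pre_isIso φ

/-! ### Cohomology and changes of the index category -/

section

variable (A : I ⥤ AB.{u})

/-- The embedding of a diagram in an acyclic diagram. -/
def toAcyclic : A ⟶ coind fun i => Injective.under (A.obj i) :=
  toCoind A fun i => Injective.ι (A.obj i)

instance : Mono (toAcyclic A) := mono_toCoind A _

/-- The embedding of a diagram in an acyclic diagram and its cokernel. -/
def acyclicSES : ShortComplex (I ⥤ AB.{u}) :=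
  ShortComplex.mk (toAcyclic A) (cokernel.π (toAcyclic A)) (cokernel.condition _)

omit [IsCofiltered I] in
lemma acyclicSES_shortExact : (acyclicSES A).ShortExact where
  exact := ShortComplex.exact_of_g_is_cokernel _ (cokernelIsCokernel _)
  mono_f := inferInstanceAs (Mono (toAcyclic A))
  epi_g := inferInstanceAs (Epi (cokernel.π (toAcyclic A)))

lemma subsingleton_cohomology_coind (M : I → AB.{u}) [∀ i, Injective (M i)] (s : ℕ) :
    Subsingleton ((cohomology (s + 1)).obj (of (coind M))) :=
  subsingleton_cohomology_coindSystem (𝟭 I) M s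

/-- An injective diagram is a retract of the acyclic coinduced diagram in which it embeds. -/
lemma subsingleton_cohomology_injective [Injective A] (s : ℕ) :
    Subsingleton ((cohomology (s + 1)).obj (of A)) := by
  have := subsingleton_cohomology_coind (fun i => Injective.under (A.obj i)) s
  have h : (cohomology (s + 1)).map (diagHom (toAcyclic A)) ≫
      (cohomology (s + 1)).map (diagHom (Injective.factorThru (𝟙 A) (toAcyclic A))) = 𝟙 _ := by
    rw [← Functor.map_comp, diagHom_comp, Injective.comp_factorThru, diagHom_id,
      CategoryTheory.Functor.map_id]
  refine ⟨fun x y => ?_⟩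
  refine congr($h x).symm.trans (Eq.trans ?_ congr($h y))
  exact congrArg ((cohomology (s + 1)).map (diagHom (Injective.factorThru (𝟙 A) (toAcyclic A))))
    (Subsingleton.elim _ _)

end

/-- Dimension shifting by `acyclicSES`, whose middle term has no cohomology in positive degrees
either before or after restriction along `φ`. Degree `0` is the invariance of limits. In the
induction step, `A` in degree `s + 1` is controlled by the middle term and the quotient in degree
`s`, so the induction runs over all diagrams. -/
lemma bijective_cohomology_reindex (s : ℕ) (φ : J ⥤ I) [φ.Initial] (A : I ⥤ AB.{u}) :
    Function.Bijective ((cohomology s).map (ofHom φ (𝟙 (φ ⋙ A)))) := by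
  induction s generalizing A with
  | zero =>
    have := (Pro.InvertsInitial.of_iso invertsInitial_limFunctor limIsoCohomology) (of A) J φ
    exact (ConcreteCategory.isIso_iff_bijective _).1 this
  | succ s ih =>
    let hS := acyclicSES_shortExact A
    have hS' : ((acyclicSES A).map (restr φ)).ShortExact := hS.map_of_exact (restr φ)
    have h1 : Subsingleton ((cohomology (s + 1)).obj (of (acyclicSES A).X₂)) :=
      subsingleton_cohomology_coind (fun i => Injective.under (A.obj i)) s
    have h2 : Subsingleton ((cohomology (s + 1)).obj (of ((acyclicSES A).map (restr φ)).X₂)) :=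
      subsingleton_cohomology_coindSystem φ (fun i => Injective.under (A.obj i)) s
    have hδ (z) : (cohomology (s + 1)).map (ofHom φ (𝟙 (φ ⋙ A))) (cohomologyδ hS s z) =
        cohomologyδ hS' s ((cohomology s).map (ofHom φ (𝟙 (φ ⋙ (acyclicSES A).X₃))) z) :=
      congr($(cohomologyδ_naturality hS s φ hS' (𝟙 _)) z)
    have hg (w) : (cohomology s).map (ofHom φ (𝟙 (φ ⋙ (acyclicSES A).X₃)))
        ((cohomology s).map (diagHom (acyclicSES A).g) w) =
          (cohomology s).map (diagHom ((acyclicSES A).map (restr φ)).g)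
            ((cohomology s).map (ofHom φ (𝟙 (φ ⋙ (acyclicSES A).X₂))) w) :=
      congr($(((cohomology s).map_comp _ _).symm.trans ((congrArg (cohomology s).map
        (diagHom_ofHom φ (acyclicSES A).g ((acyclicSES A).map (restr φ)).g (𝟙 _) (𝟙 _)
          fun j => (Category.id_comp _).trans (Category.comp_id _).symm)).trans
            ((cohomology s).map_comp _ _))) w)
    constructor
    · refine (injective_iff_map_eq_zero _).2 fun x hx => ?_
      obtain ⟨z, rfl⟩ := exists_cohomologyδ hS s x (Subsingleton.elim _ _)
      obtain ⟨w', hw'⟩ := (cohomologyδ_eq_zero_iff hS' s _).1 ((hδ z).symm.trans hx)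
      obtain ⟨w, rfl⟩ := (ih _).2 w'
      exact (cohomologyδ_eq_zero_iff hS s z).2 ⟨w, (ih _).1 ((hg w).trans hw')⟩
    · intro y
      obtain ⟨z', rfl⟩ := exists_cohomologyδ hS' s y (Subsingleton.elim _ _)
      obtain ⟨z, rfl⟩ := (ih _).2 z'
      exact ⟨_, hδ z⟩

lemma invertsInitial_cohomology (s : ℕ) : InvertsInitial (cohomology.{u} s) :=
  fun Y _ _ _ φ _ =>
    (ConcreteCategory.isIso_iff_bijective _).2 (bijective_cohomology_reindex s φ Y.X)

end InvSystem

end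

noncomputable section

/-! ### Cohomology and derived limits -/

namespace InvSystem

variable {I J : Type u} [SmallCategory I] [SmallCategory J]

section Resolution

variable {A : I ⥤ AB.{u}} (P : InjectiveResolution A)

/-- The short exact sequence of a diagram of cycles of an injective resolution. -/
def cyclesSES (b : ℕ) : ShortComplex (I ⥤ AB.{u}) :=
  ShortComplex.mk (P.cocomplex.iCycles b) (P.cocomplex.toCycles b (b + 1)) (by
    rw [← cancel_mono (P.cocomplex.iCycles (b + 1)), Category.assoc,
      HomologicalComplex.toCycles_i, HomologicalComplex.iCycles_d, zero_comp])

lemma cyclesSES_shortExact (b : ℕ) : (cyclesSES P b).ShortExact where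
  exact := ShortComplex.exact_of_f_is_kernel _ <| isKernelOfComp (P.cocomplex.iCycles (b + 1)) _
    (P.cocomplex.cyclesIsKernel b (b + 1) (by simp)) _ (P.cocomplex.toCycles_i b (b + 1))
  mono_f := inferInstanceAs (Mono (P.cocomplex.iCycles b))
  epi_g := Preadditive.epi_of_isZero_cokernel' _
    (P.cocomplex.homologyIsCokernel b (b + 1) (by simp))
    (P.cocomplex_exactAt_succ b).isZero_homology

/-- The diagram is the diagram of cycles in degree `0` of an injective resolution. -/
def isoCyclesZero : A ≅ P.cocomplex.cycles 0 :=
  have := (isResolution_injAug P).mono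
  (isResolution_injAug P).exact₀.fIsKernel.conePointUniqueUpToIso
    (P.cocomplex.cyclesIsKernel 0 1 (by simp))

lemma isoCyclesZero_hom_iCycles :
    (isoCyclesZero P).hom ≫ P.cocomplex.iCycles 0 = injAug P :=
  IsLimit.conePointUniqueUpToIso_hom_comp _ _ WalkingParallelPair.zero

lemma limMap_iCycles_injective (b : ℕ) :
    Function.Injective (lim.map (P.cocomplex.iCycles b) : limit _ ⟶ (limComplex P.cocomplex).X b) :=
  (ModuleCat.mono_iff_injective _).1 inferInstance

lemma exists_limMap_iCycles {b : ℕ} (x : (limComplex P.cocomplex).X b)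
    (hx : (limComplex P.cocomplex).d b (b + 1) x = 0) :
    ∃ z, (lim.map (P.cocomplex.iCycles b) : _ ⟶ (limComplex P.cocomplex).X b) z = x :=
  have h := (ShortComplex.exact_of_f_is_kernel (ShortComplex.mk _ _ (P.cocomplex.iCycles_d b (b + 1)))
    (P.cocomplex.cyclesIsKernel b (b + 1) (by simp))).map_of_mono_of_preservesKernel lim
      (inferInstanceAs (Mono (P.cocomplex.iCycles b))) inferInstance
  (ShortComplex.moduleCat_exact_iff _).1 h x hx

lemma limComplex_d_iCycles (b q : ℕ) (z : (limit (P.cocomplex.cycles b) : AB.{u})) :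
    (limComplex P.cocomplex).d b q (lim.map (P.cocomplex.iCycles b) z) = 0 :=
  congr($((lim.map_comp _ _).symm.trans ((congrArg lim.map (P.cocomplex.iCycles_d b q)).trans
    (lim.map_zero _ _))) z)

/-- The map from the limit of the cycles to the cohomology of the complex of limits. -/
def limCyclesToHomology (s : ℕ) :
    limit (P.cocomplex.cycles s) ⟶ (limComplex P.cocomplex).homology s :=
  (limComplex P.cocomplex).liftCycles (lim.map (P.cocomplex.iCycles s)) _ rfl
    (ModuleCat.hom_ext (LinearMap.ext fun z => limComplex_d_iCycles P s _ z)) ≫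
      (limComplex P.cocomplex).homologyπ s

lemma limCyclesToHomology_apply (s : ℕ) (z : (limit (P.cocomplex.cycles s) : AB.{u})) :
    limCyclesToHomology P s z = HomologicalComplex.cls (K := limComplex P.cocomplex)
      (lim.map (P.cocomplex.iCycles s) z) (fun q => limComplex_d_iCycles P s q z) := by
  have h : (limComplex P.cocomplex).liftCycles (lim.map (P.cocomplex.iCycles s)) _ rfl
    (ModuleCat.hom_ext (LinearMap.ext fun z => limComplex_d_iCycles P s _ z)) ≫
      (limComplex P.cocomplex).iCycles s = lim.map (P.cocomplex.iCycles s) :=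
    HomologicalComplex.liftCycles_i _ _ _ _ _
  exact HomologicalComplex.homologyπ_eq _ _ _ (congr($h z))

lemma limCyclesToHomology_surjective (s : ℕ) : Function.Surjective (limCyclesToHomology P s) := by
  intro a
  obtain ⟨x, hx, rfl⟩ := HomologicalComplex.exists_cls (K := limComplex P.cocomplex) (p := s) a
  obtain ⟨z, rfl⟩ := exists_limMap_iCycles P x (hx _)
  exact ⟨z, limCyclesToHomology_apply P s z⟩

lemma limCyclesToHomology_zero_injective : Function.Injective (limCyclesToHomology P 0) := by
  refine (injective_iff_map_eq_zero _).2 fun z hz => ?_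
  rw [limCyclesToHomology_apply] at hz
  obtain ⟨y, hy⟩ := HomologicalComplex.exists_of_cls_eq_zero rfl hz
  refine limMap_iCycles_injective P 0 (Eq.trans ?_ (map_zero _).symm)
  rw [← hy, (limComplex P.cocomplex).shape _ _ (by simp)]
  rfl

lemma limCyclesToHomology_succ_eq_zero_iff (b : ℕ)
    (z : (limit (P.cocomplex.cycles (b + 1)) : AB.{u})) :
    limCyclesToHomology P (b + 1) z = 0 ↔
      ∃ y : (limit (P.cocomplex.X b) : AB.{u}), lim.map (P.cocomplex.toCycles b (b + 1)) y = z := by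
  have h (y : (limit (P.cocomplex.X b) : AB.{u})) : lim.map (P.cocomplex.iCycles (b + 1))
      (lim.map (P.cocomplex.toCycles b (b + 1)) y) = (limComplex P.cocomplex).d b (b + 1) y :=
    congr($((lim.map_comp _ _).symm.trans
      (congrArg lim.map (P.cocomplex.toCycles_i b (b + 1)))) y)
  rw [limCyclesToHomology_apply]
  constructor
  · intro hz
    obtain ⟨y, hy⟩ := HomologicalComplex.exists_of_cls_eq_zero (o := b) (by simp) hz
    exact ⟨y, limMap_iCycles_injective P (b + 1) ((h y).trans hy)⟩
  · rintro ⟨y, rfl⟩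
    exact HomologicalComplex.cls_eq_zero_of_eq_d _ y (h y).symm

variable [IsCofiltered I]

/-- The iterated connecting homomorphism. -/
def cohomologyShift : ∀ (b k m : ℕ) (_ : k + b = m),
    (cohomology k).obj (of (P.cocomplex.cycles b)) ⟶ (cohomology m).obj (of (P.cocomplex.cycles 0))
  | 0, _, _, h => eqToHom (by subst h; rfl)
  | b + 1, k, m, h => cohomologyδ (cyclesSES_shortExact P b) k ≫
      cohomologyShift b (k + 1) m (by lia)

/-- The middle term of `cyclesSES` is injective, hence acyclic. So the connecting homomorphisms are
always onto, and from degree `1` on they are also injective. -/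
lemma cohomologyδ_surjective (b k : ℕ) :
    Function.Surjective (cohomologyδ (cyclesSES_shortExact P b) k) := by
  have : Subsingleton ((cohomology (k + 1)).obj (of (cyclesSES P b).X₂)) :=
    subsingleton_cohomology_injective (P.cocomplex.X b) k
  exact fun x => exists_cohomologyδ _ k x (Subsingleton.elim _ _)

lemma cohomologyδ_injective (b k : ℕ) :
    Function.Injective (cohomologyδ (cyclesSES_shortExact P b) (k + 1)) := by
  have : Subsingleton ((cohomology (k + 1)).obj (of (cyclesSES P b).X₂)) :=
    subsingleton_cohomology_injective (P.cocomplex.X b) k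
  refine (injective_iff_map_eq_zero _).2 fun x hx => ?_
  obtain ⟨y, rfl⟩ := (cohomologyδ_eq_zero_iff _ _ x).1 hx
  exact (congrArg _ (Subsingleton.elim y 0)).trans (map_zero _)

lemma cohomologyShift_surjective (b k m : ℕ) (h : k + b = m) :
    Function.Surjective (cohomologyShift P b k m h) := by
  induction b generalizing k with
  | zero =>
    subst h
    exact Function.surjective_id
  | succ b ih => exact (ih (k + 1) (by lia)).comp (cohomologyδ_surjective P b k)

lemma cohomologyShift_injective (b k m : ℕ) (h : (k + 1) + b = m) :
    Function.Injective (cohomologyShift P b (k + 1) m h) := by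
  induction b generalizing k with
  | zero =>
    subst h
    exact Function.injective_id
  | succ b ih => exact (ih (k + 1) (by lia)).comp (cohomologyδ_injective P b k)

/-- The map from the limit of the cycles to the cohomology of the diagram. -/
def limCyclesToCohomology (s : ℕ) : limit (P.cocomplex.cycles s) ⟶ (cohomology s).obj (of A) :=
  limToCohomology (of (P.cocomplex.cycles s)) ≫ cohomologyShift P s 0 s (Nat.zero_add s) ≫
    (cohomology s).map (diagHom (isoCyclesZero P).inv)

lemma bijective_cohomology_iso (s : ℕ) {B D : I ⥤ AB.{u}} (e : B ≅ D) :
    Function.Bijective ((cohomology s).map (diagHom e.hom)) := by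
  have h : IsIso (diagHom e.hom) := ⟨diagHom e.inv, by
    rw [diagHom_comp, e.hom_inv_id, diagHom_id], by rw [diagHom_comp, e.inv_hom_id, diagHom_id]⟩
  exact (ConcreteCategory.isIso_iff_bijective _).1 inferInstance

lemma limCyclesToCohomology_surjective (s : ℕ) :
    Function.Surjective (limCyclesToCohomology P s) :=
  ((bijective_cohomology_iso s (isoCyclesZero P).symm).2.comp
    (cohomologyShift_surjective P s 0 s _)).comp (limToCohomology_bijective _).2

lemma limCyclesToCohomology_zero_injective : Function.Injective (limCyclesToCohomology P 0) := by
  have h : Function.Injective (cohomologyShift P 0 0 0 rfl) := Function.injective_id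
  exact ((bijective_cohomology_iso 0 (isoCyclesZero P).symm).1.comp h).comp
    (limToCohomology_bijective (of (P.cocomplex.cycles 0))).1

lemma limToCohomology_diagHom {B D : I ⥤ AB.{u}} (τ : B ⟶ D) (y : (limit B : AB.{u})) :
    (cohomology 0).map (diagHom τ) (limToCohomology (of B) y) =
      limToCohomology (of D) (lim.map τ y) := by
  have h : limFunctor.map (diagHom τ) = lim.map τ := limit.hom_ext fun i =>
    (limAlong_π (𝟭 I) (B.leftUnitor.hom ≫ τ) i).trans
      ((congrArg (_ ≫ ·) (Category.id_comp (τ.app i))).trans (limMap_π τ i).symm)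
  exact (congr($(limIsoCohomology.hom.naturality (diagHom τ)) y)).symm.trans
    (congrArg (limToCohomology (of D)) congr($h y))

/-- Only the first connecting homomorphism, the one leaving degree `0`, can have a kernel. By
exactness this is the image of the limit of the injective term. -/
lemma limCyclesToCohomology_succ_eq_zero_iff (b : ℕ)
    (z : (limit (P.cocomplex.cycles (b + 1)) : AB.{u})) :
    limCyclesToCohomology P (b + 1) z = 0 ↔
      ∃ y : (limit (P.cocomplex.X b) : AB.{u}), lim.map (P.cocomplex.toCycles b (b + 1)) y = z := by
  have h1 : limCyclesToCohomology P (b + 1) z = 0 ↔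
      cohomologyδ (cyclesSES_shortExact P b) 0 (limToCohomology (of _) z) = 0 :=
    map_eq_zero_iff ((cohomologyShift P b 1 (b + 1) (by lia)) ≫
      (cohomology (b + 1)).map (diagHom (isoCyclesZero P).inv)).hom
      ((bijective_cohomology_iso (b + 1) (isoCyclesZero P).symm).1.comp
        (cohomologyShift_injective P b 0 (b + 1) _))
  rw [h1, cohomologyδ_eq_zero_iff]
  constructor
  · rintro ⟨y', hy'⟩
    obtain ⟨y, rfl⟩ := (limToCohomology_bijective _).2 y'
    exact ⟨y, (limToCohomology_bijective _).1
      ((limToCohomology_diagHom (P.cocomplex.toCycles b (b + 1)) y).symm.trans hy')⟩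
  · rintro ⟨y, rfl⟩
    exact ⟨_, limToCohomology_diagHom (P.cocomplex.toCycles b (b + 1)) y⟩

/-- The two cohomology groups are quotients of the limit of the cycles by the same subgroup: zero
for `s = 0`, and otherwise the image of the limit of the preceding injective term. This permits
their comparison by descent. -/
lemma limCycles_eq_zero_iff (s : ℕ) (z : (limit (P.cocomplex.cycles s) : AB.{u})) :
    limCyclesToCohomology P s z = 0 ↔ limCyclesToHomology P s z = 0 := by
  obtain _ | b := s
  · rw [map_eq_zero_iff _ (limCyclesToCohomology_zero_injective P),
      map_eq_zero_iff _ (limCyclesToHomology_zero_injective P)]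
  · rw [limCyclesToCohomology_succ_eq_zero_iff, limCyclesToHomology_succ_eq_zero_iff]

/-- The comparison of the cohomology of cochains and the cohomology of a complex of limits. -/
def cohomologyToHomology (s : ℕ) :
    (cohomology s).obj (of A) ⟶ (limComplex P.cocomplex).homology s :=
  ModuleCat.descSurj (limCyclesToCohomology P s) (limCyclesToCohomology_surjective P s)
    (limCyclesToHomology P s) fun z => (limCycles_eq_zero_iff P s z).1

lemma comp_cohomologyToHomology (s : ℕ) :
    limCyclesToCohomology P s ≫ cohomologyToHomology P s = limCyclesToHomology P s :=
  ModuleCat.comp_descSurj _ _ _ _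

lemma cohomologyToHomology_bijective (s : ℕ) :
    Function.Bijective (cohomologyToHomology P s) := by
  have h (z) : cohomologyToHomology P s (limCyclesToCohomology P s z) =
    limCyclesToHomology P s z := ModuleCat.descSurj_apply _ _ _ _ z
  constructor
  · refine (injective_iff_map_eq_zero _).2 fun x hx => ?_
    obtain ⟨z, rfl⟩ := limCyclesToCohomology_surjective P s x
    exact (limCycles_eq_zero_iff P s z).2 ((h z).symm.trans hx)
  · intro y
    obtain ⟨z, rfl⟩ := limCyclesToHomology_surjective P s y
    exact ⟨_, h z⟩

end Resolution

section Naturality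

variable [IsCofiltered I] [IsCofiltered J] (φ : J ⥤ I) {A : I ⥤ AB.{u}} {B : J ⥤ AB.{u}}
  (P : InjectiveResolution A) (Q : InjectiveResolution B)
  (g : restrComplex φ P.cocomplex ⟶ Q.cocomplex)

/-- The map of diagrams of cycles over a change of the index category. -/
def cyclesRestrMap (b : ℕ) : φ ⋙ P.cocomplex.cycles b ⟶ Q.cocomplex.cycles b :=
  Q.cocomplex.liftCycles ((restr φ).map (P.cocomplex.iCycles b) ≫ g.f b) _ rfl (by
    refine (Category.assoc _ _ _).trans ((congrArg (_ ≫ ·) (g.comm _ _)).trans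
      ((Category.assoc _ _ _).symm.trans ?_))
    refine (congrArg (· ≫ _) (((restr φ).map_comp _ _).symm.trans
      (congrArg (restr φ).map (P.cocomplex.iCycles_d b _)))).trans ?_
    exact (congrArg (· ≫ _) ((restr φ).map_zero _ _)).trans zero_comp)

omit [IsCofiltered I] [IsCofiltered J] in
lemma cyclesRestrMap_i (b : ℕ) : cyclesRestrMap φ P Q g b ≫ Q.cocomplex.iCycles b =
    (restr φ).map (P.cocomplex.iCycles b) ≫ g.f b := HomologicalComplex.liftCycles_i _ _ _ _ _

/-- The morphism of short exact sequences of cycles over a change of the index category. -/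
def cyclesSESMap (b : ℕ) : (cyclesSES P b).map (restr φ) ⟶ cyclesSES Q b where
  τ₁ := cyclesRestrMap φ P Q g b
  τ₂ := g.f b
  τ₃ := cyclesRestrMap φ P Q g (b + 1)
  comm₁₂ := cyclesRestrMap_i φ P Q g b
  comm₂₃ := by
    refine (cancel_mono (Q.cocomplex.iCycles (b + 1))).1 ?_
    refine (Category.assoc _ _ _).trans ((congrArg (g.f b ≫ ·)
      (Q.cocomplex.toCycles_i b (b + 1))).trans ((g.comm b (b + 1)).trans ?_))
    refine Eq.trans ?_ (Category.assoc _ _ _).symm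
    refine Eq.trans ?_ (congrArg (_ ≫ ·) (cyclesRestrMap_i φ P Q g (b + 1))).symm
    refine Eq.trans ?_ (Category.assoc _ _ _)
    refine congrArg (· ≫ _) ?_
    exact ((congrArg (restr φ).map (P.cocomplex.toCycles_i b (b + 1))).symm).trans
      ((restr φ).map_comp _ _)

lemma cohomologyShift_naturality (b k m : ℕ) (h : k + b = m) :
    cohomologyShift P b k m h ≫ (cohomology m).map (ofHom φ (cyclesRestrMap φ P Q g 0)) =
      (cohomology k).map (ofHom φ (cyclesRestrMap φ P Q g b)) ≫ cohomologyShift Q b k m h := by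
  induction b generalizing k with
  | zero =>
    subst h
    exact (Category.id_comp _).trans (Category.comp_id _).symm
  | succ b ih =>
    refine (Category.assoc _ _ _).trans ((congrArg (_ ≫ ·) (ih (k + 1) (by lia))).trans ?_)
    refine (Category.assoc _ _ _).symm.trans ?_
    refine (congrArg (· ≫ _) (cohomologyδ_naturality (cyclesSES_shortExact P b) k φ
      (cyclesSES_shortExact Q b) (cyclesSESMap φ P Q g b))).trans ?_
    exact Category.assoc _ _ _

variable (ψ : φ ⋙ A ⟶ B) (hg : (restr φ).map (injAug P) ≫ g.f 0 = ψ ≫ injAug Q)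

omit [IsCofiltered I] [IsCofiltered J] in
include hg in
lemma isoCyclesZero_hom_naturality :
    (restr φ).map (isoCyclesZero P).hom ≫ cyclesRestrMap φ P Q g 0 =
      ψ ≫ (isoCyclesZero Q).hom := by
  refine (cancel_mono (Q.cocomplex.iCycles 0)).1 ?_
  rw [Category.assoc, Category.assoc, cyclesRestrMap_i, isoCyclesZero_hom_iCycles, ← hg,
    ← isoCyclesZero_hom_iCycles]
  exact (Category.assoc _ _ _).symm.trans (congrArg (· ≫ _) ((restr φ).map_comp _ _).symm)

omit [IsCofiltered I] [IsCofiltered J] in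
include hg in
lemma isoCyclesZero_inv_naturality (j : J) :
    (cyclesRestrMap φ P Q g 0).app j ≫ (isoCyclesZero Q).inv.app j =
      (isoCyclesZero P).inv.app (φ.obj j) ≫ ψ.app j := by
  have h : (isoCyclesZero P).hom.app (φ.obj j) ≫ (cyclesRestrMap φ P Q g 0).app j =
      ψ.app j ≫ (isoCyclesZero Q).hom.app j :=
    congr_app (isoCyclesZero_hom_naturality φ P Q g ψ hg) j
  rw [← cancel_epi ((isoCyclesZero P).hom.app (φ.obj j)), Iso.hom_inv_id_app_assoc,
    ← Category.assoc, h, Category.assoc, Iso.hom_inv_id_app, Category.comp_id]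

include hg in
lemma limCyclesToCohomology_naturality (s : ℕ) :
    limCyclesToCohomology P s ≫ (cohomology s).map (ofHom φ ψ) =
      limAlong φ (cyclesRestrMap φ P Q g s) ≫ limCyclesToCohomology Q s := by
  have h1 : (cohomology s).map (diagHom (isoCyclesZero P).inv) ≫ (cohomology s).map (ofHom φ ψ) =
      (cohomology s).map (ofHom φ (cyclesRestrMap φ P Q g 0)) ≫
        (cohomology s).map (diagHom (isoCyclesZero Q).inv) :=
    (Functor.map_comp _ _ _).symm.trans ((congrArg (cohomology s).map
      (diagHom_ofHom φ _ _ _ _ (isoCyclesZero_inv_naturality φ P Q g ψ hg))).trans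
      (Functor.map_comp _ _ _))
  have h2 := limIsoCohomology.hom.naturality (ofHom φ (cyclesRestrMap φ P Q g s))
  have h3 := cohomologyShift_naturality φ P Q g s 0 s (Nat.zero_add s)
  have h2 : limAlong φ (cyclesRestrMap φ P Q g s) ≫ limToCohomology (of (Q.cocomplex.cycles s)) =
    limToCohomology (of (P.cocomplex.cycles s)) ≫
      (cohomology 0).map (ofHom φ (cyclesRestrMap φ P Q g s)) := h2
  rw [limCyclesToCohomology, limCyclesToCohomology, Category.assoc, Category.assoc, h1,
    ← Category.assoc (limAlong _ _), h2, Category.assoc, ← Category.assoc (cohomologyShift _ _ _ _ _),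
    h3, Category.assoc]

lemma limCyclesToHomology_naturality (s : ℕ) :
    limCyclesToHomology P s ≫ HomologicalComplex.homologyMap (limComplexMap φ g) s =
      limAlong φ (cyclesRestrMap φ P Q g s) ≫ limCyclesToHomology Q s := by
  refine ModuleCat.hom_ext (LinearMap.ext fun z => ?_)
  refine (congrArg (HomologicalComplex.homologyMap (limComplexMap φ g) s)
    (limCyclesToHomology_apply P s z)).trans ?_
  refine (HomologicalComplex.homologyMap_cls _ _).trans
    (Eq.trans ?_ (limCyclesToHomology_apply Q s _).symm)
  refine HomologicalComplex.cls_congr ?_ _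
  have h : lim.map (P.cocomplex.iCycles s) ≫ limAlong φ (g.f s) =
      limAlong φ (cyclesRestrMap φ P Q g s) ≫ lim.map (Q.cocomplex.iCycles s) := by
    refine limit.hom_ext fun j => ?_
    refine (Category.assoc _ _ _).trans (Eq.trans ?_ (Category.assoc _ _ _).symm)
    refine (congrArg (_ ≫ ·) (limAlong_π φ (g.f s) j)).trans
      (Eq.trans ?_ (congrArg (_ ≫ ·) (limMap_π (Q.cocomplex.iCycles s) j)).symm)
    refine (Category.assoc _ _ _).symm.trans (Eq.trans ?_ (Category.assoc _ _ _))
    refine (congrArg (· ≫ _) (limMap_π (P.cocomplex.iCycles s) (φ.obj j))).trans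
      (Eq.trans ?_ (congrArg (· ≫ _) (limAlong_π φ (cyclesRestrMap φ P Q g s) j)).symm)
    refine (Category.assoc _ _ _).trans (Eq.trans ?_ (Category.assoc _ _ _).symm)
    exact congrArg (_ ≫ ·) (congr_app (cyclesRestrMap_i φ P Q g s) j).symm
  exact congr($h z)

include hg in
lemma cohomologyToHomology_naturality (s : ℕ) :
    (cohomology s).map (ofHom φ ψ) ≫ cohomologyToHomology Q s =
      cohomologyToHomology P s ≫ HomologicalComplex.homologyMap (limComplexMap φ g) s := by
  have : Epi (limCyclesToCohomology P s) :=
    (ModuleCat.epi_iff_surjective _).2 (limCyclesToCohomology_surjective P s)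
  rw [← cancel_epi (limCyclesToCohomology P s), ← Category.assoc,
    limCyclesToCohomology_naturality φ P Q g ψ hg, Category.assoc, comp_cohomologyToHomology,
    ← Category.assoc, comp_cohomologyToHomology, limCyclesToHomology_naturality]

end Naturality

/-- The cohomology of the complex of cochains is given by the derived limits. -/
def cohomologyIsoLimDerived (s : ℕ) : cohomology.{u} s ≅ limDerived s :=
  NatIso.ofComponents (fun X =>
    @asIso _ _ _ _ (cohomologyToHomology (injectiveResolution X.X) s)
      ((ConcreteCategory.isIso_iff_bijective _).2 (cohomologyToHomology_bijective _ s)) ≪≫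
        ((injectiveResolution X.X).isoRightDerivedObj lim s).symm) fun {X Y} f => by
    have h := cohomologyToHomology_naturality (Hom.φ f) (injectiveResolution X.X)
      (injectiveResolution Y.X) _ (Hom.ψ f) (resLift_spec (Hom.φ f) (Hom.ψ f) _ _) s
    refine (Category.assoc _ _ _).symm.trans ((congrArg (· ≫ _) h).trans ?_)
    refine (Category.assoc _ _ _).trans (Eq.trans ?_ (Category.assoc _ _ _).symm)
    refine congrArg (_ ≫ ·) ?_
    exact (Iso.inv_hom_id_assoc ((injectiveResolution X.X).isoRightDerivedObj lim s) _).symm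

end InvSystem

end

noncomputable section

/-! ### The first page of the spectral sequence of a bicomplex -/

namespace TotCouple

open HomologicalComplex

section Differential

variable {K : CochainComplex CHAIN.{u} ℕ} {p : WithTop ℤ} {n n' : ℤ} (h : n' + 1 = n)

include h in
lemma totD_apply_zero (x : totX K p n) (m : ℤ) (hs : (((0 : ℕ) : ℤ) : WithTop ℤ) ≤ p)
    (hm : m = n' + (0 : ℕ)) : totπ K ⟨0, m, hs, hm⟩ (totD K p n n' x) =
      (K.X 0).d (m + 1) m (totπ K ⟨0, m + 1, hs, by lia⟩ x) := by
  refine congr($(totD_π K h ⟨0, m, hs, hm⟩) x).trans ?_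
  have e : totH K h ⟨0, m, hs, hm⟩ + ((-1 : ℤ) ^ 0) • totV K h ⟨0, m, hs, hm⟩ =
      totV K h ⟨0, m, hs, hm⟩ := by
    rw [totH, zero_add, pow_zero, one_zsmul]
  exact congr($e x)

lemma totD_apply_succ (x : totX K p n) (s : ℕ) (m : ℤ) (hs : (((s + 1 : ℕ) : ℤ) : WithTop ℤ) ≤ p)
    (hs' : (((s : ℕ) : ℤ) : WithTop ℤ) ≤ p) (hm : m = n' + (s + 1 : ℕ)) :
    totπ K ⟨s + 1, m, hs, hm⟩ (totD K p n n' x) =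
      (K.d s (s + 1)).f m (totπ K ⟨s, m, hs', by push_cast at hm; lia⟩ x) +
        (-1 : ℤ) ^ (s + 1) • (K.X (s + 1)).d (m + 1) m
          (totπ K ⟨s + 1, m + 1, hs, by lia⟩ x) :=
  congr($(totD_π K h ⟨s + 1, m, hs, hm⟩) x)

end Differential

variable (K : CochainComplex CHAIN.{u} ℕ)

section Coord

variable (s : ℕ) (n m : ℤ) (h : m = n + s)

/-- The inclusion of `Γ^{(s)}`, in degree `n`. -/
def gammaι : (ses K s).X₁.X n ⟶ totX K ((s : ℤ) : WithTop ℤ) n := (ses K s).f.f n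

lemma gammaι_exact (y : totX K ((s : ℤ) : WithTop ℤ) n) :
    (∃ x, gammaι K s n x = y) ↔ (ses K s).g.f n y = 0 := by
  have h : ((ses K s).map (eval AB.{u} (ComplexShape.down ℤ) n)).Exact :=
    (exact_iff_degreewise_exact (ses K s)).1 (ses_shortExact K s).exact n
  have h := (ShortComplex.moduleCat_exact_iff _).1 h y
  refine ⟨fun ⟨x, hx⟩ => ?_, h⟩
  have e : (ses K s).f.f n ≫ (ses K s).g.f n = 0 := congrArg (fun f => Hom.f f n) (ses K s).zero
  rw [← hx]
  exact congrArg (fun f : (ses K s).X₁.X n ⟶ (ses K s).X₃.X n => f x) e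

lemma gammaι_injective : Function.Injective (gammaι K s n) := by
  have : Mono (ses K s).f := (ses_shortExact K s).mono_f
  have : Mono ((ses K s).f.f n) := inferInstance
  exact (ModuleCat.mono_iff_injective _).1 this

lemma gammaι_d (n' : ℤ) (x : (ses K s).X₁.X n) :
    gammaι K s n' ((ses K s).X₁.d n n' x) = totD K ((s : ℤ) : WithTop ℤ) n n' (gammaι K s n x) :=
  comm_apply (ses K s).f n n' x

lemma exists_gammaι_iff (y : totX K ((s : ℤ) : WithTop ℤ) n) :
    (∃ x, gammaι K s n x = y) ↔ ∀ a : TotIndex ((s : ℤ) : WithTop ℤ) n, a.s < s → totπ K a y = 0 := by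
  rw [gammaι_exact]
  have hle : (((s : ℤ) - 1 : ℤ) : WithTop ℤ) ≤ ((s : ℤ) : WithTop ℤ) := by
    exact_mod_cast (by lia : (s : ℤ) - 1 ≤ s)
  constructor
  · intro hy a ha
    refine (totProjX_π_apply hle y ⟨a.s, a.m, by exact_mod_cast (by lia : (a.s : ℤ) ≤ s - 1),
      a.hm⟩).symm.trans ?_
    exact (congrArg (totπ K _) hy).trans (map_zero _)
  · intro hy
    refine totX_ext (K := K) fun a => ?_
    refine (totProjX_π_apply hle y a).trans ((hy _ ?_).trans (map_zero _).symm)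
    have : (a.s : ℤ) ≤ s - 1 := by exact_mod_cast a.hs
    dsimp only
    lia

/-- The nontrivial coordinate of the elements of `Γ^{(s)}`. -/
def gammaCoord : (ses K s).X₁.X n ⟶ (K.X s).X m := gammaι K s n ≫ totπ K ⟨s, m, le_rfl, h⟩

lemma gammaCoord_bijective : Function.Bijective (gammaCoord K s n m h) := by
  constructor
  · refine (injective_iff_map_eq_zero _).2 fun x hx => gammaι_injective K s n ?_
    rw [map_zero]
    refine totX_ext fun ⟨a, b, ha, hb⟩ => ?_
    have ha' : a ≤ s := by exact_mod_cast ha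
    rw [map_zero]
    rcases ha'.lt_or_eq with h' | rfl
    · exact (exists_gammaι_iff K s n _).1 ⟨x, rfl⟩ _ h'
    · subst h hb
      exact hx
  · intro y
    classical
    -- The preimage has `y` in column `s` and zero elsewhere. The cast is needed because the index
    -- `(a.s, a.m)` equals `(s, m)` only propositionally.
    obtain ⟨x, hx⟩ := (exists_gammaι_iff K s n (mkTot fun a =>
      if e : a.s = s then (by
        have := a.hm
        rw [e, ← h] at this
        exact cast (by rw [e, this]) y) else 0)).2 fun a ha => by
          rw [totπ_mkTot]
          exact dif_neg ha.ne
    refine ⟨x, (congrArg (totπ K ⟨s, m, le_rfl, h⟩) hx).trans ?_⟩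
    rw [totπ_mkTot]
    exact dif_pos rfl

/-- On elements of `Γ^{(s)}` the horizontal part of the differential does not contribute, since it
reads the vanishing column `s - 1`. The vertical part carries the sign of the total complex. -/
lemma gammaCoord_d (n' m' : ℤ) (hn : n' + 1 = n) (hm : m' + 1 = m) (x : (ses K s).X₁.X n) :
    gammaCoord K s n' m' (by lia) ((ses K s).X₁.d n n' x) =
      (-1 : ℤ) ^ s • (K.X s).d m m' (gammaCoord K s n m h x) := by
  subst hm
  refine (congrArg (totπ K _) (gammaι_d K s n n' x)).trans ?_
  obtain _ | s := s
  · rw [totD_apply_zero hn, pow_zero, one_zsmul]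
    rfl
  · rw [totD_apply_succ hn (hs' := by exact_mod_cast Nat.le_succ s),
      (exists_gammaι_iff K (s + 1) n _).1 ⟨x, rfl⟩ _ (Nat.lt_succ_self s), map_zero, zero_add]
    rfl

lemma zsmul_sign_sign {A : Type*} [AddCommGroup A] (s : ℕ) (a : A) :
    (-1 : ℤ) ^ s • (-1 : ℤ) ^ s • a = a := by
  rw [← mul_smul, ← pow_add, Even.neg_one_pow ⟨s, rfl⟩, one_zsmul]

lemma d_gammaCoord (n' m' : ℤ) (hn : n' + 1 = n) (hm : m' + 1 = m) (x : (ses K s).X₁.X n) :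
    (K.X s).d m m' (gammaCoord K s n m h x) =
      gammaCoord K s n' m' (by lia) ((-1 : ℤ) ^ s • (ses K s).X₁.d n n' x) := by
  rw [map_zsmul, gammaCoord_d K s n m h n' m' hn hm, zsmul_sign_sign]

lemma d_apply_of_not_rel {L : CHAIN.{u}} {a b : ℤ} (h : ¬b + 1 = a) (x : L.X a) : L.d a b x = 0 := by
  rw [L.shape _ _ h]
  rfl

lemma gammaCoord_cycle (x : (ses K s).X₁.X n) :
    (∀ q, (ses K s).X₁.d n q x = 0) ↔ ∀ q, (K.X s).d m q (gammaCoord K s n m h x) = 0 := by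
  constructor
  · intro hx q
    by_cases hq : q + 1 = m
    · rw [d_gammaCoord K s n m h (n - 1) q (by lia) hq, hx, zsmul_zero, map_zero]
    · exact d_apply_of_not_rel hq _
  · intro hx q
    by_cases hq : q + 1 = n
    · refine (gammaCoord_bijective K s q (m - 1) (by lia)).1 ?_
      rw [gammaCoord_d K s n m h q (m - 1) hq (by lia), hx, zsmul_zero, map_zero]
    · exact d_apply_of_not_rel hq _

/-- The homology of `Γ^{(s)}` is the homology of the column `s`. -/
def gammaHomology : (ses K s).X₁.homology n ⟶ (K.X s).homology m :=
  clsMap (gammaCoord K s n m h) (fun x => (gammaCoord_cycle K s n m h x).1) fun o y => by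
    by_cases ho : n + 1 = o
    · exact ⟨m + 1, (-1 : ℤ) ^ s • gammaCoord K s o (m + 1) (by lia) y, by
        rw [map_zsmul, gammaCoord_d K s o (m + 1) (by lia) n m ho rfl]⟩
    · exact ⟨m, 0, by rw [map_zero, d_apply_of_not_rel ho, map_zero]⟩

lemma gammaHomology_cls {x : (ses K s).X₁.X n} (hx : ∀ q, (ses K s).X₁.d n q x = 0) :
    gammaHomology K s n m h (cls x hx) =
      cls (gammaCoord K s n m h x) ((gammaCoord_cycle K s n m h x).1 hx) :=
  clsMap_cls _ _ _ hx

lemma gammaHomology_bijective : Function.Bijective (gammaHomology K s n m h) :=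
  clsMap_bijective _ _ _ (gammaCoord_bijective K s n m h)
    (fun x => (gammaCoord_cycle K s n m h x).2) fun x o' y' hy => by
      by_cases ho : m + 1 = o'
      · obtain ⟨w, rfl⟩ := (gammaCoord_bijective K s (n + 1) o' (by lia)).2 y'
        refine ⟨n + 1, (-1 : ℤ) ^ s • w, (gammaCoord_bijective K s n m h).1 ?_⟩
        rw [map_zsmul, ← d_gammaCoord K s (n + 1) o' (by lia) n m rfl ho, hy]
      · rw [d_apply_of_not_rel ho] at hy
        exact ⟨n, 0, (gammaCoord_bijective K s n m h).1 (by rw [map_zero, map_zero, hy])⟩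

end Coord

/-- The differential of the first page, in terms of the columns. -/
lemma d_gammaHomology (s : ℕ) (n n' m : ℤ) (h : m = n + s)
    (hn : n' + 1 = n) (e : (ses K s).X₁.homology n) :
    gammaHomology K (s + 1) n' m (by push_cast; lia)
        (jMap K s ((s + 1 : ℕ) : ℤ) n n' (by push_cast; lia) hn (kMap K s n e)) =
      homologyMap (K.d s (s + 1)) m (gammaHomology K s n m h e) := by
  obtain ⟨x, hx, rfl⟩ := exists_cls e
  have hle : ((((s + 1 : ℕ) : ℤ) - 1 : ℤ) : WithTop ℤ) ≤ ((s : ℤ) : WithTop ℤ) := by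
    exact_mod_cast (by push_cast; lia : ((s + 1 : ℕ) : ℤ) - 1 ≤ (s : ℤ))
  have hle' : ((((s + 1 : ℕ) : ℤ) - 1 : ℤ) : WithTop ℤ) ≤ (((s + 1 : ℕ) : ℤ) : WithTop ℤ) := by
    exact_mod_cast (by lia : ((s + 1 : ℕ) : ℤ) - 1 ≤ ((s + 1 : ℕ) : ℤ))
  let y : totX K ((s : ℤ) : WithTop ℤ) n := gammaι K s n x
  have hy (q : ℤ) : (tot K ((s : ℤ) : WithTop ℤ)).d n q y = 0 :=
    (gammaι_d K s n q x).symm.trans ((congrArg _ (hx q)).trans (map_zero _))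
  let x₃ : totX K ((((s + 1 : ℕ) : ℤ) - 1 : ℤ) : WithTop ℤ) n := totProjX K hle n y
  have hx₃ (q : ℤ) : (tot K ((((s + 1 : ℕ) : ℤ) - 1 : ℤ) : WithTop ℤ)).d n q x₃ = 0 :=
    d_map_eq_zero ((totProj hle).app K) hy q
  -- The cycle in `Tot^{(s)}` is lifted to `Tot^{(s+1)}` by zero in column `s + 1`. There the
  -- boundary of the lift is the horizontal differential of the coordinate in column `s`, and the
  -- zigzag for the connecting homomorphism yields just this.
  let x₂ : totX K (((s + 1 : ℕ) : ℤ) : WithTop ℤ) n := mkTot fun b =>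
    if hb : b.s ≤ s then totπ K (⟨b.s, b.m, by exact_mod_cast hb, b.hm⟩ :
      TotIndex ((s : ℤ) : WithTop ℤ) n) y else 0
  have h2 : totProjX K hle' n x₂ = x₃ := by
    refine totX_ext fun b => ?_
    have hb : b.s ≤ s := by
      have : (b.s : ℤ) ≤ ((s + 1 : ℕ) : ℤ) - 1 := by exact_mod_cast b.hs
      push_cast at this
      omega
    rw [totProjX_π_apply, totProjX_π_apply, totπ_mkTot]
    exact dif_pos hb
  obtain ⟨x₁, hx₁⟩ := (gammaι_exact K (s + 1) n'
    (totD K (((s + 1 : ℕ) : ℤ) : WithTop ℤ) n n' x₂)).2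
      ((comm_apply (ses K ((s + 1 : ℕ) : ℤ)).g n n' x₂).trans
        ((congrArg _ h2).trans (hx₃ n')))
  have hx₁' (q : ℤ) : (ses K ((s + 1 : ℕ) : ℤ)).X₁.d n' q x₁ = 0 := by
    refine gammaι_injective K (s + 1) q ?_
    refine (gammaι_d K (s + 1) n' q x₁).trans ((congrArg _ hx₁).trans ?_)
    exact congr($((tot K (((s + 1 : ℕ) : ℤ) : WithTop ℤ)).d_comp_d n n' q) x₂).trans
      (map_zero _).symm
  have hj : jMap K s ((s + 1 : ℕ) : ℤ) n n' (by push_cast; lia) hn (kMap K s n (cls x hx)) =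
      cls x₁ hx₁' := by
    have h3 : kMap K s n (cls x hx) = cls (K := tot K ((s : ℤ) : WithTop ℤ)) y hy :=
      homologyMap_cls _ _
    have h4 : homologyMap (proj K s (((s + 1 : ℕ) : ℤ) - 1) (by push_cast; lia)) n
        (cls (K := tot K ((s : ℤ) : WithTop ℤ)) y hy) =
          cls (K := tot K ((((s + 1 : ℕ) : ℤ) - 1 : ℤ) : WithTop ℤ)) x₃ hx₃ :=
      homologyMap_cls _ _
    refine (congrArg (jMap K s ((s + 1 : ℕ) : ℤ) n n' (by push_cast; lia) hn) h3).trans ?_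
    refine (congrArg ((ses_shortExact K ((s + 1 : ℕ) : ℤ)).δ n n' (down_rel hn)) h4).trans ?_
    exact δ_cls (ses_shortExact K ((s + 1 : ℕ) : ℤ)) (down_rel hn) hx₃ x₂ h2 x₁ hx₁ hx₁'
  rw [hj, gammaHomology_cls, gammaHomology_cls, homologyMap_cls]
  refine cls_congr ?_ _
  refine (congrArg (totπ K _) hx₁).trans ?_
  have e0 : totπ K ⟨s + 1, m + 1, le_rfl, by push_cast; lia⟩ x₂ = 0 :=
    (totπ_mkTot _ _).trans (dif_neg (Nat.not_succ_le_self s))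
  have e1 : totπ K ⟨s, m, by exact_mod_cast Nat.le_succ s, h⟩ x₂ = gammaCoord K s n m h x :=
    (totπ_mkTot _ _).trans (dif_pos le_rfl)
  rw [totD_apply_succ hn (hs' := by exact_mod_cast Nat.le_succ s), e0, e1, map_zero, zsmul_zero,
    add_zero]

/-- The naturality of the nontrivial coordinate. -/
lemma gammaHomology_naturality {K L : CochainComplex CHAIN.{u} ℕ} (f : K ⟶ L) (s : ℕ) (n m : ℤ)
    (h : m = n + s) : homologyMap (sesMap f s).τ₁ n ≫ gammaHomology L s n m h =
      gammaHomology K s n m h ≫ homologyMap (f.f s) m := by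
  refine homology_ext fun x hx => ?_
  refine (congrArg (gammaHomology L s n m h) (homologyMap_cls (sesMap f s).τ₁ hx)).trans ?_
  refine Eq.trans ?_ (congrArg (homologyMap (f.f s) m) (gammaHomology_cls K s n m h hx)).symm
  rw [gammaHomology_cls, homologyMap_cls]
  refine cls_congr ?_ _
  have h1 : gammaι L s n ((sesMap f s).τ₁.f n x) =
      totMapX ((s : ℤ) : WithTop ℤ) f n (gammaι K s n x) :=
    congr($(congrArg (fun f => Hom.f f n) (sesMap f s).comm₁₂) x)
  exact (congrArg (totπ L _) h1).trans congr($(totMapX_π f _) (gammaι K s n x))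

end TotCouple

end

noncomputable section

namespace InvSystem

open HomologicalComplex TotCouple

variable (C : InvSystem.{u} CHAIN.{u})

/-! ### The term `E_2` of the spectral sequence of a homotopy limit -/

section Omega

variable (s : ℕ) (m : ℤ)

/-- The homology of the replacement is the group of cochains in the homology groups. -/
def replHomology : (C.repl s).homology m ⟶ ((proHomology m).obj C).Cochains s :=
  ModuleCat.piLift (F := fun σ : Fin (s + 1) ⥤ C.I => (C.X.obj (σ.obj (Fin.last s))).homology m)
    fun σ => homologyMap (C.replπ σ) m

lemma replHomology_bijective : Function.Bijective (C.replHomology s m) :=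
  homology_pi_bijective (fun σ : Fin (s + 1) ⥤ C.I => C.X.obj (σ.obj (Fin.last s))) m

variable {C} in
lemma replHomology_naturality {C' : InvSystem.{u} CHAIN.{u}} (f : C ⟶ C') :
    homologyMap (replMap f s) m ≫ C'.replHomology s m =
      C.replHomology s m ≫ cochainsMap ((proHomology m).map f) s := by
  refine ModuleCat.hom_ext (LinearMap.ext fun x => cochains_ext fun σ => ?_)
  have h : homologyMap (replMap f s) m ≫ homologyMap (C'.replπ σ) m =
      homologyMap (C.replπ (σ ⋙ Hom.φ f)) m ≫ homologyMap ((Hom.ψ f).app _) m := by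
    rw [← homologyMap_comp, ← homologyMap_comp]
    exact congrArg (homologyMap · m) (replMap_π f _)
  exact congr($h x)

lemma bicomplex_d : (bicomplex.obj C).d s (s + 1) =
    ∑ k : Fin (s + 2), (-1 : ℤ) ^ (k : ℕ) • C.cosimplicialReplacement.map (SimplexCategory.δ k) :=
  CochainComplex.of_d (V := CHAIN.{u})
    (fun n => C.cosimplicialReplacement.obj (SimplexCategory.mk n))
    (AlgebraicTopology.AlternatingCofaceMapComplex.objD C.cosimplicialReplacement) s

lemma bicomplex_d_π (σ : Fin (s + 2) ⥤ C.I) : (bicomplex.obj C).d s (s + 1) ≫ C.replπ σ =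
    ∑ k : Fin (s + 2), (-1 : ℤ) ^ (k : ℕ) • (C.replπ (face k σ) ≫ C.X.map (faceLast k σ)) := by
  refine (congrArg (· ≫ C.replπ σ) (C.bicomplex_d s)).trans ?_
  refine (Preadditive.sum_comp _ _ _).trans (Finset.sum_congr rfl fun k _ => ?_)
  exact (Preadditive.zsmul_comp _ _ _).trans (congrArg _ (replLift_π _ _))

lemma replHomology_d : homologyMap ((bicomplex.obj C).d s (s + 1)) m ≫ C.replHomology (s + 1) m =
    C.replHomology s m ≫ ((proHomology m).obj C).cochainsD s := by
  refine ModuleCat.hom_ext (LinearMap.ext fun x => cochains_ext fun σ => ?_)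
  refine Eq.trans ?_ (cochainsD_apply _ _ _).symm
  have h : homologyMap ((bicomplex.obj C).d s (s + 1)) m ≫ homologyMap (C.replπ σ) m =
      ∑ k : Fin (s + 2), (-1 : ℤ) ^ (k : ℕ) •
        (homologyMap (C.replπ (face k σ)) m ≫ homologyMap (C.X.map (faceLast k σ)) m) := by
    refine (homologyMap_comp _ _ _).symm.trans ?_
    refine (congrArg (homologyMap · m) (C.bicomplex_d_π s σ)).trans ?_
    refine ((homologyFunctor AB.{u} (ComplexShape.down ℤ) m).map_sum _ _).trans
      (Finset.sum_congr rfl fun k _ => ?_)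
    refine (Functor.map_zsmul (homologyFunctor AB.{u} (ComplexShape.down ℤ) m)).trans ?_
    exact congrArg _ (homologyMap_comp _ _ _)
  refine (congr($h x)).trans ?_
  refine (congr($(ModuleCat.hom_sum _ _) x) :).trans ?_
  rw [LinearMap.sum_apply]
  rfl

end Omega

variable (s : ℕ) (t : ℤ)

/-- The first page of the spectral sequence. -/
abbrev firstPage := (holimSS.obj C).ss.page 1 le_rfl

/-- The terms of the first page are the groups of cochains. -/
def pageCochains : C.firstPage.X (s, t) ⟶ (cochains.obj ((proHomology (-t)).obj C)).X s :=
  gammaHomology (bicomplex.obj C) s (-s - t) (-t) (by ring) ≫ C.replHomology s (-t)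

lemma pageCochains_bijective : Function.Bijective (C.pageCochains s t) :=
  (C.replHomology_bijective s (-t)).comp
    (gammaHomology_bijective (bicomplex.obj C) s (-s - t) (-t) (by ring))

lemma pageCochains_d (e : C.firstPage.X (s, t)) :
    C.pageCochains (s + 1) t (C.firstPage.d (s, t) ((s + 1 : ℕ), t) e) =
      (cochains.obj ((proHomology (-t)).obj C)).d s (s + 1) (C.pageCochains s t e) := by
  have h1 := (holimSS.obj C).d_eq 1 le_rfl (s, t) ((s + 1 : ℕ), t) (by ext <;> simp)
  have h2 := d_gammaHomology (bicomplex.obj C) s (-s - t) (-(s + 1 : ℕ) - t) (-t) (by ring)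
    (by push_cast; ring) e
  refine (congrArg (C.pageCochains (s + 1) t) congr($h1 e)).trans ?_
  refine (congrArg (C.replHomology (s + 1) (-t)) h2).trans ?_
  exact congr($(C.replHomology_d s (-t))
    (gammaHomology (bicomplex.obj C) s (-s - t) (-t) (by ring) e))

lemma pageCochains_naturality {C C' : InvSystem.{u} CHAIN.{u}} (f : C ⟶ C') :
    (CoupledSS.eFunctor AB.{u} 1 le_rfl (s, t)).map (holimSS.map f) ≫ C'.pageCochains s t =
      C.pageCochains s t ≫ (cochains.map ((proHomology (-t)).map f)).f s := by
  have h1 := gammaHomology_naturality (bicomplex.map f) s (-s - t) (-t) (by ring)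
  have h2 := replHomology_naturality s (-t) f
  refine (Category.assoc _ _ _).symm.trans ?_
  refine (congrArg (· ≫ C'.replHomology s (-t)) h1).trans ?_
  refine (Category.assoc _ _ _).trans ?_
  exact (congrArg (gammaHomology (bicomplex.obj C) s (-s - t) (-t) (by ring) ≫ ·) h2).trans
    (Category.assoc _ _ _).symm

lemma firstPage_d_eq_zero {p q : ℤ × ℤ} (h : p + (1, 0) ≠ q) : C.firstPage.d p q = 0 :=
  C.firstPage.shape p q fun h' => h (by simpa using h')

lemma pageCochains_cycle (x : C.firstPage.X (s, t)) :
    (∀ q, C.firstPage.d (s, t) q x = 0) ↔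
      ∀ q, (cochains.obj ((proHomology (-t)).obj C)).d s q (C.pageCochains s t x) = 0 := by
  constructor
  · intro hx q
    by_cases hq : s + 1 = q
    · subst hq
      rw [← C.pageCochains_d s t, hx, map_zero]
    · rw [(cochains.obj ((proHomology (-t)).obj C)).shape _ _ hq]
      rfl
  · intro hx q
    by_cases hq : ((s : ℤ), t) + (1, 0) = q
    · obtain rfl : q = (((s + 1 : ℕ) : ℤ), t) := by rw [← hq]; ext <;> simp
      refine (C.pageCochains_bijective (s + 1) t).1 ?_
      rw [C.pageCochains_d s t, map_zero]
      exact hx _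
    · rw [C.firstPage_d_eq_zero hq]
      rfl

/-- The comparison of the homology of the first page with the cohomology of the complexes of
cochains. -/
def pageHomology : C.firstPage.homology (s, t) ⟶
    (cochains.obj ((proHomology (-t)).obj C)).homology s :=
  clsMap (C.pageCochains s t) (fun x => (C.pageCochains_cycle s t x).1) fun o y => by
    by_cases ho : o + (1, 0) = ((s : ℤ), t)
    · obtain _ | s := s
      · have := (holimSS.obj C).subsingleton_E 1 le_rfl o (by
          have := congrArg Prod.fst ho
          simp only [Prod.fst_add] at this
          push_cast at this
          lia)
        refine ⟨0, 0, ?_⟩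
        rw [Subsingleton.elim y 0, map_zero, map_zero, map_zero]
      · obtain rfl : o = ((s : ℤ), t) := by
          rw [← add_right_cancel_iff (a := ((1 : ℤ), (0 : ℤ))), ho]; ext <;> simp
        exact ⟨s, C.pageCochains s t y, (C.pageCochains_d s t y).symm⟩
    · refine ⟨s, 0, ?_⟩
      rw [C.firstPage_d_eq_zero ho, map_zero]
      exact (map_zero _).symm

lemma pageHomology_bijective : Function.Bijective (C.pageHomology s t) :=
  clsMap_bijective _ _ _ (C.pageCochains_bijective s t)
    (fun x => (C.pageCochains_cycle s t x).2) fun x o' y' hy => by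
      by_cases ho : o' + 1 = s
      · subst ho
        obtain ⟨w, rfl⟩ := (C.pageCochains_bijective o' t).2 y'
        exact ⟨(o', t), w, (C.pageCochains_bijective _ t).1
          ((C.pageCochains_d o' t w).trans hy)⟩
      · rw [(cochains.obj ((proHomology (-t)).obj C)).shape _ _ ho] at hy
        exact ⟨(s, t), 0, (C.pageCochains_bijective s t).1 (by
          rw [map_zero, map_zero]; exact hy)⟩

lemma pageHomology_naturality {C C' : InvSystem.{u} CHAIN.{u}} (f : C ⟶ C') :
    homologyMap (((CoupledSS.Hom.ss (holimSS.map f)).hom 1 le_rfl)) (s, t) ≫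
        C'.pageHomology s t =
      C.pageHomology s t ≫ homologyMap (cochains.map ((proHomology (-t)).map f)) s := by
  refine homology_ext fun x hx => ?_
  refine (congrArg (C'.pageHomology s t) (homologyMap_cls _ hx)).trans ?_
  refine Eq.trans ?_ (congrArg (homologyMap (cochains.map ((proHomology (-t)).map f)) s)
    (clsMap_cls _ _ _ hx)).symm
  refine (clsMap_cls _ _ _ _).trans ?_
  rw [homologyMap_cls]
  exact cls_congr congr($(pageCochains_naturality s t f) x) _

/-- `pageHomology`, as an isomorphism. -/
def pageHomologyIso : C.firstPage.homology (s, t) ≅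
    (cochains.obj ((proHomology (-t)).obj C)).homology s :=
  have := (ConcreteCategory.isIso_iff_bijective _).2 (C.pageHomology_bijective s t)
  asIso (C.pageHomology s t)

/-- The terms `E_2` are the cohomology groups of the systems of homology groups. -/
def e₂Iso : holimSS.{u} ⋙ CoupledSS.eFunctor AB.{u} 2 (by norm_num) (s, t) ≅
    proHomology (-t) ⋙ cohomology s :=
  NatIso.ofComponents (fun C => ((holimSS.obj C).ss.iso 1 2 (s, t)).symm ≪≫
    C.pageHomologyIso s t) fun {C C'} f => by
    have h1 := (CoupledSS.Hom.ss (holimSS.map f)).comm 1 2 (s, t)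
    have h2 := pageHomology_naturality s t f
    change _ ≫ (_ ≫ C'.pageHomology s t) = (_ ≫ C.pageHomology s t) ≫ _
    refine Eq.trans ?_ ((congrArg (((holimSS.obj C).ss.iso 1 2 (s, t)).inv ≫ ·) h2).trans
      (Category.assoc _ _ _).symm)
    refine (Category.assoc _ _ _).symm.trans (Eq.trans ?_ (Category.assoc _ _ _))
    refine congrArg (· ≫ C'.pageHomology s t) ?_
    exact (Iso.eq_inv_comp _).2 ((Category.assoc _ _ _).symm.trans ((Iso.comp_inv_eq _).2 h1.symm))

end InvSystem

end

noncomputable section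

namespace InvSystem

/-! ### The extension of the spectral sequence to pro-complexes -/

lemma invertsInitial_proHomology_comp {D : Type*} [Category* D] {F : InvSystem.{u} AB.{u} ⥤ D}
    (hF : InvertsInitial F) (n : ℤ) : InvertsInitial (proHomology.{u} n ⋙ F) :=
  fun Y J _ _ φ _ => by
    have h : (proHomology n).map (Y.toReindex φ) = ((proHomology n).obj Y).toReindex φ :=
      hom_ext' fun j => (HomologicalComplex.homologyFunctor AB.{u} _ n).map_id _
    have : IsIso (F.map (((proHomology n).obj Y).toReindex φ)) :=
      @hF ((proHomology n).obj Y) J _ _ φ ‹_›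
    rw [← h] at this
    exact this

/-- The spectral sequence with its exact couples, from the second page on. -/
def secondSS : InvSystem.{u} CHAIN.{u} ⥤ CoupledSS AB.{u} 2 :=
  holimSS ⋙ CoupledSS.truncate AB.{u} (by norm_num)

/-- The terms `E_2` are cohomology groups of the systems of homology groups, which do not change
under initial functors, and an isomorphism on `E_2` determines everything that follows. The terms
`E_1` are groups of cochains and depend on the index category, which is why the extension starts
with `r = 2`. -/
lemma invertsInitial_secondSS : InvertsInitial secondSS.{u} := fun Y J _ _ φ _ => by
  refine CoupledSS.isIso_of_isIso_E _ (by norm_num) fun ⟨s, t⟩ => ?_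
  obtain ⟨s, rfl⟩ | hs := (le_or_gt 0 s).imp_left Int.eq_ofNat_of_zero_le
  · exact Pro.InvertsInitial.of_iso (invertsInitial_proHomology_comp (invertsInitial_cohomology s) _)
      (e₂Iso s t).symm Y J φ
  · have h1 := (secondSS.obj Y).isZero_E 2 le_rfl (s, t) hs
    have h2 := (secondSS.obj (Y.reindex φ)).isZero_E 2 le_rfl (s, t) hs
    exact ⟨h2.to_ _, h1.eq_of_src _ _, h2.eq_of_src _ _⟩

/-- The Milnor sequences for `r = 2` transfer the invariance from the terms `D_2` to the homology of
`holim`. -/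
lemma invertsInitial_homology_holim (n : ℤ) : InvertsInitial (holim.{u} ⋙ homologyF n) :=
  fun Y J _ _ φ _ => by
    have h : IsIso (secondSS.map (Y.toReindex φ)) := invertsInitial_secondSS Y J φ
    refine (ConcreteCategory.isIso_iff_bijective _).2
      (bijective_homologyMap_holim (Y.toReindex φ) 2 (by norm_num) (fun p => ?_) n)
    exact ConcreteCategory.bijective_of_isIso
      ((CoupledSS.dFunctor AB.{u} 2 le_rfl p).map (secondSS.map (Y.toReindex φ)))

/-- The extension of the spectral sequence, with its exact couples, to pro-complexes. -/
def proSS : Pro.{u} CHAIN.{u} ⥤ CoupledSS AB.{u} 2 := Pro.extend secondSS invertsInitial_secondSS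

/-- The extension of `H_n(holim C)` to pro-complexes. -/
def proHolim (n : ℤ) : Pro.{u} CHAIN.{u} ⥤ AB.{u} :=
  Pro.extend (holim ⋙ homologyF n) (invertsInitial_homology_holim n)

lemma proHolim_map_inc {X Y : Pro.{u} CHAIN.{u}} (a : X.sys ⟶ Y.sys) (n : ℤ) :
    (proHolim n).map (Pro.inc a) = HomologicalComplex.homologyMap (holim.map a) n :=
  Pro.extendMap_inc _ (invertsInitial_homology_holim n) a

lemma proSS_map_inc {X Y : Pro.{u} CHAIN.{u}} (a : X.sys ⟶ Y.sys) :
    proSS.map (Pro.inc a) = secondSS.map a :=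
  Pro.extendMap_inc _ invertsInitial_secondSS a

/-- The maps `ρ_r^{s,t}` for pro-complexes. -/
def proRho (n r : ℤ) (hr : 2 ≤ r) (s t : ℤ) (h : s + t = -n) :
    proHolim.{u} n ⟶ proSS ⋙ CoupledSS.dFunctor AB.{u} r hr (s, t) :=
  Pro.natTransOfInv
    (Pro.InvertsInitial.comp (F := Pro.ofInv ⋙ proSS)
      (Pro.invertsInitial_ofInv_extend _ invertsInitial_secondSS)
      (CoupledSS.dFunctor AB.{u} r hr (s, t)))
    (fun X => rho X.sys n r (by lia) s t h) fun X Y a => by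
      have h1 := rho_naturality a n r (by lia) s t h
      refine (congrArg (· ≫ _) (proHolim_map_inc a n)).trans (h1.trans ?_)
      exact congrArg (fun g => rho X.sys n r (by lia) s t h ≫ CoupledSS.Hom.D g r hr (s, t))
        (proSS_map_inc a).symm

end InvSystem

namespace CoupledSS

variable {r₀ : ℤ} (r : ℤ) (hr : r₀ ≤ r) (n : ℤ)

/-- The product of the groups `D_r^{s,n-s}`, as a functor. -/
def towProd : CoupledSS AB.{u} r₀ ⥤ AB.{u} where
  obj S := ∏ᶜ S.tow r hr n
  map f := Limits.Pi.map fun s : ℕ => Hom.D f r hr ((s : ℤ), n - s)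
  map_id S := Pi.hom_ext _ _ fun s => (Limits.Pi.map_π _ _).trans
    ((Category.comp_id _).trans (Category.id_comp _).symm)
  map_comp f g := Pi.hom_ext _ _ fun s => by
    refine (Limits.Pi.map_π _ _).trans ?_
    rw [Category.assoc, Limits.Pi.map_π, ← Category.assoc, Limits.Pi.map_π, Category.assoc]
    rfl

end CoupledSS

namespace InvSystem

/-- The maps `∏ D_r^{s,-n-1-s} ⟶ H_n(holim C)` for pro-complexes. -/
def proAlpha (n r : ℤ) (hr : 2 ≤ r) :
    proSS.{u} ⋙ CoupledSS.towProd r hr (-n - 1) ⟶ proHolim.{u} n :=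
  Pro.natTransOfInv (Pro.invertsInitial_ofInv_extend _ (invertsInitial_homology_holim n))
    (fun X => alpha X.sys n r (by lia)) fun X Y a => by
      have h1 := alpha_naturality a n r (by lia)
      refine Eq.trans ?_ (h1.symm.trans (congrArg (alpha X.sys n r (by lia) ≫ ·)
        (proHolim_map_inc a n).symm))
      exact congrArg (fun g => (CoupledSS.towProd r hr (-n - 1)).map g ≫ alpha Y.sys n r (by lia))
        (proSS_map_inc a)

lemma isMilnor_pro (C : Pro.{u} CHAIN.{u}) (n r : ℤ) (hr : 2 ≤ r) :
    IsMilnor ((proSS.obj C).towMap r hr (-n - 1)) ((proSS.obj C).towMap r hr (-n))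
      (fun s : ℕ => (proRho n r hr s (-n - s) (by lia)).app C) ((proAlpha n r hr).app C) :=
  isMilnor C.sys n r (by lia)

lemma proRho_i (C : Pro.{u} CHAIN.{u}) (n r : ℤ) (hr : 2 ≤ r) (s t : ℤ) (h : s + t = -n)
    (q : ℤ × ℤ) (hq : (s, t) + (-1, 1) = q) (h' : q.1 + q.2 = -n) :
    (proRho n r hr s t h).app C ≫ (proSS.obj C).i r hr (s, t) q hq =
      (proRho n r hr q.1 q.2 h').app C := rho_i C.sys n r (by lia) s t h q hq h'

lemma proRho_ι (C : Pro.{u} CHAIN.{u}) (n r r' : ℤ) (hr : 2 ≤ r) (hr' : r + 1 = r') (s t : ℤ)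
    (h : s + t = -n) :
    (proRho n r' (hr.trans ((lt_add_one r).le.trans_eq hr')) s t h).app C ≫
        (proSS.obj C).ι r r' hr hr' (s, t) =
      (proRho n r hr s t h).app C := rho_ι C.sys n r r' (by lia) hr' s t h

/-- The comparison of Milnor sequences applies to pro-morphisms because both `proAlpha` and `proRho`
are natural for them. -/
lemma bijective_proHolim_map {C C' : Pro.{u} CHAIN.{u}} (f : C ⟶ C')
    (hE : ∀ p, IsIso ((CoupledSS.eFunctor AB.{u} 2 le_rfl p).map (proSS.map f))) (n : ℤ) :
    Function.Bijective ((proHolim n).map f) := by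
  have hD := (CoupledSS.bijective_of_isIso_E (proSS.map f) (by norm_num) hE 2 le_rfl).2
  exact (isMilnor_pro C n 2 le_rfl).bijective (isMilnor_pro C' n 2 le_rfl)
    (fun _ => CoupledSS.Hom.D (proSS.map f) 2 le_rfl _)
    (fun _ => CoupledSS.Hom.D (proSS.map f) 2 le_rfl _) _
    (fun _ => CoupledSS.Hom.i_comm (proSS.map f) 2 le_rfl _ _ _)
    (fun _ => CoupledSS.Hom.i_comm (proSS.map f) 2 le_rfl _ _ _)
    ((proAlpha n 2 le_rfl).naturality f).symm
    (fun _ => ((proRho n 2 le_rfl _ _ _).naturality f).symm) (fun _ => hD _) (fun _ => hD _)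

end InvSystem

end

noncomputable section

/-! ### Towers of abelian groups with filtrations -/

section FilteredTower

variable {A : ℕ → Type*} [∀ s, AddCommGroup (A s)]

/-- The conditions on a tower `⋯ ⟶ A 1 ⟶ A 0` with decreasing filtrations `F s`, under which its
first derived limit vanishes: `f` maps `F (s + 1) k` onto `F s (k + 1)`, and the derived limits of
the induced filtrations of the kernels `K s` of `A s ⟶ A (s - 1)` vanish. -/
structure IsFilteredTower (f : ∀ s, A (s + 1) →+ A s) (F : ∀ s, ℕ → AddSubgroup (A s))
    (K : ∀ s, AddSubgroup (A s)) : Prop where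
  F_le (s k : ℕ) : F s (k + 1) ≤ F s k
  F_zero (s : ℕ) (x : A s) : x ∈ F s 0
  map_mem (s k : ℕ) (x : A (s + 1)) (hx : x ∈ F (s + 1) k) : f s x ∈ F s (k + 1)
  exists_mem (s k : ℕ) (x : A s) (hx : x ∈ F s (k + 1)) : ∃ y ∈ F (s + 1) k, f s y = x
  K_zero (x : A 0) : x ∈ K 0
  K_succ (s : ℕ) (x : A (s + 1)) : x ∈ K (s + 1) ↔ f s x = 0
  lim1 (s : ℕ) (e : ℕ → A s) (he : ∀ m, e m ∈ F s (s + m) ∧ e m ∈ K s) :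
    ∃ z : ℕ → A s, (∀ m, z m ∈ F s (s + m) ∧ z m ∈ K s) ∧ ∀ m, e m = z m - z (m + 1)

namespace IsFilteredTower

variable {f : ∀ s, A (s + 1) →+ A s} {F : ∀ s, ℕ → AddSubgroup (A s)}
  {K : ∀ s, AddSubgroup (A s)} (h : IsFilteredTower f F K)
include h

lemma F_anti (s : ℕ) : Antitone (F s) := antitone_nat_of_succ_le (h.F_le s)

/-- It is enough to solve `b k = z k - z (k + 1)` for large `k`. -/
lemma exists_of_tail (s m : ℕ) (b : ℕ → A s) (hb : ∀ k, b k ∈ F s k)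
    (hz : ∃ z : ℕ → A s, (∀ k, z k ∈ F s (m + k)) ∧ ∀ k, b (m + k) = z k - z (k + 1)) :
    ∃ z : ℕ → A s, (∀ k, z k ∈ F s k) ∧ ∀ k, b k = z k - z (k + 1) := by
  induction m with
  | zero => simpa using hz
  | succ m ih =>
    obtain ⟨z, hz, hz'⟩ := hz
    have e : ∀ k, m + 1 + k = m + (k + 1) := fun k => by omega
    refine ih ⟨fun k => k.casesOn (b m + z 0) z, fun k => ?_, fun k => ?_⟩
    · obtain _ | k := k
      · exact add_mem (hb m) (h.F_le s m (hz 0))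
      · exact (e k) ▸ hz k
    · obtain _ | k := k
      · exact (add_sub_cancel_right _ _).symm
      · exact (e k) ▸ hz' k

/-- The filtration of `A s` has vanishing `lim¹`, by induction on `s`: solve the equation for the
images in the preceding group, lift the solution, and correct it in the kernel `K`. The hypothesis
on the kernels covers only the filtration steps with index at least the column, hence the reduction
to large `k`. -/
lemma exists_primitive (s : ℕ) (b : ℕ → A s) (hb : ∀ k, b k ∈ F s k) :
    ∃ z : ℕ → A s, (∀ k, z k ∈ F s k) ∧ ∀ k, b k = z k - z (k + 1) := by
  induction s with
  | zero =>
    obtain ⟨z, hz, hz'⟩ := h.lim1 0 b fun m => ⟨by simpa using hb m, h.K_zero _⟩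
    exact ⟨z, fun k => by simpa using (hz k).1, hz'⟩
  | succ s ih =>
    -- The map `f` raises the filtration by one, so the images are shifted by one place and a zero
    -- is put in front.
    obtain ⟨z, hz, hz'⟩ := ih (fun k => k.casesOn 0 fun k => f s (b k)) fun k => by
      obtain _ | k := k
      · exact zero_mem _
      · exact h.map_mem s k _ (hb k)
    choose y hy hy' using fun k => h.exists_mem s k (z (k + 1)) (hz (k + 1))
    -- The error of the lifted solution lies in the kernel; from the index `s + 1` on, its
    -- filtration is high enough for the hypothesis.
    obtain ⟨t, ht, ht'⟩ := h.lim1 (s + 1)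
      (fun m => b (s + 1 + m) - (y (s + 1 + m) - y (s + 1 + m + 1))) fun m =>
        ⟨sub_mem (hb _) (sub_mem (hy _) (h.F_le _ _ (hy _))), (h.K_succ _ _).2 (by
          rw [map_sub, map_sub, hy', hy', ← hz' (s + 1 + m + 1), sub_self])⟩
    refine h.exists_of_tail (s + 1) (s + 1) b hb ⟨fun k => y (s + 1 + k) + t k,
      fun k => add_mem (hy _) (ht k).1, fun k => ?_⟩
    have := ht' k
    rw [sub_eq_iff_eq_add] at this
    rw [this]
    change _ = y (s + 1 + k) + t k - (y (s + 1 + k + 1) + t (k + 1))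
    abel

/-- The maps between the intersections of the filtrations are surjective. -/
lemma exists_mem_iInf (s : ℕ) (x : A s) (hx : ∀ k, x ∈ F s k) :
    ∃ y, (∀ k, y ∈ F (s + 1) k) ∧ f s y = x := by
  choose y hy hy' using fun k => h.exists_mem s k x (hx (k + 1))
  obtain ⟨t, ht, ht'⟩ := h.lim1 (s + 1)
    (fun m => y (s + 1 + m) - y (s + 1 + m + 1)) fun m =>
      ⟨sub_mem (hy _) (h.F_le _ _ (hy _)), (h.K_succ _ _).2 (by
        rw [map_sub, hy', hy', sub_self])⟩
  -- The preimages of `x` in the various filtration steps are corrected by elements of the kernel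
  -- until they agree. The common value then lies in all steps.
  have hc : ∀ m, y (s + 1 + m) - t m = y (s + 1) - t 0 := fun m => by
    induction m with
    | zero => rfl
    | succ m ih =>
      rw [← ih, ← add_assoc, sub_eq_sub_iff_sub_eq_sub, ← neg_sub, ht' m, neg_sub]
  refine ⟨y (s + 1) - t 0, fun k => ?_, ?_⟩
  · rw [← hc k]
    exact h.F_anti (s + 1) (Nat.le_add_left k (s + 1)) (sub_mem (hy _) (ht k).1)
  · rw [map_sub, hy', (h.K_succ _ _).1 (ht 0).2, sub_zero]

/-- The image of `a (s + k)` in `A s`. -/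
lemma exists_images (a : ∀ s, A s) : ∃ b : ∀ s, ℕ → A s,
    (∀ s k, b s k ∈ F s k) ∧ (∀ s, b s 0 = a s) ∧ ∀ s k, b s (k + 1) = f s (b (s + 1) k) := by
  let b : ∀ (k s : ℕ), A s := fun k => k.rec a fun _ g s => f s (g (s + 1))
  refine ⟨fun s k => b k s, fun s k => ?_, fun s => rfl, fun s k => rfl⟩
  induction k generalizing s with
  | zero => exact h.F_zero s _
  | succ k ih => exact h.map_mem s k _ (ih (s + 1))

/-- The first derived limit of the tower vanishes. -/
lemma exists_sub (a : ∀ s, A s) : ∃ z : ∀ s, A s, ∀ s, a s = z s - f s (z (s + 1)) := by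
  -- For fixed `s`, the images of the elements `a (s + k)` in `A s` lie in deeper and deeper
  -- filtration steps, and `z s` is a formal sum of this series.
  obtain ⟨b, hb, hb0, hb1⟩ := h.exists_images a
  choose z hz hz' using fun s => h.exists_primitive s (b s) (hb s)
  -- The formal sums for neighbouring `s` are compatible up to an error which is independent of `k`,
  -- and which therefore lies in the intersection of the filtration.
  have hc : ∀ s k, z s (k + 1) - f s (z (s + 1) k) = z s 1 - f s (z (s + 1) 0) := fun s k => by
    induction k with
    | zero => rfl
    | succ k ih =>
      have h1 := hz' s (k + 1)
      rw [hb1, hz' (s + 1) k, map_sub] at h1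
      rw [← ih, sub_eq_sub_iff_sub_eq_sub, ← neg_sub, ← h1, neg_sub]
  have hF : ∀ s k, z s 1 - f s (z (s + 1) 0) ∈ F s k := fun s k => by
    rw [← hc s k]
    exact h.F_le s k (sub_mem (hz s _) (h.map_mem s k _ (hz _ _)))
  -- On the intersections the maps of the tower are surjective, so the errors can be removed by a
  -- recursion that starts with `0`.
  have step : ∀ s (v : {v : A s // ∀ k, v ∈ F s k}), ∃ w : {w : A (s + 1) // ∀ k, w ∈ F (s + 1) k},
      f s w.1 = v.1 - (z s 1 - f s (z (s + 1) 0)) := fun s v => by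
    obtain ⟨w, hw, hw'⟩ := h.exists_mem_iInf s _ fun k => sub_mem (v.2 k) (hF s k)
    exact ⟨⟨w, hw⟩, hw'⟩
  choose g hg using step
  obtain ⟨w, hw⟩ : ∃ w : ∀ s, A s, ∀ s, f s (w (s + 1)) = w s - (z s 1 - f s (z (s + 1) 0)) :=
    let w : ∀ s, {v : A s // ∀ k, v ∈ F s k} := fun s => s.rec ⟨0, fun _ => zero_mem _⟩ g
    ⟨fun s => (w s).1, fun s => hg s (w s)⟩
  refine ⟨fun s => z s 0 - w s, fun s => ?_⟩
  have key : ∀ p q r c : A s, p - q = p - c - (r - (c - (q - r))) := fun p q r c => by abel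
  rw [← hb0, hz' s 0, map_sub, hw]
  exact key _ _ _ _

/-- An element of the intersection of the filtration of `A s`, with image `0` in `A (s - 1)`, is
a member of a compatible family of elements. -/
lemma exists_family (s : ℕ) (x : A s) (hx : ∀ k, x ∈ F s k) (hK : x ∈ K s) :
    ∃ y : ∀ a, A a, (∀ a, f a (y (a + 1)) = y a) ∧ (∀ a < s, y a = 0) ∧ y s = x := by
  -- The family is zero below `s`, equals `x` at `s`, and is continued above `s` by lifting within
  -- the intersections of the filtrations.
  let P : ∀ a, A a → Prop := fun a v =>
    (∀ k, v ∈ F a k) ∧ (a < s → v = 0) ∧ ∀ e : s = a, e ▸ x = v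
  have h0 : ∃ v, P 0 v := by
    obtain _ | s := s
    · exact ⟨x, hx, fun h => absurd h (Nat.lt_irrefl 0), fun _ => rfl⟩
    · exact ⟨0, fun _ => zero_mem _, fun _ => rfl, fun e => absurd e (Nat.succ_ne_zero s)⟩
  have step : ∀ a (v : {v // P a v}), ∃ w : {w // P (a + 1) w}, f a w.1 = v.1 := by
    rintro a ⟨v, hv, hv', hv''⟩
    obtain hlt | rfl | hgt := lt_trichotomy (a + 1) s
    · refine ⟨⟨0, fun _ => zero_mem _, fun _ => rfl, fun e => absurd e hlt.ne'⟩, ?_⟩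
      exact (map_zero _).trans (hv' (by omega)).symm
    · refine ⟨⟨x, hx, fun e => absurd e (lt_irrefl _), fun _ => rfl⟩, ?_⟩
      exact ((h.K_succ a x).1 hK).trans (hv' (Nat.lt_succ_self a)).symm
    · obtain ⟨w, hw, hw'⟩ := h.exists_mem_iInf a v hv
      exact ⟨⟨w, hw, fun e => absurd e hgt.not_gt, fun e => absurd e hgt.ne⟩, hw'⟩
  obtain ⟨v₀, hv₀⟩ := h0
  choose g hg using step
  let w : ∀ a, {v // P a v} := fun a => a.rec ⟨v₀, hv₀⟩ g
  exact ⟨fun a => (w a).1, fun a => hg a (w a), fun a => (w a).2.2.1, ((w s).2.2.2 rfl).symm⟩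

end IsFilteredTower

end FilteredTower

end

noncomputable section

/-! ### Towers of abelian groups and strong convergence -/

section TowerLift

variable {C : Type*} [Category* C] (T : ℕᵒᵖ ⥤ C)

/-- The cone of a tower given by morphisms that are compatible with the maps of the tower. -/
abbrev towerCone {A : C} (g : ∀ s : ℕ, A ⟶ T.obj (Opposite.op s))
    (hg : ∀ s, g (s + 1) ≫ towerMap T s = g s) : Cone T where
  pt := A
  π := NatTrans.ofOpSequence (F := (Functor.const _).obj A) (fun s => g s)
    fun s => (Category.id_comp _).trans (hg s).symm

variable [HasLimit T]

/-- The morphism to the limit of a tower. -/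
def towerLift {A : C} (g : ∀ s : ℕ, A ⟶ T.obj (Opposite.op s))
    (hg : ∀ s, g (s + 1) ≫ towerMap T s = g s) : A ⟶ limit T := limit.lift T (towerCone T g hg)

lemma towerLift_π {A : C} (g : ∀ s : ℕ, A ⟶ T.obj (Opposite.op s))
    (hg : ∀ s, g (s + 1) ≫ towerMap T s = g s) (s : ℕ) :
    towerLift T g hg ≫ limit.π T (Opposite.op s) = g s :=
  limit.lift_π _ _

end TowerLift

namespace InvSystem.AB

variable {T : ℕᵒᵖ ⥤ AB.{u}}

lemma tower_ext {x y : (limit T : AB.{u})}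
    (h : ∀ s : ℕ, limit.π T (Opposite.op s) x = limit.π T (Opposite.op s) y) : x = y :=
  limit_ext fun k => h k.unop

end InvSystem.AB

lemma exists_of_isZero_towerLim1 {T : ℕᵒᵖ ⥤ AB.{u}} (hT : IsZero (towerLim1 T))
    (e : ∀ s : ℕ, T.obj (Opposite.op s)) :
    ∃ z : ∀ s : ℕ, T.obj (Opposite.op s), ∀ s, e s = z s - towerMap T s (z (s + 1)) := by
  let d : (∏ᶜ fun n : ℕ => T.obj (Opposite.op n)) ⟶ ∏ᶜ fun n : ℕ => T.obj (Opposite.op n) :=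
    𝟙 _ - Pi.lift fun n => Pi.π (fun n : ℕ => T.obj (Opposite.op n)) (n + 1) ≫ towerMap T n
  have hd : Epi d := Preadditive.epi_of_isZero_cokernel d hT
  obtain ⟨z, hz⟩ := (ModuleCat.epi_iff_surjective _).1 hd (AB.mkPi e)
  refine ⟨fun s => Pi.π (fun n : ℕ => T.obj (Opposite.op n)) s z, fun s => ?_⟩
  have h1 : d ≫ Pi.π _ s = Pi.π _ s - Pi.π _ (s + 1) ≫ towerMap T s := by
    rw [Preadditive.sub_comp, Category.id_comp, limit.lift_π]
    rfl
  have h2 := congr($h1 z)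
  refine Eq.trans ?_ h2
  refine (AB.π_mkPi e s).symm.trans ?_
  exact (congrArg (Pi.π (fun n : ℕ => T.obj (Opposite.op n)) s) hz).symm

namespace ModuleCat

variable {R : Type u} [Ring R] (M : ModuleCat.{v} R)

/-- The quotient by a submodule, as an object of the category of modules. -/
def quot (N : Submodule R M) : ModuleCat.{v} R := ModuleCat.of R (M ⧸ N)

variable {M}

/-- The projection to the quotient. -/
def quotMk (N : Submodule R M) : M ⟶ M.quot N := ModuleCat.ofHom N.mkQ

lemma quotMk_surjective (N : Submodule R M) : Function.Surjective (quotMk N) := N.mkQ_surjective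

lemma quotMk_eq_zero_iff (N : Submodule R M) (x : M) : quotMk N x = 0 ↔ x ∈ N :=
  Submodule.Quotient.mk_eq_zero N

/-- The morphisms from a quotient. -/
def quotDesc (N : Submodule R M) {M' : ModuleCat.{v} R} (g : M ⟶ M') (hg : ∀ x ∈ N, g x = 0) :
    M.quot N ⟶ M' := ModuleCat.ofHom (N.liftQ g.hom hg)

/-- The tower of the quotients by the submodules of a decreasing sequence. -/
def quotTower (N : ℕ → Submodule R M) (hN : ∀ s, N (s + 1) ≤ N s) : ℕᵒᵖ ⥤ ModuleCat.{v} R :=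
  Functor.ofOpSequence (X := fun s => M.quot (N s)) fun s =>
    quotDesc (N (s + 1)) (quotMk (N s)) fun _ hx => (quotMk_eq_zero_iff _ _).2 (hN s hx)

variable (N : ℕ → Submodule R M) (hN : ∀ s, N (s + 1) ≤ N s)

/-- The projection to the tower of quotients. -/
def quotTowerMk (s : ℕ) : M ⟶ (quotTower N hN).obj (Opposite.op s) := quotMk (N s)

lemma quotTowerMk_surjective (s : ℕ) : Function.Surjective (quotTowerMk N hN s) :=
  quotMk_surjective _

lemma quotTowerMk_eq_zero_iff (s : ℕ) (x : M) : quotTowerMk N hN s x = 0 ↔ x ∈ N s :=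
  quotMk_eq_zero_iff _ _

lemma quotTowerMk_map (s : ℕ) :
    quotTowerMk N hN (s + 1) ≫ towerMap (quotTower N hN) s = quotTowerMk N hN s := by
  have h : towerMap (quotTower N hN) s = quotDesc (N (s + 1)) (quotMk (N s))
      fun _ hx => (quotMk_eq_zero_iff _ _).2 (hN s hx) :=
    Functor.ofOpSequence_map_homOfLE_succ _ s
  rw [h]
  rfl

lemma epi_towerMap_quotTower (s : ℕ) : Epi (towerMap (quotTower N hN) s) := by
  have := (ModuleCat.epi_iff_surjective _).2 (quotTowerMk_surjective N hN s)
  rw [← quotTowerMk_map] at this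
  exact epi_of_epi (quotTowerMk N hN (s + 1)) _

end ModuleCat

namespace CoupledSS

section

variable (S : CoupledSS AB.{u} 2)

lemma pageIncl_k (r r' : ℤ) (hr : 2 ≤ r) (hr' : r + 1 = r') (p : ℤ × ℤ) (hp : p.1 < r) :
    S.pageIncl r r' hr hr' p hp ≫ S.k r hr p =
      S.k r' (hr.trans ((lt_add_one r).le.trans_eq hr')) p ≫ S.ι r r' hr hr' p := by
  have h := S.k_ι r r' hr hr' p
  rw [pageIncl, Category.assoc, Category.assoc, ← h, Iso.inv_comp_eq,
    ← HomologicalComplex.isoHomologyπ_hom (S.ss.page r hr) _ p rfl (S.d_eq_zero r hr _ p hp),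
    Iso.inv_hom_id_assoc]

/-- The kernel of `k` is the image of `j` from column `p.1 - r`, which is negative. -/
lemma k_injective (r : ℤ) (hr : 2 ≤ r) (p : ℤ × ℤ) (hp : p.1 < r) : Function.Injective (S.k r hr p) := by
  refine (injective_iff_map_eq_zero _).2 fun e he => ?_
  have ho : (p - (r, 1 - r)) + (r, 1 - r) = p := by simp
  obtain ⟨x, rfl⟩ := (S.k_eq_zero_iff r hr _ p ho e).1 he
  have := S.subsingleton_D r hr (p - (r, 1 - r)) (by simp; lia)
  rw [Subsingleton.elim x 0, map_zero]

variable (n : ℤ)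

/-- The filtration of `D_2` by the terms `D_r`. -/
def filtrationD (s : ℕ) (k : ℕ) : AddSubgroup (S.tow 2 le_rfl n s) :=
  (S.ιFirst (2 + k) (by lia) ((s : ℤ), n - s)).hom.toAddMonoidHom.range

lemma mem_filtrationD (s k : ℕ) (r : ℤ) (hr : 2 ≤ r) (h : r = 2 + k) (x : S.tow 2 le_rfl n s) :
    x ∈ S.filtrationD n s k ↔ ∃ y, S.ιFirst r hr ((s : ℤ), n - s) y = x := by
  subst h
  rfl

/-- The kernels of the maps of the tower of the groups `D_2`. -/
def kernelD (s : ℕ) : AddSubgroup (S.tow 2 le_rfl n s) :=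
  (S.i 2 le_rfl ((s : ℤ), n - s) _ rfl).hom.toAddMonoidHom.ker

lemma mem_kernelD (s : ℕ) (q : ℤ × ℤ) (h : ((s : ℤ), n - s) + (-1, 1) = q) (x : S.tow 2 le_rfl n s) :
    x ∈ S.kernelD n s ↔ S.i 2 le_rfl _ q h x = 0 := by
  subst h
  rfl

/-- As `i` on `D_r` is the restriction of `i` on `D_2`, exactness of the couple `r` shows that its
kernel is the image of `E_r`. In this way conditions on the `E_r` become conditions on the filtered
tower. -/
lemma mem_filtrationD_kernelD (s k : ℕ) (r : ℤ) (hr : 2 ≤ r) (h : r = 2 + k)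
    (x : S.tow 2 le_rfl n s) : x ∈ S.filtrationD n s k ∧ x ∈ S.kernelD n s ↔
      ∃ e, S.ιFirst r hr _ (S.k r hr ((s : ℤ), n - s) e) = x := by
  rw [S.mem_filtrationD n s k r hr h, S.mem_kernelD n s _ rfl]
  have hi : ∀ y, S.i 2 le_rfl _ _ rfl (S.ιFirst r hr ((s : ℤ), n - s) y) =
      S.ιFirst r hr _ (S.i r hr _ _ rfl y) := fun y => congr($(S.i_ιFirst r hr _ _ rfl) y).symm
  constructor
  · rintro ⟨⟨y, rfl⟩, hy⟩
    rw [hi] at hy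
    have hy := S.ιFirst_injective r hr _ (hy.trans (map_zero _).symm)
    obtain ⟨e, rfl⟩ := (S.i_eq_zero_iff r hr _ _ rfl y).1 hy
    exact ⟨e, rfl⟩
  · rintro ⟨e, rfl⟩
    refine ⟨⟨_, rfl⟩, (hi _).trans ?_⟩
    rw [(S.i_eq_zero_iff r hr _ _ rfl _).2 ⟨e, rfl⟩, map_zero]

/-- The maps `k` on the tower of the terms `E_r`. -/
abbrev towerK (s : ℕ) (t : ℤ) (m : ℕ) :
    (S.pageTower s t).obj (Opposite.op m) ⟶ S.D (s + 2 + m) (by lia) (s, t) :=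
  S.k (s + 2 + m) (by lia) (s, t)

/-- The maps `k` to the second couple on the tower of the terms `E_r`. -/
abbrev towerKFirst (s : ℕ) (t : ℤ) (m : ℕ) :
    (S.pageTower s t).obj (Opposite.op m) ⟶ S.D 2 le_rfl (s, t) :=
  S.towerK s t m ≫ S.ιFirst (s + 2 + m) (by lia) (s, t)

lemma towerMap_towerK (s m : ℕ) (t : ℤ) : towerMap (S.pageTower s t) m ≫ S.towerK s t m =
    S.towerK s t (m + 1) ≫
      S.ι (s + 2 + m) (s + 2 + (m + 1 : ℕ)) (by lia) (by push_cast; ring) (s, t) := by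
  have h1 : towerMap (S.pageTower s t) m = S.pageIncl (s + 2 + m) (s + 2 + (m + 1 : ℕ)) (by lia)
      (by push_cast; ring) (s, t) (by dsimp only; lia) :=
    Functor.ofOpSequence_map_homOfLE_succ _ m
  exact (congrArg (· ≫ S.towerK s t m) h1).trans (S.pageIncl_k _ _ _ _ _ _)

lemma towerMap_towerKFirst (s m : ℕ) (t : ℤ) :
    towerMap (S.pageTower s t) m ≫ S.towerKFirst s t m = S.towerKFirst s t (m + 1) := by
  refine (Category.assoc _ _ _).symm.trans ?_
  rw [towerMap_towerK, Category.assoc, ← ιFirst_succ]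

/-- Step `k` of the filtration is `D_{2+k}`, so that `i` maps one step onto the next one because the
following `D` is the image of `i`. The kernel in step `s + m` is the image of `E_{s+2+m}`, the
`m`-th term of `pageTower`, and `hS` provides the vanishing of `lim¹`. -/
lemma isFilteredTower (hS : ∀ (s : ℕ) (t : ℤ), IsZero (towerLim1 (S.pageTower s t))) :
    IsFilteredTower (fun s => (S.towMap 2 le_rfl n s).hom.toAddMonoidHom) (S.filtrationD n)
      (S.kernelD n) where
  F_le s k := by
    rintro x hx
    obtain ⟨y, rfl⟩ := (S.mem_filtrationD n s (k + 1) (2 + k + 1) (by lia) (by push_cast; ring) x).1 hx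
    refine (S.mem_filtrationD n s k (2 + k) (by lia) rfl _).2 ⟨S.ι _ _ _ rfl _ y, ?_⟩
    exact congr($(S.ιFirst_succ (2 + k) (2 + k + 1) (by lia) rfl _) y).symm
  F_zero s x := by
    refine (S.mem_filtrationD n s 0 2 le_rfl (by simp) _).2 ⟨x, ?_⟩
    rw [ιFirst_self]
    rfl
  map_mem s k x hx := by
    obtain ⟨y, rfl⟩ := (S.mem_filtrationD n (s + 1) k (2 + k) (by lia) rfl x).1 hx
    refine (S.mem_filtrationD n s (k + 1) (2 + k + 1) (by lia) (by push_cast; ring) _).2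
      ⟨S.π (2 + k) _ (by lia) rfl _ _ (tow_rel n s) y, ?_⟩
    rw [S.ιFirst_succ (2 + k) (2 + k + 1) (by lia) rfl]
    refine (congrArg (S.ιFirst (2 + k) (by lia) _) (S.π_ι_apply _ _ _ rfl _ _ (tow_rel n s) y)).trans ?_
    exact congr($(S.i_ιFirst (2 + k) (by lia) _ _ (tow_rel n s)) y)
  exists_mem s k x hx := by
    obtain ⟨y, rfl⟩ := (S.mem_filtrationD n s (k + 1) (2 + k + 1) (by lia) (by push_cast; ring) x).1 hx
    obtain ⟨z, rfl⟩ := S.π_surjective (2 + k) (by lia) _ rfl _ _ (tow_rel n s) y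
    refine ⟨_, (S.mem_filtrationD n (s + 1) k (2 + k) (by lia) rfl _).2 ⟨z, rfl⟩, ?_⟩
    rw [S.ιFirst_succ (2 + k) (2 + k + 1) (by lia) rfl]
    refine Eq.trans ?_ (congrArg (S.ιFirst (2 + k) (by lia) _) (S.π_ι_apply _ _ _ rfl _ _ (tow_rel n s) z)).symm
    exact congr($(S.i_ιFirst (2 + k) (by lia) _ _ (tow_rel n s)) z).symm
  K_zero x := by
    have := S.subsingleton_D 2 le_rfl ((((0 : ℕ) : ℤ), n - (0 : ℕ)) + (-1, 1)) (by simp)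
    exact (S.mem_kernelD n 0 _ rfl x).2 (Subsingleton.elim _ _)
  K_succ s x := S.mem_kernelD n (s + 1) _ (tow_rel n s) x
  lim1 s e he := by
    choose a ha using fun m => (S.mem_filtrationD_kernelD n s (s + m) (s + 2 + m) (by lia)
      (by push_cast; ring) _).1 (he m)
    obtain ⟨z, hz⟩ := exists_of_isZero_towerLim1 (hS s (n - s)) a
    refine ⟨fun m => S.towerKFirst s (n - s) m (z m),
      fun m => (S.mem_filtrationD_kernelD n s (s + m) (s + 2 + m) (by lia)
        (by push_cast; ring) _).2 ⟨z m, rfl⟩, fun m => ?_⟩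
    have h1 := congr($(S.towerMap_towerKFirst s m (n - s)) (z (m + 1)))
    refine (ha m).symm.trans ((congrArg (S.towerKFirst s (n - s) m) (hz m)).trans ?_)
    exact (map_sub _ _ _).trans (congrArg (_ - ·) h1)

end

end CoupledSS

end

noncomputable section

namespace CoupledSS

/-! ### Strong convergence -/

section Convergence

variable {S : CoupledSS AB.{u} 2} {n n' : ℤ} {H : AB.{u}}
  (ρ : ∀ (r : ℤ) (hr : 2 ≤ r) (s : ℕ), H ⟶ S.tow r hr n s)

/-- The elements of `H` that are annihilated by the maps to `D_2^{a,n-a}` for `a < s`. -/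
def kernelFiltration (s : ℕ) : Submodule ℤ H := ⨅ a : Fin s, LinearMap.ker (ρ 2 le_rfl a).hom

variable {ρ}

lemma mem_kernelFiltration {s : ℕ} {x : H} :
    x ∈ kernelFiltration ρ s ↔ ∀ a < s, ρ 2 le_rfl a x = 0 := by
  rw [kernelFiltration, Submodule.mem_iInf]
  exact ⟨fun h a ha => h ⟨a, ha⟩, fun h a => h a a.2⟩

variable (ρ) in
lemma kernelFiltration_succ_le (s : ℕ) : kernelFiltration ρ (s + 1) ≤ kernelFiltration ρ s :=
  fun _ hx => mem_kernelFiltration.2 fun a ha => mem_kernelFiltration.1 hx a (Nat.lt_succ_of_lt ha)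

variable (ρ) in
/-- The tower of the quotients of `H` by the kernels of the maps to `D_2^{s,n-s}`. -/
abbrev convergenceTower : ℕᵒᵖ ⥤ AB.{u} :=
  ModuleCat.quotTower (kernelFiltration ρ) (kernelFiltration_succ_le ρ)

variable (ρ) in
/-- The projections of `H` to its quotients. -/
abbrev convergenceπ (s : ℕ) : H ⟶ (convergenceTower ρ).obj (Opposite.op s) :=
  ModuleCat.quotTowerMk (kernelFiltration ρ) (kernelFiltration_succ_le ρ) s

lemma isZero_convergenceTower_zero : IsZero ((convergenceTower ρ).obj (Opposite.op 0)) := by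
  have : Subsingleton ((convergenceTower ρ).obj (Opposite.op 0)) := ⟨fun x y => by
    have h : ∀ z, z = (0 : (convergenceTower ρ).obj (Opposite.op 0)) := fun z => by
      obtain ⟨w, rfl⟩ := ModuleCat.quotTowerMk_surjective (kernelFiltration ρ)
        (kernelFiltration_succ_le ρ) 0 z
      exact (ModuleCat.quotTowerMk_eq_zero_iff _ _ _ _).2
        (mem_kernelFiltration.2 fun a ha => absurd ha (Nat.not_lt_zero a))
    rw [h x, h y]⟩
  exact ModuleCat.isZero_of_subsingleton _

variable {α : ∏ᶜ S.tow 2 le_rfl n' ⟶ H}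
  (hM : IsMilnor (S.towMap 2 le_rfl n') (S.towMap 2 le_rfl n) (ρ 2 le_rfl) α)
  (hρ : ∀ r hr s, ρ r hr s ≫ S.ιFirst r hr _ = ρ 2 le_rfl s)

section

include hρ

lemma ιFirst_ρ_apply (r : ℤ) (hr : 2 ≤ r) (s : ℕ) (x : H) :
    S.ιFirst r hr _ (ρ r hr s x) = ρ 2 le_rfl s x := congr($(hρ r hr s) x)

lemma ρ_eq_zero_iff (r : ℤ) (hr : 2 ≤ r) (s : ℕ) (x : H) : ρ r hr s x = 0 ↔ ρ 2 le_rfl s x = 0 := by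
  rw [← ιFirst_ρ_apply hρ r hr]
  exact (map_eq_zero_iff _ (S.ιFirst_injective r hr _)).symm

variable (r : ℤ) (hr : 2 ≤ r) (s : ℕ)

/-- The embeddings of the quotients of `H`. -/
def convergenceι : (convergenceTower ρ).obj (Opposite.op (s + 1)) ⟶ S.tow r hr n s :=
  ModuleCat.quotDesc _ (ρ r hr s) fun _ hx =>
    (ρ_eq_zero_iff hρ r hr s _).2 (mem_kernelFiltration.1 hx s (Nat.lt_succ_self s))

lemma convergenceπ_ι : convergenceπ ρ (s + 1) ≫ convergenceι hρ r hr s = ρ r hr s := rfl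

include hM

omit hρ in
lemma ρ_eq_zero_of_le (x : H) (hx : ρ 2 le_rfl s x = 0) : ∀ a ≤ s, ρ 2 le_rfl a x = 0 := by
  induction s with
  | zero => exact fun a ha => (Nat.le_zero.1 ha) ▸ hx
  | succ s ih =>
    intro a ha
    obtain h | rfl := ha.lt_or_eq
    · refine ih ?_ a (Nat.lt_succ_iff.1 h)
      refine congr($(hM.ρ_q s) x).symm.trans ?_
      exact (congrArg (S.towMap 2 le_rfl n s) hx).trans (map_zero _)
    · exact hx

lemma convergenceι_injective : Function.Injective (convergenceι hρ r hr s) := by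
  refine (injective_iff_map_eq_zero _).2 fun y hy => ?_
  obtain ⟨x, rfl⟩ := ModuleCat.quotTowerMk_surjective (kernelFiltration ρ)
    (kernelFiltration_succ_le ρ) (s + 1) y
  refine (ModuleCat.quotTowerMk_eq_zero_iff _ _ _ _).2 (mem_kernelFiltration.2 fun a ha => ?_)
  exact ρ_eq_zero_of_le hM s x ((ρ_eq_zero_iff hρ r hr s x).1 hy) a (Nat.lt_succ_iff.1 ha)

end

section Lim

variable (hF : ∀ m, IsFilteredTower (fun s => (S.towMap 2 le_rfl m s).hom.toAddMonoidHom)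
  (S.filtrationD m) (S.kernelD m))

variable (ρ) in
/-- The comparison of `H` with the limit of its quotients. -/
def convergenceLift : H ⟶ limit (convergenceTower ρ) :=
  towerLift (convergenceTower ρ) (convergenceπ ρ) (ModuleCat.quotTowerMk_map _ _)

lemma convergenceLift_π (s : ℕ) :
    convergenceLift ρ ≫ limit.π (convergenceTower ρ) (Opposite.op s) = convergenceπ ρ s :=
  towerLift_π _ _ _ _

include hM hρ hF

/-- By the Milnor sequence, an element that vanishes in all quotients comes from `lim¹` of the tower
`D_2`, which is zero by `IsFilteredTower.exists_sub`. Conversely, a compatible family in the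
quotients embeds as a compatible family in `D_2`, and this lifts to `H`. -/
lemma convergenceLift_bijective : Function.Bijective (convergenceLift ρ) := by
  constructor
  · refine (injective_iff_map_eq_zero _).2 fun x hx => ?_
    have h0 : ∀ s, ρ 2 le_rfl s x = 0 := fun s => by
      have h1 : convergenceπ ρ (s + 1) x = 0 :=
        congr($(convergenceLift_π (s + 1)) x).symm.trans
          ((congrArg (limit.π (convergenceTower ρ) (Opposite.op (s + 1))) hx).trans (map_zero _))
      exact mem_kernelFiltration.1 ((ModuleCat.quotTowerMk_eq_zero_iff _ _ _ _).1 h1) s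
        (Nat.lt_succ_self s)
    obtain ⟨y, rfl⟩ := (hM.ρ_eq_zero_iff x).1 h0
    exact (hM.α_eq_zero_iff y).2 ((hF n').exists_sub fun s => Pi.π (S.tow 2 le_rfl n') s y)
  · intro y
    have hy : ∀ s, towerMap (convergenceTower ρ) s
        (limit.π (convergenceTower ρ) (Opposite.op (s + 1)) y) =
          limit.π (convergenceTower ρ) (Opposite.op s) y := fun s =>
      congr($(limit.w (convergenceTower ρ) (homOfLE (Nat.le_succ s)).op) y)
    choose x hx using fun s => ModuleCat.quotTowerMk_surjective (kernelFiltration ρ)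
      (kernelFiltration_succ_le ρ) s (limit.π (convergenceTower ρ) (Opposite.op s) y)
    have hx' : ∀ s, convergenceπ ρ s (x (s + 1)) = convergenceπ ρ s (x s) := fun s => by
      refine congr($(ModuleCat.quotTowerMk_map (kernelFiltration ρ) (kernelFiltration_succ_le ρ) s)
        (x (s + 1))).symm.trans ?_
      exact ((congrArg _ (hx (s + 1))).trans (hy s)).trans (hx s).symm
    obtain ⟨z, hz⟩ := hM.exists_lift (fun s => ρ 2 le_rfl s (x (s + 1))) fun s => by
      refine congr($(hM.ρ_q s) (x (s + 2))).trans ?_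
      exact congrArg (convergenceι hρ 2 le_rfl s) (hx' (s + 1))
    refine ⟨z, InvSystem.AB.tower_ext fun s => ?_⟩
    refine congr($(convergenceLift_π s) z).trans (Eq.trans ?_ (hx s))
    obtain _ | s := s
    · have := ModuleCat.subsingleton_of_isZero (isZero_convergenceTower_zero (ρ := ρ))
      exact Subsingleton.elim _ _
    · exact convergenceι_injective hM hρ 2 le_rfl s (hz s)

end Lim

/-! #### The kernels -/

section Kernel

variable (s : ℕ)

variable (ρ) in
/-- The inclusion of the kernel. -/
abbrev kernelIncl : kernel (towerMap (convergenceTower ρ) s) ⟶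
    (convergenceTower ρ).obj (Opposite.op (s + 1)) := kernel.ι _

lemma exists_kernelIncl (x : H) (hx : ∀ a < s, ρ 2 le_rfl a x = 0) :
    ∃ y, kernelIncl ρ s y = convergenceπ ρ (s + 1) x := by
  refine ModuleCat.exists_kernel_ι _ _ ?_
  refine congr($(ModuleCat.quotTowerMk_map (kernelFiltration ρ) (kernelFiltration_succ_le ρ) s)
    x).trans ?_
  exact (ModuleCat.quotTowerMk_eq_zero_iff _ _ _ _).2 (mem_kernelFiltration.2 hx)

lemma exists_of_kernelIncl (y : (kernel (towerMap (convergenceTower ρ) s) : AB.{u})) :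
    ∃ x : H, (∀ a < s, ρ 2 le_rfl a x = 0) ∧ kernelIncl ρ s y = convergenceπ ρ (s + 1) x := by
  obtain ⟨x, hx⟩ := ModuleCat.quotTowerMk_surjective (kernelFiltration ρ)
    (kernelFiltration_succ_le ρ) (s + 1) (kernelIncl ρ s y)
  refine ⟨x, mem_kernelFiltration.1 ((ModuleCat.quotTowerMk_eq_zero_iff _
    (kernelFiltration_succ_le ρ) s x).1 ?_), hx.symm⟩
  refine congr($(ModuleCat.quotTowerMk_map (kernelFiltration ρ) (kernelFiltration_succ_le ρ) s)
    x).symm.trans ?_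
  exact (congrArg (towerMap (convergenceTower ρ) s) hx).trans congr($(kernel.condition (towerMap (convergenceTower ρ) s)) y)

include hM hρ in
-- An element of the kernel is represented by some `x` whose images in all columns below `s` vanish.
-- Then `i` kills its image in `D_r^s`, so this image is `k e` for some `e`; injectivity of `k`
-- makes the choice of `e` additive.
lemma exists_kernelToPage (k : ℕ) :
    ∃ l : kernel (towerMap (convergenceTower ρ) s) ⟶ (S.pageTower s (n - s)).obj (Opposite.op k),
      l ≫ S.towerK s (n - s) k = kernelIncl ρ s ≫ convergenceι hρ (s + 2 + k) (by lia) s := by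
  refine ModuleCat.exists_lift _ (S.k_injective _ _ _ (by dsimp only; lia)) _ fun y => ?_
  obtain ⟨x, hx, hy⟩ := exists_of_kernelIncl s y
  have h1 : S.i (s + 2 + k) (by lia) ((s : ℤ), n - s) _ rfl (ρ (s + 2 + k) (by lia) s x) = 0 := by
    obtain _ | s := s
    · have := S.subsingleton_D ((0 : ℕ) + 2 + k) (by lia)
        ((((0 : ℕ) : ℤ), n - ((0 : ℕ) : ℤ)) + (-1, 1)) (by simp)
      exact Subsingleton.elim _ _
    · have h2 : ∀ q (hq : ((((s + 1 : ℕ) : ℤ), n - ((s + 1 : ℕ) : ℤ)) + (-1, 1) = q)),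
          q = ((s : ℤ), n - s) → S.i ((s + 1 : ℕ) + 2 + k) (by lia) _ q hq
            (ρ ((s + 1 : ℕ) + 2 + k) (by lia) (s + 1) x) = 0 := by
        rintro q hq rfl
        refine S.ιFirst_injective _ _ _ (Eq.trans ?_ (map_zero _).symm)
        refine congr($(S.i_ιFirst ((s + 1 : ℕ) + 2 + k) (by lia) _ _ hq) _).trans ?_
        refine (congrArg (S.towMap 2 le_rfl n s) (ιFirst_ρ_apply hρ _ _ _ x)).trans ?_
        exact congr($(hM.ρ_q s) x).trans (hx s (Nat.lt_succ_self s))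
      exact h2 _ rfl (tow_rel n s)
  obtain ⟨e, he⟩ := (S.i_eq_zero_iff _ _ _ _ rfl _).1 h1
  exact ⟨e, he.trans (congrArg (convergenceι hρ (s + 2 + k) (by lia) s) hy).symm⟩

/-- The maps from the kernels to the terms `E_r`. -/
def kernelToPage (k : ℕ) :
    kernel (towerMap (convergenceTower ρ) s) ⟶ (S.pageTower s (n - s)).obj (Opposite.op k) :=
  (exists_kernelToPage hM hρ s k).choose

lemma kernelToPage_k (k : ℕ) : kernelToPage hM hρ s k ≫ S.towerK s (n - s) k =
    kernelIncl ρ s ≫ convergenceι hρ (s + 2 + k) (by lia) s :=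
  (exists_kernelToPage hM hρ s k).choose_spec

lemma kernelToPage_kFirst (k : ℕ) : kernelToPage hM hρ s k ≫ S.towerKFirst s (n - s) k =
    kernelIncl ρ s ≫ convergenceι hρ 2 le_rfl s := by
  rw [towerKFirst, ← Category.assoc, kernelToPage_k, Category.assoc]
  refine congrArg (kernelIncl ρ s ≫ ·) ?_
  have := (ModuleCat.epi_iff_surjective _).2 (ModuleCat.quotTowerMk_surjective
    (kernelFiltration ρ) (kernelFiltration_succ_le ρ) (s + 1))
  refine (cancel_epi (convergenceπ ρ (s + 1))).1 ?_
  rw [← Category.assoc, convergenceπ_ι, convergenceπ_ι, hρ]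

variable (S) in
lemma towerKFirst_injective (k : ℕ) (t : ℤ) : Function.Injective (S.towerKFirst s t k) :=
  (S.ιFirst_injective (s + 2 + k) (by lia) _).comp (S.k_injective _ _ _ (by dsimp only; lia))

/-- The comparison of the kernels with the limits of the terms `E_r`. -/
def kernelToLimit : kernel (towerMap (convergenceTower ρ) s) ⟶ limit (S.pageTower s (n - s)) :=
  towerLift _ (kernelToPage hM hρ s) fun k => by
    have := (ModuleCat.mono_iff_injective _).2 (towerKFirst_injective S s k (n - s))
    rw [← cancel_mono (S.towerKFirst s (n - s) k), Category.assoc, towerMap_towerKFirst,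
      kernelToPage_kFirst, kernelToPage_kFirst]

lemma kernelToLimit_π (k : ℕ) : kernelToLimit hM hρ s ≫
    limit.π (S.pageTower s (n - s)) (Opposite.op k) = kernelToPage hM hρ s k := towerLift_π _ _ _ _

/-- Surjectivity is the point. A compatible sequence in the `E_r^s` gives one element of `D_2^s`
which lies in every `D_r^s` and in the kernel of `i`. By `IsFilteredTower.exists_family` it belongs
to a compatible family vanishing below `s`, which the Milnor sequence lifts to `H`. -/
lemma kernelToLimit_bijective
    (hF : IsFilteredTower (fun s => (S.towMap 2 le_rfl n s).hom.toAddMonoidHom)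
      (S.filtrationD n) (S.kernelD n)) : Function.Bijective (kernelToLimit hM hρ s) := by
  constructor
  · refine (injective_iff_map_eq_zero _).2 fun y hy => ?_
    refine ModuleCat.kernel_ι_injective _ ((convergenceι_injective hM hρ 2 le_rfl s ?_).trans
      (map_zero _).symm)
    refine congr($(kernelToPage_kFirst hM hρ s 0) y).symm.trans (Eq.trans ?_ (map_zero _).symm)
    refine (congrArg (S.towerKFirst s (n - s) 0) ?_).trans (map_zero _)
    refine congr($(kernelToLimit_π hM hρ s 0) y).symm.trans ?_
    exact (congrArg (limit.π (S.pageTower s (n - s)) (Opposite.op 0)) hy).trans (map_zero _)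
  · intro e
    have he : ∀ k, S.towerKFirst s (n - s) k (limit.π (S.pageTower s (n - s)) (Opposite.op k) e) =
        S.towerKFirst s (n - s) 0 (limit.π (S.pageTower s (n - s)) (Opposite.op 0) e) := fun k => by
      induction k with
      | zero => rfl
      | succ k ih =>
        rw [← ih]
        refine congr($(S.towerMap_towerKFirst s k (n - s)) _).symm.trans ?_
        exact congrArg (S.towerKFirst s (n - s) k)
          congr($(limit.w (S.pageTower s (n - s)) (homOfLE (Nat.le_succ k)).op) e)
    have hx : ∀ k, S.towerKFirst s (n - s) 0 (limit.π (S.pageTower s (n - s)) (Opposite.op 0) e) ∈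
        S.filtrationD n s (s + k) ∧
        S.towerKFirst s (n - s) 0 (limit.π (S.pageTower s (n - s)) (Opposite.op 0) e) ∈
        S.kernelD n s := fun k =>
      (S.mem_filtrationD_kernelD n s (s + k) (s + 2 + k) (by lia) (by push_cast; ring) _).2
        ⟨_, he k⟩
    obtain ⟨y, hy, hy0, hys⟩ := hF.exists_family s _
      (fun k => hF.F_anti s (Nat.le_add_left k s) (hx k).1) (hx 0).2
    obtain ⟨x, hx'⟩ := hM.exists_lift y hy
    obtain ⟨z, hz⟩ := exists_kernelIncl s x fun a ha => (hx' a).trans (hy0 a ha)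
    refine ⟨z, InvSystem.AB.tower_ext fun k => towerKFirst_injective S s k (n - s) ?_⟩
    rw [he k]
    refine (congrArg (S.towerKFirst s (n - s) k) congr($(kernelToLimit_π hM hρ s k) z)).trans ?_
    refine congr($(kernelToPage_kFirst hM hρ s k) z).trans ?_
    refine (congrArg (convergenceι hρ 2 le_rfl s) hz).trans ?_
    exact (hx' s).trans hys

end Kernel

lemma two_le_index (s k : ℕ) : (2 : ℤ) ≤ s + 2 + k := by lia

include hM hρ in
/-- Strong convergence. -/
lemma exists_convergence (hS : ∀ (s : ℕ) (t : ℤ), IsZero (towerLim1 (S.pageTower s t))) :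
    ∃ (Q : ℕᵒᵖ ⥤ AB.{u}) (x : H ≅ limit Q)
      (m : ∀ (r : ℤ) (hr : 2 ≤ r) (s : ℕ), Q.obj (Opposite.op (s + 1)) ⟶ S.tow r hr n s)
      (y : ∀ s : ℕ, kernel (towerMap Q s) ≅ limit (S.pageTower s (n - s))),
      IsZero (Q.obj (Opposite.op 0)) ∧ (∀ s, Epi (towerMap Q s)) ∧
      (∀ r hr s, Mono (m r hr s)) ∧
      (∀ r hr s, x.hom ≫ limit.π Q (Opposite.op (s + 1)) ≫ m r hr s = ρ r hr s) ∧
      (∀ s k : ℕ, kernel.ι (towerMap Q s) ≫ m (s + 2 + k) (two_le_index s k) s =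
        (y s).hom ≫ limit.π (S.pageTower s (n - s)) (Opposite.op k) ≫
          S.k (s + 2 + k) (two_le_index s k) (s, n - s)) := by
  have hF := fun m => S.isFilteredTower m hS
  have h1 := (ConcreteCategory.isIso_iff_bijective _).2 (convergenceLift_bijective hM hρ hF)
  have h2 := fun s => (ConcreteCategory.isIso_iff_bijective _).2
    (kernelToLimit_bijective hM hρ s (hF n))
  refine ⟨convergenceTower ρ, asIso (convergenceLift ρ), convergenceι hρ,
    fun s => asIso (kernelToLimit hM hρ s), isZero_convergenceTower_zero,
    ModuleCat.epi_towerMap_quotTower _ _, fun r hr s => ?_, fun r hr s => ?_, fun s k => ?_⟩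
  · rw [ModuleCat.mono_iff_injective]
    exact convergenceι_injective hM hρ r hr s
  · refine (Category.assoc _ _ _).symm.trans ?_
    exact (congrArg (· ≫ convergenceι hρ r hr s) (convergenceLift_π (s + 1))).trans
      (convergenceπ_ι hρ r hr s)
  · refine (kernelToPage_k hM hρ s k).symm.trans ?_
    exact (congrArg (· ≫ S.towerK s (n - s) k) (kernelToLimit_π hM hρ s k).symm).trans
      (Category.assoc _ _ _)

end Convergence

end CoupledSS

end

noncomputable section

/-! ### Milnor sequences of functors -/

lemma shortExact_of_evaluation {P : Type*} [Category* P] (S : ShortComplex (P ⥤ AB.{u}))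
    (hinj : ∀ C, Function.Injective (S.f.app C)) (hsurj : ∀ C, Function.Surjective (S.g.app C))
    (hex : ∀ C x, S.g.app C x = 0 → ∃ y, S.f.app C y = x) : S.ShortExact where
  mono_f := by
    have : ∀ C, Mono (S.f.app C) := fun C => by
      rw [ModuleCat.mono_iff_injective]
      exact hinj C
    exact NatTrans.mono_of_mono_app _
  epi_g := by
    have : ∀ C, Epi (S.g.app C) := fun C => by
      rw [ModuleCat.epi_iff_surjective]
      exact hsurj C
    exact NatTrans.epi_of_epi_app _
  exact := by
    rw [ShortComplex.exact_iff_isZero_homology, CategoryTheory.Functor.isZero_iff]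
    intro C
    have h : (S.map ((evaluation P AB.{u}).obj C)).Exact :=
      (ShortComplex.moduleCat_exact_iff _).2 (hex C)
    exact ((ShortComplex.exact_iff_isZero_homology _).1 h).of_iso
      (S.mapHomologyIso ((evaluation P AB.{u}).obj C)).symm

section Functors

variable (T : ℕᵒᵖ ⥤ (Pro.{u} CHAIN.{u} ⥤ AB.{u}))

/-- The terms of a tower of functors. -/
abbrev towerObj (s : ℕ) : Pro.{u} CHAIN.{u} ⥤ AB.{u} := T.obj (Opposite.op s)

/-- The comparison of the value of a product of functors with the product of the values. -/
abbrev evalProd (C : Pro.{u} CHAIN.{u}) :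
    (∏ᶜ towerObj T).obj C ⟶ ∏ᶜ fun s => (towerObj T s).obj C :=
  piComparison ((evaluation _ _).obj C) (towerObj T)

lemma evalProd_bijective (C : Pro.{u} CHAIN.{u}) : Function.Bijective (evalProd T C) :=
  ConcreteCategory.bijective_of_isIso (evalProd T C)

lemma evalProd_π (C : Pro.{u} CHAIN.{u}) (s : ℕ) :
    evalProd T C ≫ Pi.π (fun s => (towerObj T s).obj C) s = (Pi.π (towerObj T) s).app C :=
  piComparison_comp_π _ _ _

/-- The map whose cokernel is the derived limit. -/
abbrev towerDiff : ∏ᶜ towerObj T ⟶ ∏ᶜ towerObj T :=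
  𝟙 _ - Pi.lift fun n => Pi.π (towerObj T) (n + 1) ≫ towerMap T n

lemma towerDiff_π (C : Pro.{u} CHAIN.{u}) (s : ℕ) (z : (∏ᶜ towerObj T).obj C) :
    (Pi.π (towerObj T) s).app C ((towerDiff T).app C z) = (Pi.π (towerObj T) s).app C z -
      (towerMap T s).app C ((Pi.π (towerObj T) (s + 1)).app C z) := by
  have h1 : towerDiff T ≫ Pi.π (towerObj T) s =
      Pi.π (towerObj T) s - Pi.π (towerObj T) (s + 1) ≫ towerMap T s := by
    rw [Preadditive.sub_comp, Category.id_comp, limit.lift_π]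
    rfl
  exact congr($(congrArg (fun g => NatTrans.app g C) h1) z)

variable {T} {T' : ℕᵒᵖ ⥤ (Pro.{u} CHAIN.{u} ⥤ AB.{u})} {H : Pro.{u} CHAIN.{u} ⥤ AB.{u}}
  (α : ∏ᶜ towerObj T ⟶ H) (ρ : ∀ s, H ⟶ towerObj T' s)
  (αC : ∀ C, (∏ᶜ fun s => (towerObj T s).obj C) ⟶ H.obj C) (hα : ∀ C, α.app C = evalProd T C ≫ αC C)
  (hM : ∀ C, IsMilnor (fun s => (towerMap T s).app C) (fun s => (towerMap T' s).app C)
    (fun s => (ρ s).app C) (αC C))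
include hα hM

lemma α_apply_eq_zero_iff (C : Pro.{u} CHAIN.{u}) (x : (∏ᶜ towerObj T).obj C) :
    α.app C x = 0 ↔ ∃ z, (towerDiff T).app C z = x := by
  have hπ : ∀ s y, Pi.π (fun s => (towerObj T s).obj C) s (evalProd T C y) =
      (Pi.π (towerObj T) s).app C y := fun s y => congr($(evalProd_π T C s) y)
  rw [hα]
  refine ((hM C).α_eq_zero_iff (evalProd T C x)).trans ⟨fun ⟨z, hz⟩ => ?_, fun ⟨z, hz⟩ => ?_⟩
  · obtain ⟨w, hw⟩ := (evalProd_bijective T C).2 (AB.mkPi z)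
    have hw' : ∀ s, (Pi.π (towerObj T) s).app C w = z s := fun s =>
      (hπ s w).symm.trans ((congrArg (Pi.π (fun s => (towerObj T s).obj C) s) hw).trans
        (AB.π_mkPi z s))
    refine ⟨w, (evalProd_bijective T C).1 (AB.pi_ext fun s => ?_)⟩
    rw [hπ, towerDiff_π, hw', hw', hz]
  · refine ⟨fun s => (Pi.π (towerObj T) s).app C z, fun s => ?_⟩
    rw [← hz, hπ, towerDiff_π]

/-- A natural family of Milnor sequences is a short exact sequence of functors. -/
lemma exists_shortExact_of_isMilnor :
    ∃ (a : towerLim1 T ⟶ H) (b : H ⟶ limit T') (w : a ≫ b = 0),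
      (∀ s : ℕ, b ≫ limit.π T' (Opposite.op s) = ρ s) ∧ (ShortComplex.mk a b w).ShortExact := by
  have h1 : towerDiff T ≫ α = 0 := by
    ext C x
    exact (α_apply_eq_zero_iff α ρ αC hα hM C _).2 ⟨x, rfl⟩
  have hρ : ∀ s, ρ (s + 1) ≫ towerMap T' s = ρ s := fun s => by
    ext C : 2
    exact (hM C).ρ_q s
  let p : ∏ᶜ towerObj T ⟶ towerLim1 T := cokernel.π (towerDiff T)
  let a : towerLim1 T ⟶ H := cokernel.desc (towerDiff T) α h1
  have hpa : p ≫ a = α := cokernel.π_desc _ _ _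
  let b : H ⟶ limit T' := towerLift T' ρ hρ
  have hb : ∀ s : ℕ, b ≫ limit.π T' (Opposite.op s) = ρ s := towerLift_π T' ρ hρ
  have hb' : ∀ s C x, (limit.π T' (Opposite.op s)).app C (b.app C x) = (ρ s).app C x :=
    fun s C x => congr($(congrArg (fun g => NatTrans.app g C) (hb s)) x)
  have hpa' : ∀ C x, a.app C (p.app C x) = α.app C x := fun C x =>
    congr($(congrArg (fun g => NatTrans.app g C) hpa) x)
  have hp : ∀ C, Function.Surjective (p.app C) := fun C => by
    have : Epi p := inferInstanceAs (Epi (cokernel.π (towerDiff T)))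
    rw [← ModuleCat.epi_iff_surjective]
    infer_instance
  -- Limits of functors are computed objectwise, so elements of the value at `C` are determined by
  -- their coordinates.
  have hext : ∀ C (x y : (limit T').obj C), (∀ s : ℕ, (limit.π T' (Opposite.op s)).app C x =
      (limit.π T' (Opposite.op s)).app C y) → x = y := fun C x y h => by
    refine (ConcreteCategory.bijective_of_isIso (limitObjIsoLimitCompEvaluation T' C).hom).1
      (InvSystem.AB.tower_ext fun s => ?_)
    have h2 := limitObjIsoLimitCompEvaluation_hom_π T' (Opposite.op s) C
    exact congr($h2 x).trans ((h s).trans congr($h2 y).symm)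
  have w : a ≫ b = 0 := by
    have : Epi p := inferInstanceAs (Epi (cokernel.π (towerDiff T)))
    rw [← cancel_epi p, ← Category.assoc, hpa, comp_zero]
    ext C x
    refine hext C _ _ fun s => (hb' s C (α.app C x)).trans ?_
    refine Eq.trans ?_ (map_zero ((limit.π T' (Opposite.op s)).app C).hom).symm
    rw [hα]
    exact ((hM C).ρ_eq_zero_iff _).2 ⟨_, rfl⟩ s
  refine ⟨a, b, w, hb, shortExact_of_evaluation _ (fun C => ?_) (fun C y => ?_) fun C x hx => ?_⟩
  · refine (injective_iff_map_eq_zero _).2 fun x hx => ?_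
    obtain ⟨x, rfl⟩ := hp C x
    obtain ⟨z, rfl⟩ := (α_apply_eq_zero_iff α ρ αC hα hM C x).1 ((hpa' C x).symm.trans hx)
    exact congr($(congrArg (fun g => NatTrans.app g C) (cokernel.condition (towerDiff T))) z)
  · obtain ⟨x, hx⟩ := (hM C).exists_lift (fun s => (limit.π T' (Opposite.op s)).app C y) fun s =>
      congr($(congrArg (fun g => NatTrans.app g C) (limit.w T' (homOfLE (Nat.le_succ s)).op)) y)
    exact ⟨x, hext C _ _ fun s => (hb' s C x).trans (hx s)⟩
  · obtain ⟨y, rfl⟩ := ((hM C).ρ_eq_zero_iff x).1 fun s => (hb' s C x).symm.trans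
      ((congrArg ((limit.π T' (Opposite.op s)).app C) hx).trans (map_zero _))
    obtain ⟨z, rfl⟩ := (evalProd_bijective T C).2 y
    exact ⟨p.app C z, (hpa' C z).trans congr($(hα C) z)⟩

end Functors

namespace InvSystem

lemma proRho_ιFirst (C : Pro.{u} CHAIN.{u}) (n r : ℤ) (hr : 2 ≤ r) (s t : ℤ) (h : s + t = -n) :
    (proRho n r hr s t h).app C ≫ (proSS.obj C).ιFirst r hr (s, t) =
      (proRho n 2 le_rfl s t h).app C := by
  induction r, hr using Int.leInduction with
  | base =>
    exact (congrArg ((proRho n 2 le_rfl s t h).app C ≫ ·) (CoupledSS.ιFirst_self _ _)).trans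
      (Category.comp_id _)
  | succ r hr ih =>
    rw [CoupledSS.ιFirst_succ _ r _ hr rfl]
    exact (Category.assoc _ _ _).symm.trans <| (congrArg (· ≫ _) (proRho_ι C n r _ hr rfl s t h)).trans ih

/-- The tower of functors `D_r^{s,n-s}`. -/
abbrev proTower (r : ℤ) (hr : 2 ≤ r) (n : ℤ) : ℕᵒᵖ ⥤ (Pro.{u} CHAIN.{u} ⥤ AB.{u}) :=
  CoupledSS.dTower AB.{u} r hr n ⋙ (Functor.whiskeringLeft _ _ _).obj proSS

lemma towerMap_proTower (r : ℤ) (hr : 2 ≤ r) (n : ℤ) (s : ℕ) (C : Pro.{u} CHAIN.{u}) :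
    (towerMap (proTower r hr n) s).app C = (proSS.obj C).towMap r hr n s := by
  have h : towerMap (CoupledSS.dTower AB.{u} r hr n) s =
      CoupledSS.iNat r hr _ _ (CoupledSS.tow_rel n s) :=
    Functor.ofOpSequence_map_homOfLE_succ _ s
  exact congrArg (fun g => NatTrans.app g (proSS.obj C)) h

/-- The comparison of the two products of the functors `D_r^{s,n-s}`. -/
def proTowerComparison (r : ℤ) (hr : 2 ≤ r) (n : ℤ) :
    ∏ᶜ towerObj (proTower.{u} r hr n) ⟶ proSS ⋙ CoupledSS.towProd r hr n where
  app C := evalProd (proTower r hr n) C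
  naturality C C' f := Pi.hom_ext _ _ fun s => by
    have h1 := evalProd_π (proTower.{u} r hr n) C s
    have h2 := evalProd_π (proTower.{u} r hr n) C' s
    refine (Category.assoc _ _ _).trans ((congrArg (_ ≫ ·) h2).trans ?_)
    refine ((Pi.π (towerObj (proTower.{u} r hr n)) s).naturality f).trans ?_
    refine (congrArg (· ≫ _) h1.symm).trans ((Category.assoc _ _ _).trans ?_)
    refine Eq.trans ?_ (Category.assoc _ _ _).symm
    exact congrArg (evalProd (proTower r hr n) C ≫ ·) (Limits.Pi.map_π
      (fun s : ℕ => CoupledSS.Hom.D (proSS.map f) r hr ((s : ℤ), n - s)) s).symm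

/-- The Milnor sequences of pro-complexes. -/
lemma exists_milnor (n r : ℤ) (hr : 2 ≤ r) :
    ∃ (a : towerLim1 (proTower.{u} r hr (-n - 1)) ⟶ proHolim n)
      (b : proHolim n ⟶ limit (proTower.{u} r hr (-n))) (w : a ≫ b = 0),
      (∀ s : ℕ, b ≫ limit.π _ (Opposite.op s) = proRho n r hr s (-n - s) (by ring)) ∧
        (ShortComplex.mk a b w).ShortExact := by
  refine exists_shortExact_of_isMilnor (T' := proTower.{u} r hr (-n))
    (proTowerComparison r hr (-n - 1) ≫ proAlpha n r hr)
    (fun s : ℕ => proRho n r hr s (-n - s) (by ring)) (fun C => (proAlpha n r hr).app C)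
    (fun C => rfl) fun C => ?_
  have h := isMilnor_pro C n r hr
  have h1 := fun s => (towerMap_proTower r hr (-n - 1) s C).symm
  have h2 := fun s => (towerMap_proTower r hr (-n) s C).symm
  rw [funext h1, funext h2] at h
  exact h

end InvSystem

end


/-! ### The theorem -/

theorem mainTheorem7 :
    ∃ (S : InvSystem.{u} CHAIN.{u} ⥤ CoupledSS AB.{u} 1) (c : InvSystem.HolimCouple S)
      (E : Pro.{u} CHAIN.{u} ⥤ CoupledSS AB.{u} 2)
      (e : Pro.ofInv ⋙ E ≅ S ⋙ CoupledSS.truncate AB.{u} (by norm_num : (1 : ℤ) ≤ 2))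
      (H : ℤ → (Pro.{u} CHAIN.{u} ⥤ AB.{u}))
      (h : ∀ n, Pro.ofInv ⋙ H n ≅ InvSystem.holim ⋙ InvSystem.homologyF n)
      (ρ : ∀ (n r : ℤ) (hr : 2 ≤ r) (s t : ℤ), s + t = -n →
        (H n ⟶ E ⋙ CoupledSS.dFunctor AB.{u} r hr (s, t))),
      -- the maps `ρ` are induced by the projections of `holim C` to `Tot^{(s)}`, and they are
      -- compatible with the maps `i` and with the inclusions of `D_{r+1}` into `D_r`
      (∀ (C : Pro.{u} CHAIN.{u}) (n r : ℤ) (hr : 2 ≤ r) (s t : ℤ) (hst : s + t = -n)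
        (q : ℤ × ℤ) (hq : (s, t) + (-1, 1) = q) (hst' : q.1 + q.2 = -n),
        (ρ n r hr s t hst).app C ≫ (E.obj C).i r hr (s, t) q hq =
          (ρ n r hr q.1 q.2 hst').app C) ∧
      (∀ (C : Pro.{u} CHAIN.{u}) (n r r' : ℤ) (hr : 2 ≤ r) (hr' : r + 1 = r') (s t : ℤ)
        (hst : s + t = -n),
        (ρ n r' (by lia) s t hst).app C ≫ (E.obj C).ι r r' hr hr' (s, t) =
          (ρ n r hr s t hst).app C) ∧
      (∀ (X : InvSystem.{u} CHAIN.{u}) (n s t : ℤ) (hst : s + t = -n),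
        (ρ n 2 le_rfl s t hst).app (Pro.ofInv.obj X) ≫
            CoupledSS.Hom.D (e.hom.app X) 2 le_rfl (s, t) ≫
            (S.obj X).ι 1 2 le_rfl rfl (s, t) ≫ (c.isoD s t n hst).hom.app X =
          (h n).hom.app X ≫ (InvSystem.homologyF n).map ((InvSystem.holimToTot s).app X)) ∧
      -- (1) the terms `E_2`
      (∀ (s : ℕ) (t : ℤ),
        Nonempty (Pro.ofInv ⋙ E ⋙ CoupledSS.eFunctor AB.{u} 2 le_rfl (s, t) ≅
          InvSystem.proHomology (-t) ⋙ InvSystem.limDerived s)) ∧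
      -- (2) the terms `D_2^{0,n}`
      (∀ n : ℤ, (∀ C, IsIso ((E.obj C).k 2 le_rfl (0, n))) ∧
        Nonempty (Pro.ofInv ⋙ E ⋙ CoupledSS.eFunctor AB.{u} 2 le_rfl (0, n) ≅
          InvSystem.proHomology (-n) ⋙ InvSystem.limFunctor)) ∧
      -- (3) the long exact sequences
      (∀ (C : Pro.{u} CHAIN.{u}) (n : ℤ),
        Mono ((E.obj C).k 2 le_rfl (1, n - 1)) ∧
        ∀ s : ℤ, 1 ≤ s → (ComposableArrows.mk₄
          ((E.obj C).k 2 le_rfl (s, n - 1))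
          ((E.obj C).i 2 le_rfl (s, n - 1) (s - 1, n) (by ext <;> simp; ring))
          ((E.obj C).j 2 le_rfl (s - 1, n) (s + 1, n - 1) (by ext <;> simp <;> ring))
          ((E.obj C).k 2 le_rfl (s + 1, n - 1))).Exact) ∧
      -- (4) the short exact sequences with `lim¹` and `lim`, natural in the pro-complex
      (∀ (n r : ℤ) (hr : 2 ≤ r),
        ∃ (α : towerLim1 (CoupledSS.dTower AB.{u} r hr (-n - 1) ⋙
              (Functor.whiskeringLeft _ _ _).obj E) ⟶ H n)
          (β : H n ⟶ limit (CoupledSS.dTower AB.{u} r hr (-n) ⋙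
              (Functor.whiskeringLeft _ _ _).obj E))
          (w : α ≫ β = 0),
          (∀ s : ℕ, β ≫ limit.π _ (Opposite.op s) = ρ n r hr s (-n - s) (by ring)) ∧
          (ShortComplex.mk α β w).ShortExact) ∧
      -- (5) comparison
      (∀ (C C' : Pro.{u} CHAIN.{u}) (f : C ⟶ C'),
        (∀ s t : ℤ, IsIso ((CoupledSS.eFunctor AB.{u} 2 le_rfl (s, t)).map (E.map f))) →
          ∀ n : ℤ, IsIso ((H n).map f)) ∧
      -- (6) strong convergence: here `Q (s + 1)` is the image of `H_n (holim C)` in `D_1^{s,-n-s}`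
      (∀ C : Pro.{u} CHAIN.{u},
        (∀ (s : ℕ) (t : ℤ), IsZero (towerLim1 ((E.obj C).pageTower s t))) →
          ∀ n : ℤ, ∃ (Q : ℕᵒᵖ ⥤ AB.{u}) (x : (H n).obj C ≅ limit Q)
            (m : ∀ (r : ℤ) (hr : 2 ≤ r) (s : ℕ),
              Q.obj (Opposite.op (s + 1)) ⟶ (E.obj C).D r hr (s, -n - s))
            (y : ∀ s : ℕ, kernel (towerMap Q s) ≅ limit ((E.obj C).pageTower s (-n - s))),
            IsZero (Q.obj (Opposite.op 0)) ∧ (∀ s, Epi (towerMap Q s)) ∧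
            (∀ r hr s, Mono (m r hr s)) ∧
            (∀ r hr s, x.hom ≫ limit.π Q (Opposite.op (s + 1)) ≫ m r hr s =
              (ρ n r hr s (-n - s) (by ring)).app C) ∧
            (∀ s k : ℕ, kernel.ι (towerMap Q s) ≫ m (s + 2 + k) (by lia) s =
              (y s).hom ≫ limit.π ((E.obj C).pageTower s (-n - s)) (Opposite.op k) ≫
                (E.obj C).k (s + 2 + k) (by lia) (s, -n - s))) := by
  -- In the columns `0` and `1`, the map `j` into `E_2` starts in a negative column. This gives the
  -- beginning of the long exact sequence and half of the statement on column `0`.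
  have hk0 : ∀ (C : Pro.{u} CHAIN.{u}) (s n : ℤ), s ≤ 1 →
      Function.Injective ((InvSystem.proSS.obj C).k 2 le_rfl (s, n)) := fun C s n hs =>
    (InvSystem.proSS.obj C).k_injective 2 le_rfl (s, n) (by dsimp only; lia)
  refine ⟨InvSystem.holimSS, InvSystem.holimCouple, InvSystem.proSS,
    Pro.ofInvExtend _ InvSystem.invertsInitial_secondSS, InvSystem.proHolim,
    fun n => Pro.ofInvExtend _ (InvSystem.invertsInitial_homology_holim n), InvSystem.proRho,
    InvSystem.proRho_i, InvSystem.proRho_ι, fun X n s t hst => ?_, fun s t => ?_,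
    fun n => ⟨fun C => ?_, ?_⟩, fun C n => ⟨?_, fun s hs => ?_⟩, InvSystem.exists_milnor,
    fun C C' f hf n => ?_, fun C hC n => ?_⟩
  · have h1 := InvSystem.rho_ιFirst X n 2 (by norm_num) s t hst
    rw [CoupledSS.ιFirst_succ _ 1 2 le_rfl rfl, CoupledSS.ιFirst_self, Category.comp_id] at h1
    have h2 : InvSystem.rhoFirst X n s t hst ≫ (InvSystem.holimCouple.isoD s t n hst).hom.app X =
        HomologicalComplex.homologyMap (TotCouple.topProj (InvSystem.bicomplex.obj X) s) n :=
      (Category.assoc _ _ _).trans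
        ((congrArg (HomologicalComplex.homologyMap
          (TotCouple.topProj (InvSystem.bicomplex.obj X) s) n ≫ ·)
            (Iso.inv_hom_id_app (InvSystem.holimCouple.isoD s t n hst) X)).trans (Category.comp_id _))
    refine Eq.trans ?_ (h2.trans (Category.id_comp _).symm)
    rw [← h1]
    refine Eq.trans ?_ (Category.assoc _ _ _).symm
    exact congrArg (InvSystem.rho X n 2 (by norm_num) s t hst ≫ ·) (Category.id_comp _)
  · exact ⟨Functor.isoWhiskerRight (Pro.ofInvExtend _ InvSystem.invertsInitial_secondSS)
        (CoupledSS.eFunctor AB.{u} 2 le_rfl (s, t)) ≪≫ InvSystem.e₂Iso s t ≪≫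
      Functor.isoWhiskerLeft (InvSystem.proHomology (-t)) (InvSystem.cohomologyIsoLimDerived s)⟩
  · refine (ConcreteCategory.isIso_iff_bijective _).2 ⟨hk0 C 0 n (by norm_num), fun x => ?_⟩
    -- Column `-1` vanishes, so `i` is zero on column `0` and `k` is onto by exactness.
    have := (InvSystem.proSS.obj C).subsingleton_D 2 le_rfl ((0, n) + (-1, 1)) (by simp)
    exact ((InvSystem.proSS.obj C).i_eq_zero_iff 2 le_rfl (0, n) _ rfl x).1 (Subsingleton.elim _ _)
  · exact ⟨Functor.isoWhiskerRight (Pro.ofInvExtend _ InvSystem.invertsInitial_secondSS)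
        (CoupledSS.eFunctor AB.{u} 2 le_rfl (0, n)) ≪≫ InvSystem.e₂Iso 0 n ≪≫
      Functor.isoWhiskerLeft (InvSystem.proHomology (-n)) InvSystem.limIsoCohomology.symm⟩
  · rw [ModuleCat.mono_iff_injective]
    exact hk0 C 1 (n - 1) le_rfl
  · exact (InvSystem.proSS.obj C).exact 2 le_rfl _ _ _ _ _
  · exact (ConcreteCategory.isIso_iff_bijective _).2
      (InvSystem.bijective_proHolim_map f (fun p => hf p.1 p.2) n)
  · exact CoupledSS.exists_convergence (InvSystem.isMilnor_pro C n 2 le_rfl)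
      (fun r hr s => InvSystem.proRho_ιFirst C n r hr s _ _) hC
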